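/- **Setting.** Let $\mathcal E$ be a category with finite limits. Let $\mathrm{Graph}(\mathcal E)$ be the category of internal graphs $G_0 \leftleftarrows G_1$ and $\mathrm{Cat}(\mathcal E)$ the category of internal categories and internal functors, and assume that the forgetful functor $U:\mathrm{Cat}(\mathcal E)\to\mathrm{Graph}(\mathcal E)$ has a left adjoint $\mathrm{fc}$; write $\mathrm{fc}$ also for the induced monad $U\,\mathrm{fc}$ on $\mathrm{Graph}(\mathcal E)$. Let $V=(V_1\rightrightarrows V_0,\otimes,I,\alpha,\lambda,\rho)$ be an internal (not necessarily strict) monoidal category in $\mathcal E$. Elements below are generalized elements. *Internal enriched categories.* An internal $V$-enriched category consists of an object $X$ of $\mathcal E$ with arrows $\hom: X\times X\to V_0$, $\ \circ: X\times X\times X\to V_1$ and $\mathrm{id}: X\to V_1$, where $\circ(x_0,x_1,x_2):\hom(x_1,x_2)\otimes\hom(x_0,x_1)\to\hom(x_0,x_2)$ and $\mathrm{id}(x): I\to\hom(x,x)$ satisfy the usual associativity and unit laws. A $V$-functor $X\to Y$ consists of $F_0:X\to Y$ and $F_1:X\times X\to V_1$, where $F_1(x_0,x_1):\hom_X(x_0,x_1)\to\hom_Y(F_0x_0,F_0x_1)$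 commutes with composition and identities. These form a category $\mathrm{Cat}_{\mathcal E}^V$. *$\mathrm{fc}$-multicategories.* An $\mathrm{fc}$-multicategory is a diagram $\mathrm{fc}\,C_0\leftarrow C_1\to C_0$ of internal graphs with a composition $C_1\times_{\mathrm{fc}\,C_0}\mathrm{fc}\,C_1\to C_1$ and identities $C_0\to C_1$ that are compatible with sources and targets and satisfy the associativity and unit axioms. A functor is a morphism of such diagrams preserving composition and identities. A transformation $F\Rightarrow G: C\to D$ is a family $C_0\to D_1$ of unary arrows $\phi_c:Fc\to Gc$ with $\phi_c\circ F\theta=G\theta\circ(\phi_{c_1},\dots,\phi_{c_n})$ for all $\theta:c_1,\dots,c_n\to c$. For an object $X$ of $\mathcal E$, the indiscrete graph $X\leftleftarrows X\times X$ is an $\mathrm{fc}$-algebra, since it underlies the indiscrete internal category on $X$; let $\mathrm{Ind}_+(X)$ be the $\mathrm{fc}$-multicategory of this algebra. For an $\mathrm{fc}$-multicategory $M$, an $M$-enriched $\mathrm{Id}$-multicategory is an object $X$ with a functor $\mathcal X:\mathrm{Ind}_+(X)\to M$. A functor $(X,\mathcal X)\to(Y,\mathcal Y)$ of such is an arrow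 $F_0:X\to Y$ with a transformation $F_1:\mathcal X\Rightarrow\mathcal Y\circ\mathrm{Ind}_+(F_0)$. These form a category $\mathrm{MCat}_{\mathrm{Id}}^{M}$. *Iterated tensor products.* Let $W=\mathrm{fc}(1\leftleftarrows V_0)_1$ be the object of words in $V_0$; it is the free internal monoid on $V_0$. An iterated tensor product on $V$ is an arrow $\otimes_0:W\to V_0$ together with isomorphisms in $V$ $$\otimes_0 l\;\otimes\;\otimes_0 m\;\cong\;\otimes_0(lm),\qquad I\cong\otimes_0(\,),\qquad \otimes_0(v)\cong v,$$ internal in $l,m:W$ and $v:V_0$, the first two of which are coherent with $\alpha,\lambda,\rho$ (that is, $\otimes_0$ is a strong monoidal functor to $V$ from the discrete monoidal category of words). It is called strict if all these isomorphisms are identities; then $\otimes_0$ is the homomorphism from $W$ to the internal monoid $(V_0,\otimes,I)$ that extends $\mathrm{id}_{V_0}$. *The data $MV$.* Given an iterated tensor product on $V$, the data $MV$ has as graph of objects $1\leftleftarrows V_0$, and as graph of arrows $1\leftleftarrows V_1^+$, where $V_1^+=W\times_{V_0}V_1$ is the object of pairs $(l,f)$ with $f:\otimes_0 l\to v$ in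 $V$; the source of $(l,f)$ is the word $l$, and its target is $v$. The identity of $v$ is $((v),\otimes_0(v)\cong v)$. The composite of $(v_1\cdots v_n,f)$ with a list $(l_1,f_1),\dots,(l_n,f_n)$, $f_i:\otimes_0 l_i\to v_i$, is $(l_1\cdots l_n,\ f\circ \otimes_1(f_1,\dots,f_n))$, where $\otimes_1(f_1,\dots,f_n):\otimes_0(l_1\cdots l_n)\to\otimes_0(v_1\cdots v_n)$ is the monoidal product of the $f_i$, formed by means of the isomorphisms above. (Lists are edges of $\mathrm{fc}(1\leftleftarrows V_1^+)$, and $\otimes_1$ is given by the universal property of $\mathrm{fc}$.) **Proposition.** 1. If $V$ is strict, it has a strict iterated tensor product. If $\mathcal E$ is cartesian closed, every $V$ has an iterated tensor product. 2. For every iterated tensor product on $V$, the data $MV$ form an $\mathrm{fc}$-multicategory. 3. For every iterated tensor product on $V$, the categories $\mathrm{MCat}_{\mathrm{Id}}^{MV}$ and $\mathrm{Cat}_{\mathcal E}^V$ are equivalent. More precisely, the following assignments are well defined and form a functor $\mathrm{MCat}_{\mathrm{Id}}^{MV}\to\mathrm{Cat}_{\mathcal E}^V$ that is an equivalence of categories: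 - An $MV$-enriched $\mathrm{Id}$-multicategory $(X,\mathcal X)$ is sent to the $V$-enriched category with object of objects $X$ and $\hom=(\mathcal X_0)_1:X\times X\to V_0$, whose composition at $x_0,x_1,x_2$ is $$\hom(x_1,x_2)\otimes\hom(x_0,x_1)\;\cong\;\otimes_0\big(\hom(x_1,x_2)\,\hom(x_0,x_1)\big)\longrightarrow\hom(x_0,x_2),$$ the second arrow being the value of $\mathcal X_1$ on the path of length two from $x_0$ through $x_1$ to $x_2$, and whose identity at $x$ is $I\cong\otimes_0(\,)\to\hom(x,x)$, the second arrow being the value of $\mathcal X_1$ on the empty path at $x$. - A functor $(F_0,F_1)$ is sent to the $V$-functor with the same $F_0$ and with the arrow $\hom_X(x_0,x_1)\cong\otimes_0(\hom_X(x_0,x_1))\to\hom_Y(F_0x_0,F_0x_1)$ given by the component of $F_1$ at $(x_0,x_1)$. -/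

import Mathlib

open CategoryTheory Limits MonoidalCategory CartesianMonoidalCategory

universe v u

set_option linter.unusedSectionVars false

namespace IntEnr

/-! ### Internal graphs -/

/-- An internal graph in `E`: a parallel pair of arrows, from edges to vertices. -/
structure IGraph (E : Type u) [Category.{v} E] where
  vert : E
  edge : E
  src : edge ⟶ vert
  tgt : edge ⟶ vert

namespace IGraph

variable {E : Type u} [Category.{v} E]

/-- Morphisms of internal graphs. -/
@[ext]
structure Hom (G H : IGraph E) where
  vert : G.vert ⟶ H.vert
  edge : G.edge ⟶ H.edge
  src_comm : edge ≫ H.src = G.src ≫ vert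
  tgt_comm : edge ≫ H.tgt = G.tgt ≫ vert

instance : Category (IGraph E) where
  Hom := Hom
  id G := ⟨𝟙 _, 𝟙 _, by simp, by simp⟩
  comp f g := ⟨f.vert ≫ g.vert, f.edge ≫ g.edge,
    by rw [Category.assoc, g.src_comm, ← Category.assoc, f.src_comm, Category.assoc],
    by rw [Category.assoc, g.tgt_comm, ← Category.assoc, f.tgt_comm, Category.assoc]⟩

@[ext]
theorem hom_ext {G H : IGraph E} {f g : G ⟶ H} (hv : f.vert = g.vert) (he : f.edge = g.edge) :
    f = g := Hom.ext hv he

@[simp] theorem id_vert (G : IGraph E) : Hom.vert (𝟙 G) = 𝟙 _ := rfl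
@[simp] theorem id_edge (G : IGraph E) : Hom.edge (𝟙 G) = 𝟙 _ := rfl
@[simp] theorem comp_vert {G H K : IGraph E} (f : G ⟶ H) (g : H ⟶ K) :
    (f ≫ g).vert = f.vert ≫ g.vert := rfl
@[simp] theorem comp_edge {G H K : IGraph E} (f : G ⟶ H) (g : H ⟶ K) :
    (f ≫ g).edge = f.edge ≫ g.edge := rfl

/-- The graph on which pullbacks are computed: pullbacks of vertices and of edges. -/
noncomputable def pb [HasPullbacks E] {A B C : IGraph E} (f : A ⟶ C) (g : B ⟶ C) : IGraph E where
  vert := pullback f.vert g.vert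
  edge := pullback f.edge g.edge
  src := pullback.lift (pullback.fst _ _ ≫ A.src) (pullback.snd _ _ ≫ B.src) (by
    rw [Category.assoc, Category.assoc, ← f.src_comm, ← g.src_comm, pullback.condition_assoc])
  tgt := pullback.lift (pullback.fst _ _ ≫ A.tgt) (pullback.snd _ _ ≫ B.tgt) (by
    rw [Category.assoc, Category.assoc, ← f.tgt_comm, ← g.tgt_comm, pullback.condition_assoc])

/-- The first projection. -/
noncomputable def pbFst [HasPullbacks E] {A B C : IGraph E} (f : A ⟶ C) (g : B ⟶ C) : pb f g ⟶ A :=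
  (⟨pullback.fst _ _, pullback.fst _ _, (pullback.lift_fst _ _ _).symm,
    (pullback.lift_fst _ _ _).symm⟩ : Hom (pb f g) A)

/-- The second projection. -/
noncomputable def pbSnd [HasPullbacks E] {A B C : IGraph E} (f : A ⟶ C) (g : B ⟶ C) : pb f g ⟶ B :=
  (⟨pullback.snd _ _, pullback.snd _ _, (pullback.lift_snd _ _ _).symm,
    (pullback.lift_snd _ _ _).symm⟩ : Hom (pb f g) B)

/-- The map into the pullback graph. -/
noncomputable def pbLift [HasPullbacks E] {A B C D : IGraph E} (f : A ⟶ C) (g : B ⟶ C)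
    (a : D ⟶ A) (b : D ⟶ B) (w : a ≫ f = b ≫ g) : D ⟶ pb f g :=
  (⟨pullback.lift a.vert b.vert (congrArg Hom.vert w),
    pullback.lift a.edge b.edge (congrArg Hom.edge w),
    by
      apply pullback.hom_ext
      · simp only [pb, Category.assoc, pullback.lift_fst, pullback.lift_fst_assoc, a.src_comm]
      · simp only [pb, Category.assoc, pullback.lift_snd, pullback.lift_snd_assoc, b.src_comm],
    by
      apply pullback.hom_ext
      · simp only [pb, Category.assoc, pullback.lift_fst, pullback.lift_fst_assoc, a.tgt_comm]
      · simp only [pb, Category.assoc, pullback.lift_snd, pullback.lift_snd_assoc, b.tgt_comm]⟩ :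
    Hom D (pb f g))

theorem isPullback_pb [HasPullbacks E] {A B C : IGraph E} (f : A ⟶ C) (g : B ⟶ C) :
    IsPullback (pbFst f g) (pbSnd f g) f g where
  w := hom_ext pullback.condition pullback.condition
  isLimit' := ⟨PullbackCone.IsLimit.mk _
    (fun s => pbLift f g s.fst s.snd s.condition)
    (fun _ => hom_ext (pullback.lift_fst _ _ _) (pullback.lift_fst _ _ _))
    (fun _ => hom_ext (pullback.lift_snd _ _ _) (pullback.lift_snd _ _ _))
    (fun _ _ h₁ h₂ => hom_ext
      (pullback.hom_ext ((congrArg Hom.vert h₁).trans (pullback.lift_fst _ _ _).symm)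
        ((congrArg Hom.vert h₂).trans (pullback.lift_snd _ _ _).symm))
      (pullback.hom_ext ((congrArg Hom.edge h₁).trans (pullback.lift_fst _ _ _).symm)
        ((congrArg Hom.edge h₂).trans (pullback.lift_snd _ _ _).symm)))⟩

instance [HasPullbacks E] : HasPullbacks (IGraph E) :=
  have : ∀ {X Y Z : IGraph E} {f : X ⟶ Z} {g : Y ⟶ Z}, HasLimit (cospan f g) :=
    fun {_ _ _ f g} => (isPullback_pb f g).hasPullback
  hasPullbacks_of_hasLimit_cospan _

end IGraph

/-! ### Internal categories -/

/-- The data of an internal category. The domain of composition is the object of pairs `(g, f)` with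
`src g = tgt f`, and the composite is `g ∘ f`. -/
structure ICatData (E : Type u) [Category.{v} E] [HasPullbacks E] where
  obj : E
  mor : E
  src : mor ⟶ obj
  tgt : mor ⟶ obj
  ident : obj ⟶ mor
  comp : pullback src tgt ⟶ mor
  ident_src : ident ≫ src = 𝟙 obj
  ident_tgt : ident ≫ tgt = 𝟙 obj
  comp_src : comp ≫ src = pullback.snd _ _ ≫ src
  comp_tgt : comp ≫ tgt = pullback.fst _ _ ≫ tgt

namespace ICatData

variable {E : Type u} [Category.{v} E] [HasPullbacks E] (C : ICatData E)

/-- The composite `g ∘ f` of generalized elements of the object of morphisms. -/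
noncomputable def cmp {S : E} (g f : S ⟶ C.mor) (h : g ≫ C.src = f ≫ C.tgt) : S ⟶ C.mor :=
  pullback.lift g f h ≫ C.comp

theorem cmp_src {S : E} (g f : S ⟶ C.mor) (h : g ≫ C.src = f ≫ C.tgt) :
    C.cmp g f h ≫ C.src = f ≫ C.src := by
  rw [cmp, Category.assoc, C.comp_src, pullback.lift_snd_assoc]

theorem cmp_tgt {S : E} (g f : S ⟶ C.mor) (h : g ≫ C.src = f ≫ C.tgt) :
    C.cmp g f h ≫ C.tgt = g ≫ C.tgt := by
  rw [cmp, Category.assoc, C.comp_tgt, pullback.lift_fst_assoc]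

theorem comp_cmp {S S' : E} (x : S' ⟶ S) (g f : S ⟶ C.mor) (h : g ≫ C.src = f ≫ C.tgt) :
    x ≫ C.cmp g f h = C.cmp (x ≫ g) (x ≫ f) (by simp [h]) := by
  rw [cmp, cmp, ← Category.assoc]
  congr 1
  apply pullback.hom_ext
  · rw [Category.assoc, pullback.lift_fst, pullback.lift_fst]
  · rw [Category.assoc, pullback.lift_snd, pullback.lift_snd]

theorem cmp_id_aux {S : E} (f : S ⟶ C.mor) : f ≫ C.src = (f ≫ C.src ≫ C.ident) ≫ C.tgt := by
  simp [C.ident_tgt]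

theorem id_cmp_aux {S : E} (f : S ⟶ C.mor) : (f ≫ C.tgt ≫ C.ident) ≫ C.src = f ≫ C.tgt := by
  simp [C.ident_src]

theorem cmp_congr {S : E} {g g' f f' : S ⟶ C.mor} (h : g ≫ C.src = f ≫ C.tgt)
    (hg : g = g') (hf : f = f') : C.cmp g f h = C.cmp g' f' (by rw [← hg, ← hf, h]) := by
  subst hg hf; rfl

end ICatData

/-- An internal category in `E`; the axioms are stated for generalized elements. -/
structure ICat (E : Type u) [Category.{v} E] [HasPullbacks E] extends ICatData E where
  cmp_id : ∀ {S : E} (f : S ⟶ mor),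
    toICatData.cmp f (f ≫ src ≫ ident) (toICatData.cmp_id_aux f) = f
  id_cmp : ∀ {S : E} (f : S ⟶ mor),
    toICatData.cmp (f ≫ tgt ≫ ident) f (toICatData.id_cmp_aux f) = f
  cmp_assoc : ∀ {S : E} (h g f : S ⟶ mor) (hg : h ≫ src = g ≫ tgt) (gf : g ≫ src = f ≫ tgt),
    toICatData.cmp (toICatData.cmp h g hg) f (by rw [toICatData.cmp_src, gf]) =
      toICatData.cmp h (toICatData.cmp g f gf) (by rw [toICatData.cmp_tgt, hg])

/-- Internal functors. -/
@[ext]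
structure IFunctor {E : Type u} [Category.{v} E] [HasPullbacks E] (C D : ICat E) where
  obj : C.obj ⟶ D.obj
  mor : C.mor ⟶ D.mor
  src_comm : mor ≫ D.src = C.src ≫ obj
  tgt_comm : mor ≫ D.tgt = C.tgt ≫ obj
  map_ident : C.ident ≫ mor = obj ≫ D.ident
  map_cmp : ∀ {S : E} (g f : S ⟶ C.mor) (h : g ≫ C.src = f ≫ C.tgt),
    C.cmp g f h ≫ mor = D.cmp (g ≫ mor) (f ≫ mor) (by
      rw [Category.assoc, Category.assoc, src_comm, tgt_comm, ← Category.assoc, h, Category.assoc])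

namespace ICat

variable {E : Type u} [Category.{v} E] [HasPullbacks E]

/-- The category of internal categories and internal functors. -/
instance : Category (ICat E) where
  Hom := IFunctor
  id C := ⟨𝟙 _, 𝟙 _, by simp, by simp, by simp, by intros; simp⟩
  comp {C D K} F G :=
    { obj := F.obj ≫ G.obj
      mor := F.mor ≫ G.mor
      src_comm := by
        rw [Category.assoc, G.src_comm, ← Category.assoc, F.src_comm, Category.assoc]
      tgt_comm := by
        rw [Category.assoc, G.tgt_comm, ← Category.assoc, F.tgt_comm, Category.assoc]
      map_ident := by
        rw [← Category.assoc, F.map_ident, Category.assoc, G.map_ident, Category.assoc]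
      map_cmp := fun g f h => by
        rw [← Category.assoc, F.map_cmp, G.map_cmp]
        exact K.cmp_congr _ (Category.assoc _ _ _) (Category.assoc _ _ _) }
  id_comp F := IFunctor.ext (Category.id_comp _) (Category.id_comp _)
  comp_id F := IFunctor.ext (Category.comp_id _) (Category.comp_id _)
  assoc F G H := IFunctor.ext (Category.assoc _ _ _) (Category.assoc _ _ _)

theorem hom_ext {C D : ICat E} {F G : C ⟶ D} (ho : F.obj = G.obj) (hm : F.mor = G.mor) :
    F = G := IFunctor.ext ho hm

@[simp] theorem id_obj (C : ICat E) : IFunctor.obj (𝟙 C) = 𝟙 _ := rfl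
@[simp] theorem id_mor (C : ICat E) : IFunctor.mor (𝟙 C) = 𝟙 _ := rfl
@[simp] theorem comp_obj {C D K : ICat E} (F : C ⟶ D) (G : D ⟶ K) :
    (F ≫ G).obj = F.obj ≫ G.obj := rfl
@[simp] theorem comp_mor {C D K : ICat E} (F : C ⟶ D) (G : D ⟶ K) :
    (F ≫ G).mor = F.mor ≫ G.mor := rfl

/-- The forgetful functor from internal categories to internal graphs. -/
def forgetGraph (E : Type u) [Category.{v} E] [HasPullbacks E] : ICat E ⥤ IGraph E where
  obj C := ⟨C.obj, C.mor, C.src, C.tgt⟩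
  map F := (⟨F.obj, F.mor, F.src_comm, F.tgt_comm⟩ : IGraph.Hom _ _)

@[simp] theorem forgetGraph_obj_vert (C : ICat E) : ((forgetGraph E).obj C).vert = C.obj := rfl
@[simp] theorem forgetGraph_obj_edge (C : ICat E) : ((forgetGraph E).obj C).edge = C.mor := rfl
@[simp] theorem forgetGraph_obj_src (C : ICat E) : ((forgetGraph E).obj C).src = C.src := rfl
@[simp] theorem forgetGraph_obj_tgt (C : ICat E) : ((forgetGraph E).obj C).tgt = C.tgt := rfl
@[simp] theorem forgetGraph_map_vert {C D : ICat E} (F : C ⟶ D) :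
    ((forgetGraph E).map F).vert = F.obj := rfl
@[simp] theorem forgetGraph_map_edge {C D : ICat E} (F : C ⟶ D) :
    ((forgetGraph E).map F).edge = F.mor := rfl

/-- Generalized objects of `C` at stage `S`: arrows `S ⟶ C.obj`. -/
@[ext]
structure El (C : ICat E) (S : E) where
  pt : S ⟶ C.obj

/-- Generalized morphisms of `C` at stage `S` with given domain and codomain; `ElHom C a b` is the
internal-language judgement `f : a → b` in context `S`. -/
@[ext]
structure ElHom (C : ICat E) {S : E} (a b : C.El S) where
  arr : S ⟶ C.mor
  src : arr ≫ C.src = a.pt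
  tgt : arr ≫ C.tgt = b.pt

/-- The category of generalized elements of an internal category at stage `S`. -/
noncomputable instance (C : ICat E) (S : E) : Category (C.El S) where
  Hom a b := ElHom C a b
  id a := ⟨a.pt ≫ C.ident,
    by rw [Category.assoc, C.ident_src, Category.comp_id],
    by rw [Category.assoc, C.ident_tgt, Category.comp_id]⟩
  comp f g := ⟨C.cmp g.arr f.arr (by rw [f.tgt, g.src]),
    by rw [C.cmp_src, f.src], by rw [C.cmp_tgt, g.tgt]⟩
  id_comp f := by
    apply ElHom.ext
    refine (C.cmp_congr _ rfl ?_).trans (C.cmp_id f.arr)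
    simp only [← Category.assoc, f.src]
  comp_id f := by
    apply ElHom.ext
    refine (C.cmp_congr _ ?_ rfl).trans (C.id_cmp f.arr)
    simp only [← Category.assoc, f.tgt]
  assoc f g h := by
    apply ElHom.ext
    exact (C.cmp_assoc _ _ _ _ _).symm

theorem el_ext {C : ICat E} {S : E} {a b : C.El S} {f g : a ⟶ b} (h : f.arr = g.arr) : f = g :=
  ElHom.ext h

theorem el_id_arr {C : ICat E} {S : E} (a : C.El S) : ElHom.arr (𝟙 a) = a.pt ≫ C.ident := rfl

theorem el_comp_arr {C : ICat E} {S : E} {a b c : C.El S} (f : a ⟶ b) (g : b ⟶ c) :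
    (f ≫ g).arr = C.cmp g.arr f.arr (by rw [f.tgt, g.src]) := rfl

theorem comp_arr_congr {C : ICat E} {S : E} {a b c a' b' c' : C.El S} {f : a ⟶ b} {g : b ⟶ c}
    {f' : a' ⟶ b'} {g' : b' ⟶ c'} (hf : f.arr = f'.arr) (hg : g.arr = g'.arr) :
    (f ≫ g).arr = (f' ≫ g').arr := C.cmp_congr _ hg hf

theorem comp_idArr {C : ICat E} {S : E} {a b c : C.El S} (f : a ⟶ b) {g : b ⟶ c}
    (hg : g.arr = b.pt ≫ C.ident) : (f ≫ g).arr = f.arr :=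
  (comp_arr_congr (f' := f) (g' := 𝟙 b) rfl hg).trans (congrArg ElHom.arr (Category.comp_id f))

theorem idArr_comp {C : ICat E} {S : E} {a b c : C.El S} {f : a ⟶ b} (g : b ⟶ c)
    (hf : f.arr = b.pt ≫ C.ident) : (f ≫ g).arr = g.arr :=
  (comp_arr_congr (f' := 𝟙 b) (g' := g) hf rfl).trans (congrArg ElHom.arr (Category.id_comp g))

/-- Restriction of generalized objects and morphisms along `x : S' ⟶ S`. -/
noncomputable def res (C : ICat E) {S S' : E} (x : S' ⟶ S) : C.El S ⥤ C.El S' where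
  obj a := ⟨x ≫ a.pt⟩
  map f := ⟨x ≫ f.arr, by rw [Category.assoc, f.src], by rw [Category.assoc, f.tgt]⟩
  map_id a := el_ext (Category.assoc _ _ _).symm
  map_comp f g := el_ext (C.comp_cmp _ _ _ _)

/-- The same generalized isomorphism, with equal domain and codomain. -/
noncomputable def castIso {C : ICat E} {S : E} {a b a' b' : C.El S} (i : a ≅ b) (ha : a = a')
    (hb : b = b') : a' ≅ b' := eqToIso ha.symm ≪≫ i ≪≫ eqToIso hb

theorem castIso_hom_arr {C : ICat E} {S : E} {a b a' b' : C.El S} (i : a ≅ b) (ha : a = a')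
    (hb : b = b') : (castIso i ha hb).hom.arr = i.hom.arr := by
  subst ha hb; simp [castIso]

theorem castIso_inv_arr {C : ICat E} {S : E} {a b a' b' : C.El S} (i : a ≅ b) (ha : a = a')
    (hb : b = b') : (castIso i ha hb).inv.arr = i.inv.arr := by
  subst ha hb; simp [castIso]

end ICat

/-! ### Internal monoidal categories -/

/-- An internal category with an internal functor `C × C ⟶ C`, the monoidal product. -/
structure TensorICat (E : Type u) [Category.{v} E] [HasPullbacks E] [CartesianMonoidalCategory E]
    extends ICat E where
  tensorObj : obj ⊗ obj ⟶ obj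
  tensorMor : mor ⊗ mor ⟶ mor
  tensor_src : tensorMor ≫ src = (src ⊗ₘ src) ≫ tensorObj
  tensor_tgt : tensorMor ≫ tgt = (tgt ⊗ₘ tgt) ≫ tensorObj
  tensor_ident : (ident ⊗ₘ ident) ≫ tensorMor = tensorObj ≫ ident
  tensor_cmp : ∀ {S : E} (g f g' f' : S ⟶ mor) (h : g ≫ src = f ≫ tgt) (h' : g' ≫ src = f' ≫ tgt),
    lift (toICat.cmp g f h) (toICat.cmp g' f' h') ≫ tensorMor =
      toICat.cmp (lift g g' ≫ tensorMor) (lift f f' ≫ tensorMor)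
        (by
          change (lift g g' ≫ tensorMor) ≫ src = (lift f f' ≫ tensorMor) ≫ tgt
          rw [Category.assoc, Category.assoc, tensor_src, tensor_tgt, lift_map_assoc,
            lift_map_assoc, h, h'])

namespace TensorICat

variable {E : Type u} [Category.{v} E] [HasPullbacks E] [CartesianMonoidalCategory E]
  (V : TensorICat E)

/-- The monoidal product of generalized objects. -/
def tens {S : E} (a b : V.El S) : V.El S := ⟨lift a.pt b.pt ≫ V.tensorObj⟩

/-- The monoidal product of generalized morphisms. -/
def tensHom {S : E} {a a' b b' : V.El S} (f : a ⟶ a') (g : b ⟶ b') :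
    V.tens a b ⟶ V.tens a' b' :=
  (⟨lift f.arr g.arr ≫ V.tensorMor,
    by rw [Category.assoc, V.tensor_src, lift_map_assoc, f.src, g.src]; rfl,
    by rw [Category.assoc, V.tensor_tgt, lift_map_assoc, f.tgt, g.tgt]; rfl⟩ : V.ElHom _ _)

theorem tensHom_arr {S : E} {a a' b b' : V.El S} (f : a ⟶ a') (g : b ⟶ b') :
    (V.tensHom f g).arr = lift f.arr g.arr ≫ V.tensorMor := rfl

theorem res_tens {S S' : E} (x : S' ⟶ S) (a b : V.El S) :
    (V.res x).obj (V.tens a b) = V.tens ((V.res x).obj a) ((V.res x).obj b) := by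
  ext; simp [tens, ICat.res, comp_lift_assoc]

end TensorICat

/-- The data of an internal monoidal category: the unit `1 ⟶ V` is a global object, and the
associator and the unitors are isomorphisms between generic objects, that is, families of
isomorphisms indexed by `V₀ × V₀ × V₀` and by `V₀`. -/
structure IMonData (E : Type u) [Category.{v} E] [HasPullbacks E] [CartesianMonoidalCategory E]
    extends TensorICat E where
  unit : 𝟙_ E ⟶ obj
  assoc : toTensorICat.tens (S := obj ⊗ (obj ⊗ obj)) (toTensorICat.tens ⟨fst _ _⟩ ⟨snd _ _ ≫ fst _ _⟩)
      ⟨snd _ _ ≫ snd _ _⟩ ≅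
    toTensorICat.tens ⟨fst _ _⟩ (toTensorICat.tens ⟨snd _ _ ≫ fst _ _⟩ ⟨snd _ _ ≫ snd _ _⟩)
  leftUnitor : toTensorICat.tens (S := obj) ⟨toUnit _ ≫ unit⟩ ⟨𝟙 obj⟩ ≅ ⟨𝟙 obj⟩
  rightUnitor : toTensorICat.tens (S := obj) ⟨𝟙 obj⟩ ⟨toUnit _ ≫ unit⟩ ≅ ⟨𝟙 obj⟩

namespace IMonData

variable {E : Type u} [Category.{v} E] [HasPullbacks E] [CartesianMonoidalCategory E]
  (V : IMonData E)

/-- The monoidal product, unit, associator and unitors at generalized objects. -/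
noncomputable instance (S : E) : MonoidalCategoryStruct (V.El S) where
  tensorObj a b := V.tens a b
  tensorHom f g := V.tensHom f g
  whiskerLeft a _ _ f := V.tensHom (𝟙 a) f
  whiskerRight f b := V.tensHom f (𝟙 b)
  tensorUnit := ⟨toUnit S ≫ V.unit⟩
  associator a b c := ICat.castIso ((V.res (lift a.pt (lift b.pt c.pt))).mapIso V.assoc)
    (by ext; simp [TensorICat.tens, ICat.res, comp_lift_assoc])
    (by ext; simp [TensorICat.tens, ICat.res, comp_lift_assoc])
  leftUnitor a := ICat.castIso ((V.res a.pt).mapIso V.leftUnitor)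
    (by ext; simp [TensorICat.tens, ICat.res, comp_lift_assoc])
    (by ext; simp [ICat.res])
  rightUnitor a := ICat.castIso ((V.res a.pt).mapIso V.rightUnitor)
    (by ext; simp [TensorICat.tens, ICat.res, comp_lift_assoc])
    (by ext; simp [ICat.res])

/-- The axioms of an internal monoidal category: naturality of the associator and of the unitors,
triangle and pentagon, in the internal language (at generalized objects of every stage `S`). -/
structure IsMonoidal (V : IMonData E) : Prop where
  associator_naturality : ∀ {S : E} {a b c a' b' c' : V.El S} (f : a ⟶ a') (g : b ⟶ b')
    (h : c ⟶ c'), ((f ⊗ₘ g) ⊗ₘ h) ≫ (α_ a' b' c').hom = (α_ a b c).hom ≫ (f ⊗ₘ (g ⊗ₘ h))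
  leftUnitor_naturality : ∀ {S : E} {a a' : V.El S} (f : a ⟶ a'),
    (𝟙 (𝟙_ (V.El S)) ⊗ₘ f) ≫ (λ_ a').hom = (λ_ a).hom ≫ f
  rightUnitor_naturality : ∀ {S : E} {a a' : V.El S} (f : a ⟶ a'),
    (f ⊗ₘ 𝟙 (𝟙_ (V.El S))) ≫ (ρ_ a').hom = (ρ_ a).hom ≫ f
  triangle : ∀ {S : E} (a b : V.El S),
    (α_ a (𝟙_ (V.El S)) b).hom ≫ (𝟙 a ⊗ₘ (λ_ b).hom) = (ρ_ a).hom ⊗ₘ 𝟙 b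
  pentagon : ∀ {S : E} (a b c d : V.El S),
    ((α_ a b c).hom ⊗ₘ 𝟙 d) ≫ (α_ a (b ⊗ c) d).hom ≫ (𝟙 a ⊗ₘ (α_ b c d).hom) =
      (α_ (a ⊗ b) c d).hom ≫ (α_ a b (c ⊗ d)).hom

end IMonData

/-- An internal monoidal category. -/
structure IMonCat (E : Type u) [Category.{v} E] [HasPullbacks E] [CartesianMonoidalCategory E]
    extends IMonData E where
  isMonoidal : toIMonData.IsMonoidal

namespace IMonCat

variable {E : Type u} [Category.{v} E] [HasPullbacks E] [CartesianMonoidalCategory E]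

/-- The generalized objects of an internal monoidal category form a monoidal category. -/
noncomputable instance (V : IMonCat E) (S : E) : MonoidalCategory (V.El S) :=
  MonoidalCategory.ofTensorHom
    (id_tensorHom_id := fun a b => ICat.el_ext (by
      change lift (a.pt ≫ V.ident) (b.pt ≫ V.ident) ≫ V.tensorMor =
        (lift a.pt b.pt ≫ V.tensorObj) ≫ V.ident
      rw [Category.assoc, ← V.tensor_ident, lift_map_assoc]))
    (id_tensorHom := fun _ _ _ _ => rfl)
    (tensorHom_id := fun _ _ => rfl)
    (tensorHom_comp_tensorHom := fun _ _ _ _ => ICat.el_ext (V.tensor_cmp _ _ _ _ _ _).symm)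
    (associator_naturality := V.isMonoidal.associator_naturality)
    (leftUnitor_naturality := V.isMonoidal.leftUnitor_naturality)
    (rightUnitor_naturality := V.isMonoidal.rightUnitor_naturality)
    (pentagon := V.isMonoidal.pentagon)
    (triangle := V.isMonoidal.triangle)

/-- A strict internal monoidal category: the associator and the unitors are identity arrows. -/
structure IsStrict (V : IMonCat E) : Prop where
  assoc : V.assoc.hom.arr = V.assoc.hom.arr ≫ V.src ≫ V.ident
  leftUnitor : V.leftUnitor.hom.arr = V.leftUnitor.hom.arr ≫ V.src ≫ V.ident
  rightUnitor : V.rightUnitor.hom.arr = V.rightUnitor.hom.arr ≫ V.src ≫ V.ident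

theorem tensorHom_arr (V : IMonCat E) {S : E} {a a' b b' : V.El S} (f : a ⟶ a') (g : b ⟶ b') :
    (f ⊗ₘ g).arr = lift f.arr g.arr ≫ V.tensorMor := rfl

theorem tensorHom_arr_congr (V : IMonCat E) {S : E} {a a' b b' c c' d d' : V.El S} {f : a ⟶ a'}
    {g : b ⟶ b'} {f' : c ⟶ c'} {g' : d ⟶ d'} (hf : f.arr = f'.arr) (hg : g.arr = g'.arr) :
    (f ⊗ₘ g).arr = (f' ⊗ₘ g').arr := by
  rw [tensorHom_arr, tensorHom_arr, hf, hg]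

theorem tensorHom_idArr (V : IMonCat E) {S : E} {a a' b b' : V.El S} {f : a ⟶ a'} {g : b ⟶ b'}
    (hf : f.arr = a'.pt ≫ V.ident) (hg : g.arr = b'.pt ≫ V.ident) :
    (f ⊗ₘ g).arr = (a' ⊗ b').pt ≫ V.ident := by
  rw [tensorHom_arr_congr V (f' := 𝟙 a') (g' := 𝟙 b') hf hg, MonoidalCategory.id_tensorHom_id]
  rfl

theorem res_tensorObj (V : IMonCat E) {S S' : E} (x : S' ⟶ S) (a b : V.El S) :
    (V.res x).obj (a ⊗ b) = (V.res x).obj a ⊗ (V.res x).obj b := V.res_tens x a b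

end IMonCat

/-! ### Internal enriched categories -/

section VCat

variable {E : Type u} [Category.{v} E] [HasPullbacks E] [CartesianMonoidalCategory E]

/-- The data of an internal `V`-enriched category. -/
structure VCatData (V : IMonCat E) where
  obj : E
  hom : obj ⊗ obj ⟶ V.obj
  comp : obj ⊗ (obj ⊗ obj) ⟶ V.mor
  ident : obj ⟶ V.mor

namespace VCatData

variable {V : IMonCat E}

/-- The internal hom of two generalized objects. -/
def homEl (X : VCatData V) {S : E} (x y : S ⟶ X.obj) : V.El S := ⟨lift x y ≫ X.hom⟩

/-- Domain and codomain of the composition and identity arrows. -/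
structure IsTyped (X : VCatData V) : Prop where
  comp_src : ∀ {S : E} (x₀ x₁ x₂ : S ⟶ X.obj),
    (lift x₀ (lift x₁ x₂) ≫ X.comp) ≫ V.src = (X.homEl x₁ x₂ ⊗ X.homEl x₀ x₁).pt
  comp_tgt : ∀ {S : E} (x₀ x₁ x₂ : S ⟶ X.obj),
    (lift x₀ (lift x₁ x₂) ≫ X.comp) ≫ V.tgt = (X.homEl x₀ x₂).pt
  ident_src : ∀ {S : E} (x : S ⟶ X.obj), (x ≫ X.ident) ≫ V.src = (𝟙_ (V.El S)).pt
  ident_tgt : ∀ {S : E} (x : S ⟶ X.obj), (x ≫ X.ident) ≫ V.tgt = (X.homEl x x).pt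

/-- Composition `X(x₁, x₂) ⊗ X(x₀, x₁) ⟶ X(x₀, x₂)` at generalized objects. -/
def IsTyped.compHom {X : VCatData V} (h : X.IsTyped) {S : E} (x₀ x₁ x₂ : S ⟶ X.obj) :
    X.homEl x₁ x₂ ⊗ X.homEl x₀ x₁ ⟶ X.homEl x₀ x₂ :=
  (⟨lift x₀ (lift x₁ x₂) ≫ X.comp, h.comp_src _ _ _, h.comp_tgt _ _ _⟩ : V.ElHom _ _)

/-- Identity `I ⟶ X(x, x)` at generalized objects. -/
def IsTyped.identHom {X : VCatData V} (h : X.IsTyped) {S : E} (x : S ⟶ X.obj) :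
    𝟙_ (V.El S) ⟶ X.homEl x x :=
  (⟨x ≫ X.ident, h.ident_src _, h.ident_tgt _⟩ : V.ElHom _ _)

/-- The axioms of an internal `V`-enriched category. -/
structure IsVCat (X : VCatData V) : Prop extends X.IsTyped where
  assoc : ∀ {S : E} (x₀ x₁ x₂ x₃ : S ⟶ X.obj),
    (toIsTyped.compHom x₁ x₂ x₃ ⊗ₘ 𝟙 (X.homEl x₀ x₁)) ≫ toIsTyped.compHom x₀ x₁ x₃ =
      (α_ (X.homEl x₂ x₃) (X.homEl x₁ x₂) (X.homEl x₀ x₁)).hom ≫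
        (𝟙 (X.homEl x₂ x₃) ⊗ₘ toIsTyped.compHom x₀ x₁ x₂) ≫ toIsTyped.compHom x₀ x₂ x₃
  id_comp : ∀ {S : E} (x₀ x₁ : S ⟶ X.obj),
    (toIsTyped.identHom x₁ ⊗ₘ 𝟙 (X.homEl x₀ x₁)) ≫ toIsTyped.compHom x₀ x₁ x₁ =
      (λ_ (X.homEl x₀ x₁)).hom
  comp_id : ∀ {S : E} (x₀ x₁ : S ⟶ X.obj),
    (𝟙 (X.homEl x₀ x₁) ⊗ₘ toIsTyped.identHom x₀) ≫ toIsTyped.compHom x₀ x₀ x₁ =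
      (ρ_ (X.homEl x₀ x₁)).hom

end VCatData

/-- Internal `V`-enriched categories. -/
structure VCat (V : IMonCat E) extends VCatData V where
  isVCat : toVCatData.IsVCat

namespace VCat

variable {V : IMonCat E}

/-- Composition `X(x₁, x₂) ⊗ X(x₀, x₁) ⟶ X(x₀, x₂)` at generalized objects. -/
def compHom (X : VCat V) {S : E} (x₀ x₁ x₂ : S ⟶ X.obj) :
    X.homEl x₁ x₂ ⊗ X.homEl x₀ x₁ ⟶ X.homEl x₀ x₂ := X.isVCat.compHom x₀ x₁ x₂

/-- Identity `I ⟶ X(x, x)` at generalized objects. -/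
def identHom (X : VCat V) {S : E} (x : S ⟶ X.obj) : 𝟙_ (V.El S) ⟶ X.homEl x x :=
  X.isVCat.identHom x

end VCat

/-- The data of an internal enriched functor. -/
@[ext]
structure VFunctorData {V : IMonCat E} (X Y : VCatData V) where
  obj : X.obj ⟶ Y.obj
  map : X.obj ⊗ X.obj ⟶ V.mor

namespace VFunctorData

variable {V : IMonCat E}

/-- Domain and codomain of the arrows `F₁(x₀, x₁)`. -/
structure IsTyped {X Y : VCatData V} (F : VFunctorData X Y) : Prop where
  map_src : ∀ {S : E} (x₀ x₁ : S ⟶ X.obj), (lift x₀ x₁ ≫ F.map) ≫ V.src = (X.homEl x₀ x₁).pt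
  map_tgt : ∀ {S : E} (x₀ x₁ : S ⟶ X.obj),
    (lift x₀ x₁ ≫ F.map) ≫ V.tgt = (Y.homEl (x₀ ≫ F.obj) (x₁ ≫ F.obj)).pt

/-- The arrow `F₁(x₀, x₁) : X(x₀, x₁) ⟶ Y(F₀ x₀, F₀ x₁)`. -/
def IsTyped.mapHom {X Y : VCatData V} {F : VFunctorData X Y} (h : F.IsTyped) {S : E}
    (x₀ x₁ : S ⟶ X.obj) : X.homEl x₀ x₁ ⟶ Y.homEl (x₀ ≫ F.obj) (x₁ ≫ F.obj) :=
  (⟨lift x₀ x₁ ≫ F.map, h.map_src _ _, h.map_tgt _ _⟩ : V.ElHom _ _)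

/-- The axioms of an internal enriched functor. -/
structure IsVFunctor {X Y : VCat V} (F : VFunctorData X.toVCatData Y.toVCatData) : Prop
    extends F.IsTyped where
  map_comp : ∀ {S : E} (x₀ x₁ x₂ : S ⟶ X.obj),
    X.compHom x₀ x₁ x₂ ≫ toIsTyped.mapHom x₀ x₂ =
      (toIsTyped.mapHom x₁ x₂ ⊗ₘ toIsTyped.mapHom x₀ x₁) ≫
        Y.compHom (x₀ ≫ F.obj) (x₁ ≫ F.obj) (x₂ ≫ F.obj)
  map_id : ∀ {S : E} (x : S ⟶ X.obj),
    X.identHom x ≫ toIsTyped.mapHom x x = Y.identHom (x ≫ F.obj)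

/-- The identity enriched functor. -/
def id (X : VCatData V) : VFunctorData X X := ⟨𝟙 _, X.hom ≫ V.ident⟩

theorem isTyped_id (X : VCatData V) : (id X).IsTyped where
  map_src x₀ x₁ := by simp [id, V.ident_src, VCatData.homEl]
  map_tgt x₀ x₁ := by simp [id, V.ident_tgt, VCatData.homEl]

/-- The composite of enriched functors: `(GF)₁(x₀, x₁) = G₁(F₀ x₀, F₀ x₁) ∘ F₁(x₀, x₁)`. -/
noncomputable def comp {X Y Z : VCatData V} (F : VFunctorData X Y) (G : VFunctorData Y Z)
    (hF : F.IsTyped) (hG : G.IsTyped) : VFunctorData X Z where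
  obj := F.obj ≫ G.obj
  map := (hF.mapHom (fst _ _) (snd _ _) ≫
    hG.mapHom (fst _ _ ≫ F.obj) (snd _ _ ≫ F.obj)).arr

theorem lift_comp_map {X Y Z : VCatData V} (F : VFunctorData X Y) (G : VFunctorData Y Z)
    (hF : F.IsTyped) (hG : G.IsTyped) {S : E} (x₀ x₁ : S ⟶ X.obj) :
    lift x₀ x₁ ≫ (F.comp G hF hG).map =
      (hF.mapHom x₀ x₁ ≫ hG.mapHom (x₀ ≫ F.obj) (x₁ ≫ F.obj)).arr := by
  dsimp only [comp]
  rw [ICat.el_comp_arr, ICat.el_comp_arr, V.comp_cmp]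
  apply V.cmp_congr
  · simp [IsTyped.mapHom]
  · simp [IsTyped.mapHom]

theorem isTyped_comp {X Y Z : VCatData V} (F : VFunctorData X Y) (G : VFunctorData Y Z)
    (hF : F.IsTyped) (hG : G.IsTyped) : (F.comp G hF hG).IsTyped where
  map_src x₀ x₁ := by rw [lift_comp_map, ICat.ElHom.src]
  map_tgt x₀ x₁ := by rw [lift_comp_map, ICat.ElHom.tgt]; simp [comp]

theorem comp_mapHom_arr {X Y Z : VCatData V} (F : VFunctorData X Y) (G : VFunctorData Y Z)
    (hF : F.IsTyped) (hG : G.IsTyped) {S : E} (x₀ x₁ : S ⟶ X.obj) :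
    ((isTyped_comp F G hF hG).mapHom x₀ x₁).arr =
      (hF.mapHom x₀ x₁ ≫ hG.mapHom (x₀ ≫ F.obj) (x₁ ≫ F.obj)).arr :=
  lift_comp_map F G hF hG x₀ x₁

end VFunctorData

/-- Internal enriched functors. -/
@[ext]
structure VFunctor {V : IMonCat E} (X Y : VCat V) where
  data : VFunctorData X.toVCatData Y.toVCatData
  isVFunctor : data.IsVFunctor

namespace VCat

variable {V : IMonCat E}

theorem id_mapHom_arr (X : VCat V) {S : E} (x₀ x₁ : S ⟶ X.obj) :
    ((VFunctorData.isTyped_id X.toVCatData).mapHom x₀ x₁).arr =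
      (X.homEl x₀ x₁).pt ≫ V.ident := by
  simp [VFunctorData.IsTyped.mapHom, VFunctorData.id, VCatData.homEl]

theorem id_mapHom_arr' (X : VCat V) {S : E} (x₀ x₁ : S ⟶ X.obj) :
    ((VFunctorData.isTyped_id X.toVCatData).mapHom x₀ x₁).arr =
      (X.homEl (x₀ ≫ (VFunctorData.id X.toVCatData).obj)
        (x₁ ≫ (VFunctorData.id X.toVCatData).obj)).pt ≫ V.ident := by
  simp [VFunctorData.IsTyped.mapHom, VFunctorData.id, VCatData.homEl]

theorem isVFunctor_id (X : VCat V) : (VFunctorData.id X.toVCatData).IsVFunctor where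
  toIsTyped := VFunctorData.isTyped_id _
  map_comp x₀ x₁ x₂ := ICat.el_ext (by
    rw [ICat.comp_idArr _ (id_mapHom_arr X x₀ x₂), ICat.idArr_comp _ (V.tensorHom_idArr
      (id_mapHom_arr' X x₁ x₂) (id_mapHom_arr' X x₀ x₁))]
    simp [compHom, VCatData.IsTyped.compHom, VFunctorData.id])
  map_id x := ICat.el_ext (by
    rw [ICat.comp_idArr _ (id_mapHom_arr X x x)]
    simp [identHom, VCatData.IsTyped.identHom, VFunctorData.id])

theorem isVFunctor_comp {X Y Z : VCat V} (F : VFunctor X Y) (G : VFunctor Y Z) :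
    (F.data.comp G.data F.isVFunctor.toIsTyped G.isVFunctor.toIsTyped).IsVFunctor where
  toIsTyped := VFunctorData.isTyped_comp _ _ _ _
  map_comp {S} x₀ x₁ x₂ := ICat.el_ext (by
    have key := fun x y : S ⟶ X.obj => VFunctorData.comp_mapHom_arr F.data G.data
      F.isVFunctor.toIsTyped G.isVFunctor.toIsTyped x y
    rw [ICat.comp_arr_congr rfl (key x₀ x₂), ← Category.assoc, F.isVFunctor.map_comp,
      Category.assoc (F.isVFunctor.mapHom x₁ x₂ ⊗ₘ F.isVFunctor.mapHom x₀ x₁),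
      G.isVFunctor.map_comp, ← Category.assoc,
      MonoidalCategory.tensorHom_comp_tensorHom]
    apply ICat.comp_arr_congr
    · exact V.tensorHom_arr_congr (key x₁ x₂).symm (key x₀ x₁).symm
    · simp [compHom, VCatData.IsTyped.compHom, VFunctorData.comp])
  map_id {S} x := ICat.el_ext (by
    have key := fun x y : S ⟶ X.obj => VFunctorData.comp_mapHom_arr F.data G.data
      F.isVFunctor.toIsTyped G.isVFunctor.toIsTyped x y
    rw [ICat.comp_arr_congr rfl (key x x), ← Category.assoc, F.isVFunctor.map_id,
      G.isVFunctor.map_id]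
    simp [identHom, VCatData.IsTyped.identHom, VFunctorData.comp])

/-- The category of internal `V`-enriched categories and functors. -/
noncomputable instance : Category (VCat V) where
  Hom X Y := VFunctor X Y
  id X := ⟨VFunctorData.id X.toVCatData, isVFunctor_id X⟩
  comp F G := ⟨F.data.comp G.data F.isVFunctor.toIsTyped G.isVFunctor.toIsTyped,
    isVFunctor_comp F G⟩
  id_comp {X Y} F := VFunctor.ext (VFunctorData.ext (Category.id_comp _) (by
    dsimp only [VFunctorData.comp]
    rw [ICat.idArr_comp _ (id_mapHom_arr' X _ _)]
    simp [VFunctorData.IsTyped.mapHom, VFunctorData.id]))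
  comp_id {X Y} F := VFunctor.ext (VFunctorData.ext (Category.comp_id _) (by
    dsimp only [VFunctorData.comp]
    rw [ICat.comp_idArr _ (id_mapHom_arr Y _ _)]
    simp [VFunctorData.IsTyped.mapHom]))
  assoc {X Y Z W} F G H := VFunctor.ext (VFunctorData.ext (Category.assoc _ _ _) (by
    have key := VFunctorData.comp_mapHom_arr F.data G.data F.isVFunctor.toIsTyped
      G.isVFunctor.toIsTyped (fst X.obj X.obj) (snd X.obj X.obj)
    have key' := VFunctorData.comp_mapHom_arr G.data H.data G.isVFunctor.toIsTyped
      H.isVFunctor.toIsTyped (fst X.obj X.obj ≫ F.data.obj) (snd X.obj X.obj ≫ F.data.obj)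
    change (VFunctorData.IsTyped.mapHom _ _ _ ≫ VFunctorData.IsTyped.mapHom _ _ _).arr =
      (VFunctorData.IsTyped.mapHom _ _ _ ≫ VFunctorData.IsTyped.mapHom _ _ _).arr
    refine (ICat.comp_arr_congr (g' := H.isVFunctor.mapHom ((fst _ _ ≫ F.data.obj) ≫ G.data.obj)
      ((snd _ _ ≫ F.data.obj) ≫ G.data.obj)) key ?_).trans ?_
    · simp [VFunctorData.IsTyped.mapHom, VFunctorData.comp]
    rw [Category.assoc (F.isVFunctor.mapHom (fst X.obj X.obj) (snd X.obj X.obj))]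
    exact ICat.comp_arr_congr rfl key'.symm))

end VCat

end VCat

/-! ### Generalized multicategories -/

section Multicategories

universe v₁ u₁

variable {G : Type u₁} [Category.{v₁} G] [HasPullbacks G] {T : Monad G}

/-- The data of a `T`-multicategory: a `T`-graph `T C₀ ⟵ C₁ ⟶ C₀` with composition
`C₁ ×_{T C₀} T C₁ ⟶ C₁` and identities `C₀ ⟶ C₁`. -/
structure MulticatData (T : Monad G) where
  ob : G
  ar : G
  src : ar ⟶ T.obj ob
  tgt : ar ⟶ ob
  comp : pullback src (T.map tgt) ⟶ ar
  ident : ob ⟶ ar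

namespace MulticatData

/-- Composition of generalized elements. -/
noncomputable def cmp (C : MulticatData T) {Q : G} (a : Q ⟶ C.ar) (b : Q ⟶ T.obj C.ar)
    (h : a ≫ C.src = b ≫ T.map C.tgt) : Q ⟶ C.ar :=
  pullback.lift a b h ≫ C.comp

theorem comp_cmp (C : MulticatData T) {Q Q' : G} (x : Q' ⟶ Q) (a : Q ⟶ C.ar)
    (b : Q ⟶ T.obj C.ar) (h : a ≫ C.src = b ≫ T.map C.tgt) :
    x ≫ C.cmp a b h = C.cmp (x ≫ a) (x ≫ b) (by rw [Category.assoc, h, Category.assoc]) := by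
  rw [cmp, cmp, ← Category.assoc]
  congr 1
  apply pullback.hom_ext
  · rw [Category.assoc, pullback.lift_fst, pullback.lift_fst]
  · rw [Category.assoc, pullback.lift_snd, pullback.lift_snd]

theorem cmp_congr (C : MulticatData T) {Q : G} {a a' : Q ⟶ C.ar} {b b' : Q ⟶ T.obj C.ar}
    (h : a ≫ C.src = b ≫ T.map C.tgt) (ha : a = a') (hb : b = b') :
    C.cmp a b h = C.cmp a' b' (by rw [← ha, ← hb, h]) := by
  subst ha hb; rfl

/-- Sources and targets of composites and identities. -/
structure IsTyped (C : MulticatData T) : Prop where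
  comp_src : C.comp ≫ C.src = pullback.snd _ _ ≫ T.map C.src ≫ T.μ.app C.ob
  comp_tgt : C.comp ≫ C.tgt = pullback.fst _ _ ≫ C.tgt
  ident_src : C.ident ≫ C.src = T.η.app C.ob
  ident_tgt : C.ident ≫ C.tgt = 𝟙 C.ob

namespace IsTyped

variable {C : MulticatData T}

theorem cmp_src (h : C.IsTyped) {Q : G} (a : Q ⟶ C.ar) (b : Q ⟶ T.obj C.ar)
    (hab : a ≫ C.src = b ≫ T.map C.tgt) :
    C.cmp a b hab ≫ C.src = b ≫ T.map C.src ≫ T.μ.app C.ob := by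
  rw [cmp, Category.assoc, h.comp_src, pullback.lift_snd_assoc]

theorem cmp_tgt (h : C.IsTyped) {Q : G} (a : Q ⟶ C.ar) (b : Q ⟶ T.obj C.ar)
    (hab : a ≫ C.src = b ≫ T.map C.tgt) : C.cmp a b hab ≫ C.tgt = a ≫ C.tgt := by
  rw [cmp, Category.assoc, h.comp_tgt, pullback.lift_fst_assoc]

theorem left (h : C.IsTyped) {Q : G} (a : Q ⟶ C.ar) :
    (a ≫ C.tgt ≫ C.ident) ≫ C.src = (a ≫ T.η.app C.ar) ≫ T.map C.tgt := by
  simp only [Category.assoc, h.ident_src]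
  rw [← T.η.naturality]; rfl

theorem right (h : C.IsTyped) {Q : G} (a : Q ⟶ C.ar) :
    a ≫ C.src = (a ≫ C.src ≫ T.map C.ident) ≫ T.map C.tgt := by
  rw [Category.assoc, Category.assoc, ← T.map_comp, h.ident_tgt, T.map_id, Category.comp_id]

theorem assoc_left (h : C.IsTyped) {Q : G} (a : Q ⟶ C.ar) (b : Q ⟶ T.obj (pullback C.src (T.map C.tgt)))
    (hab : a ≫ C.src = b ≫ T.map (pullback.fst _ _) ≫ T.map C.tgt) :
    a ≫ C.src = (b ≫ T.map C.comp) ≫ T.map C.tgt := by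
  rw [hab, Category.assoc, ← T.map_comp, ← T.map_comp, h.comp_tgt]

theorem assoc_right (h : C.IsTyped) {Q : G} (a : Q ⟶ C.ar) (b : Q ⟶ T.obj (pullback C.src (T.map C.tgt)))
    (hab : a ≫ C.src = (b ≫ T.map (pullback.fst _ _)) ≫ T.map C.tgt) :
    C.cmp a (b ≫ T.map (pullback.fst _ _)) hab ≫ C.src =
      (b ≫ T.map (pullback.snd _ _) ≫ T.μ.app C.ar) ≫ T.map C.tgt := by
  rw [h.cmp_src]
  have e : pullback.fst C.src (T.map C.tgt) ≫ C.src = pullback.snd _ _ ≫ T.map C.tgt :=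
    pullback.condition
  have n : (T.map (T.map C.tgt)) ≫ T.μ.app C.ob = T.μ.app C.ar ≫ T.map C.tgt := T.μ.naturality _
  simp only [Category.assoc]
  rw [← T.map_comp_assoc, e, T.map_comp_assoc, n]

end IsTyped

/-- The axioms of a `T`-multicategory: unitarity and associativity, the latter for a generalized
element of `C₁ ×_{T C₀} T (C₁ ×_{T C₀} T C₁)`. -/
structure IsMulticat (C : MulticatData T) : Prop extends C.IsTyped where
  ident_cmp : ∀ {Q : G} (a : Q ⟶ C.ar),
    C.cmp (a ≫ C.tgt ≫ C.ident) (a ≫ T.η.app C.ar) (toIsTyped.left a) = a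
  cmp_ident : ∀ {Q : G} (a : Q ⟶ C.ar),
    C.cmp a (a ≫ C.src ≫ T.map C.ident) (toIsTyped.right a) = a
  assoc : ∀ {Q : G} (a : Q ⟶ C.ar) (b : Q ⟶ T.obj (pullback C.src (T.map C.tgt)))
    (hab : a ≫ C.src = (b ≫ T.map (pullback.fst _ _)) ≫ T.map C.tgt),
    C.cmp a (b ≫ T.map C.comp)
        (toIsTyped.assoc_left a b (hab.trans (Category.assoc _ _ _))) =
      C.cmp (C.cmp a (b ≫ T.map (pullback.fst _ _)) hab)
        (b ≫ T.map (pullback.snd _ _) ≫ T.μ.app C.ar) (toIsTyped.assoc_right a b hab)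

end MulticatData

/-- `T`-multicategories. -/
structure Multicat (T : Monad G) extends MulticatData T where
  isMulticat : toMulticatData.IsMulticat

/-- Functors of `T`-multicategories. -/
@[ext]
structure MulticatFunctor (C D : Multicat T) where
  ob : C.ob ⟶ D.ob
  ar : C.ar ⟶ D.ar
  src_comm : ar ≫ D.src = C.src ≫ T.map ob
  tgt_comm : ar ≫ D.tgt = C.tgt ≫ ob
  map_ident : C.ident ≫ ar = ob ≫ D.ident
  map_comp : C.comp ≫ ar = D.cmp (pullback.fst _ _ ≫ ar) (pullback.snd _ _ ≫ T.map ar) (by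
    rw [Category.assoc, src_comm, Category.assoc, ← T.map_comp, tgt_comm, T.map_comp,
      pullback.condition_assoc])

namespace MulticatFunctor

/-- Composition of functors of `T`-multicategories. -/
def comp {C D K : Multicat T} (F : MulticatFunctor C D) (H : MulticatFunctor D K) :
    MulticatFunctor C K where
  ob := F.ob ≫ H.ob
  ar := F.ar ≫ H.ar
  src_comm := by
    rw [Category.assoc, H.src_comm, ← Category.assoc, F.src_comm, Category.assoc, ← T.map_comp]
  tgt_comm := by
    rw [Category.assoc, H.tgt_comm, ← Category.assoc, F.tgt_comm, Category.assoc]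
  map_ident := by
    rw [← Category.assoc, F.map_ident, Category.assoc, H.map_ident, Category.assoc]
  map_comp := by
    rw [← Category.assoc, F.map_comp, MulticatData.cmp, Category.assoc, H.map_comp, K.comp_cmp]
    apply K.cmp_congr
    · rw [pullback.lift_fst_assoc, Category.assoc]
    · rw [pullback.lift_snd_assoc, Category.assoc, ← T.map_comp]

end MulticatFunctor

/-- Transformations `F ⟶ H` of functors of `T`-multicategories: a family `α_c : F c ⟶ H c` of unary
arrows of `D`, such that `α_c ∘ F θ = H θ ∘ (α_{c₁}, …, α_{cₙ})` for `θ : c₁, …, cₙ ⟶ c`. -/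
@[ext]
structure MulticatTrans {C D : Multicat T} (F H : MulticatFunctor C D) where
  app : C.ob ⟶ D.ar
  app_src : app ≫ D.src = F.ob ≫ T.η.app D.ob
  app_tgt : app ≫ D.tgt = H.ob
  naturality : D.cmp (C.tgt ≫ app) (F.ar ≫ T.η.app D.ar) (by
      have n := T.η.naturality D.tgt
      dsimp at n
      rw [Category.assoc, app_src, Category.assoc, ← n, ← Category.assoc, ← F.tgt_comm]
      simp only [Category.assoc]) =
    D.cmp H.ar (C.src ≫ T.map app) (by
      rw [H.src_comm, Category.assoc, ← T.map_comp, app_tgt])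

/-- The `T`-multicategory of a `T`-algebra `(A, a)`: its `T`-graph is `T A ⟵ T A ⟶ A`, with legs
the identity and `a`, its composition is `μ` after the second projection and its identities are
given by `η`. -/
noncomputable def algebraMulticatData (A : T.Algebra) : MulticatData T where
  ob := A.A
  ar := T.obj A.A
  src := 𝟙 _
  tgt := A.a
  comp := pullback.snd _ _ ≫ T.μ.app A.A
  ident := T.η.app A.A

theorem algebraMulticat_cmp (A : T.Algebra) {Q : G} (a : Q ⟶ T.obj A.A)
    (b : Q ⟶ T.obj (T.obj A.A)) (h : a ≫ 𝟙 _ = b ≫ T.map A.a) :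
    (algebraMulticatData A).cmp a b h = b ≫ T.μ.app A.A := by
  dsimp only [MulticatData.cmp, algebraMulticatData]
  rw [pullback.lift_snd_assoc]

theorem algebraMulticat_isTyped (A : T.Algebra) : (algebraMulticatData A).IsTyped where
  comp_src := by
    dsimp only [algebraMulticatData]
    rw [T.map_id, Category.id_comp, Category.comp_id]
  comp_tgt := by
    dsimp only [algebraMulticatData]
    rw [Category.assoc, A.assoc, ← pullback.condition_assoc, Category.id_comp]
  ident_src := by
    dsimp only [algebraMulticatData]
    rw [Category.comp_id]
  ident_tgt := A.unit

theorem algebra_aux₁ {X Q : G} (a : Q ⟶ T.obj X) :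
    (a ≫ T.η.app (T.obj X)) ≫ T.μ.app X = a := by
  rw [Category.assoc, T.left_unit]; exact Category.comp_id _

theorem algebra_aux₂ {X Q : G} (a : Q ⟶ T.obj X) :
    (a ≫ 𝟙 _ ≫ T.map (T.η.app X)) ≫ T.μ.app X = a := by
  rw [Category.id_comp, Category.assoc, T.right_unit]; exact Category.comp_id _

theorem algebra_aux₃ {X P Q : G} (s : P ⟶ T.obj (T.obj X)) (b : Q ⟶ T.obj P) :
    (b ≫ T.map (s ≫ T.μ.app X)) ≫ T.μ.app X =
      (b ≫ T.map s ≫ T.μ.app (T.obj X)) ≫ T.μ.app X := by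
  rw [T.map_comp, Category.assoc, Category.assoc, T.assoc, Category.assoc, Category.assoc]

theorem algebra_aux₄ {X Y P : G} (s : P ⟶ T.obj (T.obj X)) (f : X ⟶ Y) :
    (s ≫ T.μ.app X) ≫ T.map f = (s ≫ T.map (T.map f)) ≫ T.μ.app Y := by
  rw [Category.assoc, Category.assoc]
  exact congrArg _ (T.μ.naturality f).symm

/-- The `T`-multicategory of a `T`-algebra. -/
noncomputable def algebraMulticat (A : T.Algebra) : Multicat T where
  toMulticatData := algebraMulticatData A
  isMulticat :=
    { toIsTyped := algebraMulticat_isTyped A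
      ident_cmp := fun a => (algebraMulticat_cmp A _ _ _).trans (algebra_aux₁ (X := A.A) a)
      cmp_ident := fun a => (algebraMulticat_cmp A _ _ _).trans (algebra_aux₂ (X := A.A) a)
      assoc := fun _ b _ => (algebraMulticat_cmp A _ _ _).trans
        ((algebra_aux₃ (X := A.A) _ b).trans (algebraMulticat_cmp A _ _ _).symm) }

/-- The functor of `T`-multicategories given by a map of `T`-algebras. -/
noncomputable def algebraMulticatMap {A B : T.Algebra} (f : A ⟶ B) :
    MulticatFunctor (algebraMulticat A) (algebraMulticat B) where
  ob := f.f
  ar := T.map f.f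
  src_comm := (Category.comp_id _).trans (Category.id_comp _).symm
  tgt_comm := f.h
  map_ident := (T.η.naturality f.f).symm
  map_comp := (algebra_aux₄ (X := A.A) _ f.f).trans (algebraMulticat_cmp B _ _ _).symm

end Multicategories

section Trans

universe v₁ u₁

variable {G : Type u₁} [Category.{v₁} G] [HasPullbacks G] {T : Monad G}

theorem eta_naturality {X Y : G} (f : X ⟶ Y) : T.η.app X ≫ T.map f = f ≫ T.η.app Y :=
  (T.η.naturality f).symm

theorem eta_map_mu {X Y : G} (f : X ⟶ T.obj Y) : T.η.app X ≫ T.map f ≫ T.μ.app Y = f := by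
  rw [← Category.assoc, eta_naturality, Category.assoc, T.left_unit]; exact Category.comp_id f

theorem map_eta_mu {X Y : G} (f : X ⟶ Y) : T.map (f ≫ T.η.app Y) ≫ T.μ.app Y = T.map f := by
  rw [T.map_comp, Category.assoc, T.right_unit]; exact Category.comp_id _

namespace MulticatData.IsMulticat

variable {C : MulticatData T}

theorem assoc_map (hC : C.IsMulticat) {Q R : G} (a : Q ⟶ C.ar) (b : Q ⟶ T.obj R) (p : R ⟶ C.ar) (q : R ⟶ T.obj C.ar)
    (h : p ≫ C.src = q ≫ T.map C.tgt) (h₁ : a ≫ C.src = (b ≫ T.map (C.cmp p q h)) ≫ T.map C.tgt)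
    (h₂ : a ≫ C.src = (b ≫ T.map p) ≫ T.map C.tgt)
    (h₃ : C.cmp a (b ≫ T.map p) h₂ ≫ C.src = (b ≫ T.map q ≫ T.μ.app C.ar) ≫ T.map C.tgt) :
    C.cmp a (b ≫ T.map (C.cmp p q h)) h₁ =
      C.cmp (C.cmp a (b ≫ T.map p) h₂) (b ≫ T.map q ≫ T.μ.app C.ar) h₃ := by
  have e : (b ≫ T.map (pullback.lift p q h)) ≫ T.map (pullback.fst _ _) = b ≫ T.map p := by
    rw [Category.assoc, ← T.map_comp, pullback.lift_fst]
  have key := hC.assoc a (b ≫ T.map (pullback.lift p q h)) (by rw [e, h₂])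
  refine Eq.trans (C.cmp_congr _ rfl ?_) (key.trans (C.cmp_congr _ (C.cmp_congr _ rfl e) ?_))
  · rw [MulticatData.cmp, T.map_comp, Category.assoc]
  · rw [Category.assoc, ← T.map_comp_assoc, pullback.lift_snd]

theorem assoc_unary (hC : C.IsMulticat) {Q : G} (a : Q ⟶ C.ar) (p : Q ⟶ C.ar) (q : Q ⟶ T.obj C.ar)
    (h : p ≫ C.src = q ≫ T.map C.tgt)
    (h₁ : a ≫ C.src = (C.cmp p q h ≫ T.η.app C.ar) ≫ T.map C.tgt)
    (h₂ : a ≫ C.src = (p ≫ T.η.app C.ar) ≫ T.map C.tgt)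
    (h₃ : C.cmp a (p ≫ T.η.app C.ar) h₂ ≫ C.src = q ≫ T.map C.tgt) :
    C.cmp a (C.cmp p q h ≫ T.η.app C.ar) h₁ = C.cmp (C.cmp a (p ≫ T.η.app C.ar) h₂) q h₃ := by
  have e₁ := eta_naturality (T := T) (C.cmp p q h)
  have e₂ := eta_naturality (T := T) p
  have e₃ := eta_map_mu (T := T) q
  have e₄ : a ≫ C.src = (T.η.app Q ≫ T.map p) ≫ T.map C.tgt := h₂.trans (by rw [e₂])
  have key := hC.assoc_map a (T.η.app Q) p q h (h₁.trans (by rw [e₁])) e₄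
    ((congrArg (· ≫ C.src) (C.cmp_congr e₄ rfl e₂)).trans (h₃.trans (by rw [e₃])))
  exact (C.cmp_congr _ rfl e₁.symm).trans (key.trans (C.cmp_congr _ (C.cmp_congr _ rfl e₂) e₃))

end MulticatData.IsMulticat

namespace MulticatTrans

variable {C D : Multicat T}

/-- A unary arrow `f` composes with `a` when `a` is unary with source the target of `f`. -/
theorem unary_aux (D : MulticatData T) {Q : G} (a f : Q ⟶ D.ar) (x : Q ⟶ D.ob)
    (ha : a ≫ D.src = x ≫ T.η.app D.ob) (hf : f ≫ D.tgt = x) :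
    a ≫ D.src = (f ≫ T.η.app D.ar) ≫ T.map D.tgt := by
  rw [Category.assoc, eta_naturality, ← Category.assoc, hf, ha]

theorem naturality' {F H : MulticatFunctor C D} (α : MulticatTrans F H)
    (h : (C.tgt ≫ α.app) ≫ D.src = (F.ar ≫ T.η.app D.ar) ≫ T.map D.tgt)
    (h' : H.ar ≫ D.src = (C.src ≫ T.map α.app) ≫ T.map D.tgt) :
    D.cmp (C.tgt ≫ α.app) (F.ar ≫ T.η.app D.ar) h = D.cmp H.ar (C.src ≫ T.map α.app) h' :=
  α.naturality

theorem src_aux {F H : MulticatFunctor C D} (α : MulticatTrans F H) :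
    (C.tgt ≫ α.app) ≫ D.src = (F.ar ≫ T.η.app D.ar) ≫ T.map D.tgt := by
  rw [Category.assoc, α.app_src, Category.assoc, eta_naturality, ← Category.assoc, ← F.tgt_comm,
    Category.assoc]

theorem tgt_aux {F H : MulticatFunctor C D} (α : MulticatTrans F H) :
    H.ar ≫ D.src = (C.src ≫ T.map α.app) ≫ T.map D.tgt := by
  rw [H.src_comm, Category.assoc, ← T.map_comp, α.app_tgt]

/-- The identity transformation. -/
def id (F : MulticatFunctor C D) : MulticatTrans F F where
  app := F.ob ≫ D.ident
  app_src := by rw [Category.assoc, D.isMulticat.ident_src]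
  app_tgt := by rw [Category.assoc, D.isMulticat.ident_tgt, Category.comp_id]
  naturality := by
    refine (D.cmp_congr _ ?_ rfl).trans ((D.isMulticat.ident_cmp F.ar).trans
      ((D.isMulticat.cmp_ident F.ar).symm.trans (D.cmp_congr _ rfl ?_)))
    · rw [← Category.assoc, ← F.tgt_comm, Category.assoc]
    · rw [← Category.assoc, F.src_comm, T.map_comp, Category.assoc]

/-- Vertical composition of transformations: `(β ∘ α)_c = β_c ∘ α_c`. -/
noncomputable def comp {F H K : MulticatFunctor C D} (α : MulticatTrans F H)
    (β : MulticatTrans H K) : MulticatTrans F K where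
  app := D.cmp β.app (α.app ≫ T.η.app D.ar) (unary_aux _ _ _ _ β.app_src α.app_tgt)
  app_src := by
    rw [D.isMulticat.cmp_src, Category.assoc, eta_map_mu, α.app_src]
  app_tgt := by rw [D.isMulticat.cmp_tgt, β.app_tgt]
  naturality := by
    have hβα := unary_aux D.toMulticatData _ _ _ β.app_src α.app_tgt
    have h₁ : (C.tgt ≫ β.app) ≫ D.src = (D.cmp (C.tgt ≫ α.app) (F.ar ≫ T.η.app D.ar)
        α.src_aux ≫ T.η.app D.ar) ≫ T.map D.tgt :=
      unary_aux _ _ _ (C.tgt ≫ H.ob) (by rw [Category.assoc, β.app_src, Category.assoc])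
        (by rw [D.isMulticat.cmp_tgt, Category.assoc, α.app_tgt])
    have h₂ : (C.tgt ≫ β.app) ≫ D.src = ((C.tgt ≫ α.app) ≫ T.η.app D.ar) ≫ T.map D.tgt :=
      unary_aux _ _ _ (C.tgt ≫ H.ob) (by rw [Category.assoc, β.app_src, Category.assoc])
        (by rw [Category.assoc, α.app_tgt])
    have h₃ : D.cmp (C.tgt ≫ β.app) ((C.tgt ≫ α.app) ≫ T.η.app D.ar) h₂ ≫ D.src =
        (F.ar ≫ T.η.app D.ar) ≫ T.map D.tgt := by
      rw [D.isMulticat.cmp_src, Category.assoc, eta_map_mu, α.src_aux]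
    have e₁ := D.isMulticat.assoc_unary (C.tgt ≫ β.app) (C.tgt ≫ α.app) (F.ar ≫ T.η.app D.ar)
      α.src_aux h₁ h₂ h₃
    have n₁ := D.cmp_congr h₁ rfl (congrArg (· ≫ T.η.app D.ar) (α.naturality' α.src_aux α.tgt_aux))
    have h₄ : D.cmp (C.tgt ≫ β.app) (H.ar ≫ T.η.app D.ar) β.src_aux ≫ D.src =
        (C.src ≫ T.map α.app) ≫ T.map D.tgt := by
      rw [D.isMulticat.cmp_src, Category.assoc, eta_map_mu, α.tgt_aux]
    have e₂ := D.isMulticat.assoc_unary (C.tgt ≫ β.app) H.ar (C.src ≫ T.map α.app)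
      α.tgt_aux (h₁.trans (by rw [α.naturality' α.src_aux α.tgt_aux])) β.src_aux h₄
    have n₂ := D.cmp_congr h₄ (β.naturality' β.src_aux β.tgt_aux) rfl
    have h₅ : K.ar ≫ D.src = (C.src ≫ T.map (D.cmp β.app (α.app ≫ T.η.app D.ar) hβα)) ≫
        T.map D.tgt := by
      rw [K.src_comm, Category.assoc, ← T.map_comp, D.isMulticat.cmp_tgt, β.app_tgt]
    have h₆ : D.cmp K.ar (C.src ≫ T.map β.app) β.tgt_aux ≫ D.src =
        (C.src ≫ T.map (α.app ≫ T.η.app D.ar) ≫ T.μ.app D.ar) ≫ T.map D.tgt := by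
      rw [map_eta_mu, ← β.naturality' β.src_aux β.tgt_aux, h₄]
    have e₃ := D.isMulticat.assoc_map K.ar C.src β.app (α.app ≫ T.η.app D.ar) hβα h₅ β.tgt_aux h₆
    have e₀ : D.cmp (C.tgt ≫ D.cmp β.app (α.app ≫ T.η.app D.ar) hβα) (F.ar ≫ T.η.app D.ar)
        (by rw [D.comp_cmp]; exact (congrArg (· ≫ D.src) (D.cmp_congr _ rfl
          (Category.assoc _ _ _).symm)).trans h₃) =
        D.cmp (D.cmp (C.tgt ≫ β.app) ((C.tgt ≫ α.app) ≫ T.η.app D.ar) h₂)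
          (F.ar ≫ T.η.app D.ar) h₃ :=
      D.cmp_congr _ ((D.comp_cmp _ _ _ _).trans (D.cmp_congr _ rfl (Category.assoc _ _ _).symm)) rfl
    have e₄ := D.cmp_congr h₆ rfl (congrArg (C.src ≫ ·) (map_eta_mu (T := T) α.app))
    exact e₀.trans (e₁.symm.trans (n₁.trans (e₂.trans (n₂.trans (e₄.symm.trans e₃.symm)))))

/-- Whiskering of a transformation with a functor. -/
def whisker {B : Multicat T} (P : MulticatFunctor B C) {F H : MulticatFunctor C D}
    (α : MulticatTrans F H) : MulticatTrans (P.comp F) (P.comp H) where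
  app := P.ob ≫ α.app
  app_src := by rw [Category.assoc, α.app_src, ← Category.assoc]; rfl
  app_tgt := by rw [Category.assoc, α.app_tgt]; rfl
  naturality := by
    have key := congrArg (P.ar ≫ ·) (α.naturality' α.src_aux α.tgt_aux)
    simp only [D.comp_cmp] at key
    refine (D.cmp_congr _ ?_ ?_).trans (key.trans (D.cmp_congr _ rfl ?_))
    · rw [← Category.assoc, ← P.tgt_comm, Category.assoc]
    · exact Category.assoc _ _ _
    · rw [← Category.assoc, P.src_comm, Category.assoc, ← T.map_comp]

theorem comp_assoc_app {F H K L : MulticatFunctor C D} (α : MulticatTrans F H)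
    (β : MulticatTrans H K) (γ : MulticatTrans K L) :
    ((α.comp β).comp γ).app = (α.comp (β.comp γ)).app :=
  D.isMulticat.assoc_unary _ _ _ _ _ _ (by
    rw [D.isMulticat.cmp_src, Category.assoc, eta_map_mu]
    exact unary_aux _ _ _ _ β.app_src α.app_tgt)

theorem whisker_comp_app {B : Multicat T} (P : MulticatFunctor B C) {F H K : MulticatFunctor C D}
    (α : MulticatTrans F H) (β : MulticatTrans H K) :
    ((whisker P α).comp (whisker P β)).app = (whisker P (α.comp β)).app :=
  (D.cmp_congr _ rfl (Category.assoc _ _ _)).trans (D.comp_cmp _ _ _ _).symm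

/-- A transformation, with equal domain and codomain. -/
def cast {F H F' H' : MulticatFunctor C D} (α : MulticatTrans F H) (hF : F = F') (hH : H = H') :
    MulticatTrans F' H' where
  app := α.app
  app_src := by subst hF; exact α.app_src
  app_tgt := by subst hH; exact α.app_tgt
  naturality := by subst hF hH; exact α.naturality

end MulticatTrans

end Trans

/-! ### Enriched generalized multicategories -/

section Enriched

variable {E : Type u} [Category.{v} E] [HasPullbacks E] [CartesianMonoidalCategory E]

/-- The indiscrete internal category on an object. -/
noncomputable def Ind (X : E) : ICat E where
  obj := X
  mor := X ⊗ X
  src := fst _ _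
  tgt := snd _ _
  ident := lift (𝟙 X) (𝟙 X)
  comp := lift (pullback.snd _ _ ≫ fst _ _) (pullback.fst _ _ ≫ snd _ _)
  ident_src := lift_fst _ _
  ident_tgt := lift_snd _ _
  comp_src := lift_fst _ _
  comp_tgt := lift_snd _ _
  cmp_id f := by
    dsimp only [ICatData.cmp]
    rw [comp_lift, pullback.lift_snd_assoc, pullback.lift_fst_assoc]
    apply CartesianMonoidalCategory.hom_ext <;> simp
  id_cmp f := by
    dsimp only [ICatData.cmp]
    rw [comp_lift, pullback.lift_snd_assoc, pullback.lift_fst_assoc]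
    apply CartesianMonoidalCategory.hom_ext <;> simp
  cmp_assoc h g f hg gf := by
    dsimp only [ICatData.cmp]
    simp only [comp_lift, pullback.lift_snd_assoc, pullback.lift_fst_assoc, lift_fst, lift_snd]

theorem Ind_cmp (X : E) {S : E} (g f : S ⟶ X ⊗ X) (h : g ≫ fst X X = f ≫ snd X X) :
    (Ind X).cmp g f h = lift (f ≫ fst _ _) (g ≫ snd _ _) := by
  dsimp only [ICatData.cmp, Ind]
  rw [comp_lift, pullback.lift_snd_assoc, pullback.lift_fst_assoc]

theorem Ind.map_aux {X Y S : E} (f : X ⟶ Y) (g h : S ⟶ X ⊗ X) :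
    lift (h ≫ fst X X) (g ≫ snd X X) ≫ (f ⊗ₘ f) =
      lift ((h ≫ (f ⊗ₘ f)) ≫ fst Y Y) ((g ≫ (f ⊗ₘ f)) ≫ snd Y Y) := by
  rw [lift_map]
  simp

/-- The internal functor between indiscrete categories given by an arrow of `E`. -/
noncomputable def Ind.map {X Y : E} (f : X ⟶ Y) : Ind X ⟶ Ind Y :=
  ({ obj := f
     mor := f ⊗ₘ f
     src_comm := tensorHom_fst _ _
     tgt_comm := tensorHom_snd _ _
     map_ident := by dsimp only [Ind]; rw [lift_map, comp_lift]; simp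
     map_cmp := fun g h w => (congrArg (· ≫ (f ⊗ₘ f)) (Ind_cmp X g h w)).trans
       ((Ind.map_aux f g h).trans (Ind_cmp Y _ _ _).symm) } : IFunctor (Ind X) (Ind Y))

theorem Ind.map_id (X : E) : Ind.map (𝟙 X) = 𝟙 (Ind X) :=
  ICat.hom_ext rfl (MonoidalCategory.id_tensorHom_id _ _)

theorem Ind.map_comp {X Y Z : E} (f : X ⟶ Y) (g : Y ⟶ Z) :
    Ind.map (f ≫ g) = Ind.map f ≫ Ind.map g :=
  ICat.hom_ext rfl (MonoidalCategory.tensorHom_comp_tensorHom _ _ _ _).symm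

variable {fc : IGraph E ⥤ ICat E} (adj : fc ⊣ ICat.forgetGraph E)

/-- The `fc`-multicategory of an object `X`, given by the `fc`-algebra structure on the indiscrete
graph on `X` that is induced by the counit of the adjunction. -/
noncomputable def IndP (X : E) : Multicat adj.toMonad :=
  algebraMulticat ((Monad.comparison adj).obj (Ind X))

/-- The functor of `fc`-multicategories given by an arrow of `E`. -/
noncomputable def IndP.map {X Y : E} (f : X ⟶ Y) : MulticatFunctor (IndP adj X) (IndP adj Y) :=
  algebraMulticatMap ((Monad.comparison adj).map (Ind.map f))

theorem IndP.map_id_comp {X : E} {M : Multicat adj.toMonad} (F : MulticatFunctor (IndP adj X) M) :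
    (IndP.map adj (𝟙 X)).comp F = F := by
  have e : (Monad.comparison adj).map (Ind.map (𝟙 X)) = 𝟙 _ := by
    rw [Ind.map_id]; exact (Monad.comparison adj).map_id _
  apply MulticatFunctor.ext
  · change ((Monad.comparison adj).map (Ind.map (𝟙 X))).f ≫ F.ob = F.ob
    rw [e]; exact Category.id_comp _
  · change adj.toMonad.map ((Monad.comparison adj).map (Ind.map (𝟙 X))).f ≫ F.ar = F.ar
    rw [e]
    refine (congrArg (· ≫ F.ar) (adj.toMonad.map_id _)).trans ?_
    exact Category.id_comp _

theorem IndP.map_comp_comp {X Y Z : E} (f : X ⟶ Y) (g : Y ⟶ Z) {M : Multicat adj.toMonad}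
    (F : MulticatFunctor (IndP adj Z) M) :
    (IndP.map adj (f ≫ g)).comp F = (IndP.map adj f).comp ((IndP.map adj g).comp F) := by
  have e : (Monad.comparison adj).map (Ind.map (f ≫ g)) =
      (Monad.comparison adj).map (Ind.map f) ≫ (Monad.comparison adj).map (Ind.map g) := by
    rw [Ind.map_comp]; exact (Monad.comparison adj).map_comp _ _
  apply MulticatFunctor.ext
  · change ((Monad.comparison adj).map (Ind.map (f ≫ g))).f ≫ F.ob = _
    rw [e]; exact Category.assoc _ _ _
  · change adj.toMonad.map ((Monad.comparison adj).map (Ind.map (f ≫ g))).f ≫ F.ar = _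
    rw [e]
    refine (congrArg (· ≫ F.ar) (adj.toMonad.map_comp _ _)).trans ?_
    exact Category.assoc _ _ _

/-- An `M`-enriched `Id`-multicategory, for an `fc`-multicategory `M`: an object `X` of `E` and a
functor of `fc`-multicategories from the indiscrete `fc`-multicategory on `X` to `M`. -/
structure EnrichedMulticat (M : Multicat adj.toMonad) where
  obj : E
  map : MulticatFunctor (IndP adj obj) M

variable {adj}

/-- A functor of `M`-enriched `Id`-multicategories: an arrow `F₀ : X ⟶ Y` and a transformation
`F₁` from `X` to the composite of `Y` with the functor induced by `F₀`. -/
@[ext]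
structure EnrichedMulticat.Functor {M : Multicat adj.toMonad} (X Y : EnrichedMulticat adj M) where
  obj : X.obj ⟶ Y.obj
  trans : MulticatTrans X.map ((IndP.map adj obj).comp Y.map)

theorem EnrichedMulticat.functor_ext {M : Multicat adj.toMonad} {X Y : EnrichedMulticat adj M}
    {F H : EnrichedMulticat.Functor X Y} (h₀ : F.obj = H.obj)
    (h₁ : F.trans.app = H.trans.app) : F = H := by
  obtain ⟨f, α⟩ := F
  obtain ⟨h, β⟩ := H
  obtain rfl : f = h := h₀
  obtain rfl : α = β := MulticatTrans.ext h₁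
  rfl

/-- The category of `M`-enriched `Id`-multicategories and their functors. -/
noncomputable instance (M : Multicat adj.toMonad) : Category (EnrichedMulticat adj M) where
  Hom X Y := EnrichedMulticat.Functor X Y
  id X := ⟨𝟙 _, (MulticatTrans.id X.map).cast rfl (IndP.map_id_comp adj X.map).symm⟩
  comp {X Y Z} F H := ⟨F.obj ≫ H.obj, (F.trans.comp (H.trans.whisker (IndP.map adj F.obj))).cast
    rfl (IndP.map_comp_comp adj F.obj H.obj Z.map).symm⟩
  id_comp {X Y} F := EnrichedMulticat.functor_ext (Category.id_comp _) (by
    refine (M.cmp_congr _ ?_ ?_).trans (M.isMulticat.cmp_ident F.trans.app)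
    · change (Ind.map (𝟙 X.obj) |> (ICat.forgetGraph E).map) ≫ F.trans.app = _
      rw [Ind.map_id, (ICat.forgetGraph E).map_id]
      exact Category.id_comp _
    · change (X.map.ob ≫ M.ident) ≫ _ = _
      rw [← Category.assoc F.trans.app, F.trans.app_src, Category.assoc, Category.assoc,
        eta_naturality])
  comp_id {X Y} F := EnrichedMulticat.functor_ext (Category.comp_id _) (by
    refine (M.cmp_congr _ ?_ rfl).trans (M.isMulticat.ident_cmp F.trans.app)
    rw [← Category.assoc, F.trans.app_tgt]
    exact (Category.assoc _ _ _).symm)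
  assoc {X Y Z W} F H K := EnrichedMulticat.functor_ext (Category.assoc _ _ _) (by
    have e : (IndP.map adj (F.obj ≫ H.obj)).ob ≫ K.trans.app =
        (IndP.map adj F.obj).ob ≫ (IndP.map adj H.obj).ob ≫ K.trans.app := by
      change (Ind.map (F.obj ≫ H.obj) |> (ICat.forgetGraph E).map) ≫ K.trans.app = _
      rw [Ind.map_comp, (ICat.forgetGraph E).map_comp]
      exact Category.assoc _ _ _
    exact (M.cmp_congr _ e rfl).trans ((MulticatTrans.comp_assoc_app F.trans
      (H.trans.whisker (IndP.map adj F.obj)) ((K.trans.whisker (IndP.map adj H.obj)).whisker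
        (IndP.map adj F.obj))).trans (M.cmp_congr _ (MulticatTrans.whisker_comp_app
          (IndP.map adj F.obj) H.trans (K.trans.whisker (IndP.map adj H.obj))) rfl)))

end Enriched

/-! ### The `fc`-multicategory of an internal monoidal category -/

section MV

variable {E : Type u} [Category.{v} E] [HasPullbacks E] [CartesianMonoidalCategory E]

/-- The internal graph with one vertex and with `A` as its object of edges. -/
abbrev bouquet (A : E) : IGraph E := ⟨𝟙_ E, A, toUnit _, toUnit _⟩

/-- A morphism of graphs into a graph with one vertex is an arrow on edges. -/
def toBouquet {A : E} (G : IGraph E) (k : G.edge ⟶ A) : G ⟶ bouquet A :=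
  (⟨toUnit _, k, toUnit_unique _ _, toUnit_unique _ _⟩ : IGraph.Hom G (bouquet A))

theorem toInd_aux₁ (C : ICat E) {X : E} (k : C.obj ⟶ X) :
    C.ident ≫ lift (C.src ≫ k) (C.tgt ≫ k) = k ≫ lift (𝟙 X) (𝟙 X) := by
  rw [comp_lift, ← Category.assoc, ← Category.assoc, C.ident_src, C.ident_tgt, comp_lift,
    Category.id_comp, Category.comp_id]

theorem toInd_aux₂ (C : ICat E) {X S : E} (k : C.obj ⟶ X) (g f : S ⟶ C.mor)
    (h : g ≫ C.src = f ≫ C.tgt) : C.cmp g f h ≫ lift (C.src ≫ k) (C.tgt ≫ k) =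
      lift ((f ≫ lift (C.src ≫ k) (C.tgt ≫ k)) ≫ fst X X)
        ((g ≫ lift (C.src ≫ k) (C.tgt ≫ k)) ≫ snd X X) := by
  rw [comp_lift, ← Category.assoc, ← Category.assoc, C.cmp_src, C.cmp_tgt]
  simp

/-- The functor into an indiscrete internal category given by an arrow on objects. -/
noncomputable def toInd (C : ICat E) {X : E} (k : C.obj ⟶ X) : C ⟶ Ind X :=
  ({ obj := k
     mor := lift (C.src ≫ k) (C.tgt ≫ k)
     src_comm := lift_fst _ _
     tgt_comm := lift_snd _ _
     map_ident := toInd_aux₁ C k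
     map_cmp := fun g f h => (toInd_aux₂ C k g f h).trans (Ind_cmp X _ _ _).symm } :
    IFunctor C (Ind X))

variable {fc : IGraph E ⥤ ICat E} (adj : fc ⊣ ICat.forgetGraph E)

/-- The unit of the adjunction on vertices. -/
def unitVert (G : IGraph E) : G.vert ⟶ (fc.obj G).obj := (adj.unit.app G).vert

/-- The unit of the adjunction on edges: paths of length one. -/
def unitEdge (G : IGraph E) : G.edge ⟶ (fc.obj G).mor := (adj.unit.app G).edge

theorem unitEdge_src (G : IGraph E) :
    unitEdge adj G ≫ (fc.obj G).src = G.src ≫ unitVert adj G := (adj.unit.app G).src_comm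

theorem unitEdge_tgt (G : IGraph E) :
    unitEdge adj G ≫ (fc.obj G).tgt = G.tgt ≫ unitVert adj G := (adj.unit.app G).tgt_comm

theorem unitEdge_naturality {G H : IGraph E} (f : G ⟶ H) :
    unitEdge adj G ≫ (fc.map f).mor = f.edge ≫ unitEdge adj H :=
  congrArg IGraph.Hom.edge (adj.unit.naturality f).symm

theorem unitVert_naturality {G H : IGraph E} (f : G ⟶ H) :
    unitVert adj G ≫ (fc.map f).obj = f.vert ≫ unitVert adj H :=
  congrArg IGraph.Hom.vert (adj.unit.naturality f).symm

theorem functor_ext_of_unit {G : IGraph E} {C : ICat E} {F H : fc.obj G ⟶ C}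
    (hv : unitVert adj G ≫ F.obj = unitVert adj G ≫ H.obj)
    (he : unitEdge adj G ≫ F.mor = unitEdge adj G ≫ H.mor) : F = H := by
  apply (adj.homEquiv _ _).injective
  rw [adj.homEquiv_unit, adj.homEquiv_unit]
  exact IGraph.hom_ext hv he

theorem toInd_ext {G : IGraph E} {X : E} {k k' : (fc.obj G).obj ⟶ X}
    (h : unitVert adj G ≫ k = unitVert adj G ≫ k') : k = k' := by
  have key : toInd (fc.obj G) k = toInd (fc.obj G) k' := by
    apply functor_ext_of_unit adj
    · exact h
    · refine (comp_lift _ _ _).trans (Eq.trans ?_ (comp_lift _ _ _).symm)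
      rw [← Category.assoc, ← Category.assoc, ← Category.assoc, ← Category.assoc, unitEdge_src,
        unitEdge_tgt, Category.assoc, Category.assoc, Category.assoc, Category.assoc, h]
  exact congrArg IFunctor.obj key

/-- The free category on a graph with one vertex has a terminal object of objects. -/
theorem bouquet_obj_unique (adj : fc ⊣ ICat.forgetGraph E) (A : E) {S : E}
    (a b : S ⟶ (fc.obj (bouquet A)).obj) : a = b := by
  have e : 𝟙 _ = toUnit _ ≫ unitVert adj (bouquet A) := by
    apply toInd_ext adj
    rw [Category.comp_id, ← Category.assoc]
    exact (Category.id_comp _).symm.trans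
      (congrArg (· ≫ unitVert adj (bouquet A)) (toUnit_unique (𝟙 (𝟙_ E)) _))
  rw [← Category.comp_id a, ← Category.comp_id b, e, ← Category.assoc, ← Category.assoc,
    toUnit_unique (a ≫ _) (b ≫ toUnit _)]

/-- The object of words in `A`: the arrows of the free internal category on the graph with one
vertex and with `A` as its object of edges, that is, the free internal monoid on `A`. -/
abbrev Word (_ : fc ⊣ ICat.forgetGraph E) (A : E) : E := (fc.obj (bouquet A)).mor

/-- Concatenation of words: composition in the free internal category. -/
noncomputable def wordMul {A S : E} (l m : S ⟶ Word adj A) : S ⟶ Word adj A :=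
  (fc.obj (bouquet A)).cmp l m (bouquet_obj_unique adj A _ _)

/-- The empty word. -/
def wordNil (A : E) : 𝟙_ E ⟶ Word adj A := unitVert adj (bouquet A) ≫ (fc.obj (bouquet A)).ident

/-- Words of length one. -/
def wordSing (A : E) : A ⟶ Word adj A := unitEdge adj (bouquet A)

theorem comp_wordMul {A S S' : E} (x : S' ⟶ S) (l m : S ⟶ Word adj A) :
    x ≫ wordMul adj l m = wordMul adj (x ≫ l) (x ≫ m) := (fc.obj (bouquet A)).comp_cmp _ _ _ _

theorem wordMul_assoc {A S : E} (l m n : S ⟶ Word adj A) :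
    wordMul adj (wordMul adj l m) n = wordMul adj l (wordMul adj m n) :=
  (fc.obj (bouquet A)).cmp_assoc _ _ _ _ _

theorem nil_wordMul {A S : E} (l : S ⟶ Word adj A) :
    wordMul adj (toUnit S ≫ wordNil adj A) l = l := by
  refine ((fc.obj (bouquet A)).cmp_congr _ ?_ rfl).trans ((fc.obj (bouquet A)).id_cmp l)
  dsimp only [wordNil]
  rw [← Category.assoc, ← Category.assoc]
  congr 1
  exact bouquet_obj_unique adj A _ _

theorem wordMul_nil {A S : E} (l : S ⟶ Word adj A) :
    wordMul adj l (toUnit S ≫ wordNil adj A) = l := by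
  refine ((fc.obj (bouquet A)).cmp_congr _ rfl ?_).trans ((fc.obj (bouquet A)).cmp_id l)
  dsimp only [wordNil]
  rw [← Category.assoc, ← Category.assoc]
  congr 1
  exact bouquet_obj_unique adj A _ _

/-- The data of an iterated tensor product: an assignment of an object `fold (v₁ ⋯ vₙ)` of `V` to
every word `v₁ ⋯ vₙ` of objects of `V`, with isomorphisms
`fold l ⊗ fold m ≅ fold (l m)`, `I ≅ fold ()` and `fold (v) ≅ v`. -/
structure IteratedTensorData (V : IMonCat E) where
  fold : Word adj V.obj ⟶ V.obj
  mulIso : (⟨fst _ _ ≫ fold⟩ ⊗ ⟨snd _ _ ≫ fold⟩ : V.El (Word adj V.obj ⊗ Word adj V.obj)) ≅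
    ⟨wordMul adj (fst _ _) (snd _ _) ≫ fold⟩
  nilIso : 𝟙_ (V.El (𝟙_ E)) ≅ ⟨wordNil adj V.obj ≫ fold⟩
  singIso : (⟨wordSing adj V.obj ≫ fold⟩ : V.El V.obj) ≅ ⟨𝟙 V.obj⟩

namespace IteratedTensorData

variable {adj} {V : IMonCat E} (τ : IteratedTensorData adj V)

/-- The iterated tensor product of a generalized word. -/
def foldEl {S : E} (l : S ⟶ Word adj V.obj) : V.El S := ⟨l ≫ τ.fold⟩

/-- The isomorphism `fold l ⊗ fold m ≅ fold (l m)` at generalized words. -/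
noncomputable def mulEl {S : E} (l m : S ⟶ Word adj V.obj) :
    τ.foldEl l ⊗ τ.foldEl m ≅ τ.foldEl (wordMul adj l m) :=
  ICat.castIso ((V.res (lift l m)).mapIso τ.mulIso)
    (by
      rw [V.res_tensorObj]
      congr 1 <;> (ext; simp [ICat.res, foldEl]))
    (by
      ext
      simp only [ICat.res, foldEl]
      rw [← Category.assoc, comp_wordMul, lift_fst, lift_snd])

/-- The isomorphism `I ≅ fold ()` at a generalized stage. -/
noncomputable def nilEl (S : E) : 𝟙_ (V.El S) ≅ τ.foldEl (toUnit S ≫ wordNil adj V.obj) :=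
  ICat.castIso ((V.res (toUnit S)).mapIso τ.nilIso)
    (by ext; change toUnit S ≫ toUnit _ ≫ V.unit = toUnit S ≫ V.unit; simp)
    (by ext; simp [ICat.res, foldEl])

/-- The isomorphism `fold (v) ≅ v` at a generalized object. -/
noncomputable def singEl {S : E} (a : V.El S) : τ.foldEl (a.pt ≫ wordSing adj V.obj) ≅ a :=
  ICat.castIso ((V.res a.pt).mapIso τ.singIso)
    (by ext; simp [ICat.res, foldEl])
    (by ext; simp [ICat.res])

theorem mulEl_hom_arr {S : E} (l m : S ⟶ Word adj V.obj) :
    (τ.mulEl l m).hom.arr = lift l m ≫ τ.mulIso.hom.arr := ICat.castIso_hom_arr _ _ _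

theorem mulEl_inv_arr {S : E} (l m : S ⟶ Word adj V.obj) :
    (τ.mulEl l m).inv.arr = lift l m ≫ τ.mulIso.inv.arr := ICat.castIso_inv_arr _ _ _

theorem singEl_inv_arr {S : E} (a : V.El S) :
    (τ.singEl a).inv.arr = a.pt ≫ τ.singIso.inv.arr := ICat.castIso_inv_arr _ _ _

end IteratedTensorData

theorem res_comp_arr {C : ICat E} {S S' : E} (x : S' ⟶ S) {a b c : C.El S} (f : a ⟶ b)
    (g : b ⟶ c) : x ≫ (f ≫ g).arr = ((C.res x).map f ≫ (C.res x).map g).arr :=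
  congrArg ICat.ElHom.arr ((C.res x).map_comp f g)

theorem inv_arr_congr {C : ICat E} {S : E} {a b a' b' : C.El S} (i : a ≅ b) (j : a' ≅ b')
    (h : i.hom.arr = j.hom.arr) : i.inv.arr = j.inv.arr := by
  obtain rfl : a = a' := ICat.El.ext (by rw [← i.hom.src, ← j.hom.src, h])
  obtain rfl : b = b' := ICat.El.ext (by rw [← i.hom.tgt, ← j.hom.tgt, h])
  obtain rfl : i = j := Iso.ext (ICat.el_ext h)
  rfl

/-- An iterated tensor product on `V`: the isomorphisms are coherent with the associator and the
unitors of `V`, in other words `fold` is a strong monoidal functor from the discrete monoidal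
category of words to `V` that extends the identity on words of length one. (The equations are
between arrows of `V`, since the codomains agree only by associativity of concatenation.) -/
structure IteratedTensor (V : IMonCat E) extends IteratedTensorData adj V where
  mul_assoc : ∀ {S : E} (l m n : S ⟶ Word adj V.obj),
    (((toIteratedTensorData.mulEl l m).hom ⊗ₘ 𝟙 (toIteratedTensorData.foldEl n)) ≫
      (toIteratedTensorData.mulEl (wordMul adj l m) n).hom).arr =
    ((α_ (toIteratedTensorData.foldEl l) (toIteratedTensorData.foldEl m)
        (toIteratedTensorData.foldEl n)).hom ≫
      (𝟙 (toIteratedTensorData.foldEl l) ⊗ₘ (toIteratedTensorData.mulEl m n).hom) ≫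
        (toIteratedTensorData.mulEl l (wordMul adj m n)).hom).arr
  nil_mul : ∀ {S : E} (l : S ⟶ Word adj V.obj),
    (((toIteratedTensorData.nilEl S).hom ⊗ₘ 𝟙 (toIteratedTensorData.foldEl l)) ≫
      (toIteratedTensorData.mulEl (toUnit S ≫ wordNil adj V.obj) l).hom).arr =
    (λ_ (toIteratedTensorData.foldEl l)).hom.arr
  mul_nil : ∀ {S : E} (l : S ⟶ Word adj V.obj),
    ((𝟙 (toIteratedTensorData.foldEl l) ⊗ₘ (toIteratedTensorData.nilEl S).hom) ≫
      (toIteratedTensorData.mulEl l (toUnit S ≫ wordNil adj V.obj)).hom).arr =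
    (ρ_ (toIteratedTensorData.foldEl l)).hom.arr

namespace IteratedTensor

variable {adj} {V : IMonCat E} (τ : IteratedTensor adj V)

/-- A strict iterated tensor product: the comparison isomorphisms are identity arrows, so that
`fold` is the homomorphism of internal monoids extending the identity of the objects of `V`. -/
structure IsStrict : Prop where
  mul : τ.mulIso.hom.arr = τ.mulIso.hom.arr ≫ V.src ≫ V.ident
  nil : τ.nilIso.hom.arr = τ.nilIso.hom.arr ≫ V.src ≫ V.ident
  sing : τ.singIso.hom.arr = τ.singIso.hom.arr ≫ V.src ≫ V.ident

/-! The one-object internal category with arrows the triples `(l, m, f : fold l ⟶ fold m)`, composed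
by concatenation of words and by the monoidal product of arrows. -/

/-- The object of triples `(l, m, f)` with `f : fold l ⟶ fold m`. -/
noncomputable abbrev Tri : E := pullback (τ.fold ⊗ₘ τ.fold) (lift V.src V.tgt)

/-- The domain word of a triple. -/
noncomputable def triDom : τ.Tri ⟶ Word adj V.obj := pullback.fst _ _ ≫ fst _ _

/-- The codomain word of a triple. -/
noncomputable def triCod : τ.Tri ⟶ Word adj V.obj := pullback.fst _ _ ≫ snd _ _

/-- The arrow of a triple. -/
noncomputable def triArr : τ.Tri ⟶ V.mor := pullback.snd _ _

theorem triArr_src : τ.triArr ≫ V.src = τ.triDom ≫ τ.fold := by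
  have e := congrArg (· ≫ fst _ _) (pullback.condition (f := τ.fold ⊗ₘ τ.fold)
    (g := lift V.src V.tgt))
  simp only [Category.assoc, lift_fst, tensorHom_fst] at e
  rw [triArr, triDom, Category.assoc]; exact e.symm

theorem triArr_tgt : τ.triArr ≫ V.tgt = τ.triCod ≫ τ.fold := by
  have e := congrArg (· ≫ snd _ _) (pullback.condition (f := τ.fold ⊗ₘ τ.fold)
    (g := lift V.src V.tgt))
  simp only [Category.assoc, lift_snd, tensorHom_snd] at e
  rw [triArr, triCod, Category.assoc]; exact e.symm

/-- The arrow of a generalized triple. -/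
noncomputable def triHom {S : E} (w : S ⟶ τ.Tri) :
    τ.foldEl (w ≫ τ.triDom) ⟶ τ.foldEl (w ≫ τ.triCod) :=
  (⟨w ≫ τ.triArr, by rw [Category.assoc, triArr_src, ← Category.assoc]; rfl,
    by rw [Category.assoc, triArr_tgt, ← Category.assoc]; rfl⟩ : V.ElHom _ _)

/-- Construction of generalized triples. -/
noncomputable def triMk {S : E} (l m : S ⟶ Word adj V.obj) (f : τ.foldEl l ⟶ τ.foldEl m) :
    S ⟶ τ.Tri :=
  pullback.lift (lift l m) f.arr (by rw [lift_map, comp_lift, f.src, f.tgt]; rfl)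

theorem triMk_dom {S : E} (l m : S ⟶ Word adj V.obj) (f : τ.foldEl l ⟶ τ.foldEl m) :
    τ.triMk l m f ≫ τ.triDom = l := by
  rw [triMk, triDom, pullback.lift_fst_assoc, lift_fst]

theorem triMk_cod {S : E} (l m : S ⟶ Word adj V.obj) (f : τ.foldEl l ⟶ τ.foldEl m) :
    τ.triMk l m f ≫ τ.triCod = m := by
  rw [triMk, triCod, pullback.lift_fst_assoc, lift_snd]

theorem triMk_arr {S : E} (l m : S ⟶ Word adj V.obj) (f : τ.foldEl l ⟶ τ.foldEl m) :
    τ.triMk l m f ≫ τ.triArr = f.arr := pullback.lift_snd _ _ _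

theorem tri_ext {S : E} {w w' : S ⟶ τ.Tri} (h₁ : w ≫ τ.triDom = w' ≫ τ.triDom)
    (h₂ : w ≫ τ.triCod = w' ≫ τ.triCod) (h₃ : w ≫ τ.triArr = w' ≫ τ.triArr) : w = w' := by
  apply pullback.hom_ext
  · apply CartesianMonoidalCategory.hom_ext
    · rw [Category.assoc, Category.assoc]; exact h₁
    · rw [Category.assoc, Category.assoc]; exact h₂
  · exact h₃

/-- Multiplication of triples: `(l, m, f) (l', m', f') = (l l', m m', f ⊗ f')`, up to the comparison
isomorphisms. -/
noncomputable def triMul {S : E} (w w' : S ⟶ τ.Tri) : S ⟶ τ.Tri :=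
  τ.triMk (wordMul adj (w ≫ τ.triDom) (w' ≫ τ.triDom)) (wordMul adj (w ≫ τ.triCod) (w' ≫ τ.triCod))
    ((τ.mulEl _ _).inv ≫ (τ.triHom w ⊗ₘ τ.triHom w') ≫ (τ.mulEl _ _).hom)

/-- The unit triple. -/
noncomputable def triOne (S : E) : S ⟶ τ.Tri :=
  τ.triMk (toUnit S ≫ wordNil adj V.obj) (toUnit S ≫ wordNil adj V.obj) (𝟙 _)

theorem triMul_arr {S : E} (w w' : S ⟶ τ.Tri) :
    τ.triMul w w' ≫ τ.triArr =
      ((τ.mulEl (w ≫ τ.triDom) (w' ≫ τ.triDom)).inv ≫ (τ.triHom w ⊗ₘ τ.triHom w') ≫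
        (τ.mulEl (w ≫ τ.triCod) (w' ≫ τ.triCod)).hom).arr := τ.triMk_arr _ _ _

theorem triMul_dom {S : E} (w w' : S ⟶ τ.Tri) :
    τ.triMul w w' ≫ τ.triDom = wordMul adj (w ≫ τ.triDom) (w' ≫ τ.triDom) := τ.triMk_dom _ _ _

theorem triMul_cod {S : E} (w w' : S ⟶ τ.Tri) :
    τ.triMul w w' ≫ τ.triCod = wordMul adj (w ≫ τ.triCod) (w' ≫ τ.triCod) := τ.triMk_cod _ _ _

theorem triOne_dom (S : E) : τ.triOne S ≫ τ.triDom = toUnit S ≫ wordNil adj V.obj :=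
  τ.triMk_dom _ _ _

theorem triOne_cod (S : E) : τ.triOne S ≫ τ.triCod = toUnit S ≫ wordNil adj V.obj :=
  τ.triMk_cod _ _ _

theorem triOne_arr (S : E) :
    τ.triOne S ≫ τ.triArr = (τ.foldEl (toUnit S ≫ wordNil adj V.obj)).pt ≫ V.ident :=
  τ.triMk_arr _ _ _

/-- The arrow part of a product of triples, with freely chosen equal arguments. -/
theorem triMul_arr_of {S : E} (w w' : S ⟶ τ.Tri) {l l' m m' : S ⟶ Word adj V.obj}
    (f : τ.foldEl l ⟶ τ.foldEl m) (f' : τ.foldEl l' ⟶ τ.foldEl m')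
    (hl : w ≫ τ.triDom = l) (hm : w ≫ τ.triCod = m) (hf : w ≫ τ.triArr = f.arr)
    (hl' : w' ≫ τ.triDom = l') (hm' : w' ≫ τ.triCod = m') (hf' : w' ≫ τ.triArr = f'.arr) :
    τ.triMul w w' ≫ τ.triArr = ((τ.mulEl l l').inv ≫ (f ⊗ₘ f') ≫ (τ.mulEl m m').hom).arr := by
  subst hl hm hl' hm'
  rw [triMul_arr]
  exact ICat.comp_arr_congr rfl (ICat.comp_arr_congr (V.tensorHom_arr_congr hf hf') rfl)

theorem comp_triMul {S S' : E} (x : S' ⟶ S) (w w' : S ⟶ τ.Tri) :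
    x ≫ τ.triMul w w' = τ.triMul (x ≫ w) (x ≫ w') := by
  apply τ.tri_ext
  · rw [Category.assoc, triMul_dom, triMul_dom, comp_wordMul, Category.assoc, Category.assoc]
  · rw [Category.assoc, triMul_cod, triMul_cod, comp_wordMul, Category.assoc, Category.assoc]
  · rw [Category.assoc, triMul_arr, triMul_arr, res_comp_arr]
    refine ICat.comp_arr_congr ?_ ?_
    · change x ≫ _ = _
      rw [τ.mulEl_inv_arr, τ.mulEl_inv_arr, ← Category.assoc, comp_lift, Category.assoc,
        Category.assoc]
    · change x ≫ _ = _
      rw [res_comp_arr]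
      refine ICat.comp_arr_congr ?_ ?_
      · change x ≫ _ = _
        rw [V.tensorHom_arr, V.tensorHom_arr, ← Category.assoc, comp_lift]
        dsimp only [triHom]
        rw [Category.assoc, Category.assoc]
      · change x ≫ _ = _
        rw [τ.mulEl_hom_arr, τ.mulEl_hom_arr, ← Category.assoc, comp_lift, Category.assoc,
          Category.assoc]

theorem comp_triOne {S S' : E} (x : S' ⟶ S) : x ≫ τ.triOne S = τ.triOne S' := by
  have e : x ≫ toUnit S ≫ wordNil adj V.obj = toUnit S' ≫ wordNil adj V.obj := by
    rw [← Category.assoc, toUnit_unique (x ≫ toUnit S) (toUnit S')]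
  apply τ.tri_ext
  · rw [Category.assoc, triOne_dom, triOne_dom, e]
  · rw [Category.assoc, triOne_cod, triOne_cod, e]
  · rw [Category.assoc, triOne_arr, triOne_arr]
    dsimp only [IteratedTensorData.foldEl]
    rw [← e]
    simp only [Category.assoc]

/-- The isomorphism `(fold l ⊗ fold m) ⊗ fold n ≅ fold ((l m) n)`. -/
noncomputable def mulL {S : E} (l m n : S ⟶ Word adj V.obj) :
    (τ.foldEl l ⊗ τ.foldEl m) ⊗ τ.foldEl n ≅ τ.foldEl (wordMul adj (wordMul adj l m) n) :=
  (τ.mulEl l m ⊗ᵢ Iso.refl (τ.foldEl n)) ≪≫ τ.mulEl (wordMul adj l m) n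

/-- The isomorphism `fold l ⊗ (fold m ⊗ fold n) ≅ fold (l (m n))`. -/
noncomputable def mulR {S : E} (l m n : S ⟶ Word adj V.obj) :
    τ.foldEl l ⊗ (τ.foldEl m ⊗ τ.foldEl n) ≅ τ.foldEl (wordMul adj l (wordMul adj m n)) :=
  (Iso.refl (τ.foldEl l) ⊗ᵢ τ.mulEl m n) ≪≫ τ.mulEl l (wordMul adj m n)

theorem mulL_arr {S : E} (l m n : S ⟶ Word adj V.obj) :
    (τ.mulL l m n).hom.arr = (α_ _ _ _ ≪≫ τ.mulR l m n).hom.arr := τ.mul_assoc l m n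

theorem mulL_inv_arr {S : E} (l m n : S ⟶ Word adj V.obj) :
    (τ.mulL l m n).inv.arr = (α_ _ _ _ ≪≫ τ.mulR l m n).inv.arr :=
  inv_arr_congr _ _ (τ.mulL_arr l m n)

theorem aux_left {W : Type u} [Category.{v} W] [MonoidalCategory W] {X Y a a' b b' c d : W}
    (p : X ⟶ b ⊗ c) (m : b ⟶ a) (F : a ⟶ a') (m' : a' ⟶ b') (f : c ⟶ d) (q : b' ⊗ d ⟶ Y) :
    p ≫ ((m ≫ F ≫ m') ⊗ₘ f) ≫ q = (p ≫ (m ⊗ₘ 𝟙 c)) ≫ (F ⊗ₘ f) ≫ (m' ⊗ₘ 𝟙 d) ≫ q := by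
  simp only [MonoidalCategory.tensorHom_comp_tensorHom_assoc, Category.assoc, Category.id_comp,
    Category.comp_id]

theorem aux_right {W : Type u} [Category.{v} W] [MonoidalCategory W] {X Y a a' b b' c d : W}
    (p : X ⟶ c ⊗ b) (m : b ⟶ a) (F : a ⟶ a') (m' : a' ⟶ b') (f : c ⟶ d) (q : d ⊗ b' ⟶ Y) :
    p ≫ (f ⊗ₘ (m ≫ F ≫ m')) ≫ q = (p ≫ (𝟙 c ⊗ₘ m)) ≫ (f ⊗ₘ F) ≫ (𝟙 d ⊗ₘ m') ≫ q := by
  simp only [MonoidalCategory.tensorHom_comp_tensorHom_assoc, Category.assoc, Category.id_comp,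
    Category.comp_id]

theorem aux_assoc {W : Type u} [Category.{v} W] [MonoidalCategory W] {X Y a b c a' b' c' : W}
    (p : X ⟶ a ⊗ (b ⊗ c)) (f : a ⟶ a') (g : b ⟶ b') (h : c ⟶ c') (q : a' ⊗ (b' ⊗ c') ⟶ Y) :
    (p ≫ (α_ a b c).inv) ≫ ((f ⊗ₘ g) ⊗ₘ h) ≫ (α_ a' b' c').hom ≫ q =
      p ≫ (f ⊗ₘ (g ⊗ₘ h)) ≫ q := by
  rw [← Category.assoc ((f ⊗ₘ g) ⊗ₘ h), MonoidalCategory.associator_naturality, Category.assoc,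
    Category.assoc, Iso.inv_hom_id_assoc]

theorem triMul_assoc {S : E} (w₁ w₂ w₃ : S ⟶ τ.Tri) :
    τ.triMul (τ.triMul w₁ w₂) w₃ = τ.triMul w₁ (τ.triMul w₂ w₃) := by
  apply τ.tri_ext
  · simp only [triMul_dom, wordMul_assoc]
  · simp only [triMul_cod, wordMul_assoc]
  · rw [τ.triMul_arr_of (τ.triMul w₁ w₂) w₃ _ (τ.triHom w₃) (τ.triMul_dom _ _) (τ.triMul_cod _ _)
      (τ.triMul_arr _ _) rfl rfl rfl,
      τ.triMul_arr_of w₁ (τ.triMul w₂ w₃) (τ.triHom w₁) _ rfl rfl rfl (τ.triMul_dom _ _)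
      (τ.triMul_cod _ _) (τ.triMul_arr _ _)]
    have h₁ := ICat.comp_arr_congr (τ.mulL_inv_arr (w₁ ≫ τ.triDom) (w₂ ≫ τ.triDom)
      (w₃ ≫ τ.triDom)) (ICat.comp_arr_congr (f := (τ.triHom w₁ ⊗ₘ τ.triHom w₂) ⊗ₘ τ.triHom w₃) rfl
        (τ.mulL_arr (w₁ ≫ τ.triCod) (w₂ ≫ τ.triCod) (w₃ ≫ τ.triCod)))
    refine Eq.trans ?_ (h₁.trans ?_)
    · exact congrArg ICat.ElHom.arr (aux_left _ _ _ _ _ _)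
    · refine congrArg ICat.ElHom.arr ((aux_assoc _ _ _ _ _).trans ?_)
      exact (aux_right _ _ _ _ _ _).symm

theorem nil_arr {S : E} (l : S ⟶ Word adj V.obj) :
    ((τ.nilEl S ⊗ᵢ Iso.refl (τ.foldEl l)) ≪≫ τ.mulEl (toUnit S ≫ wordNil adj V.obj) l).hom.arr =
      (λ_ (τ.foldEl l)).hom.arr := τ.nil_mul l

theorem arr_nil {S : E} (l : S ⟶ Word adj V.obj) :
    ((Iso.refl (τ.foldEl l) ⊗ᵢ τ.nilEl S) ≪≫ τ.mulEl l (toUnit S ≫ wordNil adj V.obj)).hom.arr =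
      (ρ_ (τ.foldEl l)).hom.arr := τ.mul_nil l

theorem triOne_mul {S : E} (w : S ⟶ τ.Tri) : τ.triMul (τ.triOne S) w = w := by
  apply τ.tri_ext
  · rw [triMul_dom, triOne_dom, nil_wordMul]
  · rw [triMul_cod, triOne_cod, nil_wordMul]
  · rw [τ.triMul_arr_of (τ.triOne S) w (𝟙 _) (τ.triHom w) (τ.triOne_dom _) (τ.triOne_cod _)
      (τ.triOne_arr _) rfl rfl rfl]
    have h := ICat.comp_arr_congr (inv_arr_congr _ _ (τ.nil_arr (w ≫ τ.triDom)))
      (ICat.comp_arr_congr (f := 𝟙 _ ⊗ₘ τ.triHom w) rfl (τ.nil_arr (w ≫ τ.triCod)))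
    refine Eq.trans ?_ (h.trans ?_)
    · rw [← (τ.nilEl S).inv_hom_id, ← Category.id_comp (τ.nilEl S).hom]
      exact congrArg ICat.ElHom.arr (aux_left _ _ _ _ _ _)
    · change _ = (τ.triHom w).arr
      congr 1
      simp

theorem triMul_one {S : E} (w : S ⟶ τ.Tri) : τ.triMul w (τ.triOne S) = w := by
  apply τ.tri_ext
  · rw [triMul_dom, triOne_dom, wordMul_nil]
  · rw [triMul_cod, triOne_cod, wordMul_nil]
  · rw [τ.triMul_arr_of w (τ.triOne S) (τ.triHom w) (𝟙 _) rfl rfl rfl (τ.triOne_dom _)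
      (τ.triOne_cod _) (τ.triOne_arr _)]
    have h := ICat.comp_arr_congr (inv_arr_congr _ _ (τ.arr_nil (w ≫ τ.triDom)))
      (ICat.comp_arr_congr (f := τ.triHom w ⊗ₘ 𝟙 _) rfl (τ.arr_nil (w ≫ τ.triCod)))
    refine Eq.trans ?_ (h.trans ?_)
    · rw [← (τ.nilEl S).inv_hom_id, ← Category.id_comp (τ.nilEl S).hom]
      exact congrArg ICat.ElHom.arr (aux_right _ _ _ _ _ _)
    · change _ = (τ.triHom w).arr
      congr 1
      simp

/-- The one-object internal category of triples. -/
noncomputable abbrev triCat : ICat E where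
  obj := 𝟙_ E
  mor := τ.Tri
  src := toUnit _
  tgt := toUnit _
  ident := τ.triOne (𝟙_ E)
  comp := τ.triMul (pullback.fst _ _) (pullback.snd _ _)
  ident_src := toUnit_unique _ _
  ident_tgt := toUnit_unique _ _
  comp_src := toUnit_unique _ _
  comp_tgt := toUnit_unique _ _
  cmp_id f := by
    dsimp only [ICatData.cmp]
    rw [comp_triMul, pullback.lift_fst, pullback.lift_snd, ← Category.assoc, comp_triOne,
      triMul_one]
  id_cmp f := by
    dsimp only [ICatData.cmp]
    rw [comp_triMul, pullback.lift_fst, pullback.lift_snd, ← Category.assoc, comp_triOne,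
      triOne_mul]
  cmp_assoc h g f hg gf := by
    dsimp only [ICatData.cmp]
    simp only [comp_triMul, pullback.lift_fst, pullback.lift_snd, triMul_assoc]

theorem triCat_cmp {S : E} (g f : S ⟶ τ.Tri) (h : g ≫ τ.triCat.src = f ≫ τ.triCat.tgt) :
    τ.triCat.cmp g f h = τ.triMul g f := by
  dsimp only [ICatData.cmp, triCat]
  rw [comp_triMul, pullback.lift_fst, pullback.lift_snd]

/-- The object of pairs `(l, f)` of a word `l` of objects of `V` and an arrow `f` of `V` with
domain `fold l`. -/
noncomputable abbrev Arrows : E := pullback τ.fold V.src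

/-- The word of a pair. -/
noncomputable def arrowsWord : τ.Arrows ⟶ Word adj V.obj := pullback.fst _ _

/-- The arrow of a pair. -/
noncomputable def arrowsArr : τ.Arrows ⟶ V.mor := pullback.snd _ _

theorem arrowsArr_src : τ.arrowsArr ≫ V.src = τ.arrowsWord ≫ τ.fold := pullback.condition.symm

/-- The arrow of a generalized pair. -/
noncomputable def arrowsHom {S : E} (p : S ⟶ τ.Arrows) :
    τ.foldEl (p ≫ τ.arrowsWord) ⟶ ⟨p ≫ τ.arrowsArr ≫ V.tgt⟩ :=
  (⟨p ≫ τ.arrowsArr, by rw [Category.assoc, arrowsArr_src, ← Category.assoc]; rfl,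
    Category.assoc _ _ _⟩ : V.ElHom _ _)

/-- Construction of generalized pairs. -/
noncomputable def arrowsMk {S : E} (l : S ⟶ Word adj V.obj) {a : V.El S} (f : τ.foldEl l ⟶ a) :
    S ⟶ τ.Arrows :=
  pullback.lift l f.arr f.src.symm

/-- The morphism of graphs sending `(l, f : fold l ⟶ v)` to the triple of `l`, of the word `(v)` and
of `f`, up to the isomorphism `fold (v) ≅ v`. -/
noncomputable def arrowsTri : bouquet τ.Arrows ⟶ (ICat.forgetGraph E).obj τ.triCat :=
  (⟨𝟙 (𝟙_ E), τ.triMk (𝟙 _ ≫ τ.arrowsWord) ((𝟙 _ ≫ τ.arrowsArr ≫ V.tgt) ≫ wordSing adj V.obj)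
    (τ.arrowsHom (𝟙 _) ≫ (τ.singEl ⟨𝟙 _ ≫ τ.arrowsArr ≫ V.tgt⟩).inv),
    toUnit_unique _ _, toUnit_unique _ _⟩ :
    IGraph.Hom (bouquet τ.Arrows) ((ICat.forgetGraph E).obj τ.triCat))

/-- The induced functor from the free category: a list of arrows `fᵢ : fold lᵢ ⟶ vᵢ` is sent to
their monoidal product, an arrow `fold (l₁ ⋯ lₙ) ⟶ fold (v₁ ⋯ vₙ)`. -/
noncomputable def arrowsProd : fc.obj (bouquet τ.Arrows) ⟶ τ.triCat :=
  (adj.homEquiv _ _).symm τ.arrowsTri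

theorem unitEdge_arrowsProd :
    unitEdge adj (bouquet τ.Arrows) ≫ τ.arrowsProd.mor = τ.arrowsTri.edge := by
  have e : (adj.homEquiv _ _) τ.arrowsProd = τ.arrowsTri := Equiv.apply_symm_apply _ _
  rw [adj.homEquiv_unit] at e
  exact congrArg IGraph.Hom.edge e

/-- The functor sending a triple to its codomain word. -/
noncomputable def triCodFunctor : τ.triCat ⟶ fc.obj (bouquet V.obj) :=
  ({ obj := unitVert adj (bouquet V.obj)
     mor := τ.triCod
     src_comm := bouquet_obj_unique adj _ _ _
     tgt_comm := bouquet_obj_unique adj _ _ _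
     map_ident := (τ.triMk_cod _ _ _).trans (by
       rw [toUnit_unit]; exact Category.id_comp _)
     map_cmp := fun g f h => by
       rw [triCat_cmp]
       exact τ.triMk_cod _ _ _ } : IFunctor τ.triCat (fc.obj (bouquet V.obj)))

/-- The target of the underlying `fc`-graph: `(l, f)` is sent to the codomain of `f`. -/
noncomputable def multicatTgt : bouquet τ.Arrows ⟶ bouquet V.obj :=
  toBouquet (bouquet τ.Arrows) (τ.arrowsArr ≫ V.tgt)

/-- The source of the underlying `fc`-graph: `(l, f)` is sent to `l`. -/
noncomputable def multicatSrc : bouquet τ.Arrows ⟶ adj.toMonad.obj (bouquet V.obj) :=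
  (⟨unitVert adj (bouquet V.obj), τ.arrowsWord, bouquet_obj_unique adj _ _ _,
    bouquet_obj_unique adj _ _ _⟩ :
    IGraph.Hom (bouquet τ.Arrows) ((ICat.forgetGraph E).obj (fc.obj (bouquet V.obj))))

theorem arrowsProd_cod : τ.arrowsProd.mor ≫ τ.triCod = (fc.map τ.multicatTgt).mor := by
  have key : τ.arrowsProd ≫ τ.triCodFunctor = fc.map τ.multicatTgt := by
    apply functor_ext_of_unit adj
    · exact bouquet_obj_unique adj _ _ _
    · rw [unitEdge_naturality]
      change unitEdge adj (bouquet τ.Arrows) ≫ τ.arrowsProd.mor ≫ τ.triCod =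
        (τ.arrowsArr ≫ V.tgt) ≫ wordSing adj V.obj
      rw [← Category.assoc, unitEdge_arrowsProd]
      refine (τ.triMk_cod _ _ _).trans ?_
      rw [Category.id_comp]
  exact congrArg IFunctor.mor key

theorem arrowsComp_aux {S : E} (p : S ⟶ τ.Arrows) (w : S ⟶ (fc.obj (bouquet τ.Arrows)).mor)
    (h : p ≫ τ.arrowsWord = w ≫ (fc.map τ.multicatTgt).mor) :
    (p ≫ τ.arrowsArr) ≫ V.src = ((w ≫ τ.arrowsProd.mor) ≫ τ.triArr) ≫ V.tgt := by
  rw [Category.assoc, arrowsArr_src, ← Category.assoc, h, ← arrowsProd_cod, Category.assoc,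
    Category.assoc, Category.assoc, Category.assoc, triArr_tgt]

/-- The composite of `f : fold l ⟶ v` with a list `w` of arrows `fᵢ : fold lᵢ ⟶ vᵢ` such that
`l = v₁ ⋯ vₙ`: the word `l₁ ⋯ lₙ`, and `f` after the monoidal product of the `fᵢ`. -/
noncomputable def arrowsComp {S : E} (p : S ⟶ τ.Arrows)
    (w : S ⟶ (fc.obj (bouquet τ.Arrows)).mor)
    (h : p ≫ τ.arrowsWord = w ≫ (fc.map τ.multicatTgt).mor) : S ⟶ τ.Arrows :=
  pullback.lift ((w ≫ τ.arrowsProd.mor) ≫ τ.triDom)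
    (V.cmp (p ≫ τ.arrowsArr) ((w ≫ τ.arrowsProd.mor) ≫ τ.triArr) (τ.arrowsComp_aux p w h)) (by
      rw [V.cmp_src, Category.assoc _ τ.triArr, triArr_src, ← Category.assoc])

theorem multicatComp_aux :
    IGraph.Hom.edge (pullback.fst τ.multicatSrc (adj.toMonad.map τ.multicatTgt)) ≫ τ.arrowsWord =
      IGraph.Hom.edge (pullback.snd τ.multicatSrc (adj.toMonad.map τ.multicatTgt)) ≫
        (fc.map τ.multicatTgt).mor :=
  (congrArg IGraph.Hom.edge (pullback.condition (f := τ.multicatSrc)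
    (g := adj.toMonad.map τ.multicatTgt)) :)

/-- The data of the `fc`-multicategory of `V`: its objects are given by the graph with one vertex
and with the objects of `V` as edges; an arrow from the word `l` to `v` is an arrow `fold l ⟶ v` of
`V`; the composite of `f : fold l ⟶ v` with a list of arrows is the composite of `f` with their
monoidal product; and the identities are the isomorphisms `fold (v) ≅ v`. -/
noncomputable def multicatData : MulticatData adj.toMonad where
  ob := bouquet V.obj
  ar := bouquet τ.Arrows
  src := τ.multicatSrc
  tgt := τ.multicatTgt
  comp := toBouquet _ (τ.arrowsComp
    (IGraph.Hom.edge (pullback.fst τ.multicatSrc (adj.toMonad.map τ.multicatTgt)))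
    (IGraph.Hom.edge (pullback.snd τ.multicatSrc (adj.toMonad.map τ.multicatTgt)))
    τ.multicatComp_aux)
  ident := toBouquet (bouquet V.obj) (τ.arrowsMk (wordSing adj V.obj) τ.singIso.hom)

/-- The `fc`-multicategory of `V`. -/
noncomputable def multicat (hM : τ.multicatData.IsMulticat) : Multicat adj.toMonad :=
  ⟨τ.multicatData, hM⟩

/-! The internal `V`-enriched category of an enriched `Id`-multicategory. -/

section Comparison

variable {τ} {hM : τ.multicatData.IsMulticat}

/-- The internal hom of an enriched `Id`-multicategory, the action of its functor on objects. -/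
def vHom (X : EnrichedMulticat adj (τ.multicat hM)) : X.obj ⊗ X.obj ⟶ V.obj :=
  IGraph.Hom.edge X.map.ob

/-- The free internal category of paths in the indiscrete graph on the objects. -/
noncomputable abbrev Path (X : EnrichedMulticat adj (τ.multicat hM)) : ICat E :=
  fc.obj ((ICat.forgetGraph E).obj (Ind X.obj))

/-- The action on paths of the functor of an enriched `Id`-multicategory. -/
noncomputable def pathArrow (X : EnrichedMulticat adj (τ.multicat hM)) :
    (Path X).mor ⟶ τ.Arrows := IGraph.Hom.edge X.map.ar

/-- The functor sending a path to the word of its homs. -/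
noncomputable def pathWord (X : EnrichedMulticat adj (τ.multicat hM)) :
    Path X ⟶ fc.obj (bouquet V.obj) := fc.map X.map.ob

/-- The inclusion of the objects in the free internal category. -/
noncomputable def pathVert (X : EnrichedMulticat adj (τ.multicat hM)) : X.obj ⟶ (Path X).obj :=
  unitVert adj ((ICat.forgetGraph E).obj (Ind X.obj))

/-- The inclusion of the edges in the free internal category. -/
noncomputable def pathEdge (X : EnrichedMulticat adj (τ.multicat hM)) :
    X.obj ⊗ X.obj ⟶ (Path X).mor :=
  unitEdge adj ((ICat.forgetGraph E).obj (Ind X.obj))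

theorem pathEdge_src (X : EnrichedMulticat adj (τ.multicat hM)) :
    pathEdge X ≫ (Path X).src = fst X.obj X.obj ≫ pathVert X := unitEdge_src adj _

theorem pathEdge_tgt (X : EnrichedMulticat adj (τ.multicat hM)) :
    pathEdge X ≫ (Path X).tgt = snd X.obj X.obj ≫ pathVert X := unitEdge_tgt adj _

theorem pathEdge_map (X : EnrichedMulticat adj (τ.multicat hM)) :
    pathEdge X ≫ (pathWord X).mor = vHom X ≫ wordSing adj V.obj :=
  unitEdge_naturality adj _

/-- The path of length one from `x` to `y`. -/
noncomputable def onePath (X : EnrichedMulticat adj (τ.multicat hM)) {S : E} (x y : S ⟶ X.obj) :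
    S ⟶ (Path X).mor :=
  lift x y ≫ pathEdge X

/-- The empty path at `x`. -/
noncomputable def emptyPath (X : EnrichedMulticat adj (τ.multicat hM)) {S : E} (x : S ⟶ X.obj) :
    S ⟶ (Path X).mor :=
  x ≫ pathVert X ≫ (Path X).ident

theorem onePath_src (X : EnrichedMulticat adj (τ.multicat hM)) {S : E} (x y : S ⟶ X.obj) :
    onePath X x y ≫ (Path X).src = x ≫ pathVert X := by
  rw [onePath, Category.assoc, pathEdge_src, lift_fst_assoc]

theorem onePath_tgt (X : EnrichedMulticat adj (τ.multicat hM)) {S : E} (x y : S ⟶ X.obj) :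
    onePath X x y ≫ (Path X).tgt = y ≫ pathVert X := by
  rw [onePath, Category.assoc, pathEdge_tgt, lift_snd_assoc]

/-- The path of length two from `x₀` to `x₂` through `x₁`. -/
noncomputable def twoPath (X : EnrichedMulticat adj (τ.multicat hM)) {S : E}
    (x₀ x₁ x₂ : S ⟶ X.obj) : S ⟶ (Path X).mor :=
  (Path X).cmp (onePath X x₁ x₂) (onePath X x₀ x₁) (by rw [onePath_src, onePath_tgt])

theorem pathArrow_word (X : EnrichedMulticat adj (τ.multicat hM)) :
    pathArrow X ≫ τ.arrowsWord = (pathWord X).mor :=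
  (congrArg IGraph.Hom.edge X.map.src_comm).trans (Category.id_comp _)

theorem onePath_map (X : EnrichedMulticat adj (τ.multicat hM)) {S : E} (x y : S ⟶ X.obj) :
    onePath X x y ≫ (pathWord X).mor = (lift x y ≫ vHom X) ≫ wordSing adj V.obj := by
  rw [onePath, Category.assoc, Category.assoc, pathEdge_map]

theorem twoPath_word (X : EnrichedMulticat adj (τ.multicat hM)) {S : E} (x₀ x₁ x₂ : S ⟶ X.obj) :
    (twoPath X x₀ x₁ x₂ ≫ pathArrow X) ≫ τ.arrowsWord =
      wordMul adj ((lift x₁ x₂ ≫ vHom X) ≫ wordSing adj V.obj)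
        ((lift x₀ x₁ ≫ vHom X) ≫ wordSing adj V.obj) := by
  rw [Category.assoc, pathArrow_word, twoPath]
  exact ((pathWord X).map_cmp _ _ _).trans
    ((fc.obj (bouquet V.obj)).cmp_congr _ (onePath_map X _ _) (onePath_map X _ _))

theorem emptyPath_word (X : EnrichedMulticat adj (τ.multicat hM)) {S : E} (x : S ⟶ X.obj) :
    (emptyPath X x ≫ pathArrow X) ≫ τ.arrowsWord = toUnit S ≫ wordNil adj V.obj := by
  rw [Category.assoc, pathArrow_word, emptyPath, Category.assoc, Category.assoc,
    (pathWord X).map_ident, ← Category.assoc, ← Category.assoc, wordNil, ← Category.assoc]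
  exact congrArg (· ≫ (fc.obj (bouquet V.obj)).ident) (bouquet_obj_unique adj _ _ _)

/-- The canonical isomorphism `a ⊗ b ≅ fold (a b)` for generalized objects `a` and `b`. -/
noncomputable def pairEl (τ : IteratedTensor adj V) {S : E} (a b : V.El S) :
    a ⊗ b ≅ τ.foldEl (wordMul adj (a.pt ≫ wordSing adj V.obj) (b.pt ≫ wordSing adj V.obj)) :=
  ((τ.singEl a).symm ⊗ᵢ (τ.singEl b).symm) ≪≫ τ.mulEl _ _

/-- The data of the `V`-enriched category of an enriched `Id`-multicategory: composition is the
action on paths of length two, after the isomorphism `a ⊗ b ≅ fold (a b)`, and the identities are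
the action on empty paths, after the isomorphism `I ≅ fold ()`. -/
noncomputable def vData (X : EnrichedMulticat adj (τ.multicat hM)) : VCatData V where
  obj := X.obj
  hom := vHom X
  comp := V.cmp
    ((twoPath X (fst _ _) (snd _ _ ≫ fst _ _) (snd _ _ ≫ snd _ _) ≫ pathArrow X) ≫ τ.arrowsArr)
    (pairEl τ ⟨lift (snd _ _ ≫ fst _ _) (snd _ _ ≫ snd _ _) ≫ vHom X⟩
      ⟨lift (fst _ _) (snd _ _ ≫ fst _ _) ≫ vHom X⟩).hom.arr (by
      rw [Category.assoc, arrowsArr_src, ← Category.assoc, twoPath_word, ICat.ElHom.tgt]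
      rfl)
  ident := V.cmp ((emptyPath X (𝟙 X.obj) ≫ pathArrow X) ≫ τ.arrowsArr)
    (τ.nilEl X.obj).hom.arr (by
      rw [Category.assoc, arrowsArr_src, ← Category.assoc, emptyPath_word, ICat.ElHom.tgt]
      rfl)

/-- The transformation of a functor of enriched `Id`-multicategories, on edges. -/
noncomputable def vTrans {X Y : EnrichedMulticat adj (τ.multicat hM)} (F : X ⟶ Y) :
    X.obj ⊗ X.obj ⟶ τ.Arrows :=
  IGraph.Hom.edge (EnrichedMulticat.Functor.trans F).app

theorem vTrans_word {X Y : EnrichedMulticat adj (τ.multicat hM)} (F : X ⟶ Y) :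
    vTrans F ≫ τ.arrowsWord = vHom X ≫ wordSing adj V.obj :=
  congrArg IGraph.Hom.edge (EnrichedMulticat.Functor.trans F).app_src

theorem vTrans_aux {X Y : EnrichedMulticat adj (τ.multicat hM)} (F : X ⟶ Y) :
    (vTrans F ≫ τ.arrowsArr) ≫ V.src = (τ.singEl ⟨vHom X⟩).inv.arr ≫ V.tgt := by
  rw [Category.assoc, arrowsArr_src, ← Category.assoc, vTrans_word, ICat.ElHom.tgt]
  rfl

/-- The data of the `V`-enriched functor of a functor of enriched `Id`-multicategories: its
transformation, after the isomorphism `a ≅ fold (a)`. -/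
noncomputable def vFunctorData {X Y : EnrichedMulticat adj (τ.multicat hM)} (F : X ⟶ Y) :
    VFunctorData (vData X) (vData Y) where
  obj := EnrichedMulticat.Functor.obj F
  map := V.cmp (vTrans F ≫ τ.arrowsArr) (τ.singEl ⟨vHom X⟩).inv.arr (vTrans_aux F)

end Comparison

end IteratedTensor

end MV

end IntEnr

open IntEnr

/-!
# Enriched categories and multicategories enriched in `MV`

Everything rests on one consequence of the adjunction `fc ⊣ forgetGraph`: a functor out of a free
internal category is determined by its values on the generating vertices and edges, and these can be
prescribed freely. In particular the words in `A` form the free internal monoid on `A`. Since lists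
of arrows and paths are generalized edges of free internal categories, there is no external
induction on their length: it is replaced by the comparison of two functors on the generators.

*Iterated tensor products.* If `V` is strict, its objects form an internal monoid, and the extension
of the identity of `V₀` to words is a strict iterated tensor product. If `E` is cartesian closed, the
product is the right-bracketed one, `v₁ ⊗ (v₂ ⊗ ⋯ ⊗ (vₙ ⊗ I))`: an arrow `B ⊗ A ⟶ B` extends to an
action of words on `B`, because the object of endomorphisms of `B` is an internal monoid (`wordAct`).
This gives recursion and induction along prefixing a word by a letter (`exists_arrow_family`,
`wordCons_induction`). The comparison isomorphisms are built by the former, with the associator at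
each step (`FoldMul`), and their coherence is proved by the latter, from the pentagon and triangle.

*The multicategory.* The monoidal product of a list of arrows is a functor on the free category on a
bouquet, with values in the one-object category of triples `(l, m, f : fold l ⟶ fold m)`. Triples
also compose vertically, and by the interchange law the vertical composite of two functors to
triples is again a functor. Hence the product of a list of composites is the composite of the
products (`listTri_arrowsComp`), which is the associativity of composition in `MV`.

*The equivalence.* An enriched `Id`-multicategory assigns an arrow of `MV` to each path. Its action
on paths of length one is forced by the identity axiom, and its action on a concatenation by the
composition axiom (`pathHom_cmp`); so it is determined by the paths of lengths two and zero, and the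
associativity of concatenation yields that of the enriched category (`vData_isVCat`). A
transformation is determined by its components, so the functor is faithful. For the other two
properties one uses, for a `V`-enriched category `Z`, the internal category with the objects of `Z`
and with arrows the quadruples `(l, x, y, f : fold l ⟶ Z(x, y))`, on which triples act by
precomposition (`homCat`, `actFunctor`). Naturality of the family obtained from a `V`-functor is an
equality of two functors from the category of paths to quadruples, so it can be checked on edges
(`vFamily_functor_eq`); this is fullness. The free category on the indiscrete graph maps to the
quadruples of `Z` by iterated composition (`compFunctor`); its compatibility with concatenation of
lists of paths is again an equality of functors (`homConcat_compFunctor`), and the resulting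
enriched `Id`-multicategory is sent to `Z` itself; this is essential surjectivity.
-/

namespace IntEnr

/-! ### Internal monoids and the free monoid of words -/

section Words

variable {E : Type u} [Category.{v} E] [HasPullbacks E] [CartesianMonoidalCategory E]

/-- An internal monoid in `E`, given by its operations on generalized elements; naturality in the
stage makes this equivalent to arrows `M ⊗ M ⟶ M` and `𝟙_ E ⟶ M`. -/
structure PointMonoid (M : E) where
  mul : ∀ {S : E}, (S ⟶ M) → (S ⟶ M) → (S ⟶ M)
  one : ∀ S : E, S ⟶ M
  comp_mul : ∀ {S S' : E} (x : S' ⟶ S) (a b : S ⟶ M), x ≫ mul a b = mul (x ≫ a) (x ≫ b)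
  comp_one : ∀ {S S' : E} (x : S' ⟶ S), x ≫ one S = one S'
  mul_assoc : ∀ {S : E} (a b c : S ⟶ M), mul (mul a b) c = mul a (mul b c)
  one_mul : ∀ {S : E} (a : S ⟶ M), mul (one S) a = a
  mul_one : ∀ {S : E} (a : S ⟶ M), mul a (one S) = a

namespace PointMonoid

variable {M : E} (m : PointMonoid M)

/-- An internal monoid as an internal category with one object. -/
noncomputable abbrev cat : ICat E where
  obj := 𝟙_ E
  mor := M
  src := toUnit _
  tgt := toUnit _
  ident := m.one (𝟙_ E)
  comp := m.mul (pullback.fst _ _) (pullback.snd _ _)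
  ident_src := toUnit_unique _ _
  ident_tgt := toUnit_unique _ _
  comp_src := toUnit_unique _ _
  comp_tgt := toUnit_unique _ _
  cmp_id f := by
    dsimp only [ICatData.cmp]
    rw [m.comp_mul, pullback.lift_fst, pullback.lift_snd, ← Category.assoc, m.comp_one, m.mul_one]
  id_cmp f := by
    dsimp only [ICatData.cmp]
    rw [m.comp_mul, pullback.lift_fst, pullback.lift_snd, ← Category.assoc, m.comp_one, m.one_mul]
  cmp_assoc h g f hg gf := by
    dsimp only [ICatData.cmp]
    simp only [m.comp_mul, pullback.lift_fst, pullback.lift_snd, m.mul_assoc]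

theorem cat_cmp {S : E} (g f : S ⟶ M) (h : g ≫ m.cat.src = f ≫ m.cat.tgt) :
    m.cat.cmp g f h = m.mul g f := by
  dsimp only [ICatData.cmp, cat]
  rw [m.comp_mul, pullback.lift_fst, pullback.lift_snd]

variable {fc : IGraph E ⥤ ICat E} (adj : fc ⊣ ICat.forgetGraph E) {A : E}

/-- The functor from the free internal category on a bouquet that corresponds to the homomorphism
extending `k`. -/
noncomputable def extFunctor (k : A ⟶ M) : fc.obj (bouquet A) ⟶ m.cat :=
  (adj.homEquiv _ _).symm (⟨𝟙 (𝟙_ E), k, toUnit_unique _ _, toUnit_unique _ _⟩ :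
    IGraph.Hom (bouquet A) ((ICat.forgetGraph E).obj m.cat))

/-- The homomorphism from the monoid of words in `A` extending `k : A ⟶ M`. -/
noncomputable def ext (k : A ⟶ M) : Word adj A ⟶ M := (m.extFunctor adj k).mor

theorem wordSing_ext (k : A ⟶ M) : wordSing adj A ≫ m.ext adj k = k := by
  have e := (adj.homEquiv _ _).apply_symm_apply (⟨𝟙 (𝟙_ E), k, toUnit_unique _ _,
    toUnit_unique _ _⟩ : IGraph.Hom (bouquet A) ((ICat.forgetGraph E).obj m.cat))
  rw [adj.homEquiv_unit] at e
  exact congrArg IGraph.Hom.edge e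

theorem wordMul_ext (k : A ⟶ M) {S : E} (l l' : S ⟶ Word adj A) :
    wordMul adj l l' ≫ m.ext adj k = m.mul (l ≫ m.ext adj k) (l' ≫ m.ext adj k) :=
  ((m.extFunctor adj k).map_cmp _ _ _).trans (m.cat_cmp _ _ _)

theorem wordNil_ext (k : A ⟶ M) (S : E) :
    (toUnit S ≫ wordNil adj A) ≫ m.ext adj k = m.one S := by
  have h := (m.extFunctor adj k).map_ident
  rw [wordNil, Category.assoc, Category.assoc]
  refine (congrArg (fun t => toUnit S ≫ unitVert adj (bouquet A) ≫ t) h).trans ?_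
  rw [← Category.assoc, ← Category.assoc]
  exact m.comp_one _

end PointMonoid

variable {fc : IGraph E ⥤ ICat E} (adj : fc ⊣ ICat.forgetGraph E) {A : E}

/-- An internal endomorphism of the monoid of words that fixes the words of length one is the
identity. -/
theorem word_endo_eq_id {f : Word adj A ⟶ Word adj A}
    (mul : ∀ {S : E} (l l' : S ⟶ Word adj A),
      wordMul adj l l' ≫ f = wordMul adj (l ≫ f) (l' ≫ f))
    (nil : wordNil adj A ≫ f = wordNil adj A)
    (sing : wordSing adj A ≫ f = wordSing adj A) : f = 𝟙 _ := by
  -- As an endofunctor of the free category on the bouquet, `f` agrees with the identity on the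
  -- generators.
  let F : fc.obj (bouquet A) ⟶ fc.obj (bouquet A) :=
    ({ obj := 𝟙 _
       mor := f
       src_comm := bouquet_obj_unique adj _ _ _
       tgt_comm := bouquet_obj_unique adj _ _ _
       map_ident := by
         have e : 𝟙 _ = toUnit _ ≫ unitVert adj (bouquet A) := bouquet_obj_unique adj _ _ _
         rw [Category.id_comp, ← Category.id_comp (fc.obj (bouquet A)).ident, e, Category.assoc,
           Category.assoc]
         exact (congrArg (toUnit _ ≫ ·) ((Category.assoc _ _ _).symm.trans nil)).trans
           (Category.assoc _ _ _).symm
       map_cmp := fun g h _ => mul g h } : IFunctor _ _)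
  have e : F = 𝟙 _ := functor_ext_of_unit adj rfl (sing.trans (Category.comp_id _).symm)
  exact congrArg IFunctor.mor e

theorem comp_nil {S S' : E} (x : S' ⟶ S) :
    x ≫ toUnit S ≫ wordNil adj A = toUnit S' ≫ wordNil adj A := by
  rw [← Category.assoc, toUnit_unique (x ≫ toUnit S) (toUnit S')]

/-- An isomorphism of generalized objects whose underlying arrow is an identity has equal ends. -/
theorem ICat.eq_of_isIdArr {C : ICat E} {S : E} {a b : C.El S} (f : a ⟶ b)
    (h : f.arr = f.arr ≫ C.src ≫ C.ident) : a = b := by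
  apply ICat.El.ext
  rw [← f.src, ← f.tgt]
  conv_rhs => rw [h]
  simp only [Category.assoc, C.ident_tgt, Category.comp_id]

/-- A transported identity arrow. -/
theorem ICat.eqToHom_arr {C : ICat E} {S : E} {a b : C.El S} (h : a = b) :
    (eqToHom h).arr = b.pt ≫ C.ident := by
  subst h; rfl

theorem arr_eq_of_isIdArr {C : ICat E} {S : E} {a b a' b' : C.El S} {f : a ⟶ b} {g : a' ⟶ b'}
    (hf : f.arr = b.pt ≫ C.ident) (hg : g.arr = b'.pt ≫ C.ident) (h : b.pt = b'.pt) :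
    f.arr = g.arr := by rw [hf, hg, h]

theorem idArr_of_isIdArr {C : ICat E} {S : E} {a b : C.El S} {f : a ⟶ b}
    (h : f.arr = f.arr ≫ C.src ≫ C.ident) : f.arr = b.pt ≫ C.ident := by
  rw [h, ← Category.assoc, f.src, ICat.eq_of_isIdArr f h]

theorem isIdArr_of_idArr {C : ICat E} {S : E} {a b : C.El S} {f : a ⟶ b}
    (h : f.arr = b.pt ≫ C.ident) : f.arr = f.arr ≫ C.src ≫ C.ident := by
  simp only [h, Category.assoc]
  rw [← Category.assoc C.ident, C.ident_src, Category.id_comp]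

/-- Identity arrows compose; the endpoints `a`, `b`, `c` are equal, but not definitionally so. -/
theorem comp_idArr' {C : ICat E} {S : E} {a b c : C.El S} {f : a ⟶ b} {g : b ⟶ c}
    (hf : f.arr = b.pt ≫ C.ident) (hg : g.arr = c.pt ≫ C.ident) :
    (f ≫ g).arr = c.pt ≫ C.ident := by
  rw [ICat.idArr_comp g hf, hg]

/-! ### The iterated tensor product of a strict internal monoidal category -/

section Strict

variable {V : IMonCat E}

theorem IMonCat.IsStrict.assoc_arr (hV : V.IsStrict) {S : E} (a b c : V.El S) :
    (α_ a b c).hom.arr = (α_ a b c).hom.arr ≫ V.src ≫ V.ident := by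
  change (ICat.castIso _ _ _).hom.arr = (ICat.castIso _ _ _).hom.arr ≫ _
  rw [ICat.castIso_hom_arr]
  change _ ≫ V.assoc.hom.arr = (_ ≫ V.assoc.hom.arr) ≫ _
  rw [Category.assoc, ← hV.assoc]

theorem IMonCat.IsStrict.leftUnitor_arr (hV : V.IsStrict) {S : E} (a : V.El S) :
    (λ_ a).hom.arr = (λ_ a).hom.arr ≫ V.src ≫ V.ident := by
  change (ICat.castIso _ _ _).hom.arr = (ICat.castIso _ _ _).hom.arr ≫ _
  rw [ICat.castIso_hom_arr]
  change _ ≫ V.leftUnitor.hom.arr = (_ ≫ V.leftUnitor.hom.arr) ≫ _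
  rw [Category.assoc, ← hV.leftUnitor]

theorem IMonCat.IsStrict.rightUnitor_arr (hV : V.IsStrict) {S : E} (a : V.El S) :
    (ρ_ a).hom.arr = (ρ_ a).hom.arr ≫ V.src ≫ V.ident := by
  change (ICat.castIso _ _ _).hom.arr = (ICat.castIso _ _ _).hom.arr ≫ _
  rw [ICat.castIso_hom_arr]
  change _ ≫ V.rightUnitor.hom.arr = (_ ≫ V.rightUnitor.hom.arr) ≫ _
  rw [Category.assoc, ← hV.rightUnitor]

/-- The objects of a strict internal monoidal category form an internal monoid. -/
noncomputable def IMonCat.IsStrict.objMonoid (hV : V.IsStrict) : PointMonoid V.obj where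
  mul a b := lift a b ≫ V.tensorObj
  one S := toUnit S ≫ V.unit
  comp_mul x a b := by rw [comp_lift_assoc]
  comp_one x := by rw [← Category.assoc, toUnit_unique (x ≫ toUnit _) (toUnit _)]
  mul_assoc {S} a b c := congrArg ICat.El.pt
    (ICat.eq_of_isIdArr _ (hV.assoc_arr (S := S) ⟨a⟩ ⟨b⟩ ⟨c⟩))
  one_mul {S} a := congrArg ICat.El.pt (ICat.eq_of_isIdArr _ (hV.leftUnitor_arr (S := S) ⟨a⟩))
  mul_one {S} a := congrArg ICat.El.pt (ICat.eq_of_isIdArr _ (hV.rightUnitor_arr (S := S) ⟨a⟩))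

section

variable (hV : V.IsStrict)

theorem IMonCat.IsStrict.fold_mul :
    (⟨fst _ _ ≫ hV.objMonoid.ext adj (𝟙 _)⟩ ⊗ ⟨snd _ _ ≫ hV.objMonoid.ext adj (𝟙 _)⟩ :
        V.El (Word adj V.obj ⊗ Word adj V.obj)) =
      ⟨wordMul adj (fst _ _) (snd _ _) ≫ hV.objMonoid.ext adj (𝟙 _)⟩ :=
  ICat.El.ext (hV.objMonoid.wordMul_ext adj (𝟙 _) _ _).symm

theorem IMonCat.IsStrict.fold_nil :
    𝟙_ (V.El (𝟙_ E)) = ⟨wordNil adj V.obj ≫ hV.objMonoid.ext adj (𝟙 _)⟩ :=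
  ICat.El.ext (by
    refine (hV.objMonoid.wordNil_ext adj (𝟙 _) _).symm.trans ?_
    rw [toUnit_unit, Category.id_comp])

theorem IMonCat.IsStrict.fold_sing :
    (⟨wordSing adj V.obj ≫ hV.objMonoid.ext adj (𝟙 _)⟩ : V.El V.obj) = ⟨𝟙 V.obj⟩ :=
  ICat.El.ext (hV.objMonoid.wordSing_ext adj (𝟙 _))

/-- The data of the strict iterated tensor product of a strict internal monoidal category. -/
noncomputable def IMonCat.IsStrict.foldData (hV : V.IsStrict) : IteratedTensorData adj V where
  fold := hV.objMonoid.ext adj (𝟙 _)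
  mulIso := eqToIso (hV.fold_mul adj)
  nilIso := eqToIso (hV.fold_nil adj)
  singIso := eqToIso (hV.fold_sing adj)

theorem IMonCat.IsStrict.mulEl_arr {S : E} (l m : S ⟶ Word adj V.obj) :
    ((hV.foldData adj).mulEl l m).hom.arr =
      ((hV.foldData adj).foldEl (wordMul adj l m)).pt ≫ V.ident := by
  apply idArr_of_isIdArr
  rw [IteratedTensorData.mulEl_hom_arr, Category.assoc]
  exact congrArg (_ ≫ ·) (isIdArr_of_idArr (ICat.eqToHom_arr (hV.fold_mul adj)))

theorem IMonCat.IsStrict.nilEl_arr (S : E) :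
    ((hV.foldData adj).nilEl S).hom.arr =
      ((hV.foldData adj).foldEl (toUnit S ≫ wordNil adj V.obj)).pt ≫ V.ident := by
  apply idArr_of_isIdArr
  have e : ((hV.foldData adj).nilEl S).hom.arr = toUnit S ≫ (hV.foldData adj).nilIso.hom.arr :=
    ICat.castIso_hom_arr _ _ _
  rw [e, Category.assoc]
  exact congrArg (_ ≫ ·) (isIdArr_of_idArr (ICat.eqToHom_arr (hV.fold_nil adj)))

/-- The strict iterated tensor product of a strict internal monoidal category. -/
noncomputable def IMonCat.IsStrict.iteratedTensor : IteratedTensor adj V where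
  toIteratedTensorData := hV.foldData adj
  mul_assoc l m n := by
    refine arr_eq_of_isIdArr
      (comp_idArr' (V.tensorHom_idArr (hV.mulEl_arr adj _ _) rfl) (hV.mulEl_arr adj _ _))
      (comp_idArr' (idArr_of_isIdArr (hV.assoc_arr _ _ _))
        (comp_idArr' (V.tensorHom_idArr rfl (hV.mulEl_arr adj _ _)) (hV.mulEl_arr adj _ _))) ?_
    rw [wordMul_assoc]
  nil_mul l := by
    refine arr_eq_of_isIdArr
      (comp_idArr' (V.tensorHom_idArr (hV.nilEl_arr adj _) rfl) (hV.mulEl_arr adj _ _))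
      (idArr_of_isIdArr (hV.leftUnitor_arr _)) ?_
    rw [nil_wordMul]
  mul_nil l := by
    refine arr_eq_of_isIdArr
      (comp_idArr' (V.tensorHom_idArr rfl (hV.nilEl_arr adj _)) (hV.mulEl_arr adj _ _))
      (idArr_of_isIdArr (hV.rightUnitor_arr _)) ?_
    rw [wordMul_nil]

theorem IMonCat.IsStrict.iteratedTensor_isStrict : (hV.iteratedTensor adj).IsStrict where
  mul := isIdArr_of_idArr (ICat.eqToHom_arr (hV.fold_mul adj))
  nil := isIdArr_of_idArr (ICat.eqToHom_arr (hV.fold_nil adj))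
  sing := isIdArr_of_idArr (ICat.eqToHom_arr (hV.fold_sing adj))

end

end Strict

end Words

end IntEnr

namespace IntEnr

/-! ### Recursion and induction on words -/

section WordRecursion

variable {E : Type u} [Category.{v} E] [HasPullbacks E] [CartesianMonoidalCategory E]
  {fc : IGraph E ⥤ ICat E} (adj : fc ⊣ ICat.forgetGraph E) {A : E}

/-- Induction on words: an equation between arrows out of the object of words holds if it holds for
the empty word and for words of length one, and is stable under concatenation. -/
theorem word_induction {T : E} {p q : Word adj A ⟶ T}
    (mul : ∀ {S : E} (l m : S ⟶ Word adj A), l ≫ p = l ≫ q → m ≫ p = m ≫ q →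
      wordMul adj l m ≫ p = wordMul adj l m ≫ q)
    (nil : wordNil adj A ≫ p = wordNil adj A ≫ q)
    (sing : wordSing adj A ≫ p = wordSing adj A ≫ q) : p = q := by
  -- The words that satisfy the equation form a submonoid; the homomorphism into it that extends
  -- the words of length one is a section of the inclusion.
  let P : E := pullback (lift p q) (lift (𝟙 T) (𝟙 T))
  let ι : P ⟶ Word adj A := pullback.fst _ _
  have good {S : E} (l : S ⟶ P) : (l ≫ ι) ≫ p = (l ≫ ι) ≫ q := by
    have h : ι ≫ lift p q = pullback.snd _ _ ≫ lift (𝟙 T) (𝟙 T) := pullback.condition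
    have h₁ := congrArg (l ≫ · ≫ fst _ _) h
    have h₂ := congrArg (l ≫ · ≫ snd _ _) h
    simp only [Category.assoc, lift_fst, lift_snd] at h₁ h₂
    rw [Category.assoc, Category.assoc, h₁, h₂]
  have exists_mk (S : E) (l : S ⟶ Word adj A) (h : l ≫ p = l ≫ q) : ∃ w : S ⟶ P, w ≫ ι = l :=
    ⟨pullback.lift l (l ≫ p) (by rw [comp_lift, comp_lift, Category.comp_id, h]),
      pullback.lift_fst _ _ _⟩
  choose mk mk_ι using exists_mk
  have ext {S : E} {l m : S ⟶ P} (h : l ≫ ι = m ≫ ι) : l = m := by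
    apply pullback.hom_ext h
    have e (l : S ⟶ P) : l ≫ pullback.snd (lift p q) (lift (𝟙 T) (𝟙 T)) = (l ≫ ι) ≫ p := by
      have h := congrArg (l ≫ · ≫ fst _ _)
        (pullback.condition (f := lift p q) (g := lift (𝟙 T) (𝟙 T)))
      simp only [Category.assoc, lift_fst, Category.comp_id] at h
      rw [Category.assoc]; exact h.symm
    rw [e, e, h]
  have gn (S : E) : (toUnit S ≫ wordNil adj A) ≫ p = (toUnit S ≫ wordNil adj A) ≫ q := by
    rw [Category.assoc, nil, Category.assoc]
  let m : PointMonoid P :=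
    { mul := fun l m => mk _ (wordMul adj (l ≫ ι) (m ≫ ι)) (mul _ _ (good l) (good m))
      one := fun S => mk S (toUnit S ≫ wordNil adj A) (gn S)
      comp_mul := fun x l m => ext (by
        rw [Category.assoc, mk_ι, mk_ι, comp_wordMul, Category.assoc, Category.assoc])
      comp_one := fun x => ext (by rw [Category.assoc, mk_ι, mk_ι, comp_nil])
      mul_assoc := fun l m n => ext (by simp only [mk_ι, wordMul_assoc])
      one_mul := fun l => ext (by simp only [mk_ι, nil_wordMul])
      mul_one := fun l => ext (by simp only [mk_ι, wordMul_nil]) }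
  let r : Word adj A ⟶ P := m.ext adj (mk _ (wordSing adj A) sing)
  have hr : r ≫ ι = 𝟙 _ := by
    apply word_endo_eq_id adj
    · intro S l l'
      rw [← Category.assoc, m.wordMul_ext]
      refine (mk_ι _ _ _).trans ?_
      rw [Category.assoc, Category.assoc]
    · have h := m.wordNil_ext adj (mk _ (wordSing adj A) sing) (𝟙_ E)
      rw [toUnit_unit, Category.id_comp] at h
      rw [← Category.assoc, h]
      exact (mk_ι _ _ _).trans (by rw [toUnit_unit, Category.id_comp])
    · rw [← Category.assoc, m.wordSing_ext, mk_ι]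
  have h := good r
  rwa [hr, Category.id_comp, Category.id_comp] at h

variable [MonoidalClosed E]

open MonoidalClosed

/-- The monoid of endomorphisms of an object of a cartesian closed category, with `p q` the
composite that applies `q` first. -/
noncomputable def endMonoid (B : E) : PointMonoid ((ihom B).obj B) where
  mul p q := curry (lift (uncurry q) (snd _ _) ≫ uncurry p)
  one S := curry (fst B S)
  comp_mul x p q := by
    rw [← curry_natural_left, uncurry_natural_left, uncurry_natural_left, comp_lift_assoc,
      whiskerLeft_snd, lift_whiskerLeft_assoc]
  comp_one x := by rw [← curry_natural_left, whiskerLeft_fst]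
  mul_assoc p q r := by
    simp only [uncurry_curry, comp_lift_assoc, lift_snd]
  one_mul p := by
    simp only [uncurry_curry, lift_fst, curry_uncurry]
  mul_one p := by
    rw [uncurry_curry, lift_fst_snd, Category.id_comp, curry_uncurry]

variable {B : E}

/-- The action of words on `B` that extends an arrow `B ⊗ A ⟶ B`. -/
noncomputable def wordAct (a : B ⊗ A ⟶ B) : B ⊗ Word adj A ⟶ B :=
  uncurry ((endMonoid B).ext adj (curry a))

theorem lift_uncurry {S T : E} {M : E} (b : S ⟶ B) (l : S ⟶ M) (p : M ⟶ (ihom B).obj T) :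
    lift b l ≫ uncurry p = lift b (𝟙 S) ≫ uncurry (l ≫ p) := by
  rw [uncurry_natural_left, lift_whiskerLeft_assoc, Category.id_comp]

theorem wordAct_mul (a : B ⊗ A ⟶ B) {S : E} (b : S ⟶ B) (l m : S ⟶ Word adj A) :
    lift b (wordMul adj l m) ≫ wordAct adj a =
      lift (lift b m ≫ wordAct adj a) l ≫ wordAct adj a := by
  have h := (endMonoid B).wordMul_ext adj (curry a) l m
  rw [wordAct, lift_uncurry, h]
  change lift b (𝟙 S) ≫ uncurry (curry _) = _
  rw [uncurry_curry, uncurry_natural_left, uncurry_natural_left, comp_lift_assoc, lift_snd,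
    lift_whiskerLeft_assoc, lift_whiskerLeft_assoc, Category.id_comp, Category.id_comp]

theorem wordAct_nil (a : B ⊗ A ⟶ B) {S : E} (b : S ⟶ B) :
    lift b (toUnit S ≫ wordNil adj A) ≫ wordAct adj a = b := by
  have h := (endMonoid B).wordNil_ext adj (curry a) S
  rw [wordAct, lift_uncurry, h]
  change lift b (𝟙 S) ≫ uncurry (curry _) = _
  rw [uncurry_curry, lift_fst]

theorem wordAct_sing (a : B ⊗ A ⟶ B) {S : E} (b : S ⟶ B) (v : S ⟶ A) :
    lift b (v ≫ wordSing adj A) ≫ wordAct adj a = lift b v ≫ a := by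
  rw [wordAct, lift_uncurry, Category.assoc, (endMonoid B).wordSing_ext, ← lift_uncurry,
    uncurry_curry]

/-- Equality of the transposes at a generalized element `l` of `M` means equality at `(b, l)` for
all generalized elements `b` of `B`; this turns equations on `B ⊗ M` into equations on `M`, where
`word_induction` applies. -/
theorem comp_curry_eq_iff {S M T : E} (l : S ⟶ M) (f g : B ⊗ M ⟶ T) :
    l ≫ curry f = l ≫ curry g ↔
      ∀ {S' : E} (x : S' ⟶ S) (b : S' ⟶ B), lift b (x ≫ l) ≫ f = lift b (x ≫ l) ≫ g := by
  rw [← curry_natural_left, ← curry_natural_left, curry_injective.eq_iff]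
  constructor
  · intro h S' x b
    have h' := congrArg (lift b x ≫ ·) h
    simpa only [lift_whiskerLeft_assoc] using h'
  · intro h
    have h' := h (snd B S) (fst B S)
    have e : lift (fst B S) (snd B S ≫ l) = B ◁ l := by
      apply CartesianMonoidalCategory.hom_ext <;> simp
    rwa [e] at h'

/-- The word `(v) l`. -/
noncomputable def wordCons {S : E} (v : S ⟶ A) (l : S ⟶ Word adj A) : S ⟶ Word adj A :=
  wordMul adj (v ≫ wordSing adj A) l

theorem comp_wordCons {S S' : E} (x : S' ⟶ S) (v : S ⟶ A) (l : S ⟶ Word adj A) :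
    x ≫ wordCons adj v l = wordCons adj (x ≫ v) (x ≫ l) := by
  rw [wordCons, wordCons, comp_wordMul, Category.assoc]

variable {adj} in
/-- Dependent recursion on words: an object over `Word ⊗ Y` with a section over the empty word and
with an operation over prefixing by a letter has a section that is compatible with these. -/
theorem exists_word_section {Y : E} (π₁ : B ⟶ Word adj A) (π₂ : B ⟶ Y) (b₀ : Y ⟶ B)
    (a : B ⊗ A ⟶ B) (h₁ : b₀ ≫ π₁ = toUnit Y ≫ wordNil adj A) (h₂ : b₀ ≫ π₂ = 𝟙 Y)
    (h₁' : ∀ {S : E} (b : S ⟶ B) (v : S ⟶ A), lift b v ≫ a ≫ π₁ = wordCons adj v (b ≫ π₁))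
    (h₂' : ∀ {S : E} (b : S ⟶ B) (v : S ⟶ A), lift b v ≫ a ≫ π₂ = b ≫ π₂) :
    ∃ s : Word adj A ⊗ Y ⟶ B, s ≫ π₁ = fst _ _ ∧ s ≫ π₂ = snd _ _ ∧
      (∀ {S : E} (y : S ⟶ Y), lift (toUnit S ≫ wordNil adj A) y ≫ s = y ≫ b₀) ∧
      ∀ {S : E} (v : S ⟶ A) (l : S ⟶ Word adj A) (y : S ⟶ Y),
        lift (wordCons adj v l) y ≫ s = lift (lift l y ≫ s) v ≫ a := by
  have r {S : E} (b : S ⟶ B) (l : S ⟶ Word adj A) :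
      lift b l ≫ lift (wordMul adj (snd B (Word adj A)) (fst _ _ ≫ π₁)) (fst _ _ ≫ π₂) =
        lift (wordMul adj l (b ≫ π₁)) (b ≫ π₂) := by
    rw [comp_lift, comp_wordMul, lift_snd, lift_fst_assoc, lift_fst_assoc]
  -- The action on `b` by `l` lies over the concatenation of `l` with the word of `b`.
  have key : curry (wordAct adj a ≫ lift π₁ π₂) =
      curry (lift (wordMul adj (snd B (Word adj A)) (fst _ _ ≫ π₁)) (fst _ _ ≫ π₂)) := by
    apply word_induction adj
    · intro S l m hl hm
      rw [comp_curry_eq_iff] at hl hm ⊢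
      intro S' x b
      have hm' := hm x b
      have hl' := hl x (lift b (x ≫ m) ≫ wordAct adj a)
      rw [r] at hl' hm' ⊢
      rw [comp_wordMul, ← Category.assoc, wordAct_mul, Category.assoc, hl']
      have e₁ := congrArg (· ≫ fst _ _) hm'
      have e₂ := congrArg (· ≫ snd _ _) hm'
      simp only [Category.assoc, lift_fst, lift_snd] at e₁ e₂
      rw [Category.assoc, Category.assoc, e₁, e₂, wordMul_assoc]
    · rw [comp_curry_eq_iff]
      intro S' x b
      rw [r, toUnit_unique x (toUnit S'), ← Category.assoc, wordAct_nil, nil_wordMul, comp_lift]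
    · rw [comp_curry_eq_iff]
      intro S' x b
      rw [r, ← Category.assoc, wordAct_sing, Category.assoc, comp_lift, comp_lift, h₁', h₂']
      rfl
  have key' := curry_injective key
  have k₁ {S : E} (b : S ⟶ B) (l : S ⟶ Word adj A) :
      lift b l ≫ wordAct adj a ≫ π₁ = wordMul adj l (b ≫ π₁) := by
    have e := congrArg (lift b l ≫ · ≫ fst _ _) key'
    simpa only [Category.assoc, lift_fst, comp_wordMul, lift_snd, lift_fst_assoc] using e
  have k₂ {S : E} (b : S ⟶ B) (l : S ⟶ Word adj A) :
      lift b l ≫ wordAct adj a ≫ π₂ = b ≫ π₂ := by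
    have e := congrArg (lift b l ≫ · ≫ snd _ _) key'
    simpa only [Category.assoc, lift_snd, lift_fst_assoc] using e
  -- The section at `(l, y)` is the result of acting by `l` on `b₀(y)`.
  refine ⟨lift (snd _ _ ≫ b₀) (fst _ _) ≫ wordAct adj a, ?_, ?_, ?_, ?_⟩
  · rw [Category.assoc, k₁, Category.assoc, h₁, comp_nil, wordMul_nil]
  · rw [Category.assoc, k₂, Category.assoc, h₂, Category.comp_id]
  · intro S y
    rw [comp_lift_assoc, lift_fst, lift_snd_assoc, wordAct_nil]
  · intro S v l y
    rw [comp_lift_assoc, lift_fst, lift_snd_assoc, comp_lift_assoc, lift_fst, lift_snd_assoc,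
      wordCons, wordAct_mul, wordAct_sing]

variable {adj} in
/-- Induction on words along prefixing by letters, for equations between natural families. -/
theorem wordCons_induction {Y T : E} {p q : ∀ {S : E}, (S ⟶ Word adj A) → (S ⟶ Y) → (S ⟶ T)}
    (hp : ∀ {S S' : E} (x : S' ⟶ S) (l : S ⟶ Word adj A) (y : S ⟶ Y),
      x ≫ p l y = p (x ≫ l) (x ≫ y))
    (hq : ∀ {S S' : E} (x : S' ⟶ S) (l : S ⟶ Word adj A) (y : S ⟶ Y),
      x ≫ q l y = q (x ≫ l) (x ≫ y))
    (nil : ∀ {S : E} (y : S ⟶ Y),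
      p (toUnit S ≫ wordNil adj A) y = q (toUnit S ≫ wordNil adj A) y)
    (cons : ∀ {S : E} (v : S ⟶ A) (l : S ⟶ Word adj A) (y : S ⟶ Y), p l y = q l y →
      p (wordCons adj v l) y = q (wordCons adj v l) y)
    {S : E} (l : S ⟶ Word adj A) (y : S ⟶ Y) : p l y = q l y := by
  -- The object of pairs `(l, y)` at which `p` and `q` agree; the recursion provides a section.
  let P : E := pullback (lift (p (fst (Word adj A) Y) (snd _ _)) (q (fst _ _) (snd _ _)))
    (lift (𝟙 T) (𝟙 T))
  let ι : P ⟶ Word adj A ⊗ Y := pullback.fst _ _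
  have good {S : E} (b : S ⟶ P) :
      p (b ≫ ι ≫ fst _ _) (b ≫ ι ≫ snd _ _) = q (b ≫ ι ≫ fst _ _) (b ≫ ι ≫ snd _ _) := by
    have h : ι ≫ lift (p (fst (Word adj A) Y) (snd _ _)) (q (fst _ _) (snd _ _)) =
      pullback.snd _ _ ≫ lift (𝟙 T) (𝟙 T) := pullback.condition
    have h₁ := congrArg (b ≫ · ≫ fst _ _) h
    have h₂ := congrArg (b ≫ · ≫ snd _ _) h
    simp only [Category.assoc, lift_fst, lift_snd, hp, hq] at h₁ h₂
    rw [h₁, h₂]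
  have exists_mk (S : E) (l : S ⟶ Word adj A) (y : S ⟶ Y) (h : p l y = q l y) :
      ∃ w : S ⟶ P, w ≫ ι = lift l y :=
    ⟨pullback.lift (lift l y) (p l y) (by
      rw [comp_lift, comp_lift, hp, hq, Category.comp_id, lift_fst, lift_snd, h]),
      pullback.lift_fst _ _ _⟩
  choose mk mk_ι using exists_mk
  obtain ⟨s, hs₁, hs₂, -, -⟩ := exists_word_section (B := P) (ι ≫ fst _ _) (ι ≫ snd _ _)
    (mk Y (toUnit Y ≫ wordNil adj A) (𝟙 Y) (nil _))
    (mk _ (wordCons adj (snd P A) (fst P A ≫ ι ≫ fst _ _)) (fst P A ≫ ι ≫ snd _ _)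
      (cons _ _ _ (good _)))
    (by rw [← Category.assoc, mk_ι, lift_fst]) (by rw [← Category.assoc, mk_ι, lift_snd])
    (fun b v => by
      rw [← Category.assoc (mk _ _ _ _), mk_ι, lift_fst, comp_wordCons, lift_snd, lift_fst_assoc])
    (fun b v => by rw [← Category.assoc (mk _ _ _ _), mk_ι, lift_snd, lift_fst_assoc])
  have h := congrArg (lift l y ≫ ·) (good s)
  simpa only [hs₁, hs₂, hp, hq, lift_fst, lift_snd] using h

end WordRecursion

end IntEnr

namespace IntEnr

/-! ### Families of arrows defined by recursion on words -/

section ArrowRecursion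

variable {E : Type u} [Category.{v} E] [HasPullbacks E] [CartesianMonoidalCategory E]
  [MonoidalClosed E] {fc : IGraph E ⥤ ICat E} {adj : fc ⊣ ICat.forgetGraph E} {A : E}

/-- Recursion on words for arrows of an internal category: a family of arrows `P(l, y) ⟶ Q(l, y)`
is determined by its values at the empty word and by an operation that extends it along prefixing
by a letter. The families are natural in the stage, and `Y` is an object of parameters. -/
theorem exists_arrow_family {C : ICat E} {Y : E}
    (P Q : ∀ {S : E}, (S ⟶ Word adj A) → (S ⟶ Y) → C.El S)
    (hP : ∀ {S S' : E} (x : S' ⟶ S) (l : S ⟶ Word adj A) (y : S ⟶ Y),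
      x ≫ (P l y).pt = (P (x ≫ l) (x ≫ y)).pt)
    (hQ : ∀ {S S' : E} (x : S' ⟶ S) (l : S ⟶ Word adj A) (y : S ⟶ Y),
      x ≫ (Q l y).pt = (Q (x ≫ l) (x ≫ y)).pt)
    (base : ∀ {S : E} (y : S ⟶ Y),
      P (toUnit S ≫ wordNil adj A) y ⟶ Q (toUnit S ≫ wordNil adj A) y)
    (hbase : ∀ {S S' : E} (x : S' ⟶ S) (y : S ⟶ Y), x ≫ (base y).arr = (base (x ≫ y)).arr)
    (step : ∀ {S : E} (v : S ⟶ A) (l : S ⟶ Word adj A) (y : S ⟶ Y), (P l y ⟶ Q l y) →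
      (P (wordCons adj v l) y ⟶ Q (wordCons adj v l) y))
    (hstep : ∀ {S S' : E} (x : S' ⟶ S) (v : S ⟶ A) (l : S ⟶ Word adj A) (y : S ⟶ Y)
      (f : P l y ⟶ Q l y) (f' : P (x ≫ l) (x ≫ y) ⟶ Q (x ≫ l) (x ≫ y)), x ≫ f.arr = f'.arr →
        x ≫ (step v l y f).arr = (step (x ≫ v) (x ≫ l) (x ≫ y) f').arr) :
    ∃ F : ∀ {S : E} (l : S ⟶ Word adj A) (y : S ⟶ Y), P l y ⟶ Q l y,
      (∀ {S S' : E} (x : S' ⟶ S) (l : S ⟶ Word adj A) (y : S ⟶ Y),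
        x ≫ (F l y).arr = (F (x ≫ l) (x ≫ y)).arr) ∧
      (∀ {S : E} (y : S ⟶ Y), F (toUnit S ≫ wordNil adj A) y = base y) ∧
      ∀ {S : E} (v : S ⟶ A) (l : S ⟶ Word adj A) (y : S ⟶ Y),
        F (wordCons adj v l) y = step v l y (F l y) := by
  -- Naturality of `step` along restrictions that are known only up to propositional equality.
  have step_of {S S' : E} (x : S' ⟶ S) (v : S ⟶ A) (l : S ⟶ Word adj A) (y : S ⟶ Y)
      {v' : S' ⟶ A} {l' : S' ⟶ Word adj A} {y' : S' ⟶ Y} (f : P l y ⟶ Q l y)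
      (f' : P l' y' ⟶ Q l' y') (hv : x ≫ v = v') (hl : x ≫ l = l') (hy : x ≫ y = y')
      (hf : x ≫ f.arr = f'.arr) : x ≫ (step v l y f).arr = (step v' l' y' f').arr := by
    subst hv hl hy; exact hstep x v l y f f' hf
  -- The object of triples `(l, y, f)` with `f : P(l, y) ⟶ Q(l, y)`.
  let B : E := pullback (lift (P (fst (Word adj A) Y) (snd _ _)).pt (Q (fst _ _) (snd _ _)).pt)
    (lift C.src C.tgt)
  let ι : B ⟶ Word adj A ⊗ Y := pullback.fst _ _
  let k : B ⟶ C.mor := pullback.snd _ _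
  have hB : ι ≫ lift (P (fst (Word adj A) Y) (snd _ _)).pt (Q (fst _ _) (snd _ _)).pt =
      k ≫ lift C.src C.tgt := pullback.condition
  have hsrc {S : E} (b : S ⟶ B) :
      (b ≫ k) ≫ C.src = (P (b ≫ ι ≫ fst _ _) (b ≫ ι ≫ snd _ _)).pt := by
    have h := congrArg (b ≫ · ≫ fst _ _) hB
    simp only [Category.assoc, lift_fst, hP] at h
    rw [Category.assoc, h]
  have htgt {S : E} (b : S ⟶ B) :
      (b ≫ k) ≫ C.tgt = (Q (b ≫ ι ≫ fst _ _) (b ≫ ι ≫ snd _ _)).pt := by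
    have h := congrArg (b ≫ · ≫ snd _ _) hB
    simp only [Category.assoc, lift_snd, hQ] at h
    rw [Category.assoc, h]
  have exists_mk (S : E) (l : S ⟶ Word adj A) (y : S ⟶ Y) (f : P l y ⟶ Q l y) :
      ∃ b : S ⟶ B, b ≫ ι = lift l y ∧ b ≫ k = f.arr :=
    ⟨pullback.lift (lift l y) f.arr (by
      rw [comp_lift, comp_lift, hP, hQ, lift_fst, lift_snd, f.src, f.tgt]),
      pullback.lift_fst _ _ _, pullback.lift_snd _ _ _⟩
  obtain ⟨b₀, hb₀, hb₀'⟩ := exists_mk Y _ (𝟙 Y) (base (𝟙 Y))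
  let g : P (fst B A ≫ ι ≫ fst _ _) (fst B A ≫ ι ≫ snd _ _) ⟶
      Q (fst B A ≫ ι ≫ fst _ _) (fst B A ≫ ι ≫ snd _ _) :=
    (⟨fst B A ≫ k, hsrc _, htgt _⟩ : C.ElHom _ _)
  obtain ⟨a, ha, ha'⟩ := exists_mk (B ⊗ A) _ _ (step (snd B A) _ _ g)
  obtain ⟨s, hs₁, hs₂, hs₀, hs⟩ := exists_word_section (ι ≫ fst _ _) (ι ≫ snd _ _) b₀ a
    (by rw [← Category.assoc, hb₀, lift_fst]) (by rw [← Category.assoc, hb₀, lift_snd])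
    (fun b v => by rw [← Category.assoc a, ha, lift_fst, comp_wordCons, lift_snd, lift_fst_assoc])
    (fun b v => by rw [← Category.assoc a, ha, lift_snd, lift_fst_assoc])
  have e₁ {S : E} (l : S ⟶ Word adj A) (y : S ⟶ Y) : (lift l y ≫ s) ≫ ι ≫ fst _ _ = l := by
    rw [Category.assoc, hs₁, lift_fst]
  have e₂ {S : E} (l : S ⟶ Word adj A) (y : S ⟶ Y) : (lift l y ≫ s) ≫ ι ≫ snd _ _ = y := by
    rw [Category.assoc, hs₂, lift_snd]
  let F {S : E} (l : S ⟶ Word adj A) (y : S ⟶ Y) : P l y ⟶ Q l y :=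
    (⟨(lift l y ≫ s) ≫ k, by rw [hsrc, e₁, e₂], by rw [htgt, e₁, e₂]⟩ : C.ElHom _ _)
  refine ⟨F, fun x l y => ?_, fun {S} y => ICat.el_ext ?_, fun v l y => ICat.el_ext ?_⟩
  · change x ≫ (lift l y ≫ s) ≫ k = (lift (x ≫ l) (x ≫ y) ≫ s) ≫ k
    rw [← comp_lift]; simp only [Category.assoc]
  · change (lift (toUnit S ≫ wordNil adj A) y ≫ s) ≫ k = _
    rw [hs₀, Category.assoc, hb₀', hbase, Category.comp_id]
  · change (lift (wordCons adj v l) y ≫ s) ≫ k = _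
    rw [hs, Category.assoc, ha']
    refine step_of _ _ _ _ g (F l y) (lift_snd _ _) ?_ ?_ ?_
    · rw [lift_fst_assoc, e₁]
    · rw [lift_fst_assoc, e₂]
    · exact lift_fst_assoc _ _ _

end ArrowRecursion

end IntEnr

namespace IntEnr

/-! ### Structure isomorphisms at generalized objects -/

section Restriction

variable {E : Type u} [Category.{v} E] [HasPullbacks E] [CartesianMonoidalCategory E]
  (V : IMonCat E)

/-- The same generalized morphism, with equal domain and codomain. -/
def ICat.castHom {C : ICat E} {S : E} {a b a' b' : C.El S} (f : a ⟶ b) (ha : a = a')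
    (hb : b = b') : a' ⟶ b' :=
  (⟨f.arr, by rw [f.src, ha], by rw [f.tgt, hb]⟩ : C.ElHom _ _)

theorem comp_tensorHom_arr {S S' : E} (x : S' ⟶ S) {a b c d : V.El S} {a' b' c' d' : V.El S'}
    {f : a ⟶ b} {g : c ⟶ d} {f' : a' ⟶ b'} {g' : c' ⟶ d'} (hf : x ≫ f.arr = f'.arr)
    (hg : x ≫ g.arr = g'.arr) : x ≫ (f ⊗ₘ g).arr = (f' ⊗ₘ g').arr := by
  rw [V.tensorHom_arr, V.tensorHom_arr, ← Category.assoc, comp_lift, hf, hg]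

theorem comp_comp_arr {C : ICat E} {S S' : E} (x : S' ⟶ S) {a b c : C.El S} {a' b' c' : C.El S'}
    {f : a ⟶ b} {g : b ⟶ c} {f' : a' ⟶ b'} {g' : b' ⟶ c'} (hf : x ≫ f.arr = f'.arr)
    (hg : x ≫ g.arr = g'.arr) : x ≫ (f ≫ g).arr = (f' ≫ g').arr := by
  rw [res_comp_arr]
  exact ICat.comp_arr_congr hf hg

theorem comp_id_arr {C : ICat E} {S S' : E} (x : S' ⟶ S) {a : C.El S} {a' : C.El S'}
    (h : x ≫ a.pt = a'.pt) : x ≫ ICat.ElHom.arr (𝟙 a) = ICat.ElHom.arr (𝟙 a') := by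
  rw [ICat.el_id_arr, ICat.el_id_arr, ← h, Category.assoc]

theorem associator_hom_arr {S : E} (a b c : V.El S) :
    (α_ a b c).hom.arr = lift a.pt (lift b.pt c.pt) ≫ V.assoc.hom.arr :=
  ICat.castIso_hom_arr _ _ _

theorem associator_inv_arr {S : E} (a b c : V.El S) :
    (α_ a b c).inv.arr = lift a.pt (lift b.pt c.pt) ≫ V.assoc.inv.arr :=
  ICat.castIso_inv_arr _ _ _

theorem leftUnitor_hom_arr {S : E} (a : V.El S) :
    (λ_ a).hom.arr = a.pt ≫ V.leftUnitor.hom.arr := ICat.castIso_hom_arr _ _ _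

theorem leftUnitor_inv_arr {S : E} (a : V.El S) :
    (λ_ a).inv.arr = a.pt ≫ V.leftUnitor.inv.arr := ICat.castIso_inv_arr _ _ _

theorem rightUnitor_hom_arr {S : E} (a : V.El S) :
    (ρ_ a).hom.arr = a.pt ≫ V.rightUnitor.hom.arr := ICat.castIso_hom_arr _ _ _

theorem comp_associator_hom {S S' : E} (x : S' ⟶ S) {a b c : V.El S} {a' b' c' : V.El S'}
    (ha : x ≫ a.pt = a'.pt) (hb : x ≫ b.pt = b'.pt) (hc : x ≫ c.pt = c'.pt) :
    x ≫ (α_ a b c).hom.arr = (α_ a' b' c').hom.arr := by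
  rw [associator_hom_arr, associator_hom_arr, ← Category.assoc, comp_lift, comp_lift, ha, hb, hc]

theorem comp_associator_inv {S S' : E} (x : S' ⟶ S) {a b c : V.El S} {a' b' c' : V.El S'}
    (ha : x ≫ a.pt = a'.pt) (hb : x ≫ b.pt = b'.pt) (hc : x ≫ c.pt = c'.pt) :
    x ≫ (α_ a b c).inv.arr = (α_ a' b' c').inv.arr := by
  rw [associator_inv_arr, associator_inv_arr, ← Category.assoc, comp_lift, comp_lift, ha, hb, hc]

end Restriction

/-! ### Inductive steps for the coherence laws -/

section Coherence

variable {W : Type*} [Category W] [MonoidalCategory W]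

/-- The associativity law for `λ` in place of the isomorphism `fold () ⊗ fold m ≅ fold m`. -/
theorem leftUnitor_tensorHom_comp {m n z : W} (g : m ⊗ n ⟶ z) :
    ((λ_ m).hom ⊗ₘ 𝟙 n) ≫ g = (α_ (𝟙_ W) m n).hom ≫ (𝟙 (𝟙_ W) ⊗ₘ g) ≫ (λ_ z).hom := by
  simp

/-- The associativity law for words `l` (hypothesis `e`) implies that for `v l`, by the pentagon. -/
theorem associator_step {v l m n k x y : W} {f : l ⊗ m ⟶ x} {g : x ⊗ n ⟶ y} {h : m ⊗ n ⟶ k}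
    {j : l ⊗ k ⟶ y} (e : (f ⊗ₘ 𝟙 n) ≫ g = (α_ l m n).hom ≫ (𝟙 l ⊗ₘ h) ≫ j) :
    (((α_ v l m).hom ≫ (𝟙 v ⊗ₘ f)) ⊗ₘ 𝟙 n) ≫ (α_ v x n).hom ≫ (𝟙 v ⊗ₘ g) =
      (α_ (v ⊗ l) m n).hom ≫ (𝟙 (v ⊗ l) ⊗ₘ h) ≫ (α_ v l k).hom ≫ (𝟙 v ⊗ₘ j) := by
  simp only [MonoidalCategory.id_tensorHom, MonoidalCategory.tensorHom_id,
    MonoidalCategory.comp_whiskerRight, Category.assoc,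
    MonoidalCategory.associator_naturality_middle_assoc,
    MonoidalCategory.tensor_whiskerLeft, Iso.inv_hom_id_assoc] at e ⊢
  rw [← MonoidalCategory.whiskerLeft_comp, e, MonoidalCategory.whiskerLeft_comp,
    MonoidalCategory.whiskerLeft_comp, MonoidalCategory.pentagon_assoc]

/-- The right unit law for words `l` (hypothesis `e`) implies that for `v l`. -/
theorem rightUnitor_step {v l : W} {u : W} {s : 𝟙_ W ⟶ u} {f : l ⊗ u ⟶ l}
    (e : (𝟙 l ⊗ₘ s) ≫ f = (ρ_ l).hom) :
    (𝟙 (v ⊗ l) ⊗ₘ s) ≫ (α_ v l u).hom ≫ (𝟙 v ⊗ₘ f) = (ρ_ (v ⊗ l)).hom := by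
  simp only [MonoidalCategory.id_tensorHom, MonoidalCategory.tensor_whiskerLeft, Category.assoc,
    Iso.inv_hom_id_assoc] at e ⊢
  rw [← MonoidalCategory.whiskerLeft_comp, e, MonoidalCategory.rightUnitor_tensor_hom]

theorem associator_conj_id {v l m x : W} {f : l ⊗ m ⟶ x} {g : x ⟶ l ⊗ m} (e : f ≫ g = 𝟙 _) :
    ((α_ v l m).hom ≫ (𝟙 v ⊗ₘ f)) ≫ (𝟙 v ⊗ₘ g) ≫ (α_ v l m).inv = 𝟙 _ := by
  rw [Category.assoc, MonoidalCategory.tensorHom_comp_tensorHom_assoc, e]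
  simp

theorem conj_associator_id {v l m x : W} {f : l ⊗ m ⟶ x} {g : x ⟶ l ⊗ m} (e : g ≫ f = 𝟙 _) :
    ((𝟙 v ⊗ₘ g) ≫ (α_ v l m).inv) ≫ (α_ v l m).hom ≫ (𝟙 v ⊗ₘ f) = 𝟙 _ := by
  rw [Category.assoc, Iso.inv_hom_id_assoc, MonoidalCategory.tensorHom_comp_tensorHom, e]
  simp

end Coherence

/-! ### The right-bracketed iterated tensor product -/

section WordFold

variable {E : Type u} [Category.{v} E] [HasPullbacks E] [CartesianMonoidalCategory E]
  [MonoidalClosed E] {fc : IGraph E ⥤ ICat E} (adj : fc ⊣ ICat.forgetGraph E) (V : IMonCat E)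

/-- The right-bracketed iterated tensor product `v₁ ⊗ (v₂ ⊗ ⋯ ⊗ (vₙ ⊗ I))`: the result of acting on
the unit `I` by a word, each letter `v` acting by `v ⊗ -`. -/
noncomputable def wordFold : Word adj V.obj ⟶ V.obj :=
  lift (toUnit _ ≫ V.unit) (𝟙 _) ≫ wordAct adj (lift (snd _ _) (fst _ _) ≫ V.tensorObj)

variable {adj}

/-- The right-bracketed iterated tensor product of a generalized word. -/
noncomputable def wordFoldEl {S : E} (l : S ⟶ Word adj V.obj) : V.El S := ⟨l ≫ wordFold adj V⟩

theorem comp_wordFold {S : E} (l : S ⟶ Word adj V.obj) : l ≫ wordFold adj V =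
    lift (toUnit S ≫ V.unit) l ≫ wordAct adj (lift (snd _ _) (fst _ _) ≫ V.tensorObj) := by
  rw [wordFold, comp_lift_assoc, Category.comp_id, ← Category.assoc l,
    toUnit_unique (l ≫ toUnit _) (toUnit S)]

theorem wordFoldEl_nil (S : E) :
    wordFoldEl V (toUnit S ≫ wordNil adj V.obj) = 𝟙_ (V.El S) := by
  apply ICat.El.ext
  exact (comp_wordFold V _).trans (wordAct_nil adj _ _)

theorem wordFoldEl_cons {S : E} (v : S ⟶ V.obj) (l : S ⟶ Word adj V.obj) :
    wordFoldEl V (wordCons adj v l) = (⟨v⟩ : V.El S) ⊗ wordFoldEl V l := by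
  apply ICat.El.ext
  refine (comp_wordFold V _).trans ?_
  rw [wordCons, wordAct_mul, wordAct_sing, ← comp_wordFold, comp_lift_assoc, lift_fst, lift_snd]
  rfl

theorem wordCons_mul {S : E} (v : S ⟶ V.obj) (l m : S ⟶ Word adj V.obj) :
    wordMul adj (wordCons adj v l) m = wordCons adj v (wordMul adj l m) := wordMul_assoc adj _ _ _

theorem comp_wordFoldEl {S S' : E} (x : S' ⟶ S) (l : S ⟶ Word adj V.obj) :
    x ≫ (wordFoldEl V l).pt = (wordFoldEl V (x ≫ l)).pt := (Category.assoc _ _ _).symm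

theorem comp_tensor_pt {S S' : E} (x : S' ⟶ S) {a b : V.El S} {a' b' : V.El S'}
    (ha : x ≫ a.pt = a'.pt) (hb : x ≫ b.pt = b'.pt) : x ≫ (a ⊗ b).pt = (a' ⊗ b').pt := by
  change x ≫ lift a.pt b.pt ≫ V.tensorObj = lift a'.pt b'.pt ≫ V.tensorObj
  rw [comp_lift_assoc, ha, hb]

variable (adj) in
/-- The isomorphisms `fold l ⊗ fold m ≅ fold (l m)` for the right-bracketed iterated tensor product,
natural in the stage and determined by recursion on `l`. -/
structure FoldMul where
  iso : ∀ {S : E} (l m : S ⟶ Word adj V.obj),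
    wordFoldEl V l ⊗ wordFoldEl V m ≅ wordFoldEl V (wordMul adj l m)
  comp_iso : ∀ {S S' : E} (x : S' ⟶ S) (l m : S ⟶ Word adj V.obj),
    x ≫ (iso l m).hom.arr = (iso (x ≫ l) (x ≫ m)).hom.arr
  nil : ∀ {S : E} (m : S ⟶ Word adj V.obj),
    (iso (toUnit S ≫ wordNil adj V.obj) m).hom.arr = (λ_ (wordFoldEl V m)).hom.arr
  cons : ∀ {S : E} (v : S ⟶ V.obj) (l m : S ⟶ Word adj V.obj),
    (iso (wordCons adj v l) m).hom.arr =
      ((α_ (⟨v⟩ : V.El S) (wordFoldEl V l) (wordFoldEl V m)).hom ≫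
        (𝟙 (⟨v⟩ : V.El S) ⊗ₘ (iso l m).hom)).arr

theorem comp_foldTensor {S S' : E} (x : S' ⟶ S) (l m : S ⟶ Word adj V.obj) :
    x ≫ (wordFoldEl V l ⊗ wordFoldEl V m).pt =
      (wordFoldEl V (x ≫ l) ⊗ wordFoldEl V (x ≫ m)).pt :=
  comp_tensor_pt V x (comp_wordFoldEl V x l) (comp_wordFoldEl V x m)

theorem comp_wordFoldEl_mul {S S' : E} (x : S' ⟶ S) (l m : S ⟶ Word adj V.obj) :
    x ≫ (wordFoldEl V (wordMul adj l m)).pt =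
      (wordFoldEl V (wordMul adj (x ≫ l) (x ≫ m))).pt := by
  rw [comp_wordFoldEl, comp_wordMul]

theorem unit_tensor_wordFoldEl {S : E} (m : S ⟶ Word adj V.obj) : 𝟙_ (V.El S) ⊗ wordFoldEl V m =
    wordFoldEl V (toUnit S ≫ wordNil adj V.obj) ⊗ wordFoldEl V m := by rw [wordFoldEl_nil]

theorem wordFoldEl_nil_mul {S : E} (m : S ⟶ Word adj V.obj) : wordFoldEl V m =
    wordFoldEl V (wordMul adj (toUnit S ≫ wordNil adj V.obj) m) := by rw [nil_wordMul]

theorem wordFoldEl_cons_tensor {S : E} (v : S ⟶ V.obj) (l m : S ⟶ Word adj V.obj) :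
    ((⟨v⟩ : V.El S) ⊗ wordFoldEl V l) ⊗ wordFoldEl V m =
      wordFoldEl V (wordCons adj v l) ⊗ wordFoldEl V m := by rw [wordFoldEl_cons]

theorem wordFoldEl_cons_mul {S : E} (v : S ⟶ V.obj) (l m : S ⟶ Word adj V.obj) :
    (⟨v⟩ : V.El S) ⊗ wordFoldEl V (wordMul adj l m) =
      wordFoldEl V (wordMul adj (wordCons adj v l) m) := by
  rw [wordCons_mul, wordFoldEl_cons]

theorem comp_foldMul_step {S S' : E} (x : S' ⟶ S) (v : S ⟶ V.obj) (l m : S ⟶ Word adj V.obj)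
    (f : wordFoldEl V l ⊗ wordFoldEl V m ⟶ wordFoldEl V (wordMul adj l m))
    (f' : wordFoldEl V (x ≫ l) ⊗ wordFoldEl V (x ≫ m) ⟶
      wordFoldEl V (wordMul adj (x ≫ l) (x ≫ m))) (h : x ≫ f.arr = f'.arr) :
    x ≫ ((α_ (⟨v⟩ : V.El S) (wordFoldEl V l) (wordFoldEl V m)).hom ≫ (𝟙 (⟨v⟩ : V.El S) ⊗ₘ f)).arr =
      ((α_ (⟨x ≫ v⟩ : V.El S') (wordFoldEl V (x ≫ l)) (wordFoldEl V (x ≫ m))).hom ≫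
        (𝟙 (⟨x ≫ v⟩ : V.El S') ⊗ₘ f')).arr :=
  comp_comp_arr x (comp_associator_hom V x rfl (comp_wordFoldEl V x l) (comp_wordFoldEl V x m))
    (comp_tensorHom_arr V x (comp_id_arr x rfl) h)

theorem comp_foldMul_step_inv {S S' : E} (x : S' ⟶ S) (v : S ⟶ V.obj)
    (l m : S ⟶ Word adj V.obj)
    (f : wordFoldEl V (wordMul adj l m) ⟶ wordFoldEl V l ⊗ wordFoldEl V m)
    (f' : wordFoldEl V (wordMul adj (x ≫ l) (x ≫ m)) ⟶
      wordFoldEl V (x ≫ l) ⊗ wordFoldEl V (x ≫ m)) (h : x ≫ f.arr = f'.arr) :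
    x ≫ ((𝟙 (⟨v⟩ : V.El S) ⊗ₘ f) ≫ (α_ (⟨v⟩ : V.El S) (wordFoldEl V l) (wordFoldEl V m)).inv).arr =
      ((𝟙 (⟨x ≫ v⟩ : V.El S') ⊗ₘ f') ≫
        (α_ (⟨x ≫ v⟩ : V.El S') (wordFoldEl V (x ≫ l)) (wordFoldEl V (x ≫ m))).inv).arr :=
  comp_comp_arr x (comp_tensorHom_arr V x (comp_id_arr x rfl) h)
    (comp_associator_inv V x rfl (comp_wordFoldEl V x l) (comp_wordFoldEl V x m))

/-- The isomorphisms of `FoldMul`, without their inverses. -/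
theorem exists_foldMul_hom : ∃ F : ∀ {S : E} (l m : S ⟶ Word adj V.obj),
      wordFoldEl V l ⊗ wordFoldEl V m ⟶ wordFoldEl V (wordMul adj l m),
    (∀ {S S' : E} (x : S' ⟶ S) (l m : S ⟶ Word adj V.obj),
      x ≫ (F l m).arr = (F (x ≫ l) (x ≫ m)).arr) ∧
    (∀ {S : E} (m : S ⟶ Word adj V.obj),
      (F (toUnit S ≫ wordNil adj V.obj) m).arr = (λ_ (wordFoldEl V m)).hom.arr) ∧
    ∀ {S : E} (v : S ⟶ V.obj) (l m : S ⟶ Word adj V.obj), (F (wordCons adj v l) m).arr =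
      ((α_ (⟨v⟩ : V.El S) (wordFoldEl V l) (wordFoldEl V m)).hom ≫
        (𝟙 (⟨v⟩ : V.El S) ⊗ₘ F l m)).arr := by
  obtain ⟨F, hF, F₀, F₁⟩ := exists_arrow_family (C := V.toICat) (adj := adj)
    (fun l m => wordFoldEl V l ⊗ wordFoldEl V m) (fun l m => wordFoldEl V (wordMul adj l m))
    (comp_foldTensor V) (comp_wordFoldEl_mul V)
    (fun m => ICat.castHom (λ_ (wordFoldEl V m)).hom (unit_tensor_wordFoldEl V m)
      (wordFoldEl_nil_mul V m))
    (fun x m => by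
      change x ≫ (λ_ (wordFoldEl V m)).hom.arr = (λ_ (wordFoldEl V (x ≫ m))).hom.arr
      rw [leftUnitor_hom_arr, leftUnitor_hom_arr, ← Category.assoc, comp_wordFoldEl])
    (fun {S} v l m f => ICat.castHom ((α_ (⟨v⟩ : V.El S) (wordFoldEl V l) (wordFoldEl V m)).hom ≫
        (𝟙 (⟨v⟩ : V.El S) ⊗ₘ f))
      (wordFoldEl_cons_tensor V v l m) (wordFoldEl_cons_mul V v l m))
    (comp_foldMul_step V)
  exact ⟨F, hF, fun m => congrArg ICat.ElHom.arr (F₀ m),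
    fun v l m => congrArg ICat.ElHom.arr (F₁ v l m)⟩

/-- The inverses of the isomorphisms of `FoldMul`. -/
theorem exists_foldMul_inv : ∃ G : ∀ {S : E} (l m : S ⟶ Word adj V.obj),
      wordFoldEl V (wordMul adj l m) ⟶ wordFoldEl V l ⊗ wordFoldEl V m,
    (∀ {S S' : E} (x : S' ⟶ S) (l m : S ⟶ Word adj V.obj),
      x ≫ (G l m).arr = (G (x ≫ l) (x ≫ m)).arr) ∧
    (∀ {S : E} (m : S ⟶ Word adj V.obj),
      (G (toUnit S ≫ wordNil adj V.obj) m).arr = (λ_ (wordFoldEl V m)).inv.arr) ∧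
    ∀ {S : E} (v : S ⟶ V.obj) (l m : S ⟶ Word adj V.obj), (G (wordCons adj v l) m).arr =
      ((𝟙 (⟨v⟩ : V.El S) ⊗ₘ G l m) ≫
        (α_ (⟨v⟩ : V.El S) (wordFoldEl V l) (wordFoldEl V m)).inv).arr := by
  obtain ⟨G, hG, G₀, G₁⟩ := exists_arrow_family (C := V.toICat) (adj := adj)
    (fun l m => wordFoldEl V (wordMul adj l m)) (fun l m => wordFoldEl V l ⊗ wordFoldEl V m)
    (comp_wordFoldEl_mul V) (comp_foldTensor V)
    (fun m => ICat.castHom (λ_ (wordFoldEl V m)).inv (wordFoldEl_nil_mul V m)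
      (unit_tensor_wordFoldEl V m))
    (fun x m => by
      change x ≫ (λ_ (wordFoldEl V m)).inv.arr = (λ_ (wordFoldEl V (x ≫ m))).inv.arr
      rw [leftUnitor_inv_arr, leftUnitor_inv_arr, ← Category.assoc, comp_wordFoldEl])
    (fun {S} v l m g => ICat.castHom ((𝟙 (⟨v⟩ : V.El S) ⊗ₘ g) ≫
        (α_ (⟨v⟩ : V.El S) (wordFoldEl V l) (wordFoldEl V m)).inv)
      (wordFoldEl_cons_mul V v l m) (wordFoldEl_cons_tensor V v l m))
    (comp_foldMul_step_inv V)
  exact ⟨G, hG, fun m => congrArg ICat.ElHom.arr (G₀ m),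
    fun v l m => congrArg ICat.ElHom.arr (G₁ v l m)⟩

theorem nonempty_foldMul : Nonempty (FoldMul adj V) := by
  obtain ⟨F, hF, F₀, F₁⟩ := exists_foldMul_hom (adj := adj) V
  obtain ⟨G, hG, G₀, G₁⟩ := exists_foldMul_inv (adj := adj) V
  -- The two families are inverse to each other, by induction on `l`.
  have FG {S : E} (l m : S ⟶ Word adj V.obj) : F l m ≫ G l m = 𝟙 _ := by
    refine ICat.el_ext (wordCons_induction (p := fun l m => (F l m ≫ G l m).arr)
      (q := fun l m => ICat.ElHom.arr (𝟙 (wordFoldEl V l ⊗ wordFoldEl V m)))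
      (fun x l m => comp_comp_arr x (hF x l m) (hG x l m))
      (fun x l m => comp_id_arr x (comp_foldTensor V x l m))
      (fun m => ?_) (fun v l m h => ?_) l m)
    · exact (ICat.comp_arr_congr (F₀ m) (G₀ m)).trans
        ((congrArg ICat.ElHom.arr (λ_ (wordFoldEl V m)).hom_inv_id).trans
          (congrArg (fun a => ICat.ElHom.arr (𝟙 a)) (unit_tensor_wordFoldEl V m)))
    · exact (ICat.comp_arr_congr (F₁ v l m) (G₁ v l m)).trans
        ((congrArg ICat.ElHom.arr (associator_conj_id (ICat.el_ext h))).trans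
          (congrArg (fun a => ICat.ElHom.arr (𝟙 a)) (wordFoldEl_cons_tensor V v l m)))
  have GF {S : E} (l m : S ⟶ Word adj V.obj) : G l m ≫ F l m = 𝟙 _ := by
    refine ICat.el_ext (wordCons_induction (p := fun l m => (G l m ≫ F l m).arr)
      (q := fun l m => ICat.ElHom.arr (𝟙 (wordFoldEl V (wordMul adj l m))))
      (fun x l m => comp_comp_arr x (hG x l m) (hF x l m))
      (fun x l m => comp_id_arr x (comp_wordFoldEl_mul V x l m))
      (fun m => ?_) (fun v l m h => ?_) l m)
    · exact (ICat.comp_arr_congr (G₀ m) (F₀ m)).trans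
        ((congrArg ICat.ElHom.arr (λ_ (wordFoldEl V m)).inv_hom_id).trans
          (congrArg (fun a => ICat.ElHom.arr (𝟙 a)) (wordFoldEl_nil_mul V m)))
    · exact (ICat.comp_arr_congr (G₁ v l m) (F₁ v l m)).trans
        ((congrArg ICat.ElHom.arr (conj_associator_id (ICat.el_ext h))).trans
          (congrArg (fun a => ICat.ElHom.arr (𝟙 a)) (wordFoldEl_cons_mul V v l m)))
  exact ⟨{
    iso := fun l m => ⟨F l m, G l m, FG l m, GF l m⟩
    comp_iso := hF
    nil := F₀
    cons := F₁ }⟩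

end WordFold

end IntEnr

namespace IntEnr

/-! ### Coherence of the right-bracketed iterated tensor product -/

section IteratedTensorOfFold

variable {E : Type u} [Category.{v} E] [HasPullbacks E] [CartesianMonoidalCategory E]
  [MonoidalClosed E] {fc : IGraph E ⥤ ICat E} {adj : fc ⊣ ICat.forgetGraph E} {V : IMonCat E}

theorem comp_rightUnitor_hom {S S' : E} (x : S' ⟶ S) {a : V.El S} {a' : V.El S'}
    (h : x ≫ a.pt = a'.pt) : x ≫ (ρ_ a).hom.arr = (ρ_ a').hom.arr := by
  rw [rightUnitor_hom_arr, rightUnitor_hom_arr, ← h, Category.assoc]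

theorem idArr_tensor_comp {S : E} {a b c d : V.El S} {f : a ⟶ b} (g : b ⊗ c ⟶ d)
    (hf : f.arr = b.pt ≫ V.ident) : ((f ⊗ₘ 𝟙 c) ≫ g).arr = g.arr :=
  (ICat.comp_arr_congr (f' := 𝟙 b ⊗ₘ 𝟙 c) (g' := g) (V.tensorHom_arr_congr hf rfl) rfl).trans
    (congrArg ICat.ElHom.arr (by rw [MonoidalCategory.id_tensorHom_id, Category.id_comp]))

theorem tensor_idArr_comp {S : E} {a b c d : V.El S} {f : a ⟶ b} (g : c ⊗ b ⟶ d)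
    (hf : f.arr = b.pt ≫ V.ident) : ((𝟙 c ⊗ₘ f) ≫ g).arr = g.arr :=
  (ICat.comp_arr_congr (f' := 𝟙 c ⊗ₘ 𝟙 b) (g' := g) (V.tensorHom_arr_congr rfl hf) rfl).trans
    (congrArg ICat.ElHom.arr (by rw [MonoidalCategory.id_tensorHom_id, Category.id_comp]))

theorem wordFoldEl_sing {S : E} (v : S ⟶ V.obj) :
    wordFoldEl V (v ≫ wordSing adj V.obj) = (⟨v⟩ : V.El S) ⊗ 𝟙_ (V.El S) := by
  rw [← wordFoldEl_nil (adj := adj), ← wordFoldEl_cons, wordCons, wordMul_nil]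

theorem leftUnitor_arr_congr {S : E} {a b : V.El S} (h : a = b) :
    (λ_ a).hom.arr = (λ_ b).hom.arr := by rw [h]

theorem rightUnitor_arr_congr {S : E} {a b : V.El S} (h : a = b) :
    (ρ_ a).hom.arr = (ρ_ b).hom.arr := by rw [h]

theorem associator_arr_congr {S : E} {a b c a' b' c' : V.El S} (ha : a = a') (hb : b = b')
    (hc : c = c') : (α_ a b c).hom.arr = (α_ a' b' c').hom.arr := by rw [ha, hb, hc]

theorem id_arr_congr {S : E} {a b : V.El S} (h : a = b) :
    ICat.ElHom.arr (𝟙 a) = ICat.ElHom.arr (𝟙 b) := by rw [h]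

namespace FoldMul

variable (M : FoldMul adj V)

theorem iso_arr_congr {S : E} {l l' m m' : S ⟶ Word adj V.obj} (hl : l = l') (hm : m = m') :
    (M.iso l m).hom.arr = (M.iso l' m').hom.arr := by rw [hl, hm]

theorem comp_iso_of {S S' : E} (x : S' ⟶ S) {l m : S ⟶ Word adj V.obj}
    {l' m' : S' ⟶ Word adj V.obj} (hl : x ≫ l = l') (hm : x ≫ m = m') :
    x ≫ (M.iso l m).hom.arr = (M.iso l' m').hom.arr :=
  (M.comp_iso x l m).trans (M.iso_arr_congr hl hm)

/-- The unit law on the right, by induction on the word. -/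
theorem mul_nil {S : E} (l : S ⟶ Word adj V.obj) :
    (M.iso l (toUnit S ≫ wordNil adj V.obj)).hom.arr = (ρ_ (wordFoldEl V l)).hom.arr := by
  refine wordCons_induction (Y := 𝟙_ E)
    (p := fun {S} l _ => (M.iso l (toUnit S ≫ wordNil adj V.obj)).hom.arr)
    (q := fun l _ => (ρ_ (wordFoldEl V l)).hom.arr)
    (fun x l _ => M.comp_iso_of x rfl (comp_nil _ x))
    (fun x l _ => comp_rightUnitor_hom x (comp_wordFoldEl V x l)) (fun {S} _ => ?_)
    (fun {S} v l _ h => ?_) l (toUnit S)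
  · have e : (λ_ (𝟙_ (V.El S))).hom.arr = (ρ_ (𝟙_ (V.El S))).hom.arr := by
      rw [MonoidalCategory.unitors_equal]
    exact (M.nil _).trans ((leftUnitor_arr_congr (wordFoldEl_nil V S)).trans
      (e.trans (rightUnitor_arr_congr (wordFoldEl_nil V S).symm)))
  · -- `rightUnitor_step` needs an arrow out of `I` itself, and `fold ()` is only propositionally
    -- equal to `I`.
    let s : 𝟙_ (V.El S) ⟶ wordFoldEl V (toUnit S ≫ wordNil adj V.obj) :=
      eqToHom (wordFoldEl_nil V S).symm
    have hs : s.arr = (wordFoldEl V (toUnit S ≫ wordNil adj V.obj)).pt ≫ V.ident :=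
      ICat.eqToHom_arr _
    let f : wordFoldEl V l ⊗ wordFoldEl V (toUnit S ≫ wordNil adj V.obj) ⟶ wordFoldEl V l :=
      ICat.castHom (M.iso l (toUnit S ≫ wordNil adj V.obj)).hom rfl (by rw [wordMul_nil])
    have hf : (𝟙 (wordFoldEl V l) ⊗ₘ s) ≫ f = (ρ_ (wordFoldEl V l)).hom :=
      ICat.el_ext ((tensor_idArr_comp f hs).trans h)
    have h' := congrArg ICat.ElHom.arr (rightUnitor_step (v := (⟨v⟩ : V.El S)) hf)
    have e : (M.iso l (toUnit S ≫ wordNil adj V.obj)).hom.arr = f.arr := rfl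
    exact (M.cons v l _).trans ((ICat.comp_arr_congr rfl (V.tensorHom_arr_congr rfl e)).trans
      ((tensor_idArr_comp _ hs).symm.trans (h'.trans
        (rightUnitor_arr_congr (wordFoldEl_cons V v l).symm))))

theorem mul_assoc_nil {S : E} (m n : S ⟶ Word adj V.obj) :
    (((M.iso (toUnit S ≫ wordNil adj V.obj) m).hom ⊗ₘ 𝟙 (wordFoldEl V n)) ≫
        (M.iso (wordMul adj (toUnit S ≫ wordNil adj V.obj) m) n).hom).arr =
      ((α_ (wordFoldEl V (toUnit S ≫ wordNil adj V.obj)) (wordFoldEl V m) (wordFoldEl V n)).hom ≫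
        (𝟙 (wordFoldEl V (toUnit S ≫ wordNil adj V.obj)) ⊗ₘ (M.iso m n).hom) ≫
          (M.iso (toUnit S ≫ wordNil adj V.obj) (wordMul adj m n)).hom).arr := by
  have h := congrArg ICat.ElHom.arr (leftUnitor_tensorHom_comp (M.iso m n).hom)
  refine (ICat.comp_arr_congr (V.tensorHom_arr_congr (M.nil m) rfl)
    (M.iso_arr_congr (nil_wordMul adj m) rfl)).trans (h.trans ?_)
  exact ICat.comp_arr_congr (associator_arr_congr (wordFoldEl_nil V S).symm rfl rfl)
    (ICat.comp_arr_congr (V.tensorHom_arr_congr (id_arr_congr (wordFoldEl_nil V S).symm) rfl)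
      (M.nil _).symm)

theorem mul_assoc_cons {S : E} (v : S ⟶ V.obj) (l m n : S ⟶ Word adj V.obj)
    (h : (((M.iso l m).hom ⊗ₘ 𝟙 (wordFoldEl V n)) ≫ (M.iso (wordMul adj l m) n).hom).arr =
      ((α_ (wordFoldEl V l) (wordFoldEl V m) (wordFoldEl V n)).hom ≫
        (𝟙 (wordFoldEl V l) ⊗ₘ (M.iso m n).hom) ≫ (M.iso l (wordMul adj m n)).hom).arr) :
    (((M.iso (wordCons adj v l) m).hom ⊗ₘ 𝟙 (wordFoldEl V n)) ≫
        (M.iso (wordMul adj (wordCons adj v l) m) n).hom).arr =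
      ((α_ (wordFoldEl V (wordCons adj v l)) (wordFoldEl V m) (wordFoldEl V n)).hom ≫
        (𝟙 (wordFoldEl V (wordCons adj v l)) ⊗ₘ (M.iso m n).hom) ≫
          (M.iso (wordCons adj v l) (wordMul adj m n)).hom).arr := by
  let j : wordFoldEl V l ⊗ wordFoldEl V (wordMul adj m n) ⟶
      wordFoldEl V (wordMul adj (wordMul adj l m) n) :=
    ICat.castHom (M.iso l (wordMul adj m n)).hom rfl (by rw [wordMul_assoc])
  have hj : (M.iso l (wordMul adj m n)).hom.arr = j.arr := rfl
  have e : ((M.iso l m).hom ⊗ₘ 𝟙 (wordFoldEl V n)) ≫ (M.iso (wordMul adj l m) n).hom =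
      (α_ (wordFoldEl V l) (wordFoldEl V m) (wordFoldEl V n)).hom ≫
        (𝟙 (wordFoldEl V l) ⊗ₘ (M.iso m n).hom) ≫ j :=
    ICat.el_ext (h.trans (ICat.comp_arr_congr rfl (ICat.comp_arr_congr rfl hj)))
  have h' := congrArg ICat.ElHom.arr (associator_step (v := (⟨v⟩ : V.El S)) e)
  refine (ICat.comp_arr_congr (V.tensorHom_arr_congr (M.cons v l m) rfl)
    ((M.iso_arr_congr (wordCons_mul V v l m) rfl).trans (M.cons v _ n))).trans (h'.trans ?_)
  exact ICat.comp_arr_congr (associator_arr_congr (wordFoldEl_cons V v l).symm rfl rfl)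
    (ICat.comp_arr_congr (V.tensorHom_arr_congr (id_arr_congr (wordFoldEl_cons V v l).symm) rfl)
      ((ICat.comp_arr_congr rfl (V.tensorHom_arr_congr rfl hj.symm)).trans
        (M.cons v l _).symm))

theorem mul_assoc {S : E} (l m n : S ⟶ Word adj V.obj) :
    (((M.iso l m).hom ⊗ₘ 𝟙 (wordFoldEl V n)) ≫ (M.iso (wordMul adj l m) n).hom).arr =
      ((α_ (wordFoldEl V l) (wordFoldEl V m) (wordFoldEl V n)).hom ≫
        (𝟙 (wordFoldEl V l) ⊗ₘ (M.iso m n).hom) ≫ (M.iso l (wordMul adj m n)).hom).arr := by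
  have h := wordCons_induction (Y := Word adj V.obj ⊗ Word adj V.obj)
    (p := fun l y => (((M.iso l (y ≫ fst _ _)).hom ⊗ₘ 𝟙 (wordFoldEl V (y ≫ snd _ _))) ≫
      (M.iso (wordMul adj l (y ≫ fst _ _)) (y ≫ snd _ _)).hom).arr)
    (q := fun l y => ((α_ (wordFoldEl V l) (wordFoldEl V (y ≫ fst _ _))
      (wordFoldEl V (y ≫ snd _ _))).hom ≫ (𝟙 (wordFoldEl V l) ⊗ₘ (M.iso _ _).hom) ≫
        (M.iso l (wordMul adj (y ≫ fst _ _) (y ≫ snd _ _))).hom).arr)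
    (fun x l y => comp_comp_arr x (comp_tensorHom_arr V x
        (M.comp_iso_of x rfl (Category.assoc _ _ _).symm)
        (comp_id_arr x (by rw [comp_wordFoldEl, Category.assoc])))
      (M.comp_iso_of x (by rw [comp_wordMul, Category.assoc]) (Category.assoc _ _ _).symm))
    (fun x l y => comp_comp_arr x (comp_associator_hom V x (comp_wordFoldEl V x l)
        (by rw [comp_wordFoldEl, Category.assoc]) (by rw [comp_wordFoldEl, Category.assoc]))
      (comp_comp_arr x (comp_tensorHom_arr V x (comp_id_arr x (comp_wordFoldEl V x l))
          (M.comp_iso_of x (Category.assoc _ _ _).symm (Category.assoc _ _ _).symm))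
        (M.comp_iso_of x rfl (by rw [comp_wordMul, Category.assoc, Category.assoc]))))
    (fun y => M.mul_assoc_nil _ _) (fun v l y h => M.mul_assoc_cons v l _ _ h) l (lift m n)
  have e₁ := lift_fst m n
  have e₂ := lift_snd m n
  generalize lift m n ≫ fst _ _ = m' at e₁ h
  generalize lift m n ≫ snd _ _ = n' at e₂ h
  subst e₁ e₂
  exact h

end FoldMul

variable (adj V) in
theorem unit_eq_wordNil_fold :
    𝟙_ (V.El (𝟙_ E)) = (⟨wordNil adj V.obj ≫ wordFold adj V⟩ : V.El (𝟙_ E)) :=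
  (wordFoldEl_nil (adj := adj) V (𝟙_ E)).symm.trans (by
    rw [wordFoldEl, toUnit_unit, Category.id_comp])

/-- The data of the right-bracketed iterated tensor product. As `fold (v)` is `v ⊗ I`, its
isomorphism with `v` is the right unitor. -/
noncomputable def iteratedTensorData (M : FoldMul adj V) : IteratedTensorData adj V where
  fold := wordFold adj V
  mulIso := M.iso (fst _ _) (snd _ _)
  nilIso := eqToIso (unit_eq_wordNil_fold adj V)
  singIso := eqToIso ((show _ = wordFoldEl V (𝟙 _ ≫ wordSing adj V.obj) by
    rw [wordFoldEl, Category.id_comp]).trans (wordFoldEl_sing (𝟙 V.obj))) ≪≫ ρ_ _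

theorem mulEl_iteratedTensorData (M : FoldMul adj V) {S : E} (l m : S ⟶ Word adj V.obj) :
    ((iteratedTensorData M).mulEl l m).hom.arr = (M.iso l m).hom.arr :=
  (IteratedTensorData.mulEl_hom_arr _ l m).trans
    (M.comp_iso_of (lift l m) (lift_fst _ _) (lift_snd _ _))

theorem nilEl_iteratedTensorData (M : FoldMul adj V) (S : E) :
    ((iteratedTensorData M).nilEl S).hom.arr =
      ((iteratedTensorData M).foldEl (toUnit S ≫ wordNil adj V.obj)).pt ≫ V.ident := by
  refine (ICat.castIso_hom_arr _ _ _).trans ?_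
  have h : (iteratedTensorData M).nilIso.hom.arr =
      (wordNil adj V.obj ≫ wordFold adj V) ≫ V.ident :=
    ICat.eqToHom_arr (unit_eq_wordNil_fold adj V)
  refine (congrArg (toUnit S ≫ ·) h).trans ?_
  change _ = ((toUnit S ≫ wordNil adj V.obj) ≫ wordFold adj V) ≫ V.ident
  simp only [Category.assoc]

theorem nonempty_iteratedTensor : Nonempty (IteratedTensor adj V) := by
  obtain ⟨M⟩ := nonempty_foldMul (adj := adj) V
  refine ⟨{ toIteratedTensorData := iteratedTensorData M, mul_assoc := fun l m n => ?_,
            nil_mul := fun {S} l => ?_, mul_nil := fun {S} l => ?_ }⟩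
  · exact (ICat.comp_arr_congr (V.tensorHom_arr_congr (mulEl_iteratedTensorData M l m) rfl)
      (mulEl_iteratedTensorData M _ n)).trans ((M.mul_assoc l m n).trans
        (ICat.comp_arr_congr rfl (ICat.comp_arr_congr
          (V.tensorHom_arr_congr rfl (mulEl_iteratedTensorData M m n))
          (mulEl_iteratedTensorData M l _))).symm)
  · exact (idArr_tensor_comp _ (nilEl_iteratedTensorData M S)).trans
      ((mulEl_iteratedTensorData M _ l).trans (M.nil l))
  · exact (tensor_idArr_comp _ (nilEl_iteratedTensorData M S)).trans
      ((mulEl_iteratedTensorData M l _).trans (M.mul_nil l))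

end IteratedTensorOfFold
end IntEnr

namespace IntEnr

/-! ### Functors out of free internal categories -/

section

variable {E : Type u} [Category.{v} E] [HasPullbacks E] [CartesianMonoidalCategory E]
  {fc : IGraph E ⥤ ICat E} (adj : fc ⊣ ICat.forgetGraph E)

/-- A morphism to a graph with one vertex is determined by its values on edges. -/
theorem bouquet_hom_ext {A : E} {G : IGraph E} {f g : G ⟶ bouquet A} (h : f.edge = g.edge) :
    f = g := IGraph.hom_ext (toUnit_unique _ _) h

theorem freeBouquet_hom_ext {A : E} {G : IGraph E} {f g : G ⟶ adj.toMonad.obj (bouquet A)}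
    (h : f.edge = g.edge) : f = g := IGraph.hom_ext (bouquet_obj_unique adj _ _ _) h

theorem unitEdge_counit (C : ICat E) :
    unitEdge adj ((ICat.forgetGraph E).obj C) ≫ (adj.counit.app C).mor = 𝟙 _ :=
  congrArg IGraph.Hom.edge (adj.right_triangle_components C)

theorem unitVert_counit (C : ICat E) :
    unitVert adj ((ICat.forgetGraph E).obj C) ≫ (adj.counit.app C).obj = 𝟙 _ :=
  congrArg IGraph.Hom.vert (adj.right_triangle_components C)

/-- The functor from a free internal category that corresponds to a morphism of graphs. -/
noncomputable def freeLift {G : IGraph E} {C : ICat E} (w : G ⟶ (ICat.forgetGraph E).obj C) :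
    fc.obj G ⟶ C := fc.map w ≫ adj.counit.app C

theorem unitEdge_freeLift {G : IGraph E} {C : ICat E} (w : G ⟶ (ICat.forgetGraph E).obj C)
    {e : G.edge ⟶ C.mor} (he : w.edge = e) : unitEdge adj G ≫ (freeLift adj w).mor = e := by
  have h := (adj.homEquiv _ _).apply_symm_apply w
  rw [adj.homEquiv_unit, adj.homEquiv_counit] at h
  exact (congrArg IGraph.Hom.edge h).trans he

theorem unitVert_freeLift {G : IGraph E} {C : ICat E} (w : G ⟶ (ICat.forgetGraph E).obj C)
    {e : G.vert ⟶ C.obj} (he : w.vert = e) : unitVert adj G ≫ (freeLift adj w).obj = e := by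
  have h := (adj.homEquiv _ _).apply_symm_apply w
  rw [adj.homEquiv_unit, adj.homEquiv_counit] at h
  exact (congrArg IGraph.Hom.vert h).trans he

theorem unitEdge_map_bouquet {G : IGraph E} {A : E} (f : G ⟶ bouquet A) {e : G.edge ⟶ A}
    (he : f.edge = e) : unitEdge adj G ≫ (fc.map f).mor = e ≫ wordSing adj A :=
  (unitEdge_naturality adj f).trans (congrArg (· ≫ wordSing adj A) he)

end

namespace IteratedTensor

variable {E : Type u} [Category.{v} E] [HasPullbacks E] [CartesianMonoidalCategory E]
  {fc : IGraph E ⥤ ICat E} {adj : fc ⊣ ICat.forgetGraph E} {V : IMonCat E}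
  (τ : IteratedTensor adj V)

/-- The arrow of a generalized triple, between prescribed words. -/
noncomputable def triHomOf {S : E} (w : S ⟶ τ.Tri) {l m : S ⟶ Word adj V.obj}
    (hl : w ≫ τ.triDom = l) (hm : w ≫ τ.triCod = m) : τ.foldEl l ⟶ τ.foldEl m :=
  (⟨w ≫ τ.triArr, by rw [Category.assoc, triArr_src, ← Category.assoc, hl]; rfl,
    by rw [Category.assoc, triArr_tgt, ← Category.assoc, hm]; rfl⟩ : V.ElHom _ _)

/-! ### Vertical composition of triples -/

/-- The vertical composite `(l, n, g ∘ f)` of triples `(l, m, f)` and `(m, n, g)`. -/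
noncomputable def triVert {S : E} (w w' : S ⟶ τ.Tri) (h : w ≫ τ.triCod = w' ≫ τ.triDom) :
    S ⟶ τ.Tri :=
  τ.triMk (w ≫ τ.triDom) (w' ≫ τ.triCod) (τ.triHomOf w rfl h ≫ τ.triHomOf w' rfl rfl)

theorem triVert_dom {S : E} (w w' : S ⟶ τ.Tri) (h : w ≫ τ.triCod = w' ≫ τ.triDom) :
    τ.triVert w w' h ≫ τ.triDom = w ≫ τ.triDom := τ.triMk_dom _ _ _

theorem triVert_cod {S : E} (w w' : S ⟶ τ.Tri) (h : w ≫ τ.triCod = w' ≫ τ.triDom) :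
    τ.triVert w w' h ≫ τ.triCod = w' ≫ τ.triCod := τ.triMk_cod _ _ _

theorem triVert_arr {S : E} (w w' : S ⟶ τ.Tri) (h : w ≫ τ.triCod = w' ≫ τ.triDom) :
    τ.triVert w w' h ≫ τ.triArr =
      (τ.triHomOf w rfl h ≫ τ.triHomOf w' rfl rfl).arr := τ.triMk_arr _ _ _

theorem triVert_arr_of {S : E} (w w' : S ⟶ τ.Tri) (h : w ≫ τ.triCod = w' ≫ τ.triDom)
    {a b c : V.El S} (f : a ⟶ b) (g : b ⟶ c)
    (hf : w ≫ τ.triArr = f.arr) (hg : w' ≫ τ.triArr = g.arr) :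
    τ.triVert w w' h ≫ τ.triArr = (f ≫ g).arr := by
  rw [triVert_arr]
  exact ICat.comp_arr_congr hf hg

theorem comp_triVert {S S' : E} (x : S' ⟶ S) (w w' : S ⟶ τ.Tri)
    (h : w ≫ τ.triCod = w' ≫ τ.triDom) :
    x ≫ τ.triVert w w' h = τ.triVert (x ≫ w) (x ≫ w') (by simp only [Category.assoc, h]) := by
  apply τ.tri_ext
  · simp only [Category.assoc, triVert_dom]
  · simp only [Category.assoc, triVert_cod]
  · rw [Category.assoc, triVert_arr, triVert_arr, res_comp_arr]
    exact ICat.comp_arr_congr (Category.assoc _ _ _).symm (Category.assoc _ _ _).symm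

/-- The comparison isomorphisms cancel between two consecutive products of arrows. -/
theorem conj_comp {W : Type*} [Category W] [MonoidalCategory W] {X Y Z a b c a' b' c' : W}
    (p : X ⟶ a ⊗ a') (q : b ⊗ b' ≅ Y) (r : c ⊗ c' ⟶ Z)
    (f : a ⟶ b) (f' : a' ⟶ b') (g : b ⟶ c) (g' : b' ⟶ c') :
    (p ≫ (f ⊗ₘ f') ≫ q.hom) ≫ q.inv ≫ (g ⊗ₘ g') ≫ r =
      p ≫ ((f ≫ g) ⊗ₘ (f' ≫ g')) ≫ r := by
  simp only [Category.assoc, Iso.hom_inv_id_assoc,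
    MonoidalCategory.tensorHom_comp_tensorHom_assoc]

/-- The interchange law. -/
theorem triVert_triMul {S : E} (w₁ w₂ w₁' w₂' : S ⟶ τ.Tri) (h₁ : w₁ ≫ τ.triCod = w₁' ≫ τ.triDom)
    (h₂ : w₂ ≫ τ.triCod = w₂' ≫ τ.triDom) :
    τ.triVert (τ.triMul w₁ w₂) (τ.triMul w₁' w₂')
        (by rw [triMul_cod, triMul_dom, h₁, h₂]) =
      τ.triMul (τ.triVert w₁ w₁' h₁) (τ.triVert w₂ w₂' h₂) := by
  apply τ.tri_ext
  · simp only [triVert_dom, triMul_dom]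
  · simp only [triVert_cod, triMul_cod]
  · rw [τ.triVert_arr_of _ _ _ _ _
      (τ.triMul_arr_of w₁ w₂ (τ.triHomOf w₁ rfl h₁) (τ.triHomOf w₂ rfl h₂) rfl h₁ rfl rfl h₂ rfl)
      (τ.triMul_arr_of w₁' w₂' (τ.triHomOf w₁' rfl rfl) (τ.triHomOf w₂' rfl rfl)
        rfl rfl rfl rfl rfl rfl),
      τ.triMul_arr_of _ _ (τ.triHomOf w₁ rfl h₁ ≫ τ.triHomOf w₁' rfl rfl)
        (τ.triHomOf w₂ rfl h₂ ≫ τ.triHomOf w₂' rfl rfl)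
        (τ.triVert_dom _ _ _) (τ.triVert_cod _ _ _) (τ.triVert_arr _ _ _)
        (τ.triVert_dom _ _ _) (τ.triVert_cod _ _ _) (τ.triVert_arr _ _ _)]
    exact congrArg ICat.ElHom.arr (conj_comp _ _ _ _ _ _ _)

theorem triVert_triOne (S : E) :
    τ.triVert (τ.triOne S) (τ.triOne S) (by rw [triOne_cod, triOne_dom]) = τ.triOne S := by
  apply τ.tri_ext
  · rw [triVert_dom]
  · rw [triVert_cod]
  · rw [τ.triVert_arr_of (τ.triOne S) (τ.triOne S) _ (𝟙 _) (𝟙 _) (τ.triOne_arr S) (τ.triOne_arr S),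
      Category.comp_id]
    exact (τ.triOne_arr S).symm

/-- The identity triple `(l, l, 1)` of a word. -/
noncomputable def triId {S : E} (l : S ⟶ Word adj V.obj) : S ⟶ τ.Tri := τ.triMk l l (𝟙 _)

theorem triId_arr {S : E} (l : S ⟶ Word adj V.obj) :
    τ.triId l ≫ τ.triArr = ICat.ElHom.arr (𝟙 (τ.foldEl l)) := τ.triMk_arr _ _ _

theorem triId_dom {S : E} (l : S ⟶ Word adj V.obj) : τ.triId l ≫ τ.triDom = l :=
  τ.triMk_dom _ _ _

theorem triId_cod {S : E} (l : S ⟶ Word adj V.obj) : τ.triId l ≫ τ.triCod = l :=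
  τ.triMk_cod _ _ _

theorem comp_triId {S S' : E} (x : S' ⟶ S) (l : S ⟶ Word adj V.obj) :
    x ≫ τ.triId l = τ.triId (x ≫ l) := by
  apply τ.tri_ext
  · rw [Category.assoc, triId_dom, triId_dom]
  · rw [Category.assoc, triId_cod, triId_cod]
  · rw [Category.assoc, triId_arr, triId_arr, ICat.el_id_arr, ICat.el_id_arr]
    simp [IteratedTensorData.foldEl]

theorem triId_wordMul {S : E} (l m : S ⟶ Word adj V.obj) :
    τ.triId (wordMul adj l m) = τ.triMul (τ.triId l) (τ.triId m) := by
  apply τ.tri_ext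
  · rw [triMul_dom, triId_dom, triId_dom, triId_dom]
  · rw [triMul_cod, triId_cod, triId_cod, triId_cod]
  · rw [triId_arr, τ.triMul_arr_of (τ.triId l) (τ.triId m) (𝟙 _) (𝟙 _) (τ.triId_dom l)
      (τ.triId_cod l) (τ.triId_arr l) (τ.triId_dom m) (τ.triId_cod m) (τ.triId_arr m)]
    simp

/-- The functor sending a word to its identity triple. -/
noncomputable def triIdFunctor : fc.obj (bouquet V.obj) ⟶ τ.triCat :=
  ({ obj := toUnit _
     mor := τ.triId (𝟙 _)
     src_comm := toUnit_unique _ _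
     tgt_comm := toUnit_unique _ _
     map_ident := by
       change _ ≫ τ.triId _ = _ ≫ τ.triOne _
       rw [comp_triId, comp_triOne, Category.comp_id]
       have e : (fc.obj (bouquet V.obj)).ident = toUnit _ ≫ wordNil adj V.obj := by
         rw [wordNil, ← Category.assoc, bouquet_obj_unique adj _ (toUnit _ ≫ _) (𝟙 _),
           Category.id_comp]
       rw [e]; rfl
     map_cmp := fun g f h => by
       rw [triCat_cmp, comp_triId, comp_triId, comp_triId, Category.comp_id, Category.comp_id,
         Category.comp_id, ← triId_wordMul]
       rfl } : IFunctor (fc.obj (bouquet V.obj)) τ.triCat)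

/-- The functor sending a triple to its domain word. -/
noncomputable def triDomFunctor : τ.triCat ⟶ fc.obj (bouquet V.obj) :=
  ({ obj := unitVert adj (bouquet V.obj)
     mor := τ.triDom
     src_comm := bouquet_obj_unique adj _ _ _
     tgt_comm := bouquet_obj_unique adj _ _ _
     map_ident := (τ.triMk_dom _ _ _).trans (by
       rw [toUnit_unit]; exact Category.id_comp _)
     map_cmp := fun g f h => by
       rw [triCat_cmp]
       exact τ.triMk_dom _ _ _ } : IFunctor τ.triCat (fc.obj (bouquet V.obj)))

theorem functor_ext_triCat {G : IGraph E} {F H : fc.obj G ⟶ τ.triCat}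
    (he : unitEdge adj G ≫ F.mor = unitEdge adj G ≫ H.mor) : F = H :=
  functor_ext_of_unit adj (toUnit_unique _ _) he

/-- The vertical composite of two functors into the category of triples, which is a functor by the
interchange law. -/
noncomputable def vertFunctor {C : ICat E} (F G : C ⟶ τ.triCat)
    (h : F.mor ≫ τ.triCod = G.mor ≫ τ.triDom) : C ⟶ τ.triCat :=
  ({ obj := toUnit _
     mor := τ.triVert F.mor G.mor h
     src_comm := toUnit_unique _ _
     tgt_comm := toUnit_unique _ _
     map_ident := by
       have key : ∀ H : C ⟶ τ.triCat, C.ident ≫ H.mor = τ.triOne _ := fun H =>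
         H.map_ident.trans (τ.comp_triOne _)
       rw [comp_triVert]
       change _ = _ ≫ τ.triOne _
       rw [comp_triOne]
       simp only [key, triVert_triOne]
     map_cmp := fun g f w => by
       have key : ∀ H : C ⟶ τ.triCat, C.cmp g f w ≫ H.mor = τ.triMul (g ≫ H.mor) (f ≫ H.mor) :=
         fun H => (H.map_cmp g f w).trans (τ.triCat_cmp _ _ _)
       rw [triCat_cmp, comp_triVert, comp_triVert, comp_triVert, ← triVert_triMul]
       simp only [key] } : IFunctor C τ.triCat)

/-! ### The multicategory of a monoidal category -/

theorem arrows_ext {S : E} {p q : S ⟶ τ.Arrows} (h₁ : p ≫ τ.arrowsWord = q ≫ τ.arrowsWord)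
    (h₂ : p ≫ τ.arrowsArr = q ≫ τ.arrowsArr) : p = q := pullback.hom_ext h₁ h₂

theorem arrowsMk_word {S : E} (l : S ⟶ Word adj V.obj) {a : V.El S} (f : τ.foldEl l ⟶ a) :
    τ.arrowsMk l f ≫ τ.arrowsWord = l := pullback.lift_fst _ _ _

theorem arrowsMk_arr {S : E} (l : S ⟶ Word adj V.obj) {a : V.El S} (f : τ.foldEl l ⟶ a) :
    τ.arrowsMk l f ≫ τ.arrowsArr = f.arr := pullback.lift_snd _ _ _

/-- The arrow of a generalized pair, with prescribed word and target. -/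
noncomputable def arrowsHomOf {S : E} (p : S ⟶ τ.Arrows) {l : S ⟶ Word adj V.obj} {a : V.El S}
    (hl : p ≫ τ.arrowsWord = l) (ha : p ≫ τ.arrowsArr ≫ V.tgt = a.pt) : τ.foldEl l ⟶ a :=
  (⟨p ≫ τ.arrowsArr, by rw [Category.assoc, arrowsArr_src, ← Category.assoc, hl]; rfl,
    by rw [Category.assoc, ha]⟩ : V.ElHom _ _)

theorem arrowsHomOf_arr {S : E} (p : S ⟶ τ.Arrows) {l : S ⟶ Word adj V.obj} {a : V.El S}
    (hl : p ≫ τ.arrowsWord = l) (ha : p ≫ τ.arrowsArr ≫ V.tgt = a.pt) :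
    (τ.arrowsHomOf p hl ha).arr = p ≫ τ.arrowsArr := rfl

/-- The triple of a pair `(l, f : fold l ⟶ v)`: the word `l`, the word `(v)` and `f`, up to the
isomorphism `fold (v) ≅ v`. -/
noncomputable def pairTri : τ.Arrows ⟶ τ.Tri := τ.arrowsTri.edge

/-- The triple of a list of pairs: the monoidal product of its arrows. -/
noncomputable def listTri : Word adj τ.Arrows ⟶ τ.Tri := τ.arrowsProd.mor

theorem wordSing_listTri : wordSing adj τ.Arrows ≫ τ.listTri = τ.pairTri := τ.unitEdge_arrowsProd

theorem listTri_cod : τ.listTri ≫ τ.triCod = (fc.map τ.multicatTgt).mor := τ.arrowsProd_cod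

theorem pairTri_dom : τ.pairTri ≫ τ.triDom = τ.arrowsWord :=
  (τ.triMk_dom _ _ _).trans (Category.id_comp _)

theorem pairTri_cod : τ.pairTri ≫ τ.triCod = τ.arrowsArr ≫ V.tgt ≫ wordSing adj V.obj := by
  refine (τ.triMk_cod _ _ _).trans ?_
  simp only [Category.id_comp, Category.assoc]

theorem comp_singEl_inv {S S' : E} (x : S' ⟶ S) (a : V.El S) :
    x ≫ (τ.singEl a).inv.arr = (τ.singEl (S := S') ⟨x ≫ a.pt⟩).inv.arr := by
  rw [τ.singEl_inv_arr, τ.singEl_inv_arr, Category.assoc]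

theorem singEl_hom_arr {S : E} (a : V.El S) :
    (τ.singEl a).hom.arr = a.pt ≫ τ.singIso.hom.arr := ICat.castIso_hom_arr _ _ _

theorem pairTri_arr {S : E} (p : S ⟶ τ.Arrows) {l : S ⟶ Word adj V.obj} {a : V.El S}
    (hl : p ≫ τ.arrowsWord = l) (ha : p ≫ τ.arrowsArr ≫ V.tgt = a.pt) :
    (p ≫ τ.pairTri) ≫ τ.triArr = (τ.arrowsHomOf p hl ha ≫ (τ.singEl a).inv).arr := by
  rw [Category.assoc]
  refine (congrArg (p ≫ ·) (τ.triMk_arr _ _ _)).trans ?_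
  rw [res_comp_arr]
  refine ICat.comp_arr_congr ?_ ?_
  · change p ≫ 𝟙 _ ≫ _ = p ≫ _
    rw [Category.id_comp]
  · refine (τ.comp_singEl_inv p _).trans ?_
    rw [τ.singEl_inv_arr, τ.singEl_inv_arr, ← ha]
    simp

theorem arrowsComp_word {S : E} (p : S ⟶ τ.Arrows) (w : S ⟶ Word adj τ.Arrows)
    (h : p ≫ τ.arrowsWord = w ≫ (fc.map τ.multicatTgt).mor) :
    τ.arrowsComp p w h ≫ τ.arrowsWord = (w ≫ τ.listTri) ≫ τ.triDom := pullback.lift_fst _ _ _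

theorem arrowsComp_aux' {S : E} (p : S ⟶ τ.Arrows) (w : S ⟶ Word adj τ.Arrows)
    (h : p ≫ τ.arrowsWord = w ≫ (fc.map τ.multicatTgt).mor) :
    (p ≫ τ.arrowsArr) ≫ V.src = ((w ≫ τ.listTri) ≫ τ.triArr) ≫ V.tgt := τ.arrowsComp_aux p w h

theorem arrowsComp_arr {S : E} (p : S ⟶ τ.Arrows) (w : S ⟶ Word adj τ.Arrows)
    (h : p ≫ τ.arrowsWord = w ≫ (fc.map τ.multicatTgt).mor) :
    τ.arrowsComp p w h ≫ τ.arrowsArr = V.cmp (p ≫ τ.arrowsArr) ((w ≫ τ.listTri) ≫ τ.triArr)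
      (τ.arrowsComp_aux' p w h) := pullback.lift_snd _ _ _

/-- The arrow of a composite, computed from freely chosen representatives. -/
theorem arrowsComp_arr_of {S : E} (p : S ⟶ τ.Arrows) (w : S ⟶ Word adj τ.Arrows)
    (h : p ≫ τ.arrowsWord = w ≫ (fc.map τ.multicatTgt).mor) {a b c : V.El S} (f : a ⟶ b)
    (g : b ⟶ c) (hf : (w ≫ τ.listTri) ≫ τ.triArr = f.arr) (hg : p ≫ τ.arrowsArr = g.arr) :
    τ.arrowsComp p w h ≫ τ.arrowsArr = (f ≫ g).arr := by
  rw [arrowsComp_arr]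
  exact V.cmp_congr _ hg hf

theorem comp_arrowsComp {S S' : E} (x : S' ⟶ S) (p : S ⟶ τ.Arrows)
    (w : S ⟶ Word adj τ.Arrows)
    (h : p ≫ τ.arrowsWord = w ≫ (fc.map τ.multicatTgt).mor) :
    x ≫ τ.arrowsComp p w h =
      τ.arrowsComp (x ≫ p) (x ≫ w) (by rw [Category.assoc, h, Category.assoc]) := by
  apply τ.arrows_ext
  · simp only [Category.assoc, arrowsComp_word]
  · rw [Category.assoc, arrowsComp_arr, arrowsComp_arr, V.comp_cmp]
    exact V.cmp_congr _ (Category.assoc _ _ _).symm (by simp only [Category.assoc])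

theorem arrowsComp_congr {S : E} {p p' : S ⟶ τ.Arrows}
    {w w' : S ⟶ Word adj τ.Arrows}
    (h : p ≫ τ.arrowsWord = w ≫ (fc.map τ.multicatTgt).mor) (hp : p = p') (hw : w = w') :
    τ.arrowsComp p w h = τ.arrowsComp p' w' (by rw [← hp, ← hw, h]) := by
  subst hp hw; rfl

/-- Composition in the multicategory, on edges. -/
theorem multicat_cmp_edge {Q : IGraph E} {a : Q ⟶ τ.multicatData.ar}
    {b : Q ⟶ adj.toMonad.obj τ.multicatData.ar}
    {h : a ≫ τ.multicatData.src = b ≫ adj.toMonad.map τ.multicatData.tgt}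
    {p : Q.edge ⟶ τ.Arrows} {w : Q.edge ⟶ Word adj τ.Arrows} (hp : a.edge = p) (hw : b.edge = w)
    (h' : p ≫ τ.arrowsWord = w ≫ (fc.map τ.multicatTgt).mor) :
    (τ.multicatData.cmp a b h).edge = τ.arrowsComp p w h' := by
  refine (τ.comp_arrowsComp _ _ _ τ.multicatComp_aux).trans (τ.arrowsComp_congr _ ?_ ?_)
  · exact (congrArg IGraph.Hom.edge (pullback.lift_fst a b h)).trans hp
  · exact (congrArg IGraph.Hom.edge (pullback.lift_snd a b h)).trans hw

/-- The functor sending a list of pairs to the concatenation of their words. -/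
noncomputable def listWordFunctor : fc.obj (bouquet τ.Arrows) ⟶ fc.obj (bouquet V.obj) :=
  freeLift adj (C := fc.obj (bouquet V.obj)) τ.multicatSrc

theorem wordSing_listWord : wordSing adj τ.Arrows ≫ τ.listWordFunctor.mor = τ.arrowsWord :=
  unitEdge_freeLift adj (C := fc.obj (bouquet V.obj)) τ.multicatSrc rfl

/-- The domain of the monoidal product of a list of arrows is the concatenation of the words. -/
theorem listTri_dom : τ.listTri ≫ τ.triDom = τ.listWordFunctor.mor := by
  have key : τ.arrowsProd ≫ τ.triDomFunctor = τ.listWordFunctor := by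
    apply functor_ext_of_unit adj (bouquet_obj_unique adj _ _ _)
    change wordSing adj τ.Arrows ≫ τ.listTri ≫ τ.triDom =
      wordSing adj τ.Arrows ≫ τ.listWordFunctor.mor
    rw [← Category.assoc, wordSing_listTri, pairTri_dom, wordSing_listWord]
  exact congrArg IFunctor.mor key

/-- The identity arrows of the multicategory. -/
noncomputable def arrowsId : V.obj ⟶ τ.Arrows := τ.arrowsMk (wordSing adj V.obj) τ.singIso.hom

theorem arrowsId_word : τ.arrowsId ≫ τ.arrowsWord = wordSing adj V.obj := τ.arrowsMk_word _ _

theorem arrowsId_arr : τ.arrowsId ≫ τ.arrowsArr = τ.singIso.hom.arr := τ.arrowsMk_arr _ _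

theorem arrowsId_tgt : τ.arrowsId ≫ τ.arrowsArr ≫ V.tgt = 𝟙 _ := by
  rw [← Category.assoc, arrowsId_arr]
  exact τ.singIso.hom.tgt

/-- The list of identities of a word. -/
noncomputable def listId : Word adj V.obj ⟶ Word adj τ.Arrows := (fc.map τ.multicatData.ident).mor

/-- The monoidal product of a list of identities is an identity. -/
theorem listId_listTri : τ.listId ≫ τ.listTri = τ.triId (𝟙 _) := by
  have key : fc.map τ.multicatData.ident ≫ τ.arrowsProd = τ.triIdFunctor := by
    apply τ.functor_ext_triCat
    have e : wordSing adj V.obj ≫ τ.listId = τ.arrowsId ≫ wordSing adj τ.Arrows :=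
      unitEdge_map_bouquet adj (G := bouquet V.obj) τ.multicatData.ident rfl
    change wordSing adj V.obj ≫ τ.listId ≫ τ.listTri = wordSing adj V.obj ≫ τ.triId (𝟙 _)
    rw [← Category.assoc, e, Category.assoc, wordSing_listTri, comp_triId, Category.comp_id]
    apply τ.tri_ext
    · rw [Category.assoc, pairTri_dom, triId_dom, arrowsId_word]
    · rw [Category.assoc, pairTri_cod, triId_cod, reassoc_of% τ.arrowsId_tgt]
    · rw [τ.pairTri_arr _ τ.arrowsId_word (a := ⟨𝟙 _⟩) τ.arrowsId_tgt]
      refine Eq.trans ?_ (τ.triId_arr _).symm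
      refine (ICat.comp_arr_congr (f' := τ.singIso.hom) (g' := τ.singIso.inv) τ.arrowsId_arr
        ?_).trans ?_
      · rw [τ.singEl_inv_arr]; exact Category.id_comp _
      · rw [Iso.hom_inv_id]; rfl
  exact congrArg IFunctor.mor key

/-- The products of a list `w` of arrows and of a list `p` of arrows with sources the targets of
those in `w` are vertically composable. -/
theorem listTri_composable {G : IGraph E} (p : G ⟶ bouquet τ.Arrows)
    (w : G ⟶ (ICat.forgetGraph E).obj (fc.obj (bouquet τ.Arrows)))
    {we : G.edge ⟶ Word adj τ.Arrows} (hwe : w.edge = we)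
    (h : p.edge ≫ τ.arrowsWord = we ≫ (fc.map τ.multicatTgt).mor) :
    ((freeLift adj w).mor ≫ τ.listTri) ≫ τ.triCod =
      ((fc.map p).mor ≫ τ.listTri) ≫ τ.triDom := by
  have key : freeLift adj w ≫ fc.map τ.multicatTgt = fc.map p ≫ τ.listWordFunctor := by
    apply functor_ext_of_unit adj (bouquet_obj_unique adj _ _ _)
    rw [ICat.comp_mor, ICat.comp_mor, ← Category.assoc, ← Category.assoc,
      unitEdge_freeLift adj w hwe, unitEdge_map_bouquet adj p rfl, Category.assoc,
      wordSing_listWord, h]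
  rw [Category.assoc, Category.assoc, listTri_cod, listTri_dom]
  exact congrArg IFunctor.mor key

/-- Composition of lists of composable pairs: the monoidal product of a list of composites is the
vertical composite of the monoidal products. -/
theorem listTri_arrowsComp {G : IGraph E} (c p : G ⟶ bouquet τ.Arrows)
    (w : G ⟶ (ICat.forgetGraph E).obj (fc.obj (bouquet τ.Arrows)))
    {we : G.edge ⟶ Word adj τ.Arrows} (hwe : w.edge = we)
    (h : p.edge ≫ τ.arrowsWord = we ≫ (fc.map τ.multicatTgt).mor)
    (hc : c.edge = τ.arrowsComp p.edge we h) :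
    (fc.map c).mor ≫ τ.listTri =
      τ.triVert ((freeLift adj w).mor ≫ τ.listTri) ((fc.map p).mor ≫ τ.listTri)
        (τ.listTri_composable p w hwe h) := by
  generalize_proofs h'
  -- Both sides are functors on the free category on `G`, so lists of length one suffice.
  have key : fc.map c ≫ τ.arrowsProd =
      τ.vertFunctor (freeLift adj w ≫ τ.arrowsProd) (fc.map p ≫ τ.arrowsProd) h' := by
    apply τ.functor_ext_triCat
    change unitEdge adj _ ≫ (fc.map c).mor ≫ τ.listTri = unitEdge adj _ ≫
      τ.triVert ((freeLift adj w).mor ≫ τ.listTri) ((fc.map p).mor ≫ τ.listTri) h'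
    rw [← Category.assoc, unitEdge_map_bouquet adj c rfl, Category.assoc, wordSing_listTri,
      comp_triVert]
    have eF : unitEdge adj G ≫ (freeLift adj w).mor ≫ τ.listTri = we ≫ τ.listTri := by
      rw [← Category.assoc, unitEdge_freeLift adj w hwe]
    have eH : unitEdge adj G ≫ (fc.map p).mor ≫ τ.listTri = p.edge ≫ τ.pairTri := by
      rw [← Category.assoc, unitEdge_map_bouquet adj p rfl, Category.assoc, wordSing_listTri]
    have ew := τ.arrowsComp_word p.edge we h
    have ea := τ.arrowsComp_arr p.edge we h
    have et : c.edge ≫ τ.arrowsArr ≫ V.tgt = p.edge ≫ τ.arrowsArr ≫ V.tgt := by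
      rw [hc, ← Category.assoc, ea, V.cmp_tgt, Category.assoc]
    rw [← hc] at ew ea
    apply τ.tri_ext
    · rw [Category.assoc, pairTri_dom, triVert_dom, eF, ew]
    · rw [Category.assoc, pairTri_cod, triVert_cod, eH, Category.assoc, pairTri_cod,
        reassoc_of% et]
    · rw [τ.pairTri_arr _ ew (a := ⟨p.edge ≫ τ.arrowsArr ≫ V.tgt⟩) et]
      have hd : (we ≫ τ.listTri) ≫ τ.triCod = p.edge ≫ τ.arrowsWord := by
        rw [Category.assoc, listTri_cod, h]
      rw [τ.triVert_arr_of _ _ _ (τ.triHomOf (we ≫ τ.listTri) rfl hd)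
        (τ.arrowsHomOf p.edge rfl (a := ⟨p.edge ≫ τ.arrowsArr ≫ V.tgt⟩) rfl ≫
          (τ.singEl ⟨p.edge ≫ τ.arrowsArr ≫ V.tgt⟩).inv) (by rw [eF]; rfl)
        (by rw [eH, τ.pairTri_arr p.edge rfl (a := ⟨p.edge ≫ τ.arrowsArr ≫ V.tgt⟩) rfl]),
        ← Category.assoc (τ.triHomOf _ _ _)]
      exact ICat.comp_arr_congr ea rfl
  exact congrArg IFunctor.mor key

theorem multicat_isTyped : τ.multicatData.IsTyped where
  comp_src := by
    apply freeBouquet_hom_ext adj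
    refine (τ.arrowsComp_word _ _ τ.multicatComp_aux).trans ((Category.assoc _ _ _).trans ?_)
    exact congrArg (_ ≫ ·) τ.listTri_dom
  comp_tgt := by
    apply bouquet_hom_ext
    have h := congrArg (· ≫ V.tgt) (τ.arrowsComp_arr _ _ τ.multicatComp_aux)
    simp only [V.cmp_tgt, Category.assoc] at h
    exact h
  ident_src := freeBouquet_hom_ext adj (τ.arrowsMk_word _ _)
  ident_tgt := bouquet_hom_ext τ.arrowsId_tgt

theorem arrowsComp_id_left {S : E} (p : S ⟶ τ.Arrows)
    (h : (p ≫ (τ.arrowsArr ≫ V.tgt) ≫ τ.arrowsId) ≫ τ.arrowsWord =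
      (p ≫ wordSing adj τ.Arrows) ≫ (fc.map τ.multicatTgt).mor) :
    τ.arrowsComp (p ≫ (τ.arrowsArr ≫ V.tgt) ≫ τ.arrowsId) (p ≫ wordSing adj τ.Arrows) h = p := by
  have hp : (p ≫ wordSing adj τ.Arrows) ≫ τ.listTri = p ≫ τ.pairTri := by
    rw [Category.assoc, wordSing_listTri]
  apply τ.arrows_ext
  · rw [arrowsComp_word, hp, Category.assoc, pairTri_dom]
  · rw [τ.arrowsComp_arr_of _ _ _
      (τ.arrowsHomOf p rfl (a := ⟨p ≫ τ.arrowsArr ≫ V.tgt⟩) rfl ≫ (τ.singEl _).inv)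
      (τ.singEl _).hom (by rw [hp, τ.pairTri_arr p rfl rfl])
      (by simp only [Category.assoc, arrowsId_arr, singEl_hom_arr]),
      Category.assoc, Iso.inv_hom_id, Category.comp_id, arrowsHomOf_arr]

theorem arrowsComp_id_right {S : E} (p : S ⟶ τ.Arrows)
    (h : p ≫ τ.arrowsWord = (p ≫ τ.arrowsWord ≫ τ.listId) ≫ (fc.map τ.multicatTgt).mor) :
    τ.arrowsComp p (p ≫ τ.arrowsWord ≫ τ.listId) h = p := by
  have hp : (p ≫ τ.arrowsWord ≫ τ.listId) ≫ τ.listTri = τ.triId (p ≫ τ.arrowsWord) := by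
    rw [Category.assoc, Category.assoc, listId_listTri, comp_triId, comp_triId, Category.comp_id]
  apply τ.arrows_ext
  · rw [arrowsComp_word, hp, triId_dom]
  · rw [τ.arrowsComp_arr_of _ _ _ (𝟙 _)
      (τ.arrowsHomOf p rfl (a := ⟨p ≫ τ.arrowsArr ≫ V.tgt⟩) rfl) (by rw [hp, triId_arr]) rfl,
      Category.id_comp, arrowsHomOf_arr]

/-- Associativity, for a list `b` of composable pairs `(p, w)` with composites `c`: it follows from
the associativity of composition in `V`, since the product of the list of composites is the
composite of the products. -/
theorem arrowsComp_assoc {G : IGraph E} (c p : G ⟶ bouquet τ.Arrows)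
    (w : G ⟶ (ICat.forgetGraph E).obj (fc.obj (bouquet τ.Arrows)))
    {we : G.edge ⟶ Word adj τ.Arrows} (hwe : w.edge = we)
    (h : p.edge ≫ τ.arrowsWord = we ≫ (fc.map τ.multicatTgt).mor)
    (hc : c.edge = τ.arrowsComp p.edge we h) {S : E} (a : S ⟶ τ.Arrows) (b : S ⟶ (fc.obj G).mor)
    (h₁ : a ≫ τ.arrowsWord = (b ≫ (fc.map c).mor) ≫ (fc.map τ.multicatTgt).mor)
    (h₂ : a ≫ τ.arrowsWord = (b ≫ (fc.map p).mor) ≫ (fc.map τ.multicatTgt).mor)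
    (h₃ : τ.arrowsComp a (b ≫ (fc.map p).mor) h₂ ≫ τ.arrowsWord =
      (b ≫ (freeLift adj w).mor) ≫ (fc.map τ.multicatTgt).mor) :
    τ.arrowsComp a (b ≫ (fc.map c).mor) h₁ =
      τ.arrowsComp (τ.arrowsComp a (b ≫ (fc.map p).mor) h₂) (b ≫ (freeLift adj w).mor) h₃ := by
  have e : (b ≫ (fc.map c).mor) ≫ τ.listTri = τ.triVert ((b ≫ (freeLift adj w).mor) ≫ τ.listTri)
      ((b ≫ (fc.map p).mor) ≫ τ.listTri) (by
        simp only [Category.assoc]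
        simpa only [Category.assoc] using congrArg (b ≫ ·) (τ.listTri_composable p w hwe h)) := by
    rw [Category.assoc, τ.listTri_arrowsComp c p w hwe h hc, comp_triVert]
    simp only [Category.assoc]
  apply τ.arrows_ext
  · rw [arrowsComp_word, arrowsComp_word, e, triVert_dom]
  · have ea := τ.arrowsComp_arr_of a (b ≫ (fc.map p).mor) h₂
      (τ.triHomOf ((b ≫ (fc.map p).mor) ≫ τ.listTri) rfl (by
        rw [Category.assoc, listTri_cod, ← h₂]))
      (τ.arrowsHomOf a rfl (a := ⟨a ≫ τ.arrowsArr ≫ V.tgt⟩) rfl) rfl rfl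
    have hd : ((b ≫ (freeLift adj w).mor) ≫ τ.listTri) ≫ τ.triCod =
        ((b ≫ (fc.map p).mor) ≫ τ.listTri) ≫ τ.triDom := by
      simpa only [Category.assoc] using congrArg (b ≫ ·) (τ.listTri_composable p w hwe h)
    rw [τ.arrowsComp_arr_of _ _ h₃ (τ.triHomOf ((b ≫ (freeLift adj w).mor) ≫ τ.listTri) rfl hd)
      _ rfl ea, ← Category.assoc (τ.triHomOf _ _ _)]
    exact τ.arrowsComp_arr_of _ _ _ _ _ (by
      rw [e]; exact τ.triVert_arr_of _ _ _ _ _ rfl rfl) rfl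

/-- The data `MV` form an `fc`-multicategory. -/
theorem isMulticat : τ.multicatData.IsMulticat where
  toIsTyped := τ.multicat_isTyped
  ident_cmp := fun a => bouquet_hom_ext
    ((τ.multicat_cmp_edge rfl rfl _).trans (τ.arrowsComp_id_left a.edge
      (congrArg IGraph.Hom.edge (τ.multicat_isTyped.left a))))
  cmp_ident := fun a => bouquet_hom_ext
    ((τ.multicat_cmp_edge rfl rfl _).trans (τ.arrowsComp_id_right a.edge
      (congrArg IGraph.Hom.edge (τ.multicat_isTyped.right a))))
  assoc := fun a b hab => bouquet_hom_ext (by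
    have h₁ := congrArg IGraph.Hom.edge (τ.multicat_isTyped.assoc_left a b
      (hab.trans (Category.assoc _ _ _)))
    have h₃ := congrArg IGraph.Hom.edge (τ.multicat_isTyped.assoc_right a b hab)
    have e := τ.multicat_cmp_edge (a := a) (b := b ≫ adj.toMonad.map (pullback.fst _ _)) (h := hab)
      rfl rfl (congrArg IGraph.Hom.edge hab)
    refine (τ.multicat_cmp_edge rfl rfl h₁).trans (Eq.trans ?_
      (τ.multicat_cmp_edge e rfl ((congrArg (· ≫ τ.arrowsWord) e.symm).trans h₃)).symm)
    exact τ.arrowsComp_assoc τ.multicatData.comp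
      (pullback.fst τ.multicatSrc (adj.toMonad.map τ.multicatTgt))
      (pullback.snd τ.multicatSrc (adj.toMonad.map τ.multicatTgt)) rfl τ.multicatComp_aux rfl
      a.edge b.edge h₁ (congrArg IGraph.Hom.edge hab) _)

end IteratedTensor

end IntEnr

namespace IntEnr

/-! ### Functors on the multicategory of an algebra -/

section AlgebraFunctor

universe v₁ u₁

variable {G : Type u₁} [Category.{v₁} G] [HasPullbacks G] {T : Monad G} {A : T.Algebra}
  {M : Multicat T}

/-- The compatibility with composition of a functor on the `T`-multicategory of a `T`-algebra, for
the generic pair of composable arrows. -/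
theorem mu_algebraFunctor (F : MulticatFunctor (algebraMulticat A) M) {f : T.obj A.A ⟶ M.ar}
    (hf : F.ar = f) (h : (T.map A.a ≫ f) ≫ M.src = T.map f ≫ T.map M.tgt) :
    T.μ.app A.A ≫ f = M.cmp (T.map A.a ≫ f) (T.map f) h := by
  subst hf
  have hc : T.map A.a ≫ 𝟙 (T.obj A.A) = 𝟙 _ ≫ T.map A.a := by simp
  have e : (pullback.lift (T.map A.a) (𝟙 (T.obj (T.obj A.A))) hc ≫ pullback.snd _ _ ≫
      T.μ.app A.A) ≫ F.ar = _ :=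
    (Category.assoc _ _ _).trans
      ((congrArg (pullback.lift _ _ hc ≫ ·) F.map_comp).trans (M.comp_cmp _ _ _ _))
  rw [pullback.lift_snd_assoc, Category.id_comp] at e
  refine e.trans (M.cmp_congr _ ?_ ?_)
  · exact pullback.lift_fst_assoc _ _ hc _
  · exact (pullback.lift_snd_assoc _ _ hc _).trans (Category.id_comp _)

/-- A functor on the `T`-multicategory of a `T`-algebra, with compatibility with composition stated
for the generic pair of composable arrows. -/
noncomputable def algebraFunctorMk (f₀ : A.A ⟶ M.ob) (f : T.obj A.A ⟶ M.ar)
    (src : f ≫ M.src = T.map f₀) (tgt : f ≫ M.tgt = A.a ≫ f₀)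
    (ident : T.η.app A.A ≫ f = f₀ ≫ M.ident)
    (h : (T.map A.a ≫ f) ≫ M.src = T.map f ≫ T.map M.tgt)
    (comp : T.μ.app A.A ≫ f = M.cmp (T.map A.a ≫ f) (T.map f) h) :
    MulticatFunctor (algebraMulticat A) M where
  ob := f₀
  ar := f
  src_comm := src.trans (Category.id_comp _).symm
  tgt_comm := tgt
  map_ident := ident
  map_comp := by
    refine (Category.assoc _ _ _).trans ((congrArg (pullback.snd _ _ ≫ ·) comp).trans
      ((M.comp_cmp _ _ _ _).trans (M.cmp_congr _ ?_ rfl)))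
    have e : pullback.fst (𝟙 (T.obj A.A)) (T.map A.a) ≫ 𝟙 _ = pullback.snd _ _ ≫ T.map A.a :=
      pullback.condition
    rw [Category.comp_id] at e
    exact (Category.assoc _ _ _).symm.trans (congrArg (· ≫ f) e.symm)

end AlgebraFunctor

namespace IteratedTensor

variable {E : Type u} [Category.{v} E] [HasPullbacks E] [CartesianMonoidalCategory E]
  {fc : IGraph E ⥤ ICat E} {adj : fc ⊣ ICat.forgetGraph E} {V : IMonCat E}
  (τ : IteratedTensor adj V)

/-! ### Enriched composition of arrows out of iterated tensor products -/

section FoldComp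

variable {Z : VCatData V} (h : Z.IsTyped)

/-- Composition of arrows `fold l ⟶ Z(x₁, x₂)` and `fold m ⟶ Z(x₀, x₁)`, an arrow
`fold (l m) ⟶ Z(x₀, x₂)`. -/
noncomputable def foldComp {S : E} {l m : S ⟶ Word adj V.obj} {x₀ x₁ x₂ : S ⟶ Z.obj}
    (f : τ.foldEl l ⟶ Z.homEl x₁ x₂) (g : τ.foldEl m ⟶ Z.homEl x₀ x₁) :
    τ.foldEl (wordMul adj l m) ⟶ Z.homEl x₀ x₂ :=
  (τ.mulEl l m).inv ≫ (f ⊗ₘ g) ≫ h.compHom x₀ x₁ x₂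

/-- The identity of `x`, as an arrow `fold () ⟶ Z(x, x)`. -/
noncomputable def foldUnit {S : E} (x : S ⟶ Z.obj) :
    τ.foldEl (toUnit S ≫ wordNil adj V.obj) ⟶ Z.homEl x x :=
  (τ.nilEl S).inv ≫ h.identHom x

/-- Naturality of `foldComp` in the stage, for freely chosen restrictions. -/
theorem comp_foldComp_arr {S S' : E} (y : S' ⟶ S) {l m : S ⟶ Word adj V.obj}
    {x₀ x₁ x₂ : S ⟶ Z.obj} {l' m' : S' ⟶ Word adj V.obj} {x₀' x₁' x₂' : S' ⟶ Z.obj}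
    (f : τ.foldEl l ⟶ Z.homEl x₁ x₂) (g : τ.foldEl m ⟶ Z.homEl x₀ x₁)
    (f' : τ.foldEl l' ⟶ Z.homEl x₁' x₂') (g' : τ.foldEl m' ⟶ Z.homEl x₀' x₁')
    (hl : y ≫ l = l') (hm : y ≫ m = m') (h₀ : y ≫ x₀ = x₀') (h₁ : y ≫ x₁ = x₁')
    (h₂ : y ≫ x₂ = x₂') (hf : y ≫ f.arr = f'.arr) (hg : y ≫ g.arr = g'.arr) :
    y ≫ (τ.foldComp h f g).arr = (τ.foldComp h f' g').arr := by
  subst hl hm h₀ h₁ h₂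
  rw [foldComp, foldComp, res_comp_arr]
  refine ICat.comp_arr_congr ?_ ?_
  · change y ≫ _ = _
    rw [τ.mulEl_inv_arr, τ.mulEl_inv_arr, ← Category.assoc, comp_lift]
  · change y ≫ _ = _
    rw [res_comp_arr]
    refine ICat.comp_arr_congr ?_ ?_
    · change y ≫ _ = _
      rw [V.tensorHom_arr, V.tensorHom_arr, ← Category.assoc, comp_lift, hf, hg]
    · change y ≫ _ ≫ _ = _ ≫ _
      rw [← Category.assoc, comp_lift, comp_lift]

theorem foldComp_arr_congr {S : E} {l m : S ⟶ Word adj V.obj}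
    {x₀ x₁ x₂ : S ⟶ Z.obj} {l' m' : S ⟶ Word adj V.obj} {x₀' x₁' x₂' : S ⟶ Z.obj}
    {f : τ.foldEl l ⟶ Z.homEl x₁ x₂} {g : τ.foldEl m ⟶ Z.homEl x₀ x₁}
    {f' : τ.foldEl l' ⟶ Z.homEl x₁' x₂'} {g' : τ.foldEl m' ⟶ Z.homEl x₀' x₁'}
    (hl : l = l') (hm : m = m') (h₀ : x₀ = x₀') (h₁ : x₁ = x₁')
    (h₂ : x₂ = x₂') (hf : f.arr = f'.arr) (hg : g.arr = g'.arr) :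
    (τ.foldComp h f g).arr = (τ.foldComp h f' g').arr := by
  subst hl hm h₀ h₁ h₂
  rw [ICat.el_ext hf, ICat.el_ext hg]

theorem comp_foldUnit_arr {S S' : E} (y : S' ⟶ S) (x : S ⟶ Z.obj) :
    y ≫ (τ.foldUnit h x).arr = (τ.foldUnit h (y ≫ x)).arr := by
  rw [foldUnit, foldUnit, res_comp_arr]
  refine ICat.comp_arr_congr ?_ ?_
  · have e : ∀ T : E, (τ.nilEl T).inv.arr = toUnit T ≫ τ.nilIso.inv.arr := fun T =>
      ICat.castIso_inv_arr _ _ _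
    change y ≫ _ = _
    rw [e, e, ← Category.assoc, toUnit_unique (y ≫ toUnit S) (toUnit S')]
  · change y ≫ x ≫ _ = (y ≫ x) ≫ _
    rw [Category.assoc]

/-- A left-bracketed composite, in a form in which the associativity axiom of `Z` can be applied. -/
theorem foldComp_left {S : E} {l m n : S ⟶ Word adj V.obj} {x₀ x₁ x₂ x₃ : S ⟶ Z.obj}
    (f : τ.foldEl l ⟶ Z.homEl x₂ x₃) (g : τ.foldEl m ⟶ Z.homEl x₁ x₂)
    (k : τ.foldEl n ⟶ Z.homEl x₀ x₁) :
    (τ.foldComp h (τ.foldComp h f g) k).arr =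
      ((τ.mulR l m n).inv ≫ (f ⊗ₘ (g ⊗ₘ k)) ≫ (α_ _ _ _).inv ≫
        (h.compHom x₁ x₂ x₃ ⊗ₘ 𝟙 (Z.homEl x₀ x₁)) ≫ h.compHom x₀ x₁ x₃).arr := by
  have e₁ : τ.foldComp h (τ.foldComp h f g) k = (τ.mulL l m n).inv ≫
      ((f ⊗ₘ g) ⊗ₘ k) ≫ (h.compHom x₁ x₂ x₃ ⊗ₘ 𝟙 (Z.homEl x₀ x₁)) ≫ h.compHom x₀ x₁ x₃ :=
    aux_left _ _ _ _ _ _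
  rw [e₁]
  refine (ICat.comp_arr_congr (τ.mulL_inv_arr l m n) rfl).trans (congrArg ICat.ElHom.arr ?_)
  simp only [Iso.trans_inv, Category.assoc]
  rw [← MonoidalCategory.associator_inv_naturality_assoc]

/-- A right-bracketed composite, in a form in which the associativity axiom of `Z` can be applied.
-/
theorem foldComp_right {S : E} {l m n : S ⟶ Word adj V.obj} {x₀ x₁ x₂ x₃ : S ⟶ Z.obj}
    (f : τ.foldEl l ⟶ Z.homEl x₂ x₃) (g : τ.foldEl m ⟶ Z.homEl x₁ x₂)
    (k : τ.foldEl n ⟶ Z.homEl x₀ x₁) :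
    τ.foldComp h f (τ.foldComp h g k) = (τ.mulR l m n).inv ≫ (f ⊗ₘ (g ⊗ₘ k)) ≫
      (𝟙 (Z.homEl x₂ x₃) ⊗ₘ h.compHom x₀ x₁ x₂) ≫ h.compHom x₀ x₂ x₃ :=
  aux_right _ _ _ _ _ _

theorem foldUnit_comp {S : E} {l : S ⟶ Word adj V.obj} {x₀ x₁ : S ⟶ Z.obj}
    (f : τ.foldEl l ⟶ Z.homEl x₀ x₁) :
    (τ.foldComp h (τ.foldUnit h x₁) f).arr = (f ≫ (λ_ _).inv ≫
      (h.identHom x₁ ⊗ₘ 𝟙 (Z.homEl x₀ x₁)) ≫ h.compHom x₀ x₁ x₁).arr := by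
  have e₁ : τ.foldComp h (τ.foldUnit h x₁) f =
      ((τ.nilEl S ⊗ᵢ Iso.refl (τ.foldEl l)) ≪≫ τ.mulEl (toUnit S ≫ wordNil adj V.obj) l).inv ≫
        (𝟙 _ ⊗ₘ f) ≫ (h.identHom x₁ ⊗ₘ 𝟙 (Z.homEl x₀ x₁)) ≫ h.compHom x₀ x₁ x₁ := by
    have e := aux_left (q := h.compHom x₀ x₁ x₁) (τ.mulEl _ _).inv (τ.nilEl S).inv (𝟙 _)
      (h.identHom x₁) f
    rw [Category.id_comp] at e
    exact e
  rw [e₁]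
  refine (ICat.comp_arr_congr (inv_arr_congr _ _ (τ.nil_arr l)) rfl).trans
    (congrArg ICat.ElHom.arr ?_)
  simp

theorem comp_foldUnit {S : E} {l : S ⟶ Word adj V.obj} {x₀ x₁ : S ⟶ Z.obj}
    (f : τ.foldEl l ⟶ Z.homEl x₀ x₁) :
    (τ.foldComp h f (τ.foldUnit h x₀)).arr = (f ≫ (ρ_ _).inv ≫
      (𝟙 (Z.homEl x₀ x₁) ⊗ₘ h.identHom x₀) ≫ h.compHom x₀ x₀ x₁).arr := by
  have e₁ : τ.foldComp h f (τ.foldUnit h x₀) =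
      ((Iso.refl (τ.foldEl l) ⊗ᵢ τ.nilEl S) ≪≫ τ.mulEl l (toUnit S ≫ wordNil adj V.obj)).inv ≫
        (f ⊗ₘ 𝟙 _) ≫ (𝟙 (Z.homEl x₀ x₁) ⊗ₘ h.identHom x₀) ≫ h.compHom x₀ x₀ x₁ := by
    have e := aux_right (q := h.compHom x₀ x₀ x₁) (τ.mulEl _ _).inv (τ.nilEl S).inv (𝟙 _)
      (h.identHom x₀) f
    rw [Category.id_comp] at e
    exact e
  rw [e₁]
  refine (ICat.comp_arr_congr (inv_arr_congr _ _ (τ.arr_nil l)) rfl).trans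
    (congrArg ICat.ElHom.arr ?_)
  simp

end FoldComp

/-! ### The action of an enriched multicategory on paths -/

section Paths

variable {τ} {hM : τ.multicatData.IsMulticat} (X : EnrichedMulticat adj (τ.multicat hM))

/-- The evaluation of paths: the functor from the free internal category on the indiscrete graph
that is the identity on edges. -/
noncomputable def pathEval : Path X ⟶ Ind X.obj := adj.counit.app (Ind X.obj)

/-- The object of a vertex of a path. -/
noncomputable def pathObj : (Path X).obj ⟶ X.obj := (pathEval X).obj

theorem pathVert_obj : pathVert X ≫ pathObj X = 𝟙 _ := unitVert_counit adj (Ind X.obj)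

theorem pathObj_vert : pathObj X ≫ pathVert X = 𝟙 _ := by
  apply toInd_ext adj
  change pathVert X ≫ pathObj X ≫ pathVert X = pathVert X ≫ 𝟙 _
  rw [← Category.assoc, pathVert_obj, Category.id_comp, Category.comp_id]

theorem pathEval_mor :
    (pathEval X).mor = lift ((Path X).src ≫ pathObj X) ((Path X).tgt ≫ pathObj X) := by
  apply CartesianMonoidalCategory.hom_ext
  · rw [lift_fst]; exact (pathEval X).src_comm
  · rw [lift_snd]; exact (pathEval X).tgt_comm

theorem pathArrow_tgt :
    pathArrow X ≫ τ.arrowsArr ≫ V.tgt =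
      lift ((Path X).src ≫ pathObj X) ((Path X).tgt ≫ pathObj X) ≫ vHom X := by
  rw [← pathEval_mor]
  exact congrArg IGraph.Hom.edge X.map.tgt_comm

/-- The action of an enriched `Id`-multicategory on a path from `x` to `y`. -/
noncomputable def pathHom {S : E} (u : S ⟶ (Path X).mor) {l : S ⟶ Word adj V.obj}
    {x y : S ⟶ X.obj} (hl : u ≫ (pathWord X).mor = l) (hx : u ≫ (Path X).src ≫ pathObj X = x)
    (hy : u ≫ (Path X).tgt ≫ pathObj X = y) : τ.foldEl l ⟶ (vData X).homEl x y :=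
  τ.arrowsHomOf (u ≫ pathArrow X) (a := (vData X).homEl x y)
    (by rw [Category.assoc, pathArrow_word, hl])
    (by
      rw [Category.assoc, pathArrow_tgt, ← Category.assoc, comp_lift, hx, hy]; rfl)

theorem onePath_src_obj {S : E} (x y : S ⟶ X.obj) :
    onePath X x y ≫ (Path X).src ≫ pathObj X = x := by
  rw [← Category.assoc, onePath_src, Category.assoc, pathVert_obj, Category.comp_id]

theorem onePath_tgt_obj {S : E} (x y : S ⟶ X.obj) :
    onePath X x y ≫ (Path X).tgt ≫ pathObj X = y := by
  rw [← Category.assoc, onePath_tgt, Category.assoc, pathVert_obj, Category.comp_id]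

theorem twoPath_src_obj {S : E} (x₀ x₁ x₂ : S ⟶ X.obj) :
    twoPath X x₀ x₁ x₂ ≫ (Path X).src ≫ pathObj X = x₀ := by
  rw [twoPath, ← Category.assoc, (Path X).cmp_src, Category.assoc, onePath_src_obj]

theorem twoPath_tgt_obj {S : E} (x₀ x₁ x₂ : S ⟶ X.obj) :
    twoPath X x₀ x₁ x₂ ≫ (Path X).tgt ≫ pathObj X = x₂ := by
  rw [twoPath, ← Category.assoc, (Path X).cmp_tgt, Category.assoc, onePath_tgt_obj]

theorem emptyPath_src_obj {S : E} (x : S ⟶ X.obj) :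
    emptyPath X x ≫ (Path X).src ≫ pathObj X = x := by
  rw [emptyPath, Category.assoc, Category.assoc, reassoc_of% (Path X).ident_src, pathVert_obj,
    Category.comp_id]

theorem emptyPath_tgt_obj {S : E} (x : S ⟶ X.obj) :
    emptyPath X x ≫ (Path X).tgt ≫ pathObj X = x := by
  rw [emptyPath, Category.assoc, Category.assoc, reassoc_of% (Path X).ident_tgt, pathVert_obj,
    Category.comp_id]

theorem comp_onePath {S S' : E} (z : S' ⟶ S) (x y : S ⟶ X.obj) :
    z ≫ onePath X x y = onePath X (z ≫ x) (z ≫ y) := by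
  rw [onePath, onePath, ← Category.assoc, comp_lift]

theorem comp_twoPath {S S' : E} (z : S' ⟶ S) (x₀ x₁ x₂ : S ⟶ X.obj) :
    z ≫ twoPath X x₀ x₁ x₂ = twoPath X (z ≫ x₀) (z ≫ x₁) (z ≫ x₂) := by
  rw [twoPath, twoPath, (Path X).comp_cmp]
  exact (Path X).cmp_congr _ (comp_onePath X _ _ _) (comp_onePath X _ _ _)

theorem twoPath_word' {S : E} (x₀ x₁ x₂ : S ⟶ X.obj) :
    twoPath X x₀ x₁ x₂ ≫ (pathWord X).mor =
      wordMul adj (((vData X).homEl x₁ x₂).pt ≫ wordSing adj V.obj)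
        (((vData X).homEl x₀ x₁).pt ≫ wordSing adj V.obj) := by
  rw [← pathArrow_word, ← Category.assoc, twoPath_word]; rfl

theorem emptyPath_word' {S : E} (x : S ⟶ X.obj) :
    emptyPath X x ≫ (pathWord X).mor = toUnit S ≫ wordNil adj V.obj := by
  rw [← pathArrow_word, ← Category.assoc, emptyPath_word]

/-- The action on paths of length two. -/
noncomputable def twoPathHom {S : E} (x₀ x₁ x₂ : S ⟶ X.obj) :
    τ.foldEl (wordMul adj (((vData X).homEl x₁ x₂).pt ≫ wordSing adj V.obj)
      (((vData X).homEl x₀ x₁).pt ≫ wordSing adj V.obj)) ⟶ (vData X).homEl x₀ x₂ :=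
  pathHom X (twoPath X x₀ x₁ x₂) (twoPath_word' X _ _ _) (twoPath_src_obj X _ _ _)
    (twoPath_tgt_obj X _ _ _)

/-- The action on empty paths. -/
noncomputable def emptyPathHom {S : E} (x : S ⟶ X.obj) :
    τ.foldEl (toUnit S ≫ wordNil adj V.obj) ⟶ (vData X).homEl x x :=
  pathHom X (emptyPath X x) (emptyPath_word' X _) (emptyPath_src_obj X _) (emptyPath_tgt_obj X _)

theorem comp_pairEl_arr {S S' : E} (z : S' ⟶ S) (a b : V.El S) :
    z ≫ (pairEl τ a b).hom.arr = (pairEl τ (S := S') ⟨z ≫ a.pt⟩ ⟨z ≫ b.pt⟩).hom.arr := by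
  change z ≫ (_ ≫ (τ.mulEl _ _).hom).arr = (_ ≫ (τ.mulEl _ _).hom).arr
  rw [res_comp_arr]
  refine ICat.comp_arr_congr ?_ ?_
  · change z ≫ lift (τ.singEl a).inv.arr (τ.singEl b).inv.arr ≫ _ = lift _ _ ≫ _
    rw [← Category.assoc, comp_lift, comp_singEl_inv, comp_singEl_inv]
    rfl
  · change z ≫ _ = _
    rw [τ.mulEl_hom_arr, τ.mulEl_hom_arr, ← Category.assoc, comp_lift, Category.assoc,
      Category.assoc]

theorem pairEl_arr_congr {S : E} {a b a' b' : V.El S} (ha : a = a') (hb : b = b') :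
    (pairEl τ a b).hom.arr = (pairEl τ a' b').hom.arr := by
  subst ha hb; rfl

theorem lift_vData_comp {S : E} (x₀ x₁ x₂ : S ⟶ X.obj) :
    lift x₀ (lift x₁ x₂) ≫ (vData X).comp =
      ((pairEl τ ((vData X).homEl x₁ x₂) ((vData X).homEl x₀ x₁)).hom ≫
        twoPathHom X x₀ x₁ x₂).arr := by
  refine (V.comp_cmp _ _ _ _).trans (V.cmp_congr _ ?_ ?_)
  · rw [← Category.assoc, ← Category.assoc, comp_twoPath]
    simp only [lift_fst, lift_snd_assoc, lift_snd]
    rfl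
  · rw [comp_pairEl_arr]
    apply pairEl_arr_congr
    · apply ICat.El.ext
      simp [VCatData.homEl, vData]
    · apply ICat.El.ext
      simp [VCatData.homEl, vData, comp_lift_assoc]

theorem comp_nilEl_arr {S S' : E} (z : S' ⟶ S) :
    z ≫ (τ.nilEl S).hom.arr = (τ.nilEl S').hom.arr := by
  have e : ∀ T : E, (τ.nilEl T).hom.arr = toUnit T ≫ τ.nilIso.hom.arr := fun T =>
    ICat.castIso_hom_arr _ _ _
  rw [e, e, ← Category.assoc, toUnit_unique (z ≫ toUnit S) (toUnit S')]

theorem comp_vData_ident {S : E} (x : S ⟶ X.obj) :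
    x ≫ (vData X).ident = ((τ.nilEl S).hom ≫ emptyPathHom X x).arr := by
  refine (V.comp_cmp _ _ _ _).trans (V.cmp_congr _ ?_ ?_)
  · rw [← Category.assoc, ← Category.assoc]
    have e : x ≫ emptyPath X (𝟙 X.obj) = emptyPath X x := by
      rw [emptyPath, emptyPath, Category.id_comp]
    rw [e]; rfl
  · exact comp_nilEl_arr x

theorem vData_isTyped : (vData X).IsTyped where
  comp_src x₀ x₁ x₂ :=
    (congrArg (· ≫ V.src) (lift_vData_comp X x₀ x₁ x₂)).trans (ICat.ElHom.src _)
  comp_tgt x₀ x₁ x₂ :=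
    (congrArg (· ≫ V.tgt) (lift_vData_comp X x₀ x₁ x₂)).trans (ICat.ElHom.tgt _)
  ident_src x := (congrArg (· ≫ V.src) (comp_vData_ident X x)).trans (ICat.ElHom.src _)
  ident_tgt x := (congrArg (· ≫ V.tgt) (comp_vData_ident X x)).trans (ICat.ElHom.tgt _)

theorem vData_compHom {S : E} (x₀ x₁ x₂ : S ⟶ X.obj) :
    (vData_isTyped X).compHom x₀ x₁ x₂ =
      (pairEl τ ((vData X).homEl x₁ x₂) ((vData X).homEl x₀ x₁)).hom ≫ twoPathHom X x₀ x₁ x₂ :=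
  ICat.el_ext (lift_vData_comp X _ _ _)

theorem vData_identHom {S : E} (x : S ⟶ X.obj) :
    (vData_isTyped X).identHom x = (τ.nilEl S).hom ≫ emptyPathHom X x :=
  ICat.el_ext (comp_vData_ident X _)

/-- The action on empty paths is given by the identities. -/
theorem emptyPathHom_eq {S : E} (x : S ⟶ X.obj) :
    emptyPathHom X x = τ.foldUnit (vData_isTyped X) x :=
  ((τ.nilEl S).inv_hom_id_assoc _).symm.trans
    (congrArg ((τ.nilEl S).inv ≫ ·) (vData_identHom X x).symm)

/-- The action on paths of length one is the isomorphism `fold (v) ≅ v`. -/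
theorem onePath_arr {S : E} (x y : S ⟶ X.obj) :
    (onePath X x y ≫ pathArrow X) ≫ τ.arrowsArr = (τ.singEl ((vData X).homEl x y)).hom.arr := by
  have e : pathEdge X ≫ pathArrow X = vHom X ≫ τ.arrowsId :=
    congrArg IGraph.Hom.edge X.map.map_ident
  have h : (onePath X x y ≫ pathArrow X) ≫ τ.arrowsArr =
      (lift x y ≫ vHom X) ≫ τ.singIso.hom.arr := by
    rw [onePath, Category.assoc, Category.assoc, reassoc_of% e, arrowsId_arr, Category.assoc]
  exact h.trans (τ.singEl_hom_arr _).symm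

/-! ### Lists of paths -/

/-- The free internal category on the graph of paths. -/
noncomputable abbrev PathList : ICat E := fc.obj ((ICat.forgetGraph E).obj (Path X))

/-- The action on paths, as a morphism of graphs. -/
noncomputable def pathGraphHom : (ICat.forgetGraph E).obj (Path X) ⟶ bouquet τ.Arrows := X.map.ar

/-- Concatenation of a list of paths. -/
noncomputable def listConcat : PathList X ⟶ Path X := adj.counit.app (Path X)

/-- The path with steps the ends of a list of paths. -/
noncomputable def listEnds : PathList X ⟶ Path X :=
  fc.map ((ICat.forgetGraph E).map (pathEval X))

/-- The list of arrows of a list of paths. -/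
noncomputable def listArrows : PathList X ⟶ fc.obj (bouquet τ.Arrows) := fc.map (pathGraphHom X)

/-- The list with one path. -/
noncomputable def listSing : (Path X).mor ⟶ (PathList X).mor :=
  unitEdge adj ((ICat.forgetGraph E).obj (Path X))

theorem listEnds_word :
    (listEnds X).mor ≫ (pathWord X).mor = (listArrows X).mor ≫ (fc.map τ.multicatTgt).mor := by
  have e : listEnds X ≫ pathWord X = listArrows X ≫ fc.map τ.multicatTgt := by
    have h := congrArg fc.map X.map.tgt_comm
    rw [fc.map_comp, fc.map_comp] at h
    exact h.symm
  exact congrArg IFunctor.mor e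

/-- The functor of an enriched `Id`-multicategory is compatible with composition: its action on the
concatenation of a list of paths. -/
theorem listConcat_arrow :
    (listConcat X).mor ≫ pathArrow X =
      τ.arrowsComp ((listEnds X).mor ≫ pathArrow X) (listArrows X).mor (by
        rw [Category.assoc, pathArrow_word, listEnds_word]) := by
  have h : (adj.toMonad.map ((Monad.comparison adj).obj (Ind X.obj)).a ≫ X.map.ar) ≫
      (τ.multicat hM).src = adj.toMonad.map X.map.ar ≫ adj.toMonad.map (τ.multicat hM).tgt := by
    apply freeBouquet_hom_ext adj
    refine Eq.trans ?_ (listEnds_word X)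
    exact (Category.assoc _ _ _).trans (congrArg ((listEnds X).mor ≫ ·) (pathArrow_word X))
  exact (congrArg IGraph.Hom.edge (mu_algebraFunctor X.map rfl h)).trans
    (τ.multicat_cmp_edge rfl rfl _)

end Paths

end IteratedTensor

end IntEnr

namespace IntEnr

namespace IteratedTensor

variable {E : Type u} [Category.{v} E] [HasPullbacks E] [CartesianMonoidalCategory E]
  {fc : IGraph E ⥤ ICat E} {adj : fc ⊣ ICat.forgetGraph E} {V : IMonCat E}
  {τ : IteratedTensor adj V}

theorem wordMul_listTri {S : E} (l m : S ⟶ Word adj τ.Arrows) :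
    wordMul adj l m ≫ τ.listTri = τ.triMul (l ≫ τ.listTri) (m ≫ τ.listTri) :=
  (τ.arrowsProd.map_cmp _ _ _).trans (τ.triCat_cmp _ _ _)

theorem wordNil_listTri (S : E) :
    (toUnit S ≫ wordNil adj τ.Arrows) ≫ τ.listTri = τ.triOne S := by
  have h : (fc.obj (bouquet τ.Arrows)).ident ≫ τ.listTri = _ := τ.arrowsProd.map_ident
  rw [wordNil, Category.assoc, Category.assoc]
  refine (congrArg (fun t => toUnit S ≫ unitVert adj (bouquet τ.Arrows) ≫ t) h).trans ?_
  rw [← Category.assoc, ← Category.assoc]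
  exact τ.comp_triOne _

/-- The monoidal product of a list of two unary arrows. -/
theorem pair_listTri_arr {S : E} (p q : S ⟶ τ.Arrows) {l m : S ⟶ Word adj V.obj} {a b : V.El S}
    (f : τ.foldEl l ⟶ a) (g : τ.foldEl m ⟶ b)
    (hl : p ≫ τ.arrowsWord = l) (hm : q ≫ τ.arrowsWord = m)
    (hf : p ≫ τ.arrowsArr = f.arr) (hg : q ≫ τ.arrowsArr = g.arr) :
    (wordMul adj (p ≫ wordSing adj τ.Arrows) (q ≫ wordSing adj τ.Arrows) ≫ τ.listTri) ≫ τ.triArr =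
      ((τ.mulEl l m).inv ≫ (f ⊗ₘ g) ≫ (pairEl τ a b).hom).arr := by
  have hfa : p ≫ τ.arrowsArr ≫ V.tgt = a.pt := by rw [← Category.assoc, hf, f.tgt]
  have hga : q ≫ τ.arrowsArr ≫ V.tgt = b.pt := by rw [← Category.assoc, hg, g.tgt]
  have ef : τ.arrowsHomOf p hl hfa = f := ICat.el_ext hf
  have eg : τ.arrowsHomOf q hm hga = g := ICat.el_ext hg
  rw [wordMul_listTri, Category.assoc, Category.assoc, wordSing_listTri,
    τ.triMul_arr_of (p ≫ τ.pairTri) (q ≫ τ.pairTri) (τ.arrowsHomOf p hl hfa ≫ (τ.singEl a).inv)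
      (τ.arrowsHomOf q hm hga ≫ (τ.singEl b).inv)
      (by rw [Category.assoc, pairTri_dom, hl])
      (by rw [Category.assoc, pairTri_cod, reassoc_of% hfa])
      (τ.pairTri_arr p hl hfa)
      (by rw [Category.assoc, pairTri_dom, hm])
      (by rw [Category.assoc, pairTri_cod, reassoc_of% hga])
      (τ.pairTri_arr q hm hga), ef, eg]
  refine congrArg ICat.ElHom.arr (congrArg ((τ.mulEl l m).inv ≫ ·) ?_)
  change _ = (f ⊗ₘ g) ≫ ((τ.singEl a).inv ⊗ₘ (τ.singEl b).inv) ≫ _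
  rw [MonoidalCategory.tensorHom_comp_tensorHom_assoc]

/-! ### The axioms of the enriched category of an enriched multicategory -/

section Paths

variable {hM : τ.multicatData.IsMulticat} (X : EnrichedMulticat adj (τ.multicat hM))

theorem listSing_concat : listSing X ≫ (listConcat X).mor = 𝟙 _ := unitEdge_counit adj (Path X)

/-- The ends of a path. -/
noncomputable def pathEnds : (Path X).mor ⟶ X.obj ⊗ X.obj := (pathEval X).mor

theorem pathEnds_eq :
    pathEnds X = lift ((Path X).src ≫ pathObj X) ((Path X).tgt ≫ pathObj X) := pathEval_mor X

theorem listSing_ends : listSing X ≫ (listEnds X).mor = pathEnds X ≫ pathEdge X :=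
  unitEdge_naturality adj ((ICat.forgetGraph E).map (pathEval X))

theorem listSing_arrows : listSing X ≫ (listArrows X).mor = pathArrow X ≫ wordSing adj τ.Arrows :=
  unitEdge_map_bouquet adj (pathGraphHom X) rfl

/-- The inclusion of the vertices in the free internal category on the graph of paths. -/
noncomputable def listVert : (Path X).obj ⟶ (PathList X).obj :=
  unitVert adj ((ICat.forgetGraph E).obj (Path X))

theorem listSing_src : listSing X ≫ (PathList X).src = (Path X).src ≫ listVert X :=
  unitEdge_src adj _

theorem listSing_tgt : listSing X ≫ (PathList X).tgt = (Path X).tgt ≫ listVert X :=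
  unitEdge_tgt adj _

theorem listSing_src_tgt {S : E} {u v : S ⟶ (Path X).mor}
    (h : u ≫ (Path X).src = v ≫ (Path X).tgt) :
    (u ≫ listSing X) ≫ (PathList X).src = (v ≫ listSing X) ≫ (PathList X).tgt := by
  rw [Category.assoc, Category.assoc, listSing_src, listSing_tgt, ← Category.assoc,
    ← Category.assoc, h]

theorem path_ends {S : E} (u : S ⟶ (Path X).mor) {x y : S ⟶ X.obj}
    (hx : u ≫ (Path X).src ≫ pathObj X = x) (hy : u ≫ (Path X).tgt ≫ pathObj X = y) :
    u ≫ pathEnds X = lift x y := by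
  rw [pathEnds_eq, comp_lift, hx, hy]

/-- The action on a composite of paths is determined by the composition of the enriched
category. -/
theorem pathHom_cmp {S : E} (u v : S ⟶ (Path X).mor) (h : u ≫ (Path X).src = v ≫ (Path X).tgt)
    {l m : S ⟶ Word adj V.obj} {x₀ x₁ x₂ : S ⟶ X.obj} (hl : u ≫ (pathWord X).mor = l)
    (hm : v ≫ (pathWord X).mor = m) (h₀ : v ≫ (Path X).src ≫ pathObj X = x₀)
    (h₁ : v ≫ (Path X).tgt ≫ pathObj X = x₁) (h₁' : u ≫ (Path X).src ≫ pathObj X = x₁)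
    (h₂ : u ≫ (Path X).tgt ≫ pathObj X = x₂) :
    ((Path X).cmp u v h ≫ pathArrow X) ≫ τ.arrowsArr =
      (τ.foldComp (vData_isTyped X) (pathHom X u hl h₁' h₂) (pathHom X v hm h₀ h₁)).arr := by
  -- The list of the two paths `u` and `v`: its concatenation is the composite path, and the path of
  -- its ends has length two.
  let w := (PathList X).cmp (u ≫ listSing X) (v ≫ listSing X) (listSing_src_tgt X h)
  have w₁ : w ≫ (listConcat X).mor = (Path X).cmp u v h := by
    refine ((listConcat X).map_cmp _ _ _).trans ((Path X).cmp_congr _ ?_ ?_)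
    · rw [Category.assoc, listSing_concat, Category.comp_id]
    · rw [Category.assoc, listSing_concat, Category.comp_id]
  have w₂ : w ≫ (listEnds X).mor = twoPath X x₀ x₁ x₂ := by
    refine ((listEnds X).map_cmp _ _ _).trans ((Path X).cmp_congr _ ?_ ?_)
    · rw [Category.assoc, listSing_ends, ← Category.assoc, path_ends X u h₁' h₂, onePath]
    · rw [Category.assoc, listSing_ends, ← Category.assoc, path_ends X v h₀ h₁, onePath]
  have w₃ : w ≫ (listArrows X).mor = wordMul adj ((u ≫ pathArrow X) ≫ wordSing adj τ.Arrows)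
      ((v ≫ pathArrow X) ≫ wordSing adj τ.Arrows) := by
    refine ((listArrows X).map_cmp _ _ _).trans (ICatData.cmp_congr _ _ ?_ ?_)
    · rw [Category.assoc, listSing_arrows, Category.assoc]
    · rw [Category.assoc, listSing_arrows, Category.assoc]
  rw [← w₁, Category.assoc w, listConcat_arrow, comp_arrowsComp,
    τ.arrowsComp_congr _ ((Category.assoc _ _ _).symm.trans (congrArg (· ≫ pathArrow X) w₂)) w₃,
    τ.arrowsComp_arr_of _ _ _ _ (twoPathHom X x₀ x₁ x₂)
      (pair_listTri_arr _ _ (pathHom X u hl h₁' h₂) (pathHom X v hm h₀ h₁)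
        (by rw [Category.assoc, pathArrow_word, hl]) (by rw [Category.assoc, pathArrow_word, hm])
        rfl rfl) rfl]
  have e : τ.foldComp (vData_isTyped X) (pathHom X u hl h₁' h₂) (pathHom X v hm h₀ h₁) =
      (τ.mulEl _ _).inv ≫ (_ ⊗ₘ _) ≫ _ ≫ _ := congrArg (fun t => (τ.mulEl _ _).inv ≫ (_ ⊗ₘ _) ≫ t)
        (vData_compHom X x₀ x₁ x₂)
  rw [e]
  simp only [Category.assoc]

theorem onePath_word {S : E} (x y : S ⟶ X.obj) :
    onePath X x y ≫ (pathWord X).mor = ((vData X).homEl x y).pt ≫ wordSing adj V.obj :=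
  onePath_map X x y

theorem onePathHom {S : E} (x y : S ⟶ X.obj) :
    pathHom X (onePath X x y) (onePath_word X x y) (onePath_src_obj X x y)
      (onePath_tgt_obj X x y) = (τ.singEl ((vData X).homEl x y)).hom :=
  ICat.el_ext (onePath_arr X x y)

theorem onePath_composable {S : E} (x₀ x₁ x₂ : S ⟶ X.obj) :
    onePath X x₁ x₂ ≫ (Path X).src = onePath X x₀ x₁ ≫ (Path X).tgt := by
  rw [onePath_src, onePath_tgt]

/-- The action on paths of length two is the composition. -/
theorem twoPathHom_eq {S : E} (x₀ x₁ x₂ : S ⟶ X.obj) :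
    twoPathHom X x₀ x₁ x₂ =
      τ.foldComp (vData_isTyped X) (τ.singEl ((vData X).homEl x₁ x₂)).hom
        (τ.singEl ((vData X).homEl x₀ x₁)).hom := by
  rw [← onePathHom, ← onePathHom]
  exact ICat.el_ext (pathHom_cmp X _ _ _ _ _ _ _ _ _)

/-- Both sides are the action on the path `x₀, x₁, x₂, x₃`, by associativity of concatenation. -/
theorem foldComp_assoc_onePath {S : E} (x₀ x₁ x₂ x₃ : S ⟶ X.obj) :
    (τ.foldComp (vData_isTyped X) (τ.foldComp (vData_isTyped X)
      (τ.singEl ((vData X).homEl x₂ x₃)).hom (τ.singEl ((vData X).homEl x₁ x₂)).hom)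
      (τ.singEl ((vData X).homEl x₀ x₁)).hom).arr =
    (τ.foldComp (vData_isTyped X) (τ.singEl ((vData X).homEl x₂ x₃)).hom
      (τ.foldComp (vData_isTyped X) (τ.singEl ((vData X).homEl x₁ x₂)).hom
        (τ.singEl ((vData X).homEl x₀ x₁)).hom)).arr := by
  have ha := onePath_composable X x₁ x₂ x₃
  have hb := onePath_composable X x₀ x₁ x₂
  have hab : (Path X).cmp (onePath X x₂ x₃) (onePath X x₁ x₂) ha ≫ (Path X).src =
      onePath X x₀ x₁ ≫ (Path X).tgt := by rw [(Path X).cmp_src, hb]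
  have hbc : onePath X x₂ x₃ ≫ (Path X).src =
      (Path X).cmp (onePath X x₁ x₂) (onePath X x₀ x₁) hb ≫ (Path X).tgt := by
    rw [(Path X).cmp_tgt, ha]
  have e := (Path X).cmp_assoc _ _ _ ha hb
  have e₁ := pathHom_cmp X _ _ hab (twoPath_word' X x₁ x₂ x₃) (onePath_word X x₀ x₁)
    (onePath_src_obj X x₀ x₁) (onePath_tgt_obj X x₀ x₁) (twoPath_src_obj X x₁ x₂ x₃)
    (twoPath_tgt_obj X x₁ x₂ x₃)
  have e₂ := pathHom_cmp X _ _ hbc (onePath_word X x₂ x₃) (twoPath_word' X x₀ x₁ x₂)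
    (twoPath_src_obj X x₀ x₁ x₂) (twoPath_tgt_obj X x₀ x₁ x₂) (onePath_src_obj X x₂ x₃)
    (onePath_tgt_obj X x₂ x₃)
  rw [← twoPathHom_eq, ← twoPathHom_eq, ← onePathHom, ← onePathHom]
  exact e₁.symm.trans ((congrArg (fun t => (t ≫ pathArrow X) ≫ τ.arrowsArr) e).trans e₂)

/-- Both sides are the action on the path `x₀, x₁`, which composition with the empty path at `x₁`
does not change. -/
theorem foldUnit_comp_onePath {S : E} (x₀ x₁ : S ⟶ X.obj) :
    (τ.foldComp (vData_isTyped X) (τ.foldUnit (vData_isTyped X) x₁)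
      (τ.singEl ((vData X).homEl x₀ x₁)).hom).arr = (τ.singEl ((vData X).homEl x₀ x₁)).hom.arr := by
  have h : emptyPath X x₁ ≫ (Path X).src = onePath X x₀ x₁ ≫ (Path X).tgt := by
    rw [emptyPath, onePath_tgt, Category.assoc, Category.assoc, (Path X).ident_src,
      Category.comp_id]
  rw [← emptyPathHom_eq, ← onePathHom]
  refine (pathHom_cmp X _ _ h _ _ _ _ _ _).symm.trans
    (congrArg (fun t => (t ≫ pathArrow X) ≫ τ.arrowsArr) ?_)
  refine Eq.trans ((Path X).cmp_congr _ ?_ rfl) ((Path X).id_cmp (onePath X x₀ x₁))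
  rw [emptyPath, ← Category.assoc, ← Category.assoc, onePath_tgt]

/-- Both sides are the action on the path `x₀, x₁`, which composition with the empty path at `x₀`
does not change. -/
theorem foldComp_unit_onePath {S : E} (x₀ x₁ : S ⟶ X.obj) :
    (τ.foldComp (vData_isTyped X) (τ.singEl ((vData X).homEl x₀ x₁)).hom
      (τ.foldUnit (vData_isTyped X) x₀)).arr = (τ.singEl ((vData X).homEl x₀ x₁)).hom.arr := by
  have h : onePath X x₀ x₁ ≫ (Path X).src = emptyPath X x₀ ≫ (Path X).tgt := by
    rw [emptyPath, onePath_src, Category.assoc, Category.assoc, (Path X).ident_tgt,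
      Category.comp_id]
  rw [← emptyPathHom_eq, ← onePathHom]
  refine (pathHom_cmp X _ _ h _ _ _ _ _ _).symm.trans
    (congrArg (fun t => (t ≫ pathArrow X) ≫ τ.arrowsArr) ?_)
  refine Eq.trans ((Path X).cmp_congr _ rfl ?_) ((Path X).cmp_id (onePath X x₀ x₁))
  rw [emptyPath, ← Category.assoc, ← Category.assoc, onePath_src]

/-- The `V`-enriched category of an enriched `Id`-multicategory satisfies the axioms: they are the
associativity and unit laws for paths, after cancellation of the isomorphisms `fold (v) ≅ v`. -/
theorem vData_isVCat : (vData X).IsVCat where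
  toIsTyped := vData_isTyped X
  assoc {S} x₀ x₁ x₂ x₃ := by
    have e := (foldComp_left τ (vData_isTyped X) _ _ _).symm.trans
      ((foldComp_assoc_onePath X x₀ x₁ x₂ x₃).trans
        (congrArg ICat.ElHom.arr (foldComp_right τ (vData_isTyped X) _ _ _)))
    have e' := (cancel_epi (τ.singEl ((vData X).homEl x₂ x₃) ⊗ᵢ
        (τ.singEl ((vData X).homEl x₁ x₂) ⊗ᵢ τ.singEl ((vData X).homEl x₀ x₁))).hom).1
      ((cancel_epi _).1 (ICat.el_ext e))
    exact (Iso.inv_comp_eq _).1 e'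
  id_comp {S} x₀ x₁ := by
    have e := (foldUnit_comp τ (vData_isTyped X) _).symm.trans
      ((foldUnit_comp_onePath X x₀ x₁).trans (congrArg ICat.ElHom.arr (Category.comp_id _).symm))
    have e' := (cancel_epi _).1 (ICat.el_ext e)
    exact ((Iso.inv_comp_eq _).1 e').trans (Category.comp_id _)
  comp_id {S} x₀ x₁ := by
    have e := (comp_foldUnit τ (vData_isTyped X) _).symm.trans
      ((foldComp_unit_onePath X x₀ x₁).trans (congrArg ICat.ElHom.arr (Category.comp_id _).symm))
    have e' := (cancel_epi _).1 (ICat.el_ext e)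
    exact ((Iso.inv_comp_eq _).1 e').trans (Category.comp_id _)

end Paths

end IteratedTensor

end IntEnr

namespace IntEnr

namespace IteratedTensor

variable {E : Type u} [Category.{v} E] [HasPullbacks E] [CartesianMonoidalCategory E]
  {fc : IGraph E ⥤ ICat E} {adj : fc ⊣ ICat.forgetGraph E} {V : IMonCat E}
  {τ : IteratedTensor adj V} {hM : τ.multicatData.IsMulticat}
  {X Y : EnrichedMulticat adj (τ.multicat hM)}

/-! ### Transformations as natural families of unary arrows -/

section Family

variable (X Y)

/-- The action on paths of an arrow on objects. -/
noncomputable def pathMap (f : X.obj ⟶ Y.obj) : (Path X).mor ⟶ (Path Y).mor :=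
  (fc.map ((ICat.forgetGraph E).map (Ind.map f))).mor

/-- The list of the components of a family along a path. -/
noncomputable def familyFunctor (t : X.obj ⊗ X.obj ⟶ τ.Arrows) :
    Path X ⟶ fc.obj (bouquet τ.Arrows) :=
  fc.map (toBouquet ((ICat.forgetGraph E).obj (Ind X.obj)) t)

/-- The list of the components of a family along a path, on arrows. -/
noncomputable def familyList (t : X.obj ⊗ X.obj ⟶ τ.Arrows) :
    (Path X).mor ⟶ Word adj τ.Arrows := (familyFunctor X t).mor

theorem pathEdge_familyList (t : X.obj ⊗ X.obj ⟶ τ.Arrows) :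
    pathEdge X ≫ familyList X t = t ≫ wordSing adj τ.Arrows :=
  unitEdge_map_bouquet adj _ rfl

theorem onePath_familyList (t : X.obj ⊗ X.obj ⟶ τ.Arrows) {S : E} (x y : S ⟶ X.obj) :
    onePath X x y ≫ familyList X t = (lift x y ≫ t) ≫ wordSing adj τ.Arrows := by
  rw [onePath, Category.assoc, pathEdge_familyList, Category.assoc]

theorem twoPath_familyList (t : X.obj ⊗ X.obj ⟶ τ.Arrows) {S : E} (x₀ x₁ x₂ : S ⟶ X.obj) :
    twoPath X x₀ x₁ x₂ ≫ familyList X t =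
      wordMul adj ((lift x₁ x₂ ≫ t) ≫ wordSing adj τ.Arrows)
        ((lift x₀ x₁ ≫ t) ≫ wordSing adj τ.Arrows) :=
  ((familyFunctor X t).map_cmp _ _ _).trans (ICatData.cmp_congr _ _ (onePath_familyList X t _ _)
    (onePath_familyList X t _ _))

theorem emptyPath_familyList (t : X.obj ⊗ X.obj ⟶ τ.Arrows) {S : E} (x : S ⟶ X.obj) :
    emptyPath X x ≫ familyList X t = toUnit S ≫ wordNil adj τ.Arrows := by
  have e : (Path X).ident ≫ familyList X t = _ := (familyFunctor X t).map_ident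
  rw [emptyPath, Category.assoc, Category.assoc, e, wordNil, ← Category.assoc, ← Category.assoc,
    ← Category.assoc]
  exact congrArg (· ≫ (fc.obj (bouquet τ.Arrows)).ident) (bouquet_obj_unique adj _ _ _)

theorem pathEdge_pathMap (f : X.obj ⟶ Y.obj) :
    pathEdge X ≫ pathMap X Y f = (f ⊗ₘ f) ≫ pathEdge Y := unitEdge_naturality adj _

theorem onePath_pathMap (f : X.obj ⟶ Y.obj) {S : E} (x y : S ⟶ X.obj) :
    onePath X x y ≫ pathMap X Y f = onePath Y (x ≫ f) (y ≫ f) := by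
  rw [onePath, onePath, Category.assoc, pathEdge_pathMap, ← Category.assoc, lift_map]

theorem twoPath_pathMap (f : X.obj ⟶ Y.obj) {S : E} (x₀ x₁ x₂ : S ⟶ X.obj) :
    twoPath X x₀ x₁ x₂ ≫ pathMap X Y f = twoPath Y (x₀ ≫ f) (x₁ ≫ f) (x₂ ≫ f) :=
  ((fc.map ((ICat.forgetGraph E).map (Ind.map f))).map_cmp _ _ _).trans
    ((Path Y).cmp_congr _ (onePath_pathMap X Y f _ _) (onePath_pathMap X Y f _ _))

theorem emptyPath_pathMap (f : X.obj ⟶ Y.obj) {S : E} (x : S ⟶ X.obj) :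
    emptyPath X x ≫ pathMap X Y f = emptyPath Y (x ≫ f) := by
  have e : (Path X).ident ≫ pathMap X Y f = _ :=
    (fc.map ((ICat.forgetGraph E).map (Ind.map f))).map_ident
  have e' : pathVert X ≫ (fc.map ((ICat.forgetGraph E).map (Ind.map f))).obj = f ≫ pathVert Y :=
    unitVert_naturality adj _
  rw [emptyPath, emptyPath, Category.assoc, Category.assoc, e, reassoc_of% e', Category.assoc]

variable {X Y}

theorem comp_pathArrow_listTri {S : E} (u : S ⟶ (Path X).mor) :
    (u ≫ pathArrow X ≫ wordSing adj τ.Arrows) ≫ τ.listTri = (u ≫ pathArrow X) ≫ τ.pairTri := by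
  rw [Category.assoc, Category.assoc, wordSing_listTri, Category.assoc]

/-- The arrow `t` is a family of unary arrows `t(x, y) : fold (X(x, y)) ⟶ Y(f x, f y)`: its words
are the words of length one `(X(x, y))`, and its targets are the `Y(f x, f y)`. -/
structure IsFamily (f : X.obj ⟶ Y.obj) (t : X.obj ⊗ X.obj ⟶ τ.Arrows) : Prop where
  word : t ≫ τ.arrowsWord = vHom X ≫ wordSing adj V.obj
  tgt : t ≫ τ.arrowsArr ≫ V.tgt = (f ⊗ₘ f) ≫ vHom Y

namespace IsFamily

variable {f : X.obj ⟶ Y.obj} {t : X.obj ⊗ X.obj ⟶ τ.Arrows} (h : IsFamily f t)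

include h

theorem list_cod : familyList X t ≫ (fc.map τ.multicatTgt).mor =
    pathMap X Y f ≫ (pathWord Y).mor := by
  have e : familyFunctor X t ≫ fc.map τ.multicatTgt =
      fc.map ((ICat.forgetGraph E).map (Ind.map f)) ≫ pathWord Y := by
    exact (fc.map_comp _ _).symm.trans
      ((congrArg fc.map (bouquet_hom_ext h.tgt)).trans (fc.map_comp _ _))
  exact congrArg IFunctor.mor e

theorem listTri_cod : (familyList X t ≫ τ.listTri) ≫ τ.triCod =
    pathMap X Y f ≫ (pathWord Y).mor := by
  rw [Category.assoc, τ.listTri_cod, h.list_cod]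

theorem listTri_dom : (familyList X t ≫ τ.listTri) ≫ τ.triDom = (pathWord X).mor := by
  have e : familyFunctor X t ≫ τ.listWordFunctor = pathWord X := by
    apply functor_ext_of_unit adj (bouquet_obj_unique adj _ _ _)
    change pathEdge X ≫ familyList X t ≫ τ.listWordFunctor.mor = pathEdge X ≫ (pathWord X).mor
    rw [← Category.assoc, pathEdge_familyList, pathEdge_map, Category.assoc, wordSing_listWord,
      h.word]
  rw [Category.assoc, τ.listTri_dom]
  exact congrArg IFunctor.mor e

theorem left_aux : (pathEnds X ≫ t) ≫ τ.arrowsWord =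
    (pathArrow X ≫ wordSing adj τ.Arrows) ≫ (fc.map τ.multicatTgt).mor := by
  have e : wordSing adj τ.Arrows ≫ (fc.map τ.multicatTgt).mor =
      (τ.arrowsArr ≫ V.tgt) ≫ wordSing adj V.obj := unitEdge_map_bouquet adj _ rfl
  rw [Category.assoc, h.word, Category.assoc, e, ← Category.assoc, ← Category.assoc,
    pathArrow_tgt, pathEnds_eq]

theorem right_aux : (pathMap X Y f ≫ pathArrow Y) ≫ τ.arrowsWord =
    familyList X t ≫ (fc.map τ.multicatTgt).mor := by
  rw [Category.assoc, pathArrow_word, h.list_cod]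

/-- The component of a family at two objects. -/
noncomputable def hom {S : E} (x y : S ⟶ X.obj) :
    τ.foldEl (((vData X).homEl x y).pt ≫ wordSing adj V.obj) ⟶
      (vData Y).homEl (x ≫ f) (y ≫ f) :=
  τ.arrowsHomOf (lift x y ≫ t) (a := (vData Y).homEl (x ≫ f) (y ≫ f))
    (by rw [Category.assoc, h.word, ← Category.assoc]; rfl)
    (by rw [Category.assoc, h.tgt, ← Category.assoc, lift_map]; rfl)

theorem hom_arr {S : E} (x y : S ⟶ X.obj) :
    (h.hom x y).arr = (lift x y ≫ t) ≫ τ.arrowsArr := rfl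

/-- The monoidal product of the components of a family along a path. -/
noncomputable def prod {S : E} (u : S ⟶ (Path X).mor) {l m : S ⟶ Word adj V.obj}
    (hl : u ≫ (pathWord X).mor = l) (hm : (u ≫ pathMap X Y f) ≫ (pathWord Y).mor = m) :
    τ.foldEl l ⟶ τ.foldEl m :=
  τ.triHomOf (u ≫ familyList X t ≫ τ.listTri) (by rw [Category.assoc, h.listTri_dom, hl])
    (by rw [Category.assoc, h.listTri_cod, ← Category.assoc, hm])

theorem left_arr {S : E} (u : S ⟶ (Path X).mor) {l : S ⟶ Word adj V.obj}
    {x y : S ⟶ X.obj} (hl : u ≫ (pathWord X).mor = l) (hx : u ≫ (Path X).src ≫ pathObj X = x)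
    (hy : u ≫ (Path X).tgt ≫ pathObj X = y) :
    u ≫ τ.arrowsComp (pathEnds X ≫ t) (pathArrow X ≫ wordSing adj τ.Arrows) h.left_aux ≫
      τ.arrowsArr = (pathHom X u hl hx hy ≫ (τ.singEl _).inv ≫ h.hom x y).arr := by
  rw [← Category.assoc, comp_arrowsComp, ← Category.assoc (pathHom _ _ _ _ _)]
  apply τ.arrowsComp_arr_of
  · exact (congrArg (· ≫ τ.triArr) (comp_pathArrow_listTri u)).trans (τ.pairTri_arr _ _ _)
  · rw [← Category.assoc u, path_ends X u hx hy]; rfl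

theorem right_arr {S : E} (u : S ⟶ (Path X).mor) {l m : S ⟶ Word adj V.obj}
    {x y : S ⟶ Y.obj} (hl : u ≫ (pathWord X).mor = l)
    (hm : (u ≫ pathMap X Y f) ≫ (pathWord Y).mor = m)
    (hx : (u ≫ pathMap X Y f) ≫ (Path Y).src ≫ pathObj Y = x)
    (hy : (u ≫ pathMap X Y f) ≫ (Path Y).tgt ≫ pathObj Y = y) :
    u ≫ τ.arrowsComp (pathMap X Y f ≫ pathArrow Y) (familyList X t) h.right_aux ≫ τ.arrowsArr =
      (h.prod u hl hm ≫ pathHom Y (u ≫ pathMap X Y f) hm hx hy).arr := by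
  rw [← Category.assoc, comp_arrowsComp]
  apply τ.arrowsComp_arr_of
  · rw [Category.assoc u]; rfl
  · rw [← Category.assoc u]; rfl

end IsFamily

/-- Naturality of a family: for every path, the action of `X` followed by the component at the ends
equals the product of the components along the path followed by the action of `Y`. -/
def IsFamily.IsNatural {f : X.obj ⟶ Y.obj} {t : X.obj ⊗ X.obj ⟶ τ.Arrows}
    (h : IsFamily f t) : Prop :=
  τ.arrowsComp (pathEnds X ≫ t) (pathArrow X ≫ wordSing adj τ.Arrows) h.left_aux =
    τ.arrowsComp (pathMap X Y f ≫ pathArrow Y) (familyList X t) h.right_aux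

/-- Naturality of a family at a generalized path, as an equation in `V`. -/
theorem IsFamily.IsNatural.hom_eq {f : X.obj ⟶ Y.obj} {t : X.obj ⊗ X.obj ⟶ τ.Arrows}
    {h : IsFamily f t} (n : h.IsNatural) {S : E} (u : S ⟶ (Path X).mor) {l m : S ⟶ Word adj V.obj}
    {x y : S ⟶ X.obj} (hl : u ≫ (pathWord X).mor = l) (hx : u ≫ (Path X).src ≫ pathObj X = x)
    (hy : u ≫ (Path X).tgt ≫ pathObj X = y)
    (hm : (u ≫ pathMap X Y f) ≫ (pathWord Y).mor = m)
    (hx' : (u ≫ pathMap X Y f) ≫ (Path Y).src ≫ pathObj Y = x ≫ f)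
    (hy' : (u ≫ pathMap X Y f) ≫ (Path Y).tgt ≫ pathObj Y = y ≫ f) :
    pathHom X u hl hx hy ≫ (τ.singEl _).inv ≫ h.hom x y =
      h.prod u hl hm ≫ pathHom Y (u ≫ pathMap X Y f) hm hx' hy' :=
  ICat.el_ext ((h.left_arr u hl hx hy).symm.trans
    ((congrArg (fun t => u ≫ t ≫ τ.arrowsArr) n).trans (h.right_arr u hl hm hx' hy')))

theorem isFamily_vTrans (F : X ⟶ Y) : IsFamily (EnrichedMulticat.Functor.obj F) (vTrans F) where
  word := vTrans_word F
  tgt := congrArg IGraph.Hom.edge (EnrichedMulticat.Functor.trans F).app_tgt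

theorem isNatural_vTrans (F : X ⟶ Y) : (isFamily_vTrans F).IsNatural := by
  have h := congrArg IGraph.Hom.edge (EnrichedMulticat.Functor.trans F).naturality
  have e : familyList X (vTrans F) =
      (fc.map (EnrichedMulticat.Functor.trans F).app).mor :=
    congrArg (fun t => (fc.map t).mor) (bouquet_hom_ext rfl)
  refine Eq.trans (Eq.symm ?_) (h.trans ?_)
  · exact τ.multicat_cmp_edge rfl rfl _
  · exact τ.multicat_cmp_edge rfl ((Category.id_comp _).trans e.symm) _

/-- The transformation given by a natural family. -/
noncomputable def IsFamily.IsNatural.trans {f : X.obj ⟶ Y.obj} {t : X.obj ⊗ X.obj ⟶ τ.Arrows}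
    {h : IsFamily f t} (n : h.IsNatural) :
    MulticatTrans X.map ((IndP.map adj f).comp Y.map) where
  app := toBouquet ((ICat.forgetGraph E).obj (Ind X.obj)) t
  app_src := freeBouquet_hom_ext adj h.word
  app_tgt := bouquet_hom_ext h.tgt
  naturality := by
    apply bouquet_hom_ext
    refine (τ.multicat_cmp_edge rfl rfl h.left_aux).trans (Eq.trans n ?_)
    refine Eq.symm ?_
    exact τ.multicat_cmp_edge rfl (Category.id_comp _) h.right_aux

/-! ### The enriched functor of a natural family -/

/-- The passage from naturality on a path of length two, which involves the isomorphisms `s`, `s'`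
and `m` of the iterated tensor product, to compatibility with the composition of the enriched
categories. -/
theorem pair_comp (W : Type*) [Category W] [MonoidalCategory W] {a b c d a' b' c' P Z Z' : W}
    (s : a ⟶ b) (s' : c ⟶ d) (m : b ⊗ d ≅ P) (g : b ⟶ a') (g' : d ⟶ c')
    (p : P ⟶ Z) (k : Z ⟶ Z') (q : a' ⊗ c' ⟶ b') (r : b' ⟶ Z')
    (e : p ≫ k = (m.inv ≫ (g ⊗ₘ g') ≫ q) ≫ r) :
    (((s ⊗ₘ s') ≫ m.hom) ≫ p) ≫ k = ((s ≫ g) ⊗ₘ (s' ≫ g')) ≫ q ≫ r := by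
  rw [Category.assoc, e]
  simp only [Category.assoc, Iso.hom_inv_id_assoc, MonoidalCategory.tensorHom_comp_tensorHom_assoc]

namespace IsFamily

variable {f : X.obj ⟶ Y.obj} {t : X.obj ⊗ X.obj ⟶ τ.Arrows} (h : IsFamily f t)

theorem prod_twoPath {S : E} (x₀ x₁ x₂ : S ⟶ X.obj)
    (hm : (twoPath X x₀ x₁ x₂ ≫ pathMap X Y f) ≫ (pathWord Y).mor =
      wordMul adj (((vData Y).homEl (x₁ ≫ f) (x₂ ≫ f)).pt ≫ wordSing adj V.obj)
        (((vData Y).homEl (x₀ ≫ f) (x₁ ≫ f)).pt ≫ wordSing adj V.obj)) :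
    h.prod (twoPath X x₀ x₁ x₂) (twoPath_word' X x₀ x₁ x₂) hm =
      (τ.mulEl _ _).inv ≫ (h.hom x₁ x₂ ⊗ₘ h.hom x₀ x₁) ≫ (pairEl τ _ _).hom := by
  apply ICat.el_ext
  change (twoPath X x₀ x₁ x₂ ≫ familyList X t ≫ τ.listTri) ≫ τ.triArr = _
  rw [← Category.assoc (twoPath X x₀ x₁ x₂), twoPath_familyList]
  exact pair_listTri_arr _ _ (h.hom x₁ x₂) (h.hom x₀ x₁)
    (by rw [Category.assoc, h.word, ← Category.assoc]; rfl)
    (by rw [Category.assoc, h.word, ← Category.assoc]; rfl) rfl rfl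

theorem prod_emptyPath {S : E} (x : S ⟶ X.obj)
    (hm : (emptyPath X x ≫ pathMap X Y f) ≫ (pathWord Y).mor = toUnit S ≫ wordNil adj V.obj) :
    h.prod (emptyPath X x) (emptyPath_word' X x) hm = 𝟙 _ := by
  apply ICat.el_ext
  change (emptyPath X x ≫ familyList X t ≫ τ.listTri) ≫ τ.triArr = _
  rw [← Category.assoc (emptyPath X x), emptyPath_familyList, wordNil_listTri]
  exact τ.triOne_arr S

variable {h} (n : h.IsNatural)

include n

theorem IsNatural.twoPathHom {S : E} (x₀ x₁ x₂ : S ⟶ X.obj) :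
    twoPathHom X x₀ x₁ x₂ ≫ (τ.singEl _).inv ≫ h.hom x₀ x₂ =
      ((τ.mulEl _ _).inv ≫ (h.hom x₁ x₂ ⊗ₘ h.hom x₀ x₁) ≫ (pairEl τ _ _).hom) ≫
        twoPathHom Y (x₀ ≫ f) (x₁ ≫ f) (x₂ ≫ f) := by
  have e := twoPath_pathMap X Y f x₀ x₁ x₂
  have hm := (congrArg (· ≫ (pathWord Y).mor) e).trans (twoPath_word' Y _ _ _)
  have hx := (congrArg (· ≫ (Path Y).src ≫ pathObj Y) e).trans (twoPath_src_obj Y _ _ _)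
  have hy := (congrArg (· ≫ (Path Y).tgt ≫ pathObj Y) e).trans (twoPath_tgt_obj Y _ _ _)
  rw [← h.prod_twoPath x₀ x₁ x₂ hm]
  refine (n.hom_eq _ (twoPath_word' X x₀ x₁ x₂) (twoPath_src_obj X x₀ x₁ x₂)
    (twoPath_tgt_obj X x₀ x₁ x₂) hm hx hy).trans (congrArg (h.prod _ _ hm ≫ ·) ?_)
  exact ICat.el_ext (congrArg (fun t => (t ≫ pathArrow Y) ≫ τ.arrowsArr) e)

theorem IsNatural.emptyPathHom {S : E} (x : S ⟶ X.obj) :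
    emptyPathHom X x ≫ (τ.singEl _).inv ≫ h.hom x x = emptyPathHom Y (x ≫ f) := by
  have e := emptyPath_pathMap X Y f x
  have hm := (congrArg (· ≫ (pathWord Y).mor) e).trans (emptyPath_word' Y _)
  have hx := (congrArg (· ≫ (Path Y).src ≫ pathObj Y) e).trans (emptyPath_src_obj Y _)
  have hy := (congrArg (· ≫ (Path Y).tgt ≫ pathObj Y) e).trans (emptyPath_tgt_obj Y _)
  refine (n.hom_eq _ (emptyPath_word' X x) (emptyPath_src_obj X x)
    (emptyPath_tgt_obj X x) hm hx hy).trans ?_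
  rw [h.prod_emptyPath x hm, Category.id_comp]
  exact ICat.el_ext (congrArg (fun t => (t ≫ pathArrow Y) ≫ τ.arrowsArr) e)

theorem IsNatural.compHom {S : E} (x₀ x₁ x₂ : S ⟶ X.obj) :
    (vData_isTyped X).compHom x₀ x₁ x₂ ≫ (τ.singEl _).inv ≫ h.hom x₀ x₂ =
      (((τ.singEl _).inv ≫ h.hom x₁ x₂) ⊗ₘ ((τ.singEl _).inv ≫ h.hom x₀ x₁)) ≫
        (vData_isTyped Y).compHom (x₀ ≫ f) (x₁ ≫ f) (x₂ ≫ f) := by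
  refine (congrArg (· ≫ (τ.singEl _).inv ≫ h.hom x₀ x₂) (vData_compHom X x₀ x₁ x₂)).trans
    (Eq.trans ?_ (congrArg (_ ≫ ·) (vData_compHom Y _ _ _).symm))
  exact pair_comp (V.El S) _ _ _ _ _ _ _ _ _ (n.twoPathHom x₀ x₁ x₂)

theorem IsNatural.identHom {S : E} (x : S ⟶ X.obj) :
    (vData_isTyped X).identHom x ≫ (τ.singEl _).inv ≫ h.hom x x =
      (vData_isTyped Y).identHom (x ≫ f) := by
  refine (congrArg (· ≫ (τ.singEl _).inv ≫ h.hom x x) (vData_identHom X x)).trans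
    (Eq.trans ?_ (vData_identHom Y _).symm)
  exact (Category.assoc _ _ _).trans (congrArg ((τ.nilEl S).hom ≫ ·) (n.emptyPathHom x))

end IsFamily

theorem lift_vFunctorData_map (F : X ⟶ Y) {S : E} (x y : S ⟶ X.obj) :
    lift x y ≫ (vFunctorData F).map = ((τ.singEl _).inv ≫ (isFamily_vTrans F).hom x y).arr := by
  refine (V.comp_cmp _ _ _ _).trans (V.cmp_congr _ ?_ ?_)
  · exact (Category.assoc _ _ _).symm
  · exact comp_singEl_inv τ _ _

theorem vFunctorData_isTyped (F : X ⟶ Y) : (vFunctorData F).IsTyped where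
  map_src x y := (congrArg (· ≫ V.src) (lift_vFunctorData_map F x y)).trans (ICat.ElHom.src _)
  map_tgt x y := (congrArg (· ≫ V.tgt) (lift_vFunctorData_map F x y)).trans (ICat.ElHom.tgt _)

theorem vFunctorData_mapHom (F : X ⟶ Y) {S : E} (x y : S ⟶ X.obj) :
    (vFunctorData_isTyped F).mapHom x y = (τ.singEl _).inv ≫ (isFamily_vTrans F).hom x y :=
  ICat.el_ext (lift_vFunctorData_map F x y)

theorem vFunctorData_isVFunctor (F : X ⟶ Y) :
    VFunctorData.IsVFunctor (X := ⟨vData X, vData_isVCat X⟩) (Y := ⟨vData Y, vData_isVCat Y⟩)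
      (vFunctorData F) where
  toIsTyped := vFunctorData_isTyped F
  map_comp x₀ x₁ x₂ :=
    Eq.trans (congrArg (_ ≫ ·) (vFunctorData_mapHom F x₀ x₂))
      (((isNatural_vTrans F).compHom x₀ x₁ x₂).trans (congrArg (· ≫ _)
        (congrArg₂ (· ⊗ₘ ·) (vFunctorData_mapHom F x₁ x₂).symm
          (vFunctorData_mapHom F x₀ x₁).symm)))
  map_id x :=
    Eq.trans (congrArg (_ ≫ ·) (vFunctorData_mapHom F x x)) ((isNatural_vTrans F).identHom x)

theorem vFunctorData_map_eq (F : X ⟶ Y) : (vFunctorData F).map =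
    ((τ.singEl ((vData X).homEl (fst X.obj X.obj) (snd X.obj X.obj))).inv ≫
      (isFamily_vTrans F).hom (fst X.obj X.obj) (snd X.obj X.obj)).arr := by
  rw [← lift_vFunctorData_map]
  exact (Category.id_comp _).symm.trans (congrArg (· ≫ (vFunctorData F).map) lift_fst_snd.symm)

theorem vTrans_id (X : EnrichedMulticat adj (τ.multicat hM)) :
    vTrans (𝟙 X) = vHom X ≫ τ.arrowsId := rfl

theorem vTrans_id_hom {S : E} (x y : S ⟶ X.obj) :
    ((isFamily_vTrans (𝟙 X)).hom x y).arr = (τ.singEl ((vData X).homEl x y)).hom.arr := by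
  rw [IsFamily.hom_arr, vTrans_id, Category.assoc, Category.assoc, arrowsId_arr, singEl_hom_arr,
    ← Category.assoc]
  rfl

theorem vFunctorData_id (X : EnrichedMulticat adj (τ.multicat hM)) :
    vFunctorData (𝟙 X) = VFunctorData.id (vData X) := by
  refine VFunctorData.ext rfl ?_
  refine (vFunctorData_map_eq (𝟙 X)).trans ?_
  refine (ICat.comp_arr_congr rfl (vTrans_id_hom _ _)).trans ?_
  rw [Iso.inv_hom_id, ICat.el_id_arr]
  refine congrArg (· ≫ V.ident) ?_
  exact (congrArg (· ≫ vHom X) lift_fst_snd).trans (Category.id_comp _)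

section Comp

variable {Z : EnrichedMulticat adj (τ.multicat hM)} (F : X ⟶ Y) (G : Y ⟶ Z)

/-- The arrow on objects of a functor of enriched `Id`-multicategories. -/
abbrev vObj (F : X ⟶ Y) : X.obj ⟶ Y.obj := EnrichedMulticat.Functor.obj F

theorem vTrans_comp_aux : ((vObj F ⊗ₘ vObj F) ≫ vTrans G) ≫ τ.arrowsWord =
    (vTrans F ≫ wordSing adj τ.Arrows) ≫ (fc.map τ.multicatTgt).mor := by
  have e : wordSing adj τ.Arrows ≫ (fc.map τ.multicatTgt).mor =
      (τ.arrowsArr ≫ V.tgt) ≫ wordSing adj V.obj := unitEdge_map_bouquet adj _ rfl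
  rw [Category.assoc, vTrans_word, Category.assoc, e, ← Category.assoc, ← Category.assoc,
    (isFamily_vTrans F).tgt]

theorem vTrans_comp : vTrans (F ≫ G) =
    τ.arrowsComp ((vObj F ⊗ₘ vObj F) ≫ vTrans G) (vTrans F ≫ wordSing adj τ.Arrows)
      (vTrans_comp_aux F G) :=
  τ.multicat_cmp_edge rfl rfl _

theorem vTrans_comp_hom {S : E} (x y : S ⟶ X.obj) :
    ((isFamily_vTrans (F ≫ G)).hom x y).arr = (((isFamily_vTrans F).hom x y ≫ (τ.singEl _).inv) ≫
      (isFamily_vTrans G).hom (x ≫ vObj F) (y ≫ vObj F)).arr := by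
  rw [IsFamily.hom_arr, vTrans_comp, comp_arrowsComp]
  apply τ.arrowsComp_arr_of
  · have e : (lift x y ≫ vTrans F ≫ wordSing adj τ.Arrows) ≫ τ.listTri =
        (lift x y ≫ vTrans F) ≫ τ.pairTri := by
      rw [Category.assoc, Category.assoc, wordSing_listTri, Category.assoc]
    exact (congrArg (· ≫ τ.triArr) e).trans (τ.pairTri_arr _ _ _)
  · rw [← Category.assoc, lift_map]; rfl

theorem vFunctorData_comp : vFunctorData (F ≫ G) =
    (vFunctorData F).comp (vFunctorData G) (vFunctorData_isTyped F) (vFunctorData_isTyped G) := by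
  refine VFunctorData.ext rfl ?_
  refine (vFunctorData_map_eq (F ≫ G)).trans ((ICat.comp_arr_congr rfl
    (vTrans_comp_hom F G _ _)).trans ?_)
  refine Eq.trans ?_ (congrArg ICat.ElHom.arr (congrArg₂ (· ≫ ·)
    (vFunctorData_mapHom F (fst X.obj X.obj) (snd X.obj X.obj)).symm
    (vFunctorData_mapHom G (fst X.obj X.obj ≫ vObj F) (snd X.obj X.obj ≫ vObj F)).symm))
  have e {W : Type _} [Category.{v} W] {a b c d e : W} (f : a ⟶ b) (g : b ⟶ c) (h : c ⟶ d)
      (k : d ⟶ e) : f ≫ (g ≫ h) ≫ k = (f ≫ g) ≫ h ≫ k := by simp only [Category.assoc]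
  exact congrArg ICat.ElHom.arr (e _ _ _ _)

end Comp

end Family

/-! ### The functor to enriched categories -/

section Functor

variable (hM)

/-- The functor sending an enriched `Id`-multicategory to its `V`-enriched category. -/
noncomputable def enrichedFunctor : EnrichedMulticat adj (τ.multicat hM) ⥤ VCat V where
  obj X := ⟨vData X, vData_isVCat X⟩
  map F := ⟨vFunctorData F, vFunctorData_isVFunctor F⟩
  map_id X := VFunctor.ext (vFunctorData_id X)
  map_comp F G := VFunctor.ext (vFunctorData_comp F G)

/-- An enriched functor between the enriched categories determines the family of unary arrows. -/
instance : (enrichedFunctor hM).Faithful where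
  map_injective {X Y F G} h := by
    have hd : vFunctorData F = vFunctorData G := congrArg VFunctor.data h
    have ho : EnrichedMulticat.Functor.obj F = EnrichedMulticat.Functor.obj G :=
      congrArg VFunctorData.obj hd
    refine EnrichedMulticat.functor_ext ho (bouquet_hom_ext ?_)
    change vTrans F = vTrans G
    apply τ.arrows_ext
    · rw [vTrans_word, vTrans_word]
    · have key : ∀ H : X ⟶ Y, vTrans H ≫ τ.arrowsArr =
          ((τ.singEl ((vData X).homEl (fst X.obj X.obj) (snd X.obj X.obj))).hom ≫
            (vFunctorData_isTyped H).mapHom (fst X.obj X.obj) (snd X.obj X.obj)).arr := fun H => by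
        refine Eq.symm ((congrArg ICat.ElHom.arr ((congrArg (_ ≫ ·)
          (vFunctorData_mapHom H (fst X.obj X.obj) (snd X.obj X.obj))).trans
            (Iso.hom_inv_id_assoc _ _))).trans ?_)
        rw [IsFamily.hom_arr, lift_fst_snd, Category.id_comp]
      rw [key, key]
      exact ICat.comp_arr_congr rfl (congrArg (lift _ _ ≫ ·) (congrArg VFunctorData.map hd))

end Functor

end IteratedTensor

end IntEnr

namespace IntEnr

namespace IteratedTensor

variable {E : Type u} [Category.{v} E] [HasPullbacks E] [CartesianMonoidalCategory E]
  {fc : IGraph E ⥤ ICat E} {adj : fc ⊣ ICat.forgetGraph E} {V : IMonCat E}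
  (τ : IteratedTensor adj V)

/-! ### The internal category of arrows `fold l ⟶ Z(x, y)` of an enriched category -/

section Hom

variable (Z : VCat V)

theorem foldComp_assoc {S : E} {l m n : S ⟶ Word adj V.obj} {x₀ x₁ x₂ x₃ : S ⟶ Z.obj}
    (f : τ.foldEl l ⟶ Z.homEl x₂ x₃) (g : τ.foldEl m ⟶ Z.homEl x₁ x₂)
    (k : τ.foldEl n ⟶ Z.homEl x₀ x₁) :
    (τ.foldComp Z.isVCat.toIsTyped (τ.foldComp Z.isVCat.toIsTyped f g) k).arr =
      (τ.foldComp Z.isVCat.toIsTyped f (τ.foldComp Z.isVCat.toIsTyped g k)).arr := by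
  rw [foldComp_left, foldComp_right, Z.isVCat.assoc, Iso.inv_hom_id_assoc]

theorem foldUnit_foldComp {S : E} {l : S ⟶ Word adj V.obj} {x₀ x₁ : S ⟶ Z.obj}
    (f : τ.foldEl l ⟶ Z.homEl x₀ x₁) :
    (τ.foldComp Z.isVCat.toIsTyped (τ.foldUnit Z.isVCat.toIsTyped x₁) f).arr = f.arr := by
  rw [foldUnit_comp, Z.isVCat.id_comp, Iso.inv_hom_id, Category.comp_id]

theorem foldComp_foldUnit {S : E} {l : S ⟶ Word adj V.obj} {x₀ x₁ : S ⟶ Z.obj}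
    (f : τ.foldEl l ⟶ Z.homEl x₀ x₁) :
    (τ.foldComp Z.isVCat.toIsTyped f (τ.foldUnit Z.isVCat.toIsTyped x₀)).arr = f.arr := by
  rw [comp_foldUnit, Z.isVCat.comp_id, Iso.inv_hom_id, Category.comp_id]

/-- The object of quadruples `(l, x, y, f)` with `f : fold l ⟶ Z(x, y)`. -/
noncomputable abbrev HomArrows : E := pullback (τ.fold ⊗ₘ Z.hom) (lift V.src V.tgt)

/-- The word of a quadruple. -/
noncomputable def homWord : τ.HomArrows Z ⟶ Word adj V.obj := pullback.fst _ _ ≫ fst _ _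

/-- The domain object of a quadruple. -/
noncomputable def homDom : τ.HomArrows Z ⟶ Z.obj := pullback.fst _ _ ≫ snd _ _ ≫ fst _ _

/-- The codomain object of a quadruple. -/
noncomputable def homCod : τ.HomArrows Z ⟶ Z.obj := pullback.fst _ _ ≫ snd _ _ ≫ snd _ _

/-- The arrow of a quadruple. -/
noncomputable def homArr : τ.HomArrows Z ⟶ V.mor := pullback.snd _ _

theorem homArr_src : τ.homArr Z ≫ V.src = τ.homWord Z ≫ τ.fold := by
  have e := congrArg (· ≫ fst _ _) (pullback.condition (f := τ.fold ⊗ₘ Z.hom)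
    (g := lift V.src V.tgt))
  simp only [Category.assoc, lift_fst, tensorHom_fst] at e
  rw [homArr, homWord, Category.assoc]; exact e.symm

theorem homArr_tgt : τ.homArr Z ≫ V.tgt = lift (τ.homDom Z) (τ.homCod Z) ≫ Z.hom := by
  have e := congrArg (· ≫ snd _ _) (pullback.condition (f := τ.fold ⊗ₘ Z.hom)
    (g := lift V.src V.tgt))
  simp only [Category.assoc, lift_snd, tensorHom_snd] at e
  have d : lift (τ.homDom Z) (τ.homCod Z) = pullback.fst _ _ ≫ snd _ _ := by
    apply CartesianMonoidalCategory.hom_ext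
    · rw [lift_fst, homDom, Category.assoc]
    · rw [lift_snd, homCod, Category.assoc]
  rw [d, homArr, Category.assoc]; exact e.symm

variable {Z}

/-- The arrow of a generalized quadruple, with prescribed word and objects. -/
noncomputable def homHomOf {S : E} (p : S ⟶ τ.HomArrows Z) {l : S ⟶ Word adj V.obj}
    {x y : S ⟶ Z.obj} (hl : p ≫ τ.homWord Z = l) (hx : p ≫ τ.homDom Z = x)
    (hy : p ≫ τ.homCod Z = y) : τ.foldEl l ⟶ Z.homEl x y :=
  (⟨p ≫ τ.homArr Z, by rw [Category.assoc, homArr_src, ← Category.assoc, hl]; rfl,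
    by rw [Category.assoc, homArr_tgt, ← Category.assoc, comp_lift, hx, hy]; rfl⟩ : V.ElHom _ _)

/-- Construction of generalized quadruples. -/
noncomputable def homMk {S : E} (l : S ⟶ Word adj V.obj) (x y : S ⟶ Z.obj)
    (f : τ.foldEl l ⟶ Z.homEl x y) : S ⟶ τ.HomArrows Z :=
  pullback.lift (lift l (lift x y)) f.arr (by rw [lift_map, comp_lift, f.src, f.tgt]; rfl)

section

variable {S : E} (l : S ⟶ Word adj V.obj) (x y : S ⟶ Z.obj) (f : τ.foldEl l ⟶ Z.homEl x y)

theorem homMk_word : τ.homMk l x y f ≫ τ.homWord Z = l := by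
  rw [homMk, homWord, pullback.lift_fst_assoc, lift_fst]

theorem homMk_dom : τ.homMk l x y f ≫ τ.homDom Z = x := by
  rw [homMk, homDom, pullback.lift_fst_assoc, lift_snd_assoc, lift_fst]

theorem homMk_cod : τ.homMk l x y f ≫ τ.homCod Z = y := by
  rw [homMk, homCod, pullback.lift_fst_assoc, lift_snd_assoc, lift_snd]

theorem homMk_arr : τ.homMk l x y f ≫ τ.homArr Z = f.arr := pullback.lift_snd _ _ _

end

theorem homArrows_ext {S : E} {p q : S ⟶ τ.HomArrows Z} (h₁ : p ≫ τ.homWord Z = q ≫ τ.homWord Z)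
    (h₂ : p ≫ τ.homDom Z = q ≫ τ.homDom Z) (h₃ : p ≫ τ.homCod Z = q ≫ τ.homCod Z)
    (h₄ : p ≫ τ.homArr Z = q ≫ τ.homArr Z) : p = q := by
  apply pullback.hom_ext
  · apply CartesianMonoidalCategory.hom_ext
    · rw [Category.assoc, Category.assoc]; exact h₁
    · apply CartesianMonoidalCategory.hom_ext
      · rw [Category.assoc, Category.assoc, Category.assoc, Category.assoc]; exact h₂
      · rw [Category.assoc, Category.assoc, Category.assoc, Category.assoc]; exact h₃
  · exact h₄

/-- Composition of quadruples. -/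
noncomputable def homMul {S : E} (p q : S ⟶ τ.HomArrows Z) (h : p ≫ τ.homDom Z = q ≫ τ.homCod Z) :
    S ⟶ τ.HomArrows Z :=
  τ.homMk (wordMul adj (p ≫ τ.homWord Z) (q ≫ τ.homWord Z)) (q ≫ τ.homDom Z) (p ≫ τ.homCod Z)
    (τ.foldComp Z.isVCat.toIsTyped (τ.homHomOf p rfl h rfl) (τ.homHomOf q rfl rfl rfl))

/-- The identity quadruples. -/
noncomputable def homOne {S : E} (x : S ⟶ Z.obj) : S ⟶ τ.HomArrows Z :=
  τ.homMk (toUnit S ≫ wordNil adj V.obj) x x (τ.foldUnit Z.isVCat.toIsTyped x)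

section

variable {S : E} (p q : S ⟶ τ.HomArrows Z) (h : p ≫ τ.homDom Z = q ≫ τ.homCod Z)

theorem homMul_word :
    τ.homMul p q h ≫ τ.homWord Z = wordMul adj (p ≫ τ.homWord Z) (q ≫ τ.homWord Z) :=
  τ.homMk_word _ _ _ _

theorem homMul_dom : τ.homMul p q h ≫ τ.homDom Z = q ≫ τ.homDom Z := τ.homMk_dom _ _ _ _

theorem homMul_cod : τ.homMul p q h ≫ τ.homCod Z = p ≫ τ.homCod Z := τ.homMk_cod _ _ _ _

/-- The arrow of a composite, computed from freely chosen representatives. -/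
theorem homMul_arr_of {l m : S ⟶ Word adj V.obj} {x₀ x₁ x₂ : S ⟶ Z.obj}
    (f : τ.foldEl l ⟶ Z.homEl x₁ x₂) (g : τ.foldEl m ⟶ Z.homEl x₀ x₁)
    (hl : p ≫ τ.homWord Z = l) (hx : p ≫ τ.homDom Z = x₁) (hy : p ≫ τ.homCod Z = x₂)
    (hf : p ≫ τ.homArr Z = f.arr) (hm : q ≫ τ.homWord Z = m) (hx' : q ≫ τ.homDom Z = x₀)
    (hg : q ≫ τ.homArr Z = g.arr) :
    τ.homMul p q h ≫ τ.homArr Z = (τ.foldComp Z.isVCat.toIsTyped f g).arr :=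
  (τ.homMk_arr _ _ _ _).trans (τ.foldComp_arr_congr _ hl hm hx' (h.symm.trans hx) hy hf hg)

end

theorem homOne_word {S : E} (x : S ⟶ Z.obj) :
    τ.homOne x ≫ τ.homWord Z = toUnit S ≫ wordNil adj V.obj := τ.homMk_word _ _ _ _

theorem homOne_dom {S : E} (x : S ⟶ Z.obj) : τ.homOne x ≫ τ.homDom Z = x := τ.homMk_dom _ _ _ _

theorem homOne_cod {S : E} (x : S ⟶ Z.obj) : τ.homOne x ≫ τ.homCod Z = x := τ.homMk_cod _ _ _ _

theorem homOne_arr {S : E} (x : S ⟶ Z.obj) :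
    τ.homOne x ≫ τ.homArr Z = (τ.foldUnit Z.isVCat.toIsTyped x).arr := τ.homMk_arr _ _ _ _

theorem comp_homMul {S S' : E} (z : S' ⟶ S) (p q : S ⟶ τ.HomArrows Z)
    (h : p ≫ τ.homDom Z = q ≫ τ.homCod Z) :
    z ≫ τ.homMul p q h =
      τ.homMul (z ≫ p) (z ≫ q) (by rw [Category.assoc, h, Category.assoc]) := by
  apply τ.homArrows_ext
  · rw [Category.assoc, homMul_word, homMul_word, comp_wordMul, Category.assoc, Category.assoc]
  · rw [Category.assoc, homMul_dom, homMul_dom, Category.assoc]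
  · rw [Category.assoc, homMul_cod, homMul_cod, Category.assoc]
  · rw [Category.assoc, τ.homMul_arr_of p q h (τ.homHomOf p rfl h rfl) (τ.homHomOf q rfl rfl rfl)
      rfl h rfl rfl rfl rfl rfl]
    refine (τ.comp_foldComp_arr _ z (τ.homHomOf p rfl h rfl) (τ.homHomOf q rfl rfl rfl)
      (τ.homHomOf (z ≫ p) rfl (Category.assoc _ _ _) rfl)
      (τ.homHomOf (z ≫ q) rfl rfl (by rw [h, Category.assoc])) (Category.assoc _ _ _).symm
      (Category.assoc _ _ _).symm (Category.assoc _ _ _).symm (by rw [h])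
      (Category.assoc _ _ _).symm (Category.assoc _ _ _).symm (Category.assoc _ _ _).symm).trans ?_
    exact (τ.homMul_arr_of _ _ _ _ _ rfl (by rw [Category.assoc]) rfl rfl rfl rfl rfl).symm

theorem comp_homOne {S S' : E} (z : S' ⟶ S) (x : S ⟶ Z.obj) :
    z ≫ τ.homOne x = τ.homOne (z ≫ x) := by
  apply τ.homArrows_ext
  · rw [Category.assoc, homOne_word, homOne_word, comp_nil]
  · rw [Category.assoc, homOne_dom, homOne_dom]
  · rw [Category.assoc, homOne_cod, homOne_cod]
  · rw [Category.assoc, homOne_arr, homOne_arr, comp_foldUnit_arr]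

theorem homMul_congr {S : E} {p q p' q' : S ⟶ τ.HomArrows Z}
    (h : p ≫ τ.homDom Z = q ≫ τ.homCod Z) (hp : p = p') (hq : q = q') :
    τ.homMul p q h = τ.homMul p' q' (by rw [← hp, ← hq, h]) := by
  subst hp hq; rfl

theorem homOne_mul {S : E} (p : S ⟶ τ.HomArrows Z) (h : τ.homOne (p ≫ τ.homCod Z) ≫ τ.homDom Z =
    p ≫ τ.homCod Z) : τ.homMul (τ.homOne (p ≫ τ.homCod Z)) p h = p := by
  apply τ.homArrows_ext
  · rw [homMul_word, homOne_word, nil_wordMul]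
  · rw [homMul_dom]
  · rw [homMul_cod, homOne_cod]
  · rw [τ.homMul_arr_of _ _ h _ (τ.homHomOf p rfl rfl rfl) (τ.homOne_word _) (τ.homOne_dom _)
      (τ.homOne_cod _) (τ.homOne_arr _) rfl rfl rfl, foldUnit_foldComp]
    rfl

theorem homMul_one {S : E} (p : S ⟶ τ.HomArrows Z) (h : p ≫ τ.homDom Z =
    τ.homOne (p ≫ τ.homDom Z) ≫ τ.homCod Z) : τ.homMul p (τ.homOne (p ≫ τ.homDom Z)) h = p := by
  apply τ.homArrows_ext
  · rw [homMul_word, homOne_word, wordMul_nil]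
  · rw [homMul_dom, homOne_dom]
  · rw [homMul_cod]
  · rw [τ.homMul_arr_of _ _ h (τ.homHomOf p rfl rfl rfl) _ rfl rfl rfl rfl (τ.homOne_word _)
      (τ.homOne_dom _) (τ.homOne_arr _), foldComp_foldUnit]
    rfl

theorem homMul_assoc {S : E} (p q r : S ⟶ τ.HomArrows Z) (h : p ≫ τ.homDom Z = q ≫ τ.homCod Z)
    (h' : q ≫ τ.homDom Z = r ≫ τ.homCod Z) (h₁ : τ.homMul p q h ≫ τ.homDom Z = r ≫ τ.homCod Z)
    (h₂ : p ≫ τ.homDom Z = τ.homMul q r h' ≫ τ.homCod Z) :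
    τ.homMul (τ.homMul p q h) r h₁ = τ.homMul p (τ.homMul q r h') h₂ := by
  apply τ.homArrows_ext
  · simp only [homMul_word, wordMul_assoc]
  · simp only [homMul_dom]
  · simp only [homMul_cod]
  · rw [τ.homMul_arr_of (τ.homMul p q h) r h₁ _ (τ.homHomOf r rfl rfl h'.symm)
      (τ.homMul_word _ _ _) (τ.homMul_dom _ _ _) (τ.homMul_cod _ _ _)
      (τ.homMul_arr_of p q h (τ.homHomOf p rfl h rfl) (τ.homHomOf q rfl rfl rfl) rfl h rfl rfl rfl
        rfl rfl) rfl rfl rfl,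
      τ.homMul_arr_of p (τ.homMul q r h') h₂ (τ.homHomOf p rfl h rfl) _ rfl h rfl rfl
      (τ.homMul_word _ _ _) (τ.homMul_dom _ _ _)
      (τ.homMul_arr_of q r h' (τ.homHomOf q rfl rfl rfl) (τ.homHomOf r rfl rfl h'.symm) rfl rfl rfl
        rfl rfl rfl rfl), foldComp_assoc]

variable (Z)

/-- The internal category with the objects of `Z` as objects, in which an arrow from `x` to `y` is a
word `l` with an arrow `fold l ⟶ Z(x, y)`. -/
noncomputable abbrev homCat : ICat E where
  obj := Z.obj
  mor := τ.HomArrows Z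
  src := τ.homDom Z
  tgt := τ.homCod Z
  ident := τ.homOne (𝟙 Z.obj)
  comp := τ.homMul (pullback.fst _ _) (pullback.snd _ _) pullback.condition
  ident_src := τ.homOne_dom _
  ident_tgt := τ.homOne_cod _
  comp_src := τ.homMul_dom _ _ _
  comp_tgt := τ.homMul_cod _ _ _
  cmp_id f := by
    dsimp only [ICatData.cmp]
    rw [comp_homMul, τ.homMul_congr _ (pullback.lift_fst _ _ _) (pullback.lift_snd _ _ _),
      τ.homMul_congr _ rfl ((congrArg (f ≫ ·) (τ.comp_homOne _ _)).trans (τ.comp_homOne _ _)),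
      τ.homMul_congr _ rfl (congrArg τ.homOne
        ((congrArg (f ≫ ·) (Category.comp_id _)) : f ≫ τ.homDom Z ≫ 𝟙 _ = _)), homMul_one]
  id_cmp f := by
    dsimp only [ICatData.cmp]
    rw [comp_homMul, τ.homMul_congr _ (pullback.lift_fst _ _ _) (pullback.lift_snd _ _ _),
      τ.homMul_congr _ ((congrArg (f ≫ ·) (τ.comp_homOne _ _)).trans (τ.comp_homOne _ _)) rfl,
      τ.homMul_congr _ (congrArg τ.homOne
        ((congrArg (f ≫ ·) (Category.comp_id _)) : f ≫ τ.homCod Z ≫ 𝟙 _ = _)) rfl, homOne_mul]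
  cmp_assoc h g f hg gf := by
    dsimp only [ICatData.cmp]
    simp only [comp_homMul, pullback.lift_fst, pullback.lift_snd]
    exact τ.homMul_assoc _ _ _ _ _ _ _

theorem homCat_cmp {S : E} (p q : S ⟶ τ.HomArrows Z) (h : p ≫ τ.homDom Z = q ≫ τ.homCod Z) :
    (τ.homCat Z).cmp p q h = τ.homMul p q h := by
  dsimp only [ICatData.cmp, homCat]
  rw [comp_homMul]
  exact τ.homMul_congr _ (pullback.lift_fst _ _ _) (pullback.lift_snd _ _ _)

/-- The functor sending a quadruple to its word. -/
noncomputable def homWordFunctor : τ.homCat Z ⟶ fc.obj (bouquet V.obj) :=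
  ({ obj := toUnit _ ≫ unitVert adj (bouquet V.obj)
     mor := τ.homWord Z
     src_comm := bouquet_obj_unique adj _ _ _
     tgt_comm := bouquet_obj_unique adj _ _ _
     map_ident := (τ.homOne_word _).trans (Category.assoc _ _ _).symm
     map_cmp := fun g f h => by
       rw [homCat_cmp]
       exact τ.homMul_word _ _ _ } : IFunctor (τ.homCat Z) (fc.obj (bouquet V.obj)))

variable {Z}

/-! ### The action of triples on quadruples -/

/-- The action `(l, m, f) (m, x, y, g) = (l, x, y, g ∘ f)` of a triple on a quadruple. -/
noncomputable def homAct {S : E} (w : S ⟶ τ.Tri) (p : S ⟶ τ.HomArrows Z)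
    (h : w ≫ τ.triCod = p ≫ τ.homWord Z) : S ⟶ τ.HomArrows Z :=
  τ.homMk (w ≫ τ.triDom) (p ≫ τ.homDom Z) (p ≫ τ.homCod Z)
    (τ.triHomOf w rfl h ≫ τ.homHomOf p rfl rfl rfl)

section

variable {S : E} (w : S ⟶ τ.Tri) (p : S ⟶ τ.HomArrows Z) (h : w ≫ τ.triCod = p ≫ τ.homWord Z)

theorem homAct_word : τ.homAct w p h ≫ τ.homWord Z = w ≫ τ.triDom := τ.homMk_word _ _ _ _

theorem homAct_dom : τ.homAct w p h ≫ τ.homDom Z = p ≫ τ.homDom Z := τ.homMk_dom _ _ _ _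

theorem homAct_cod : τ.homAct w p h ≫ τ.homCod Z = p ≫ τ.homCod Z := τ.homMk_cod _ _ _ _

theorem homAct_arr : τ.homAct w p h ≫ τ.homArr Z =
    (τ.triHomOf w rfl h ≫ τ.homHomOf p rfl rfl rfl).arr := τ.homMk_arr _ _ _ _

theorem homAct_arr_of {a b c : V.El S} (f : a ⟶ b) (g : b ⟶ c) (hf : w ≫ τ.triArr = f.arr)
    (hg : p ≫ τ.homArr Z = g.arr) : τ.homAct w p h ≫ τ.homArr Z = (f ≫ g).arr :=
  (τ.homAct_arr w p h).trans (ICat.comp_arr_congr hf hg)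

theorem comp_homAct {S' : E} (z : S' ⟶ S) :
    z ≫ τ.homAct w p h = τ.homAct (z ≫ w) (z ≫ p) (by simp only [Category.assoc, h]) := by
  apply τ.homArrows_ext
  · simp only [Category.assoc, homAct_word]
  · simp only [Category.assoc, homAct_dom]
  · simp only [Category.assoc, homAct_cod]
  · rw [Category.assoc, homAct_arr, homAct_arr, res_comp_arr]
    exact ICat.comp_arr_congr (Category.assoc _ _ _).symm (Category.assoc _ _ _).symm

end

theorem homAct_congr {S : E} {w w' : S ⟶ τ.Tri} {p p' : S ⟶ τ.HomArrows Z}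
    (h : w ≫ τ.triCod = p ≫ τ.homWord Z) (hw : w = w') (hp : p = p') :
    τ.homAct w p h = τ.homAct w' p' (by rw [← hw, ← hp, h]) := by
  subst hw hp; rfl

theorem homAct_homMul {S : E} (w w' : S ⟶ τ.Tri) (p p' : S ⟶ τ.HomArrows Z)
    (h : w ≫ τ.triCod = p ≫ τ.homWord Z) (h' : w' ≫ τ.triCod = p' ≫ τ.homWord Z)
    (hp : p ≫ τ.homDom Z = p' ≫ τ.homCod Z) :
    τ.homAct (τ.triMul w w') (τ.homMul p p' hp) (by rw [triMul_cod, homMul_word, h, h']) =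
      τ.homMul (τ.homAct w p h) (τ.homAct w' p' h') (by rw [homAct_dom, homAct_cod, hp]) := by
  apply τ.homArrows_ext
  · simp only [homAct_word, homMul_word, triMul_dom]
  · simp only [homAct_dom, homMul_dom]
  · simp only [homAct_cod, homMul_cod]
  · rw [τ.homAct_arr_of _ _ _ _ _
      (τ.triMul_arr_of w w' (τ.triHomOf w rfl h) (τ.triHomOf w' rfl h') rfl h rfl rfl h' rfl)
      (τ.homMul_arr_of p p' hp (τ.homHomOf p rfl rfl rfl) (τ.homHomOf p' rfl rfl hp.symm)
        rfl rfl rfl rfl rfl rfl rfl),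
      τ.homMul_arr_of _ _ _ (τ.triHomOf w rfl h ≫ τ.homHomOf p rfl rfl rfl)
        (τ.triHomOf w' rfl h' ≫ τ.homHomOf p' rfl rfl hp.symm)
        (τ.homAct_word _ _ _) (τ.homAct_dom _ _ _) (τ.homAct_cod _ _ _) (τ.homAct_arr _ _ _)
        (τ.homAct_word _ _ _) (τ.homAct_dom _ _ _) (τ.homAct_arr_of _ _ _ _ _ rfl rfl)]
    exact congrArg ICat.ElHom.arr (conj_comp _ _ _ _ _ _ _)

theorem homAct_homOne {S : E} (x : S ⟶ Z.obj) :
    τ.homAct (τ.triOne S) (τ.homOne x) (by rw [triOne_cod, homOne_word]) = τ.homOne x := by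
  apply τ.homArrows_ext
  · rw [homAct_word, triOne_dom, homOne_word]
  · rw [homAct_dom]
  · rw [homAct_cod]
  · rw [τ.homAct_arr_of _ _ _ (𝟙 _) _ (τ.triOne_arr S) (τ.homOne_arr x), Category.id_comp,
      homOne_arr]

/-- The action of a functor to triples on a functor to quadruples. -/
noncomputable def actFunctor {C : ICat E} (F : C ⟶ τ.triCat) (G : C ⟶ τ.homCat Z)
    (h : F.mor ≫ τ.triCod = G.mor ≫ τ.homWord Z) : C ⟶ τ.homCat Z :=
  ({ obj := G.obj
     mor := τ.homAct F.mor G.mor h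
     src_comm := (τ.homAct_dom _ _ _).trans G.src_comm
     tgt_comm := (τ.homAct_cod _ _ _).trans G.tgt_comm
     map_ident := by
       have e : C.ident ≫ F.mor = τ.triOne _ := F.map_ident.trans (τ.comp_triOne _)
       have e' : C.ident ≫ G.mor = τ.homOne G.obj := G.map_ident.trans
         ((τ.comp_homOne _ _).trans (congrArg τ.homOne (Category.comp_id _)))
       rw [comp_homAct]
       refine Eq.trans ?_ (e'.symm.trans G.map_ident)
       simp only [e, e', homAct_homOne]
     map_cmp := fun g f w => by
       have e : C.cmp g f w ≫ F.mor = τ.triMul (g ≫ F.mor) (f ≫ F.mor) :=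
         (F.map_cmp g f w).trans (τ.triCat_cmp _ _ _)
       have e' : C.cmp g f w ≫ G.mor = _ := (G.map_cmp g f w).trans (τ.homCat_cmp Z _ _ _)
       rw [homCat_cmp, comp_homAct]
       simp only [comp_homAct, e, e']
       exact τ.homAct_homMul _ _ _ _ _ _ _ } : IFunctor C (τ.homCat Z))

end Hom

end IteratedTensor

end IntEnr

namespace IntEnr

namespace IteratedTensor

variable {E : Type u} [Category.{v} E] [HasPullbacks E] [CartesianMonoidalCategory E]
  {fc : IGraph E ⥤ ICat E} {adj : fc ⊣ ICat.forgetGraph E} {V : IMonCat E}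

/-! ### The action of enriched functors on quadruples -/

section Push

variable (τ : IteratedTensor adj V)

variable {Z W : VCat V} (G : Z ⟶ W)

/-- The arrow on objects of an enriched functor. -/
abbrev vfObj {Z W : VCat V} (G : Z ⟶ W) : Z.obj ⟶ W.obj := (VFunctor.data G).obj

/-- The action of an enriched functor on homs. -/
def vfHom {Z W : VCat V} (G : Z ⟶ W) {S : E} (x y : S ⟶ Z.obj) :
    Z.homEl x y ⟶ W.homEl (x ≫ vfObj G) (y ≫ vfObj G) :=
  (VFunctor.isVFunctor G).mapHom x y

theorem foldComp_vfHom {S : E} {l m : S ⟶ Word adj V.obj} {x₀ x₁ x₂ : S ⟶ Z.obj}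
    (f : τ.foldEl l ⟶ Z.homEl x₁ x₂) (g : τ.foldEl m ⟶ Z.homEl x₀ x₁) :
    τ.foldComp Z.isVCat.toIsTyped f g ≫ vfHom G x₀ x₂ =
      τ.foldComp W.isVCat.toIsTyped (f ≫ vfHom G x₁ x₂) (g ≫ vfHom G x₀ x₁) := by
  have e : Z.isVCat.compHom x₀ x₁ x₂ ≫ vfHom G x₀ x₂ =
      (vfHom G x₁ x₂ ⊗ₘ vfHom G x₀ x₁) ≫ W.isVCat.compHom _ _ _ :=
    (VFunctor.isVFunctor G).map_comp x₀ x₁ x₂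
  rw [foldComp, foldComp, Category.assoc, Category.assoc, e,
    MonoidalCategory.tensorHom_comp_tensorHom_assoc]

theorem foldUnit_vfHom {S : E} (x : S ⟶ Z.obj) :
    τ.foldUnit Z.isVCat.toIsTyped x ≫ vfHom G x x =
      τ.foldUnit W.isVCat.toIsTyped (x ≫ vfObj G) := by
  have e : Z.isVCat.identHom x ≫ vfHom G x x = W.isVCat.identHom _ :=
    (VFunctor.isVFunctor G).map_id x
  rw [foldUnit, foldUnit, Category.assoc, e]

/-- The action of an enriched functor on quadruples. -/
noncomputable def homPush {S : E} (p : S ⟶ τ.HomArrows Z) : S ⟶ τ.HomArrows W :=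
  τ.homMk (p ≫ τ.homWord Z) ((p ≫ τ.homDom Z) ≫ vfObj G) ((p ≫ τ.homCod Z) ≫ vfObj G)
    (τ.homHomOf p rfl rfl rfl ≫ vfHom G _ _)

section

variable {S : E} (p : S ⟶ τ.HomArrows Z)

theorem homPush_word : τ.homPush G p ≫ τ.homWord W = p ≫ τ.homWord Z := τ.homMk_word _ _ _ _

theorem homPush_dom : τ.homPush G p ≫ τ.homDom W = (p ≫ τ.homDom Z) ≫ vfObj G :=
  τ.homMk_dom _ _ _ _

theorem homPush_cod : τ.homPush G p ≫ τ.homCod W = (p ≫ τ.homCod Z) ≫ vfObj G :=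
  τ.homMk_cod _ _ _ _

theorem vfHom_arr_congr {x y x' y' : S ⟶ Z.obj} (hx : x = x') (hy : y = y') :
    (vfHom G x y).arr = (vfHom G x' y').arr := by
  subst hx hy; rfl

theorem homPush_arr_of {a : V.El S} {x y : S ⟶ Z.obj} (f : a ⟶ Z.homEl x y)
    (hx : p ≫ τ.homDom Z = x) (hy : p ≫ τ.homCod Z = y) (hf : p ≫ τ.homArr Z = f.arr) :
    τ.homPush G p ≫ τ.homArr W = (f ≫ vfHom G x y).arr :=
  (τ.homMk_arr _ _ _ _).trans (ICat.comp_arr_congr hf (vfHom_arr_congr G hx hy))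

theorem comp_homPush {S' : E} (z : S' ⟶ S) : z ≫ τ.homPush G p = τ.homPush G (z ≫ p) := by
  apply τ.homArrows_ext
  · simp only [Category.assoc, homPush_word]
  · simp only [Category.assoc, homPush_dom]
  · simp only [Category.assoc, homPush_cod]
  · rw [Category.assoc, τ.homPush_arr_of G p (τ.homHomOf p rfl rfl rfl) rfl rfl rfl,
      τ.homPush_arr_of G (z ≫ p) (τ.homHomOf (z ≫ p) rfl rfl rfl) rfl rfl rfl, res_comp_arr]
    refine ICat.comp_arr_congr (Category.assoc _ _ _).symm ?_
    change z ≫ lift _ _ ≫ _ = lift _ _ ≫ _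
    rw [← Category.assoc, comp_lift, Category.assoc, Category.assoc]

end

/-- The functor given by an enriched functor on quadruples. -/
noncomputable def pushFunctor : τ.homCat Z ⟶ τ.homCat W :=
  ({ obj := vfObj G
     mor := τ.homPush G (𝟙 _)
     src_comm := (τ.homPush_dom G _).trans (by rw [Category.id_comp])
     tgt_comm := (τ.homPush_cod G _).trans (by rw [Category.id_comp])
     map_ident := by
       change τ.homOne (𝟙 _) ≫ _ = _ ≫ τ.homOne (𝟙 _)
       rw [comp_homPush, comp_homOne, Category.comp_id, Category.comp_id]
       apply τ.homArrows_ext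
       · rw [homPush_word, homOne_word, homOne_word]
       · rw [homPush_dom, homOne_dom, homOne_dom, Category.id_comp]
       · rw [homPush_cod, homOne_cod, homOne_cod, Category.id_comp]
       · rw [τ.homPush_arr_of G _ _ (τ.homOne_dom _) (τ.homOne_cod _) (τ.homOne_arr _),
           foldUnit_vfHom, homOne_arr, Category.id_comp]
     map_cmp := fun p q w => by
       rw [homCat_cmp, homCat_cmp, comp_homPush, Category.comp_id]
       rw [τ.homMul_congr _ (τ.comp_homPush G _ p) (τ.comp_homPush G _ q),
         τ.homMul_congr _ (congrArg (τ.homPush G) (Category.comp_id p))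
           (congrArg (τ.homPush G) (Category.comp_id q))]
       apply τ.homArrows_ext
       · rw [homPush_word, homMul_word, homMul_word, homPush_word, homPush_word]
       · rw [homPush_dom, homMul_dom, homMul_dom, homPush_dom]
       · rw [homPush_cod, homMul_cod, homMul_cod, homPush_cod]
       · rw [τ.homPush_arr_of G _ _ (τ.homMul_dom p q w) (τ.homMul_cod p q w)
             (τ.homMul_arr_of p q w (τ.homHomOf p rfl rfl rfl) (τ.homHomOf q rfl rfl w.symm)
               rfl rfl rfl rfl rfl rfl rfl), foldComp_vfHom]
         exact (τ.homMul_arr_of _ _ _ _ _ (τ.homPush_word G p) (τ.homPush_dom G p)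
           (τ.homPush_cod G p) (τ.homPush_arr_of G p _ rfl rfl rfl) (τ.homPush_word G q)
           (τ.homPush_dom G q) (τ.homPush_arr_of G q _ rfl w.symm rfl)).symm } :
    IFunctor (τ.homCat Z) (τ.homCat W))

end Push

end IteratedTensor

end IntEnr

namespace IntEnr

namespace IteratedTensor

variable {E : Type u} [Category.{v} E] [HasPullbacks E] [CartesianMonoidalCategory E]
  {fc : IGraph E ⥤ ICat E} {adj : fc ⊣ ICat.forgetGraph E} {V : IMonCat E}
  {τ : IteratedTensor adj V} {hM : τ.multicatData.IsMulticat}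

/-- The `V`-enriched category of an enriched `Id`-multicategory. -/
noncomputable abbrev vCat (X : EnrichedMulticat adj (τ.multicat hM)) : VCat V :=
  ⟨vData X, vData_isVCat X⟩

/-! ### Fullness -/

section Full

variable (X : EnrichedMulticat adj (τ.multicat hM))

/-- The object of a vertex of a path, as an object of the enriched category. -/
noncomputable def pathVtx : (Path X).obj ⟶ (vCat X).obj := pathObj X

/-- The action on paths, with values in quadruples. -/
noncomputable def pathQuad : (Path X).mor ⟶ τ.HomArrows (vCat X) :=
  τ.homMk (Z := vCat X) (𝟙 _ ≫ (pathWord X).mor) (𝟙 _ ≫ (Path X).src ≫ pathVtx X)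
    (𝟙 _ ≫ (Path X).tgt ≫ pathVtx X) (pathHom X (𝟙 _) rfl rfl rfl)

theorem pathQuad_word : pathQuad X ≫ τ.homWord (vCat X) = (pathWord X).mor :=
  (τ.homMk_word _ _ _ _).trans (Category.id_comp _)

theorem pathQuad_dom : pathQuad X ≫ τ.homDom (vCat X) = (Path X).src ≫ pathVtx X :=
  (τ.homMk_dom _ _ _ _).trans (Category.id_comp _)

theorem pathQuad_cod : pathQuad X ≫ τ.homCod (vCat X) = (Path X).tgt ≫ pathVtx X :=
  (τ.homMk_cod _ _ _ _).trans (Category.id_comp _)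

theorem pathQuad_arr : pathQuad X ≫ τ.homArr (vCat X) = pathArrow X ≫ τ.arrowsArr :=
  (τ.homMk_arr _ _ _ _).trans (congrArg (· ≫ τ.arrowsArr) (Category.id_comp (pathArrow X)))

theorem comp_pathQuad_arr {S : E} (u : S ⟶ (Path X).mor) :
    (u ≫ pathQuad X) ≫ τ.homArr (vCat X) = (u ≫ pathArrow X) ≫ τ.arrowsArr := by
  rw [Category.assoc, pathQuad_arr, Category.assoc]

theorem ident_pathQuad :
    (Path X).ident ≫ pathQuad X = τ.homOne (Z := vCat X) (pathVtx X) := by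
  have e : (Path X).ident = emptyPath X (pathObj X) := by
    rw [emptyPath, ← Category.assoc, pathObj_vert, Category.id_comp]
  have ew : (Path X).ident ≫ (pathWord X).mor = toUnit _ ≫ wordNil adj V.obj := by
    rw [e, emptyPath_word']
  have ea : ((Path X).ident ≫ pathArrow X) ≫ τ.arrowsArr =
      (τ.foldUnit (vCat X).isVCat.toIsTyped (pathVtx X)).arr :=
    (congrArg (fun t => (t ≫ pathArrow X) ≫ τ.arrowsArr) e).trans
      (congrArg ICat.ElHom.arr (emptyPathHom_eq X (pathObj X)))
  apply τ.homArrows_ext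
  · rw [Category.assoc, pathQuad_word, homOne_word, ew]
  · rw [Category.assoc, pathQuad_dom, homOne_dom, ← Category.assoc, (Path X).ident_src,
      Category.id_comp]
  · rw [Category.assoc, pathQuad_cod, homOne_cod, ← Category.assoc, (Path X).ident_tgt,
      Category.id_comp]
  · rw [comp_pathQuad_arr, homOne_arr, ea]

/-- The action on paths preserves composition, by `pathHom_cmp`. -/
theorem cmp_pathQuad {S : E} (p q : S ⟶ (Path X).mor) (h : p ≫ (Path X).src = q ≫ (Path X).tgt)
    (h' : (p ≫ pathQuad X) ≫ τ.homDom (vCat X) = (q ≫ pathQuad X) ≫ τ.homCod (vCat X)) :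
    (Path X).cmp p q h ≫ pathQuad X = τ.homMul (p ≫ pathQuad X) (q ≫ pathQuad X) h' := by
  have ew : ∀ u : S ⟶ (Path X).mor, (u ≫ pathQuad X) ≫ τ.homWord (vCat X) =
      u ≫ (pathWord X).mor := fun u => by rw [Category.assoc, pathQuad_word]
  have ed : ∀ u : S ⟶ (Path X).mor, (u ≫ pathQuad X) ≫ τ.homDom (vCat X) =
      u ≫ (Path X).src ≫ pathVtx X := fun u => by rw [Category.assoc, pathQuad_dom]
  have ec : ∀ u : S ⟶ (Path X).mor, (u ≫ pathQuad X) ≫ τ.homCod (vCat X) =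
      u ≫ (Path X).tgt ≫ pathVtx X := fun u => by rw [Category.assoc, pathQuad_cod]
  have hq : q ≫ (Path X).tgt ≫ pathObj X = p ≫ (Path X).src ≫ pathObj X := by
    rw [← Category.assoc, ← h, Category.assoc]
  apply τ.homArrows_ext
  · rw [homMul_word, ew, ew, ew]
    exact (pathWord X).map_cmp _ _ _
  · rw [homMul_dom, ed, ed, ← Category.assoc, (Path X).cmp_src, Category.assoc]
  · rw [homMul_cod, ec, ec, ← Category.assoc, (Path X).cmp_tgt, Category.assoc]
  · rw [comp_pathQuad_arr]
    refine (pathHom_cmp X p q h rfl rfl rfl hq rfl rfl).trans ?_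
    exact (τ.homMul_arr_of _ _ _ (pathHom X p rfl rfl rfl) (pathHom X q rfl rfl hq) (ew p) (ed p)
      (ec p) (comp_pathQuad_arr X p) (ew q) (ed q) (comp_pathQuad_arr X q)).symm

/-- The action on paths is a functor. -/
noncomputable def pathFunctor : Path X ⟶ τ.homCat (vCat X) :=
  ({ obj := pathVtx X
     mor := pathQuad X
     src_comm := pathQuad_dom X
     tgt_comm := pathQuad_cod X
     map_ident := (ident_pathQuad X).trans ((τ.comp_homOne _ _).trans
       (congrArg τ.homOne (Category.comp_id _))).symm
     map_cmp := fun p q h => (cmp_pathQuad X p q h (by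
       rw [Category.assoc, pathQuad_dom, Category.assoc, pathQuad_cod, ← Category.assoc, h,
         Category.assoc])).trans (τ.homCat_cmp _ _ _ _).symm } :
    IFunctor (Path X) (τ.homCat (vCat X)))

theorem pathEdge_quad_arr : (pathEdge X ≫ pathQuad X) ≫ τ.homArr (vCat X) =
    (τ.singEl ((vData X).homEl (fst X.obj X.obj) (snd X.obj X.obj))).hom.arr := by
  rw [comp_pathQuad_arr, ← onePath_arr, onePath, lift_fst_snd, Category.id_comp]

variable {X} {Y : EnrichedMulticat adj (τ.multicat hM)} (G : vCat X ⟶ vCat Y)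

/-- The family of unary arrows `fold (X(x, y)) ≅ X(x, y) ⟶ Y(G x, G y)` of an enriched functor. -/
noncomputable def vFamily : X.obj ⊗ X.obj ⟶ τ.Arrows :=
  τ.arrowsMk (((vData X).homEl (fst X.obj X.obj) (snd X.obj X.obj)).pt ≫ wordSing adj V.obj)
    ((τ.singEl ((vData X).homEl (fst X.obj X.obj) (snd X.obj X.obj))).hom ≫
      vfHom G (fst X.obj X.obj) (snd X.obj X.obj))

/-- The arrow on objects of an enriched functor between the enriched categories of enriched
`Id`-multicategories. -/
noncomputable def vFamilyObj : X.obj ⟶ Y.obj := vfObj G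

theorem homEl_fst_snd (X : EnrichedMulticat adj (τ.multicat hM)) :
    ((vData X).homEl (fst X.obj X.obj) (snd X.obj X.obj)).pt = vHom X :=
  (congrArg (· ≫ vHom X) lift_fst_snd).trans (Category.id_comp _)

theorem isFamily_vFamily : IsFamily (vFamilyObj G) (vFamily G) where
  word := (τ.arrowsMk_word _ _).trans (congrArg (· ≫ wordSing adj V.obj) (homEl_fst_snd X))
  tgt := by
    rw [← Category.assoc]
    refine (congrArg (· ≫ V.tgt) (τ.arrowsMk_arr _ _)).trans ((ICat.ElHom.tgt _).trans ?_)
    have e : lift (fst X.obj X.obj ≫ vFamilyObj G) (snd X.obj X.obj ≫ vFamilyObj G) =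
        (vFamilyObj G ⊗ₘ vFamilyObj G) := by
      rw [← lift_map, lift_fst_snd, Category.id_comp]
    exact congrArg (· ≫ vHom Y) e

theorem vFamily_hom {S : E} (x y : S ⟶ X.obj) :
    (isFamily_vFamily G).hom x y = (τ.singEl ((vData X).homEl x y)).hom ≫ vfHom G x y := by
  apply ICat.el_ext
  rw [IsFamily.hom_arr, Category.assoc]
  refine (congrArg (lift x y ≫ ·) (τ.arrowsMk_arr _ _)).trans ?_
  rw [res_comp_arr]
  refine ICat.comp_arr_congr ?_ ?_
  · change lift x y ≫ _ = _
    rw [singEl_hom_arr, singEl_hom_arr, ← Category.assoc]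
    refine congrArg (· ≫ τ.singIso.hom.arr) ?_
    exact congrArg (lift x y ≫ ·) (homEl_fst_snd X)
  · change lift x y ≫ lift _ _ ≫ _ = lift _ _ ≫ _
    refine congrArg (lift x y ≫ ·) ?_
    exact (congrArg (· ≫ (VFunctor.data G).map) lift_fst_snd).trans (Category.id_comp _)

theorem vFamily_functor_aux :
    (familyFunctor X (vFamily G) ≫ τ.arrowsProd).mor ≫ τ.triCod =
      (fc.map ((ICat.forgetGraph E).map (Ind.map (vFamilyObj G))) ≫ pathFunctor Y).mor ≫
        τ.homWord (vCat Y) := by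
  refine (isFamily_vFamily G).listTri_cod.trans ?_
  exact (congrArg (pathMap X Y (vFamilyObj G) ≫ ·) (pathQuad_word Y).symm).trans
    (Category.assoc _ _ _).symm

theorem pathEdge_quad_word : (pathEdge X ≫ pathQuad X) ≫ τ.homWord (vCat X) =
    vHom X ≫ wordSing adj V.obj := by
  rw [Category.assoc, pathQuad_word, pathEdge_map]

theorem pathEdge_quad_dom : (pathEdge X ≫ pathQuad X) ≫ τ.homDom (vCat X) = fst X.obj X.obj := by
  have e : pathEdge X ≫ (Path X).src ≫ pathObj X = fst X.obj X.obj := by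
    rw [← Category.assoc, pathEdge_src, Category.assoc, pathVert_obj, Category.comp_id]
  rw [Category.assoc, pathQuad_dom]
  exact e

theorem pathEdge_quad_cod : (pathEdge X ≫ pathQuad X) ≫ τ.homCod (vCat X) = snd X.obj X.obj := by
  have e : pathEdge X ≫ (Path X).tgt ≫ pathObj X = snd X.obj X.obj := by
    rw [← Category.assoc, pathEdge_tgt, Category.assoc, pathVert_obj, Category.comp_id]
  rw [Category.assoc, pathQuad_cod]
  exact e

theorem vFamily_pairTri_dom :
    (vFamily G ≫ τ.pairTri) ≫ τ.triDom = vHom X ≫ wordSing adj V.obj := by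
  rw [Category.assoc, pairTri_dom, (isFamily_vFamily G).word]

theorem vFamily_pairTri_cod : (vFamily G ≫ τ.pairTri) ≫ τ.triCod =
    ((vFamilyObj G ⊗ₘ vFamilyObj G) ≫ pathEdge Y ≫ pathQuad Y) ≫ τ.homWord (vCat Y) := by
  rw [Category.assoc, pairTri_cod, Category.assoc, pathEdge_quad_word,
    ← reassoc_of% (isFamily_vFamily G).tgt]

theorem comp_inv_comp_hom {C : Type*} [Category C] {a b c : C} (f : a ⟶ b) (i : c ≅ b) :
    (f ≫ i.inv) ≫ i.hom = f := by simp

theorem comp_inv_comp {C : Type*} [Category C] {a b c d : C} (i : a ≅ b) {g : a ⟶ d} {k : b ⟶ d}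
    (h : g = i.hom ≫ k) (f : c ⟶ b) : f ≫ i.inv ≫ g = f ≫ k := by simp [h]

/-- The edge case of `vFamily_functor_eq`. -/
theorem vFamily_edge :
    τ.homPush G (pathEdge X ≫ pathQuad X) =
      τ.homAct (vFamily G ≫ τ.pairTri)
        ((vFamilyObj G ⊗ₘ vFamilyObj G) ≫ pathEdge Y ≫ pathQuad Y) (vFamily_pairTri_cod G) := by
  have ef : (vFamilyObj G ⊗ₘ vFamilyObj G) ≫ fst Y.obj Y.obj = fst X.obj X.obj ≫ vFamilyObj G :=
    tensorHom_fst _ _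
  have es : (vFamilyObj G ⊗ₘ vFamilyObj G) ≫ snd Y.obj Y.obj = snd X.obj X.obj ≫ vFamilyObj G :=
    tensorHom_snd _ _
  apply τ.homArrows_ext
  · rw [homPush_word, homAct_word, pathEdge_quad_word, vFamily_pairTri_dom]
  · rw [homPush_dom, homAct_dom, Category.assoc (vFamilyObj G ⊗ₘ vFamilyObj G)]
    refine (congrArg (· ≫ vfObj G) (pathEdge_quad_dom (X := X))).trans
      (Eq.trans ?_ (congrArg (_ ≫ ·) (pathEdge_quad_dom (X := Y))).symm)
    exact ef.symm
  · rw [homPush_cod, homAct_cod, Category.assoc (vFamilyObj G ⊗ₘ vFamilyObj G)]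
    refine (congrArg (· ≫ vfObj G) (pathEdge_quad_cod (X := X))).trans
      (Eq.trans ?_ (congrArg (_ ≫ ·) (pathEdge_quad_cod (X := Y))).symm)
    exact es.symm
  · have h := vFamily_hom G (fst X.obj X.obj) (snd X.obj X.obj)
    have ht := τ.pairTri_arr (vFamily G) (isFamily_vFamily G).word
      (a := (vData Y).homEl (fst X.obj X.obj ≫ vFamilyObj G) (snd X.obj X.obj ≫ vFamilyObj G))
      (by
        rw [(isFamily_vFamily G).tgt, ← lift_fst_comp_snd_comp]; rfl)
    have hp : ((vFamilyObj G ⊗ₘ vFamilyObj G) ≫ pathEdge Y ≫ pathQuad Y) ≫ τ.homArr (vCat Y) =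
        (τ.singEl ((vData Y).homEl (fst X.obj X.obj ≫ vFamilyObj G)
          (snd X.obj X.obj ≫ vFamilyObj G))).hom.arr := by
      rw [Category.assoc, pathEdge_quad_arr, singEl_hom_arr, singEl_hom_arr, homEl_fst_snd,
        ← Category.assoc, ← lift_fst_comp_snd_comp]
      rfl
    refine (τ.homPush_arr_of G _ _ (pathEdge_quad_dom (X := X)) (pathEdge_quad_cod (X := X))
      (pathEdge_quad_arr X)).trans (Eq.trans ?_ (τ.homAct_arr_of _ _ _ _ _ ht hp).symm)
    refine Eq.trans (congrArg ICat.ElHom.arr h.symm) (Eq.trans ?_ (congrArg ICat.ElHom.arr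
      (comp_inv_comp_hom _ (τ.singEl _))).symm)
    rw [IsFamily.hom_arr, lift_fst_snd, Category.id_comp, arrowsHomOf_arr]

/-- The action of `X` on paths followed by `G` equals the product of the components along the path
followed by the action of `Y`. Both sides are functors on a free internal category, so it suffices
to compare them on paths of length one. -/
theorem vFamily_functor_eq :
    pathFunctor X ≫ τ.pushFunctor G =
      τ.actFunctor (familyFunctor X (vFamily G) ≫ τ.arrowsProd)
        (fc.map ((ICat.forgetGraph E).map (Ind.map (vFamilyObj G))) ≫ pathFunctor Y)
        (vFamily_functor_aux G) := by
  apply functor_ext_of_unit adj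
  · have e : pathVert X ≫ (fc.map ((ICat.forgetGraph E).map (Ind.map (vFamilyObj G)))).obj =
        vFamilyObj G ≫ pathVert Y := unitVert_naturality adj _
    have l : pathVert X ≫ pathObj X ≫ vFamilyObj G = vFamilyObj G := by
      rw [← Category.assoc, pathVert_obj, Category.id_comp]
    have r : pathVert X ≫ (fc.map ((ICat.forgetGraph E).map (Ind.map (vFamilyObj G)))).obj ≫
        pathObj Y = vFamilyObj G := by
      rw [← Category.assoc, e, Category.assoc, pathVert_obj, Category.comp_id]
    exact l.trans r.symm
  · have h₁ : pathEdge X ≫ familyList X (vFamily G) ≫ τ.listTri = vFamily G ≫ τ.pairTri := by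
      rw [← Category.assoc, pathEdge_familyList, Category.assoc, wordSing_listTri]
    have h₂ : pathEdge X ≫ pathMap X Y (vFamilyObj G) ≫ pathQuad Y =
        (vFamilyObj G ⊗ₘ vFamilyObj G) ≫ pathEdge Y ≫ pathQuad Y := by
      rw [← Category.assoc, pathEdge_pathMap, Category.assoc]
    have l : pathEdge X ≫ pathQuad X ≫ τ.homPush G (𝟙 _) =
        τ.homPush G (pathEdge X ≫ pathQuad X) := by
      rw [← Category.assoc, comp_homPush, Category.comp_id]
    refine l.trans (Eq.trans ?_ (τ.comp_homAct _ _ (vFamily_functor_aux G) (pathEdge X)).symm)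
    exact (vFamily_edge G).trans (τ.homAct_congr _ h₁.symm h₂.symm)

/-- Naturality is the equality `vFamily_functor_eq`, read off on paths. -/
theorem isNatural_vFamily : (isFamily_vFamily G).IsNatural := by
  have e : (pathQuad X ≫ τ.homPush G (𝟙 _)) =
      τ.homAct (familyList X (vFamily G) ≫ τ.listTri)
        (pathMap X Y (vFamilyObj G) ≫ pathQuad Y) (vFamily_functor_aux G) :=
    congrArg IFunctor.mor (vFamily_functor_eq G)
  rw [comp_homPush, Category.comp_id] at e
  have ew : (pathArrow X ≫ wordSing adj τ.Arrows) ≫ τ.listTri = pathArrow X ≫ τ.pairTri := by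
    rw [Category.assoc, wordSing_listTri]
  apply τ.arrows_ext
  · rw [arrowsComp_word, arrowsComp_word, (isFamily_vFamily G).listTri_dom, ew, Category.assoc,
      pairTri_dom, pathArrow_word]
  · have el := (isFamily_vFamily G).left_arr (𝟙 _) rfl rfl rfl
    have er := (isFamily_vFamily G).right_arr (𝟙 _) (l := 𝟙 _ ≫ (pathWord X).mor) rfl rfl rfl rfl
    rw [Category.id_comp] at el er
    refine el.trans (Eq.trans ?_ er.symm)
    have hl := congrArg ICat.ElHom.arr (comp_inv_comp (τ.singEl _) (vFamily_hom G
      (𝟙 _ ≫ (Path X).src ≫ pathObj X) (𝟙 _ ≫ (Path X).tgt ≫ pathObj X))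
      (pathHom X (𝟙 _) rfl rfl rfl))
    have hp := τ.homPush_arr_of G (pathQuad X) (pathHom X (𝟙 _) rfl rfl rfl)
      ((pathQuad_dom X).trans (Category.id_comp _).symm)
      ((pathQuad_cod X).trans (Category.id_comp _).symm)
      ((pathQuad_arr X).trans (congrArg (· ≫ τ.arrowsArr) (Category.id_comp (pathArrow X)).symm))
    have ha := τ.homAct_arr_of _ _ (vFamily_functor_aux G)
      ((isFamily_vFamily G).prod (𝟙 _) (l := 𝟙 _ ≫ (pathWord X).mor) rfl rfl)
      (pathHom Y (𝟙 _ ≫ pathMap X Y (vFamilyObj G)) rfl rfl rfl)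
      (congrArg (· ≫ τ.triArr) (Category.id_comp _).symm)
      ((comp_pathQuad_arr Y _).trans (congrArg (fun t => (t ≫ pathArrow Y) ≫ τ.arrowsArr)
        (Category.id_comp (pathMap X Y (vFamilyObj G))).symm))
    exact hl.trans (hp.symm.trans ((congrArg (· ≫ τ.homArr (vCat Y)) e).trans ha))

theorem vFunctorData_vFamily :
    vFunctorData (⟨vFamilyObj G, (isNatural_vFamily G).trans⟩ : X ⟶ Y) = VFunctor.data G := by
  refine VFunctorData.ext rfl ?_
  refine (vFunctorData_map_eq _).trans ?_
  have h := vFamily_hom G (fst X.obj X.obj) (snd X.obj X.obj)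
  refine (congrArg ICat.ElHom.arr ((Iso.inv_comp_eq _).2 h)).trans ?_
  exact (congrArg (· ≫ (VFunctor.data G).map) lift_fst_snd).trans (Category.id_comp _)

/-- A `V`-functor is the image of its family of unary arrows. -/
instance full_enrichedFunctor : (enrichedFunctor hM).Full where
  map_surjective G := ⟨⟨vFamilyObj G, (isNatural_vFamily G).trans⟩,
    VFunctor.ext (vFunctorData_vFamily G)⟩

end Full

end IteratedTensor

end IntEnr

namespace IntEnr

namespace IteratedTensor

variable {E : Type u} [Category.{v} E] [HasPullbacks E] [CartesianMonoidalCategory E]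
  {fc : IGraph E ⥤ ICat E} {adj : fc ⊣ ICat.forgetGraph E} {V : IMonCat E}
  (τ : IteratedTensor adj V)

/-! ### Iterated composition and essential surjectivity -/

section EssSurj

variable (Z : VCat V)

/-- The free internal category on the indiscrete graph on the objects of `Z`. -/
noncomputable abbrev HomPath (_ : IteratedTensor adj V) (Z : VCat V) : ICat E :=
  fc.obj ((ICat.forgetGraph E).obj (Ind Z.obj))

/-- The evaluation of paths at their ends. -/
noncomputable def homEval : τ.HomPath Z ⟶ Ind Z.obj := adj.counit.app (Ind Z.obj)

/-- The object of a vertex of a path. -/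
noncomputable def homVtx : (τ.HomPath Z).obj ⟶ Z.obj := (τ.homEval Z).obj

/-- The ends of a path. -/
noncomputable def homEnds : (τ.HomPath Z).mor ⟶ Z.obj ⊗ Z.obj := (τ.homEval Z).mor

/-- The inclusion of the objects in the free internal category. -/
noncomputable def homVert : Z.obj ⟶ (τ.HomPath Z).obj :=
  unitVert adj ((ICat.forgetGraph E).obj (Ind Z.obj))

/-- The inclusion of the edges in the free internal category. -/
noncomputable def homEdge : Z.obj ⊗ Z.obj ⟶ (τ.HomPath Z).mor :=
  unitEdge adj ((ICat.forgetGraph E).obj (Ind Z.obj))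

theorem homVert_vtx : τ.homVert Z ≫ τ.homVtx Z = 𝟙 _ := unitVert_counit adj (Ind Z.obj)

theorem homEnds_fst : τ.homEnds Z ≫ fst _ _ = (τ.HomPath Z).src ≫ τ.homVtx Z :=
  (τ.homEval Z).src_comm

theorem homEnds_snd : τ.homEnds Z ≫ snd _ _ = (τ.HomPath Z).tgt ≫ τ.homVtx Z :=
  (τ.homEval Z).tgt_comm

/-- The quadruple `((Z(x, y)), x, y, fold (Z(x, y)) ≅ Z(x, y))`. -/
noncomputable def edgeQuad : Z.obj ⊗ Z.obj ⟶ τ.HomArrows Z :=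
  τ.homMk ((Z.homEl (fst _ _) (snd _ _)).pt ≫ wordSing adj V.obj) (fst _ _) (snd _ _)
    (τ.singEl (Z.homEl (fst _ _) (snd _ _))).hom

theorem generic_homEl : (Z.homEl (fst Z.obj Z.obj) (snd _ _)).pt = Z.hom :=
  (congrArg (· ≫ Z.hom) lift_fst_snd).trans (Category.id_comp _)

theorem edgeQuad_word : τ.edgeQuad Z ≫ τ.homWord Z = Z.hom ≫ wordSing adj V.obj :=
  (τ.homMk_word _ _ _ _).trans (congrArg (· ≫ wordSing adj V.obj) (generic_homEl Z))

theorem edgeQuad_dom : τ.edgeQuad Z ≫ τ.homDom Z = fst _ _ := τ.homMk_dom _ _ _ _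

theorem edgeQuad_cod : τ.edgeQuad Z ≫ τ.homCod Z = snd _ _ := τ.homMk_cod _ _ _ _

theorem edgeQuad_arr : τ.edgeQuad Z ≫ τ.homArr Z = Z.hom ≫ τ.singIso.hom.arr :=
  (τ.homMk_arr _ _ _ _).trans ((τ.singEl_hom_arr _).trans
    (congrArg (· ≫ τ.singIso.hom.arr) (generic_homEl Z)))

/-- The functor on paths given by the composition of `Z`: it sends a path `x₀, …, xₙ` to the
iterated composition `fold (Z(xₙ₋₁, xₙ) ⋯ Z(x₀, x₁)) ⟶ Z(x₀, xₙ)`. -/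
noncomputable def compFunctor : τ.HomPath Z ⟶ τ.homCat Z :=
  freeLift adj (C := τ.homCat Z) (⟨𝟙 Z.obj, τ.edgeQuad Z,
    (τ.edgeQuad_dom Z).trans (Category.comp_id _).symm,
    (τ.edgeQuad_cod Z).trans (Category.comp_id _).symm⟩ :
    IGraph.Hom ((ICat.forgetGraph E).obj (Ind Z.obj)) ((ICat.forgetGraph E).obj (τ.homCat Z)))

/-- The quadruple of a path. -/
noncomputable def compQuad : (τ.HomPath Z).mor ⟶ τ.HomArrows Z := (τ.compFunctor Z).mor

theorem homEdge_compQuad : τ.homEdge Z ≫ τ.compQuad Z = τ.edgeQuad Z :=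
  unitEdge_freeLift adj (C := τ.homCat Z) _ rfl

/-- On objects, iterated composition is the identification of the vertices of paths with the objects
of `Z`. -/
theorem compFunctor_obj : (τ.compFunctor Z).obj = τ.homVtx Z := by
  apply toInd_ext adj
  exact (unitVert_freeLift adj (C := τ.homCat Z) _ rfl).trans (τ.homVert_vtx Z).symm

theorem compQuad_dom : τ.compQuad Z ≫ τ.homDom Z = (τ.HomPath Z).src ≫ τ.homVtx Z :=
  (τ.compFunctor Z).src_comm.trans (congrArg (_ ≫ ·) (τ.compFunctor_obj Z))

theorem compQuad_cod : τ.compQuad Z ≫ τ.homCod Z = (τ.HomPath Z).tgt ≫ τ.homVtx Z :=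
  (τ.compFunctor Z).tgt_comm.trans (congrArg (_ ≫ ·) (τ.compFunctor_obj Z))

/-- The word of homs along a path. -/
noncomputable def compWord : τ.HomPath Z ⟶ fc.obj (bouquet V.obj) :=
  fc.map (toBouquet ((ICat.forgetGraph E).obj (Ind Z.obj)) Z.hom)

theorem compQuad_word : τ.compQuad Z ≫ τ.homWord Z = (τ.compWord Z).mor := by
  have key : τ.compFunctor Z ≫ τ.homWordFunctor Z = τ.compWord Z := by
    apply functor_ext_of_unit adj (bouquet_obj_unique adj _ _ _)
    change τ.homEdge Z ≫ τ.compQuad Z ≫ τ.homWord Z = τ.homEdge Z ≫ (τ.compWord Z).mor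
    rw [← Category.assoc, homEdge_compQuad, edgeQuad_word]
    exact (unitEdge_map_bouquet adj (toBouquet ((ICat.forgetGraph E).obj (Ind Z.obj)) Z.hom)
      rfl).symm
  exact congrArg IFunctor.mor key

/-- The pair `(l, f)` of a quadruple `(l, x, y, f)`. -/
noncomputable def homPair : τ.HomArrows Z ⟶ τ.Arrows :=
  pullback.lift (τ.homWord Z) (τ.homArr Z) (τ.homArr_src Z).symm

theorem homPair_word : τ.homPair Z ≫ τ.arrowsWord = τ.homWord Z := pullback.lift_fst _ _ _

theorem homPair_arr : τ.homPair Z ≫ τ.arrowsArr = τ.homArr Z := pullback.lift_snd _ _ _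

/-- The arrow of the `fc`-multicategory of `V` given by iterated composition along a path. -/
noncomputable def compArrow : (τ.HomPath Z).mor ⟶ τ.Arrows := τ.compQuad Z ≫ τ.homPair Z

theorem compArrow_word : τ.compArrow Z ≫ τ.arrowsWord = (τ.compWord Z).mor := by
  rw [compArrow, Category.assoc, homPair_word, compQuad_word]

theorem compArrow_arr : τ.compArrow Z ≫ τ.arrowsArr = τ.compQuad Z ≫ τ.homArr Z := by
  rw [compArrow, Category.assoc, homPair_arr]

theorem compArrow_tgt : τ.compArrow Z ≫ τ.arrowsArr ≫ V.tgt = τ.homEnds Z ≫ Z.hom := by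
  rw [← Category.assoc, compArrow_arr, Category.assoc, homArr_tgt, ← Category.assoc, comp_lift,
    compQuad_dom, compQuad_cod, ← homEnds_fst, ← homEnds_snd, ← comp_lift, lift_fst_snd,
    Category.comp_id]

theorem homEdge_compArrow : τ.homEdge Z ≫ τ.compArrow Z = Z.hom ≫ τ.arrowsId := by
  apply τ.arrows_ext
  · rw [Category.assoc, compArrow_word, Category.assoc, arrowsId_word]
    exact unitEdge_map_bouquet adj _ rfl
  · rw [Category.assoc, compArrow_arr, ← Category.assoc, homEdge_compQuad, edgeQuad_arr,
      Category.assoc, arrowsId_arr]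

/-! ### Associativity of iterated composition -/

/-- The free internal category on the graph of paths. -/
noncomputable abbrev HomPathList : ICat E := fc.obj ((ICat.forgetGraph E).obj (τ.HomPath Z))

/-- Concatenation of a list of paths. -/
noncomputable def homConcat : τ.HomPathList Z ⟶ τ.HomPath Z := adj.counit.app (τ.HomPath Z)

/-- The path with steps the ends of a list of paths. -/
noncomputable def homListEnds : τ.HomPathList Z ⟶ τ.HomPath Z :=
  fc.map ((ICat.forgetGraph E).map (τ.homEval Z))

/-- The action on paths, as a morphism of graphs. -/
noncomputable def compGraphHom : (ICat.forgetGraph E).obj (τ.HomPath Z) ⟶ bouquet τ.Arrows :=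
  toBouquet _ (τ.compArrow Z)

/-- The list of arrows of a list of paths. -/
noncomputable def compList : τ.HomPathList Z ⟶ fc.obj (bouquet τ.Arrows) :=
  fc.map (τ.compGraphHom Z)

/-- The list with one path. -/
noncomputable def homListSing : (τ.HomPath Z).mor ⟶ (τ.HomPathList Z).mor :=
  unitEdge adj ((ICat.forgetGraph E).obj (τ.HomPath Z))

theorem homListSing_concat : τ.homListSing Z ≫ (τ.homConcat Z).mor = 𝟙 _ :=
  unitEdge_counit adj (τ.HomPath Z)

theorem homListSing_ends :
    τ.homListSing Z ≫ (τ.homListEnds Z).mor = τ.homEnds Z ≫ τ.homEdge Z :=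
  unitEdge_naturality adj ((ICat.forgetGraph E).map (τ.homEval Z))

theorem homListSing_list :
    τ.homListSing Z ≫ (τ.compList Z).mor = τ.compArrow Z ≫ wordSing adj τ.Arrows :=
  unitEdge_naturality adj (τ.compGraphHom Z)

theorem homListEnds_word :
    (τ.homListEnds Z).mor ≫ (τ.compWord Z).mor =
      (τ.compList Z).mor ≫ (fc.map τ.multicatTgt).mor := by
  have e : τ.homListEnds Z ≫ τ.compWord Z = τ.compList Z ≫ fc.map τ.multicatTgt :=
    (fc.map_comp _ _).symm.trans ((congrArg fc.map
      (bouquet_hom_ext (τ.compArrow_tgt Z).symm)).trans (fc.map_comp _ _))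
  exact congrArg IFunctor.mor e

theorem compList_cod : (τ.compList Z ≫ τ.arrowsProd).mor ≫ τ.triCod =
    (τ.homListEnds Z ≫ τ.compFunctor Z).mor ≫ τ.homWord Z := by
  have l : ((τ.compList Z).mor ≫ τ.listTri) ≫ τ.triCod =
      ((τ.homListEnds Z).mor ≫ τ.compQuad Z) ≫ τ.homWord Z := by
    rw [Category.assoc, listTri_cod, Category.assoc, compQuad_word, homListEnds_word]
  exact l

theorem compArrow_pairTri_cod : (τ.compArrow Z ≫ τ.pairTri) ≫ τ.triCod =
    (τ.homEnds Z ≫ τ.edgeQuad Z) ≫ τ.homWord Z := by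
  rw [Category.assoc, pairTri_cod, Category.assoc, edgeQuad_word, ← Category.assoc τ.arrowsArr,
    ← Category.assoc, compArrow_tgt, Category.assoc]

/-- The case of lists of length one in `homConcat_compFunctor`: the quadruple of a path is its arrow
acting on the isomorphism `fold (v) ≅ v` at its ends. -/
theorem compQuad_eq_act : τ.compQuad Z = τ.homAct (τ.compArrow Z ≫ τ.pairTri)
    (τ.homEnds Z ≫ τ.edgeQuad Z) (τ.compArrow_pairTri_cod Z) := by
  apply τ.homArrows_ext
  · rw [homAct_word, Category.assoc, pairTri_dom, compArrow_word, compQuad_word]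
  · rw [homAct_dom, Category.assoc, edgeQuad_dom, compQuad_dom, homEnds_fst]
  · rw [homAct_cod, Category.assoc, edgeQuad_cod, compQuad_cod, homEnds_snd]
  · have ht := τ.pairTri_arr (τ.compArrow Z) rfl (a := ⟨τ.homEnds Z ≫ Z.hom⟩) (τ.compArrow_tgt Z)
    have hp : (τ.homEnds Z ≫ τ.edgeQuad Z) ≫ τ.homArr Z =
        (τ.singEl ⟨τ.homEnds Z ≫ Z.hom⟩).hom.arr := by
      rw [singEl_hom_arr, Category.assoc, edgeQuad_arr, Category.assoc]
    refine Eq.trans ?_ (τ.homAct_arr_of _ _ _ _ _ ht hp).symm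
    refine Eq.trans ?_ (congrArg ICat.ElHom.arr (comp_inv_comp_hom _ (τ.singEl _))).symm
    rw [arrowsHomOf_arr, compArrow_arr]

/-- Associativity of iterated composition: composing along the concatenation of a list of paths is
composing along the paths, and then along the path of their ends. -/
theorem homConcat_compFunctor : τ.homConcat Z ≫ τ.compFunctor Z =
    τ.actFunctor (τ.compList Z ≫ τ.arrowsProd) (τ.homListEnds Z ≫ τ.compFunctor Z)
      (τ.compList_cod Z) := by
  apply functor_ext_of_unit adj
  · have l : unitVert adj ((ICat.forgetGraph E).obj (τ.HomPath Z)) ≫ (τ.homConcat Z).obj =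
        𝟙 _ := unitVert_counit adj (τ.HomPath Z)
    have r : unitVert adj ((ICat.forgetGraph E).obj (τ.HomPath Z)) ≫ (τ.homListEnds Z).obj =
        τ.homVtx Z ≫ τ.homVert Z := unitVert_naturality adj _
    have e := τ.compFunctor_obj Z
    have e' : τ.homVert Z ≫ (τ.compFunctor Z).obj = 𝟙 Z.obj := by
      rw [e]; exact τ.homVert_vtx Z
    refine (Category.assoc _ _ _).symm.trans ((congrArg (· ≫ (τ.compFunctor Z).obj) l).trans
      ((Category.id_comp _).trans (Eq.trans ?_ (Category.assoc _ _ _))))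
    refine Eq.trans ?_ (congrArg (· ≫ (τ.compFunctor Z).obj) r).symm
    exact e.trans ((Category.comp_id _).symm.trans ((congrArg (τ.homVtx Z ≫ ·) e'.symm).trans
      (Category.assoc _ _ _).symm))
  · have l : τ.homListSing Z ≫ (τ.homConcat Z).mor ≫ τ.compQuad Z = τ.compQuad Z := by
      rw [← Category.assoc, homListSing_concat, Category.id_comp]
    have h₁ : τ.homListSing Z ≫ (τ.compList Z).mor ≫ τ.listTri = τ.compArrow Z ≫ τ.pairTri := by
      rw [← Category.assoc, homListSing_list, Category.assoc, wordSing_listTri]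
    have h₂ : τ.homListSing Z ≫ (τ.homListEnds Z).mor ≫ τ.compQuad Z =
        τ.homEnds Z ≫ τ.edgeQuad Z := by
      rw [← Category.assoc, homListSing_ends, Category.assoc, homEdge_compQuad]
    refine l.trans (Eq.trans ?_ (τ.comp_homAct _ _ (τ.compList_cod Z) (τ.homListSing Z)).symm)
    exact (τ.compQuad_eq_act Z).trans (τ.homAct_congr _ h₁.symm h₂.symm)

theorem homConcat_aux : ((τ.homListEnds Z).mor ≫ τ.compArrow Z) ≫ τ.arrowsWord =
    (τ.compList Z).mor ≫ (fc.map τ.multicatTgt).mor := by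
  rw [Category.assoc, compArrow_word, homListEnds_word]

/-- The functor of `fc`-multicategories given by iterated composition preserves composition. -/
theorem homConcat_compArrow : (τ.homConcat Z).mor ≫ τ.compArrow Z =
    τ.arrowsComp ((τ.homListEnds Z).mor ≫ τ.compArrow Z) (τ.compList Z).mor
      (τ.homConcat_aux Z) := by
  have key : (τ.homConcat Z).mor ≫ τ.compQuad Z =
      τ.homAct ((τ.compList Z).mor ≫ τ.listTri) ((τ.homListEnds Z).mor ≫ τ.compQuad Z)
        (τ.compList_cod Z) := congrArg IFunctor.mor (τ.homConcat_compFunctor Z)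
  apply τ.arrows_ext
  · rw [arrowsComp_word, Category.assoc, compArrow_word, ← compQuad_word, ← Category.assoc, key]
    exact τ.homAct_word _ _ _
  · rw [Category.assoc, compArrow_arr, ← Category.assoc, key]
    have hw : ((τ.compList Z).mor ≫ τ.listTri) ≫ τ.triCod =
      ((τ.homListEnds Z).mor ≫ τ.compQuad Z) ≫ τ.homWord Z := τ.compList_cod Z
    refine (τ.homAct_arr_of _ _ _ (τ.triHomOf ((τ.compList Z).mor ≫ τ.listTri) rfl hw)
      (τ.homHomOf ((τ.homListEnds Z).mor ≫ τ.compQuad Z) rfl rfl rfl) rfl rfl).trans ?_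
    refine (τ.arrowsComp_arr_of _ _ (τ.homConcat_aux Z) _ _ rfl ?_).symm
    rw [Category.assoc, compArrow_arr, ← Category.assoc]
    rfl

variable (hM : τ.multicatData.IsMulticat)

/-- The functor of `fc`-multicategories of a `V`-enriched category. -/
noncomputable def compMulticatFunctor : MulticatFunctor (IndP adj Z.obj) (τ.multicat hM) :=
  algebraFunctorMk (A := (Monad.comparison adj).obj (Ind Z.obj)) (M := τ.multicat hM)
    (toBouquet ((ICat.forgetGraph E).obj (Ind Z.obj)) Z.hom) (τ.compGraphHom Z)
    (freeBouquet_hom_ext adj (τ.compArrow_word Z))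
    (bouquet_hom_ext (τ.compArrow_tgt Z))
    (bouquet_hom_ext (τ.homEdge_compArrow Z))
    (freeBouquet_hom_ext adj (τ.homConcat_aux Z))
    (bouquet_hom_ext ((τ.homConcat_compArrow Z).trans
      (Eq.symm (τ.multicat_cmp_edge rfl rfl (τ.homConcat_aux Z)))))

/-- The enriched `Id`-multicategory of a `V`-enriched category. -/
noncomputable def compMulticat : EnrichedMulticat adj (τ.multicat hM) :=
  ⟨Z.obj, τ.compMulticatFunctor Z hM⟩

/-- Iterated composition along a path of length two. -/
theorem cmp_compQuad_arr {S : E} (x₀ x₁ x₂ : S ⟶ Z.obj)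
    (h : (lift x₁ x₂ ≫ τ.homEdge Z) ≫ (τ.HomPath Z).src =
      (lift x₀ x₁ ≫ τ.homEdge Z) ≫ (τ.HomPath Z).tgt) :
    ((τ.HomPath Z).cmp (lift x₁ x₂ ≫ τ.homEdge Z) (lift x₀ x₁ ≫ τ.homEdge Z) h ≫ τ.compArrow Z) ≫
        τ.arrowsArr =
      (τ.foldComp Z.isVCat.toIsTyped (τ.singEl (Z.homEl x₁ x₂)).hom
        (τ.singEl (Z.homEl x₀ x₁)).hom).arr := by
  have q : ∀ x y : S ⟶ Z.obj, (lift x y ≫ τ.homEdge Z) ≫ τ.compQuad Z = lift x y ≫ τ.edgeQuad Z :=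
    fun x y => by rw [Category.assoc, homEdge_compQuad]
  have qw : ∀ x y : S ⟶ Z.obj, (lift x y ≫ τ.edgeQuad Z) ≫ τ.homWord Z =
      (Z.homEl x y).pt ≫ wordSing adj V.obj :=
    fun x y => by rw [Category.assoc, edgeQuad_word, ← Category.assoc]; rfl
  have qd : ∀ x y : S ⟶ Z.obj, (lift x y ≫ τ.edgeQuad Z) ≫ τ.homDom Z = x :=
    fun x y => by rw [Category.assoc, edgeQuad_dom, lift_fst]
  have qc : ∀ x y : S ⟶ Z.obj, (lift x y ≫ τ.edgeQuad Z) ≫ τ.homCod Z = y :=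
    fun x y => by rw [Category.assoc, edgeQuad_cod, lift_snd]
  have qa : ∀ x y : S ⟶ Z.obj, (lift x y ≫ τ.edgeQuad Z) ≫ τ.homArr Z =
      (τ.singEl (Z.homEl x y)).hom.arr :=
    fun x y => by rw [Category.assoc, edgeQuad_arr, singEl_hom_arr, ← Category.assoc]; rfl
  have hc : (lift x₁ x₂ ≫ τ.edgeQuad Z) ≫ τ.homDom Z =
      (lift x₀ x₁ ≫ τ.edgeQuad Z) ≫ τ.homCod Z := by rw [qd, qc]
  have e : (τ.HomPath Z).cmp (lift x₁ x₂ ≫ τ.homEdge Z) (lift x₀ x₁ ≫ τ.homEdge Z) h ≫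
      τ.compQuad Z = τ.homMul (lift x₁ x₂ ≫ τ.edgeQuad Z) (lift x₀ x₁ ≫ τ.edgeQuad Z) hc :=
    ((τ.compFunctor Z).map_cmp _ _ h).trans ((τ.homCat_cmp Z _ _ _).trans
      (τ.homMul_congr _ (q x₁ x₂) (q x₀ x₁)))
  rw [Category.assoc, compArrow_arr, ← Category.assoc, e]
  exact τ.homMul_arr_of _ _ hc _ _ (qw _ _) (qd _ _) (qc _ _) (qa _ _) (qw _ _) (qd _ _) (qa _ _)

/-- Iterated composition along the empty path. -/
theorem ident_compQuad_arr {S : E} (x : S ⟶ Z.obj) :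
    ((x ≫ τ.homVert Z ≫ (τ.HomPath Z).ident) ≫ τ.compArrow Z) ≫ τ.arrowsArr =
      (τ.foldUnit Z.isVCat.toIsTyped x).arr := by
  have e : (τ.HomPath Z).ident ≫ τ.compQuad Z = τ.homOne (τ.homVtx Z) :=
    (τ.compFunctor Z).map_ident.trans ((τ.comp_homOne _ _).trans (congrArg τ.homOne
      ((Category.comp_id _).trans (τ.compFunctor_obj Z))))
  have h : (x ≫ τ.homVert Z ≫ (τ.HomPath Z).ident) ≫ τ.compQuad Z = τ.homOne x := by
    rw [Category.assoc, Category.assoc, e, comp_homOne, comp_homOne, homVert_vtx, Category.comp_id]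
  rw [Category.assoc, compArrow_arr, ← Category.assoc, h, homOne_arr]

theorem pairEl_foldComp {S : E} (x₀ x₁ x₂ : S ⟶ Z.obj) :
    (pairEl τ (Z.homEl x₁ x₂) (Z.homEl x₀ x₁)).hom ≫
      τ.foldComp Z.isVCat.toIsTyped (τ.singEl (Z.homEl x₁ x₂)).hom
        (τ.singEl (Z.homEl x₀ x₁)).hom = Z.isVCat.compHom x₀ x₁ x₂ := by
  refine (Category.assoc _ _ _).trans ?_
  refine (congrArg (_ ≫ ·) (Iso.hom_inv_id_assoc (τ.mulEl _ _) _)).trans ?_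
  exact Iso.inv_hom_id_assoc (τ.singEl (Z.homEl x₁ x₂) ⊗ᵢ τ.singEl (Z.homEl x₀ x₁)) _

theorem generic_triple (A : E) : lift (fst A (A ⊗ A)) (lift (snd _ _ ≫ fst _ _)
    (snd _ _ ≫ snd _ _)) = 𝟙 _ := by
  rw [← comp_lift, lift_fst_snd, Category.comp_id, lift_fst_snd]

/-- Composition and identities are recovered on the nose, as iterated composition along paths of
lengths two and zero. -/
theorem vData_compMulticat : vData (τ.compMulticat Z hM) = Z.toVCatData := by
  have hc : (vData (τ.compMulticat Z hM)).comp = Z.comp := by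
    refine (V.cmp_congr _ (τ.cmp_compQuad_arr Z (fst _ _) (snd _ _ ≫ fst _ _)
      (snd _ _ ≫ snd _ _) _) rfl).trans ?_
    refine (congrArg ICat.ElHom.arr (τ.pairEl_foldComp Z (fst _ _) (snd _ _ ≫ fst _ _)
      (snd _ _ ≫ snd _ _))).trans ?_
    exact (congrArg (· ≫ Z.comp) (generic_triple Z.obj)).trans (Category.id_comp _)
  have hi : (vData (τ.compMulticat Z hM)).ident = Z.ident := by
    refine (V.cmp_congr _ (τ.ident_compQuad_arr Z (𝟙 _)) rfl).trans ?_
    refine (congrArg ICat.ElHom.arr (Iso.hom_inv_id_assoc (τ.nilEl Z.obj)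
      (Z.isVCat.identHom (𝟙 _)))).trans ?_
    exact Category.id_comp _
  exact congrArg₂ (fun c i => VCatData.mk Z.obj Z.hom c i) hc hi

theorem vCat_compMulticat : vCat (τ.compMulticat Z hM) = Z := by
  obtain ⟨Z, hZ⟩ := Z
  have h := τ.vData_compMulticat ⟨Z, hZ⟩ hM
  simp only [vCat, h]

instance essSurj_enrichedFunctor : (enrichedFunctor hM).EssSurj where
  mem_essImage Z := ⟨τ.compMulticat Z hM, ⟨eqToIso (τ.vCat_compMulticat Z hM)⟩⟩

theorem isEquivalence_enrichedFunctor : (enrichedFunctor hM).IsEquivalence where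

end EssSurj

end IteratedTensor

end IntEnr

theorem mainTheorem3 {E : Type u} [Category.{v} E] [HasPullbacks E] [CartesianMonoidalCategory E]
    {fc : IGraph E ⥤ ICat E} (adj : fc ⊣ ICat.forgetGraph E) (V : IMonCat E) :
    (V.IsStrict → ∃ τ : IteratedTensor adj V, τ.IsStrict) ∧
    (∀ _ : MonoidalClosed E, Nonempty (IteratedTensor adj V)) ∧
    ∀ τ : IteratedTensor adj V,
      ∃ (hM : τ.multicatData.IsMulticat)
        (hobj : ∀ X : EnrichedMulticat adj (τ.multicat hM), (IteratedTensor.vData X).IsVCat)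
        (hmap : ∀ {X Y : EnrichedMulticat adj (τ.multicat hM)} (F : X ⟶ Y),
          VFunctorData.IsVFunctor (X := ⟨IteratedTensor.vData X, hobj X⟩)
            (Y := ⟨IteratedTensor.vData Y, hobj Y⟩) (IteratedTensor.vFunctorData F))
        (Φ : EnrichedMulticat adj (τ.multicat hM) ⥤ VCat V),
        Φ.toPrefunctor =
          { obj := fun X => ⟨IteratedTensor.vData X, hobj X⟩
            map := fun F => ⟨IteratedTensor.vFunctorData F, hmap F⟩ } ∧
        Φ.IsEquivalence := by
  refine ⟨fun hV => ⟨hV.iteratedTensor adj, hV.iteratedTensor_isStrict adj⟩, ?_, fun τ => ?_⟩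
  · exact fun _ => nonempty_iteratedTensor
  · refine ⟨τ.isMulticat, IteratedTensor.vData_isVCat, IteratedTensor.vFunctorData_isVFunctor,
      IteratedTensor.enrichedFunctor τ.isMulticat, rfl,
      IteratedTensor.isEquivalence_enrichedFunctor τ τ.isMulticat⟩
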